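/- Consider the non-preemptive scheduling of $n$ jobs on $m$ identical machines, where $1\le m\le n$. Job $j$ has a release time $r_j\ge 0$ and a processing time $p_j>0$ (real numbers); it becomes known at time $r_j$, and it must be assigned to a machine and a start time $s_j\ge r_j$ and then run on that machine without interruption during $[s_j,s_j+p_j)$; a machine runs at most one job at a time. The total flow time of the resulting schedule is $\sum_j (s_j+p_j-r_j)$. An online algorithm knows $n$ and $m$ in advance; what it does before time $t$ may depend only on the jobs released before $t$ and on its random bits. For an instance $J$ let $\mathrm{OPT}_m(J)$ be the infimum of the total flow times $\sum_j (C_j-r_j)$ over all offline preemptive schedules without migration on $m$ machines (a job may be interrupted and resumed later, on the same machine, without loss of work; $C_j$ is its completion time). Running time is measured on an additive real RAM with fair random bits: integers and reals are stored in memories with indirect addressing, and copying, addition, subtraction, comparison and drawing a random bit have unit cost. **Theorem.** There are a single randomized non-preemptive online algorithm and constants $C$ and $d$ such that, for all $1\le m\le n$ and every instance $J$ with $n$ jobs, the algorithm always produces a feasible non-preemptive schedule on $m$ machines, uses at most $d\,n^d$ steps at every release and at most $d\,n^d$ independent fair random bits in total, and $$\mathbb E\big[F(\mathrm{ALG}(J))\big]\;\le\;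 C\,\sqrt{n/m}\;\cdot\mathrm{OPT}_m(J),$$ where $F(\mathrm{ALG}(J))$ is the total flow time of its schedule. That is, there is a polynomial-time randomized non-preemptive online algorithm that is $O(\sqrt{n/m})$-competitive against the preemptive non-migratory offline optimum; for $m=1$ the ratio is $O(\sqrt n)$. The schedule computed at the last release, when all jobs are known, is in particular a randomized polynomial-time offline $O(\sqrt{n/m})$-approximation. -/

import Mathlib

open MeasureTheory

noncomputable section

namespace FlowTime

/-! ### Instances and schedules -/

/-- An instance with `k` jobs, numbered in the order in which they are released. -/
structure Instance (k : ℕ) where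
  release : Fin k → ℝ
  size : Fin k → ℝ
  release_nonneg : ∀ j, 0 ≤ release j
  release_mono : Monotone release
  size_pos : ∀ j, 0 < size j

/-- The instance formed by the first `i` jobs. -/
def Instance.take {n : ℕ} (I : Instance n) (i : ℕ) (hi : i ≤ n) : Instance i where
  release j := I.release (Fin.castLE hi j)
  size j := I.size (Fin.castLE hi j)
  release_nonneg _ := I.release_nonneg _
  release_mono _ _ h := I.release_mono (by simpa using h)
  size_pos _ := I.size_pos _

/-- A non-preemptive schedule: job `j` runs without interruption on machine `machine j` during
`[start j, start j + size j)`. Machines are numbered from `0`. -/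
structure Schedule (k : ℕ) where
  start : Fin k → ℝ
  machine : Fin k → ℕ

/-- Feasibility of a non-preemptive schedule on `m` identical machines. -/
structure Schedule.Feasible {k : ℕ} (S : Schedule k) (m : ℕ) (J : Instance k) : Prop where
  machine_lt : ∀ j, S.machine j < m
  release_le : ∀ j, J.release j ≤ S.start j
  no_overlap : ∀ i j, i ≠ j → S.machine i = S.machine j →
    S.start i + J.size i ≤ S.start j ∨ S.start j + J.size j ≤ S.start i

/-- Total flow time `∑ (C_j - r_j)` of a non-preemptive schedule, with `C_j = s_j + p_j`. -/
def Schedule.totalFlow {k : ℕ} (S : Schedule k) (J : Instance k) : ℝ :=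
  ∑ j, (S.start j + J.size j - J.release j)

/-- A preemptive schedule without migration on `m` machines: job `j` is processed only on
`machine j`, exactly during the time set `run j`, which has total length `size j` and lies between
its release time and its completion time; a machine processes at most one job at a time. -/
structure PreemptiveSchedule (m : ℕ) {k : ℕ} (J : Instance k) where
  machine : Fin k → Fin m
  run : Fin k → Set ℝ
  completion : Fin k → ℝ
  measurable_run : ∀ j, MeasurableSet (run j)
  run_subset : ∀ j, run j ⊆ Set.Ico (J.release j) (completion j)
  volume_run : ∀ j, volume (run j) = ENNReal.ofReal (J.size j)
  disjoint_run : ∀ i j, i ≠ j → machine i = machine j → Disjoint (run i) (run j)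

/-- Total flow time of a preemptive schedule. -/
def PreemptiveSchedule.totalFlow {m k : ℕ} {J : Instance k} (S : PreemptiveSchedule m J) : ℝ :=
  ∑ j, (S.completion j - J.release j)

/-- The optimal total flow time over all offline preemptive non-migratory schedules. -/
def opt (m : ℕ) {k : ℕ} (J : Instance k) : ℝ :=
  ⨅ S : PreemptiveSchedule m J, S.totalFlow

/-- In a preemptive schedule every job has flow time at least its size. -/
theorem PreemptiveSchedule.size_le {m k : ℕ} {J : Instance k} (S : PreemptiveSchedule m J)
    (j : Fin k) : J.size j ≤ S.completion j - J.release j := by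
  have h := measure_mono (μ := volume) (S.run_subset j)
  rw [S.volume_run, Real.volume_Ico] at h
  by_contra hc
  push Not at hc
  exact absurd h (not_le.mpr ((ENNReal.ofReal_lt_ofReal_iff (J.size_pos j)).mpr hc))

/-- The infimum in `opt` is over a set that is bounded below. -/
theorem opt_bddBelow (m : ℕ) {k : ℕ} (J : Instance k) :
    BddBelow (Set.range fun S : PreemptiveSchedule m J => S.totalFlow) := by
  refine ⟨0, ?_⟩
  rintro _ ⟨S, rfl⟩
  exact Finset.sum_nonneg fun j _ => (J.size_pos j).le.trans (S.size_le j)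

/-- The infimum in `opt` is over a non-empty set as soon as there is a machine. -/
theorem nonempty_preemptiveSchedule {m : ℕ} (hm : 1 ≤ m) {k : ℕ} (J : Instance k) :
    Nonempty (PreemptiveSchedule m J) := by
  let a : Fin k → ℝ := fun j => ∑ i, J.release i + ∑ i ∈ Finset.univ.filter (· < j), J.size i
  have key : ∀ i j : Fin k, i < j → a i + J.size i ≤ a j := by
    intro i j hij
    have h1 : ∑ l ∈ Finset.univ.filter (· < i), J.size l + J.size i
        = ∑ l ∈ insert i (Finset.univ.filter (· < i)), J.size l := by
      rw [Finset.sum_insert (by simp), add_comm]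
    have h2 : ∑ l ∈ insert i (Finset.univ.filter (· < i)), J.size l
        ≤ ∑ l ∈ Finset.univ.filter (· < j), J.size l := by
      apply Finset.sum_le_sum_of_subset_of_nonneg
      · intro l hl
        simp only [Finset.mem_insert, Finset.mem_filter, Finset.mem_univ, true_and] at hl ⊢
        rcases hl with rfl | hl
        · exact hij
        · exact hl.trans hij
      · intro l _ _
        exact (J.size_pos l).le
    simp only [a]
    linarith
  refine ⟨⟨fun _ => ⟨0, hm⟩, fun j => Set.Ico (a j) (a j + J.size j), fun j => a j + J.size j,
    fun _ => measurableSet_Ico, ?_, ?_, ?_⟩⟩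
  · intro j
    apply Set.Ico_subset_Ico_left
    have h1 : J.release j ≤ ∑ i, J.release i :=
      Finset.single_le_sum (fun i _ => J.release_nonneg i) (Finset.mem_univ j)
    have h2 : 0 ≤ ∑ i ∈ Finset.univ.filter (· < j), J.size i :=
      Finset.sum_nonneg fun i _ => (J.size_pos i).le
    simp only [a]
    linarith
  · intro j
    rw [Real.volume_Ico]
    congr 1
    ring
  · intro i j hij _
    rw [Set.disjoint_left]
    rintro x ⟨hx1, hx2⟩ ⟨hx3, hx4⟩
    rcases lt_or_gt_of_ne hij with h | h
    · linarith [key i j h]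
    · linarith [key j i h]

/-! ### The machine model

An additive real RAM with coin flips. It has a memory of natural numbers and a memory of real
numbers, both with indirect addressing. Natural numbers and reals can be copied, added, subtracted
and compared; there are no multiplication, division or rounding instructions and no real constants,
so a unit cost per instruction gives no hidden computing power. -/

/-- Expressions over the memory of natural numbers; `mem e` is the content of cell `e`, and `sub`
is truncated subtraction. -/
inductive NatExp where
  | lit (c : ℕ)
  | mem (e : NatExp)
  | add (a b : NatExp)
  | sub (a b : NatExp)

/-- Expressions over the memory of reals; `mem e` is the content of cell `e`. -/
inductive RealExp where
  | mem (e : NatExp)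
  | add (x y : RealExp)
  | sub (x y : RealExp)

/-- Boolean tests. -/
inductive Test where
  | natLe (a b : NatExp)
  | realLe (x y : RealExp)
  | neg (t : Test)
  | both (t u : Test)

/-- Programs. `setNat a e` writes `e` to cell `a` of the natural memory, `setReal a x` writes `x`
to cell `a` of the real memory, `flip a` writes the next random bit to cell `a` of the natural
memory. -/
inductive Cmd where
  | skip
  | setNat (a e : NatExp)
  | setReal (a : NatExp) (x : RealExp)
  | flip (a : NatExp)
  | seq (c d : Cmd)
  | branch (t : Test) (c d : Cmd)
  | loop (t : Test) (c : Cmd)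

/-- Memory contents, together with the number of random bits consumed so far. -/
structure State where
  nat : ℕ → ℕ
  real : ℕ → ℝ
  used : ℕ

def NatExp.eval (s : State) : NatExp → ℕ
  | lit c => c
  | mem e => s.nat (e.eval s)
  | add a b => a.eval s + b.eval s
  | sub a b => a.eval s - b.eval s

def RealExp.eval (s : State) : RealExp → ℝ
  | mem e => s.real (e.eval s)
  | add x y => x.eval s + y.eval s
  | sub x y => x.eval s - y.eval s

def Test.holds (s : State) : Test → Prop
  | natLe a b => a.eval s ≤ b.eval s
  | realLe x y => x.eval s ≤ y.eval s
  | neg t => ¬ t.holds s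
  | both t u => t.holds s ∧ u.holds s

/-- A configuration: the stack of programs still to be executed, and the state. -/
abbrev Config := List Cmd × State

open Classical in
/-- One step of computation, where `tape` is the sequence of random bits. -/
def step (tape : ℕ → Bool) : Config → Config
  | ([], s) => ([], s)
  | (Cmd.skip :: K, s) => (K, s)
  | (Cmd.setNat a e :: K, s) =>
      (K, { s with nat := Function.update s.nat (a.eval s) (e.eval s) })
  | (Cmd.setReal a x :: K, s) =>
      (K, { s with real := Function.update s.real (a.eval s) (x.eval s) })
  | (Cmd.flip a :: K, s) =>
      (K, { s with nat := Function.update s.nat (a.eval s) (tape s.used).toNat,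
                   used := s.used + 1 })
  | (Cmd.seq c d :: K, s) => (c :: d :: K, s)
  | (Cmd.branch t c d :: K, s) => if t.holds s then (c :: K, s) else (d :: K, s)
  | (Cmd.loop t c :: K, s) => if t.holds s then (c :: Cmd.loop t c :: K, s) else (K, s)

/-! ### Online algorithms

At the release of its `i`-th job the algorithm is run on the data that are available then: the
total number `n` of jobs, the number `m` of machines, the jobs released so far, and the random bits.
It outputs a plan for the jobs released so far, which is followed until the next release. -/

/-- The input: `n`, `m` and the number `i` of released jobs in the first cells of the natural
memory; release time and size of job `j` in cells `2 j` and `2 j + 1` of the real memory. All other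
cells are zero. -/
def input (n m : ℕ) {i : ℕ} (J : Instance i) : State where
  nat a := if a = 0 then n else if a = 1 then m else if a = 2 then i else 0
  real a := if h : a / 2 < i then
      (if a % 2 = 0 then J.release ⟨a / 2, h⟩ else J.size ⟨a / 2, h⟩) else 0
  used := 0

/-- `T` random bits, followed by zeros; a computation of `T` steps cannot read further. -/
def tape {T : ℕ} (ω : Fin T → Bool) (k : ℕ) : Bool :=
  if h : k < T then ω ⟨k, h⟩ else false

/-- The configuration reached by `P` after `T` steps. -/
def run (P : Cmd) (n m : ℕ) {i : ℕ} (J : Instance i) {T : ℕ} (ω : Fin T → Bool) : Config :=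
  (step (tape ω))^[T] ([P], input n m J)

/-- The plan that `P` outputs: the start time of job `j` is in cell `j` of the real memory, its
machine in cell `j` of the natural memory. -/
def plan (P : Cmd) (n m : ℕ) {i : ℕ} (J : Instance i) {T : ℕ} (ω : Fin T → Bool) :
    Schedule i where
  start j := (run P n m J ω).2.real j
  machine j := (run P n m J ω).2.nat j

/-- With random bits `ω : Fin T → Bool`, the program `P` works as a non-preemptive online algorithm
on the instance `I` with `m` machines, and needs at most `T` steps at every release. Stability
says that a plan is never revised in the past: what is started before the release of job `i` is the
same before and after that release. Hence the schedule that is carried out is the last plan. -/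
structure RunsOnline (P : Cmd) (m : ℕ) {n : ℕ} (I : Instance n) {T : ℕ} (ω : Fin T → Bool) :
    Prop where
  halts : ∀ (i : ℕ) (hi : i ≤ n), (run P n m (I.take i hi) ω).1 = []
  feasible : ∀ (i : ℕ) (hi : i ≤ n), (plan P n m (I.take i hi) ω).Feasible m (I.take i hi)
  stable : ∀ (i : ℕ) (hi : i < n) (j : Fin i),
    let old := plan P n m (I.take i hi.le) ω
    let new := plan P n m (I.take (i + 1) hi) ω
    (old.start j < I.release ⟨i, hi⟩ ∨ new.start j.castSucc < I.release ⟨i, hi⟩) →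
      new.start j.castSucc = old.start j ∧ new.machine j.castSucc = old.machine j

/-- Expected total flow time of the schedule that `P` produces on the instance `I`, when it uses
`T` independent fair random bits. -/
def expectedFlow (P : Cmd) (m : ℕ) {n : ℕ} (I : Instance n) (T : ℕ) : ℝ :=
  (∑ ω : Fin T → Bool, (plan P n m I ω).totalFlow I) / 2 ^ T

end FlowTime

end

/-!
The algorithm combines a deterministic virtual schedule of the small jobs with a randomized
treatment of the big ones.

Let `Q = 2 ^ lev n m` be the least power of two with `n ≤ Q ^ 2 * m`; then `Q ≤ 2 * √(n / m)`. A
released job of size `p` is *small* if `p * m * Q` is at most the volume `V` of all released jobs,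
and *big* otherwise. Every job becomes small once enough volume has been released. The small jobs
form a virtual schedule: non-preemptive list scheduling, shortest job first, planned anew at every
release. In the final virtual schedule the jobs are short, as their sizes are at most
`θ = V / (m * Q)`.

At any time there are fewer than `m * Q` big jobs before a release, since otherwise their volume
would exceed `V`. First fit therefore puts them into `m` groups with at most `Q` big jobs each. A
random rotation maps the groups to the machines. A big job runs in the idle time of the virtual
schedule on its machine, and this is expressed on the *idle clock* of the machine, which advances
only while the machine is virtually idle. When a big job of size `p` is released, it gets as trigger
clock the value of the *free clock* of its machine plus `K * p`, where `K` is uniform in `{0, …,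
Q - 1}`; the free clock is the first idle clock value not taken by started big jobs, minus their
total work. The waiting big jobs of a machine are planned in the order of their trigger clocks. A
started big job may still run when virtual work is due; that work is then delayed by the *lag*, the
part of the big job that lies beyond the current idle clock value. This gives feasible plans that
are never revised in the past: `Actual.inv` and `Actual.stable`.

The total flow time is the total size plus three kinds of waiting times.

* In the virtual schedule (`Virtual.sum_wait_le`). At any time, for every bound on the size, the
  waiting jobs below that bound have at most the volume of the jobs that are unfinished in the
  optimal schedule a time `θ` earlier, plus that of the jobs that were still big when the current
  busy period began. Dividing volumes by sizes, which is Abel summation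
  (`card_le_card_add_of_volume`), turns this into an inequality between numbers of jobs: there are
  at most as many waiting jobs as unfinished ones, plus `m * Q` while all `m` machines are busy.
  Integration over time gives at most `OPT + n * θ + Q * V ≤ OPT + 2 * Q * V`.
* For the big jobs (`Actual.sum_leave_le`). A big job leaves the waiting state as soon as the free
  clock passes its trigger clock or it becomes small. So its waiting time is at most `K * p` plus
  the growth of the slack of its machine, the difference of time and free clock. The slacks grow to
  at most `2 * V` in total, and at most `Q` jobs wait on a machine at any time, which bounds the
  waiting times by `3 * Q * V` in total.
* By the lags. Fix all random numbers except `K` for one big job. A larger value of `K` moves the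
  interval of this job on the idle clock to the right by at least its own length
  (`Actual.u_add_le_of_lt`), so a given clock value lies in that interval for at most one value of
  `K`. Together with the rotation, a given big job delays a given start with probability at most
  `2 / (m * Q)` (`card_hits_le`). The virtual schedule does not depend on the random bits, and hence
  the expected lags are at most `n * 2 * V / (m * Q) ≤ 2 * Q * V` in total.

As `V ≤ OPT`, the expected total flow time is at most `(2 + 7 * Q) * OPT`.

The program is written in a small structured language with arrays and loops of `n + 1` rounds, for
which a polynomial bound on the cost is immediate (`HC.exists_cost_le`) and whose translation to the
machine is correct (`HC.program_correct`). That the virtual schedule does not depend on the random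
bits follows from a noninterference property that is checked on the program text (`HC.agree_det`).
-/

open MeasureTheory

noncomputable section

namespace FlowTime

/-! ### A small structured language and its cost -/

/-- Natural expressions of the structured language. The natural memory is divided into 32 arrays,
called fields; `var f e` is cell `e` of field `f`, and `njobs`, `nmach`, `nrel` are the number of
jobs, of machines and of released jobs. -/
inductive NE where
  | lit (c : ℕ) | njobs | nmach | nrel
  | var (f : Fin 32) (e : NE) | add (a b : NE) | sub (a b : NE)

/-- Real expressions. `rel e` and `siz e` are release time and size of job `e`; `var f e` is cell
`e` of field `f` of the real memory, which has 32 fields of its own. -/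
inductive RE where
  | rel (e : NE) | siz (e : NE) | var (f : Fin 32) (e : NE) | add (x y : RE) | sub (x y : RE)

/-- Tests of the structured language. -/
inductive TE where
  | nle (a b : NE) | rle (x y : RE) | neg (t : TE) | both (t u : TE)

/-- Programs of the structured language. The only loop is `rep c`, which performs `c` exactly
`n + 1` times, so that every program halts and its cost can be read off its text. -/
inductive HC where
  | skip
  | setN (f : Fin 32) (i e : NE)
  | setR (f : Fin 32) (i : NE) (x : RE)
  | flip (f : Fin 32) (i : NE)
  | seq (c d : HC)
  | ite (t : TE) (c d : HC)
  | rep (c : HC)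

/-- What a program cannot change: the numbers of jobs, machines and released jobs, the release
times, the sizes and the random bits. -/
structure Env where
  n : ℕ
  m : ℕ
  i : ℕ
  rel : ℕ → ℝ
  siz : ℕ → ℝ
  tape : ℕ → Bool

/-- The contents of the natural and real fields, and the number of random bits consumed. -/
@[ext] structure HS where
  N : Fin 32 → ℕ → ℕ
  R : Fin 32 → ℕ → ℝ
  used : ℕ

/-- Content of cell `2 n + a` of the real memory. -/
def HS.over (h : HS) (a : ℕ) : ℝ := h.R ⟨a % 32, Nat.mod_lt _ (by norm_num)⟩ (a / 32)

/-- The value of a natural expression. -/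
def NE.ev (E : Env) (h : HS) : NE → ℕ
  | lit c => c
  | njobs => E.n
  | nmach => E.m
  | nrel => E.i
  | var f e => h.N f (e.ev E h)
  | add a b => a.ev E h + b.ev E h
  | sub a b => a.ev E h - b.ev E h

/-- The value of a real expression. The machine keeps the input and the fields in the same real
memory, so the release time or size of a job `e ≥ n` is the content of a cell of some field. -/
def RE.ev (E : Env) (h : HS) : RE → ℝ
  | rel e => if e.ev E h < E.n then E.rel (e.ev E h) else h.over (2 * e.ev E h - 2 * E.n)
  | siz e => if e.ev E h < E.n then E.siz (e.ev E h) else h.over (2 * e.ev E h + 1 - 2 * E.n)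
  | var f e => h.R f (e.ev E h)
  | add a b => a.ev E h + b.ev E h
  | sub a b => a.ev E h - b.ev E h

/-- The truth of a test. -/
def TE.ev (E : Env) (h : HS) : TE → Prop
  | nle a b => a.ev E h ≤ b.ev E h
  | rle a b => a.ev E h ≤ b.ev E h
  | neg t => ¬ t.ev E h
  | both t u => t.ev E h ∧ u.ev E h

/-- Writes `v` to cell `i` of the natural field `f`. -/
def HS.setN (h : HS) (f : Fin 32) (i v : ℕ) : HS :=
  { h with N := Function.update h.N f (Function.update (h.N f) i v) }

/-- Writes `v` to cell `i` of the real field `f`. -/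
def HS.setR (h : HS) (f : Fin 32) (i : ℕ) (v : ℝ) : HS :=
  { h with R := Function.update h.R f (Function.update (h.R f) i v) }

open Classical in
/-- The effect of a program on the fields. -/
def HC.run (E : Env) : HC → HS → HS
  | skip, h => h
  | setN f i e, h => h.setN f (i.ev E h) (e.ev E h)
  | setR f i x, h => h.setR f (i.ev E h) (x.ev E h)
  | flip f i, h => { h.setN f (i.ev E h) (E.tape h.used).toNat with used := h.used + 1 }
  | seq c d, h => d.run E (c.run E h)
  | ite t c d, h => if t.ev E h then c.run E h else d.run E h
  | rep c, h => (c.run E)^[E.n + 1] h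

/-- The expression `2 e`. -/
def NatExp.dbl (e : NatExp) : NatExp := .add e e

/-- The expression `b + f + 32 e`: the fields are interleaved, and start at the address `b`. -/
def NatExp.addr (b : NatExp) (f : Fin 32) (e : NatExp) : NatExp :=
  .add (.add b (.lit f)) e.dbl.dbl.dbl.dbl.dbl

/-- Translation of natural expressions: `n`, `m` and `i` are in the cells `0`, `1` and `2`, and
cell `k` of field `f` is cell `n + 8 + f + 32 k`. -/
def NE.comp : NE → NatExp
  | lit c => .lit c
  | njobs => .mem (.lit 0)
  | nmach => .mem (.lit 1)
  | nrel => .mem (.lit 2)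
  | var f e => .mem (.addr (.add (.mem (.lit 0)) (.lit 8)) f e.comp)
  | add a b => .add a.comp b.comp
  | sub a b => .sub a.comp b.comp

/-- Translation of real expressions: the input is in the cells below `2 n`, and cell `k` of field
`f` is cell `2 n + f + 32 k`. -/
def RE.comp : RE → RealExp
  | rel e => .mem (.dbl e.comp)
  | siz e => .mem (.add (.dbl e.comp) (.lit 1))
  | var f e => .mem (.addr (.dbl (.mem (.lit 0))) f e.comp)
  | add a b => .add a.comp b.comp
  | sub a b => .sub a.comp b.comp

/-- Translation of tests. -/
def TE.comp : TE → Test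
  | nle a b => .natLe a.comp b.comp
  | rle a b => .realLe a.comp b.comp
  | neg t => .neg t.comp
  | both t u => .both t.comp u.comp

/-- Translation of a program that stands inside `d` loops. The counters of these loops are in the
natural cells `3, …, 2 + d`, and a loop of the program takes the next cell as its counter. -/
def HC.comp (d : ℕ) : HC → Cmd
  | skip => .skip
  | setN f i e => .setNat (.addr (.add (.mem (.lit 0)) (.lit 8)) f i.comp) e.comp
  | setR f i x => .setReal (.addr (.dbl (.mem (.lit 0))) f i.comp) x.comp
  | flip f i => .flip (.addr (.add (.mem (.lit 0)) (.lit 8)) f i.comp)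
  | seq c e => .seq (c.comp d) (e.comp d)
  | ite t c e => .branch t.comp (c.comp d) (e.comp d)
  | rep c => .seq (.setNat (.lit (3 + d)) (.add (.mem (.lit 0)) (.lit 1)))
      (.loop (.natLe (.lit 1) (.mem (.lit (3 + d))))
        (.seq (.setNat (.lit (3 + d)) (.sub (.mem (.lit (3 + d))) (.lit 1))) (c.comp (d + 1))))

/-- The nesting depth of the loops. -/
def HC.depth : HC → ℕ
  | seq c d => max c.depth d.depth
  | ite _ c d => max c.depth d.depth
  | rep c => c.depth + 1
  | _ => 0

/-- A bound for the number of steps of the translated program on inputs with `n` jobs. -/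
def HC.cost (n : ℕ) : HC → ℕ
  | seq c d => 1 + c.cost n + d.cost n
  | ite _ c d => 1 + c.cost n + d.cost n
  | rep c => 3 + (n + 1) * (c.cost n + 3)
  | _ => 1

/-- The state `s` of the machine represents the input `E` and the fields `h`. -/
structure Rel (E : Env) (s : State) (h : HS) : Prop where
  n : s.nat 0 = E.n
  m : s.nat 1 = E.m
  i : s.nat 2 = E.i
  N : ∀ (f : Fin 32) k, s.nat (E.n + 8 + f + 32 * k) = h.N f k
  R : ∀ (f : Fin 32) k, s.real (2 * E.n + f + 32 * k) = h.R f k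
  rel : ∀ k < E.n, s.real (2 * k) = E.rel k
  siz : ∀ k < E.n, s.real (2 * k + 1) = E.siz k
  used : s.used = h.used

section
variable {E : Env} {s : State} {h : HS}

theorem NatExp.eval_dbl (e : NatExp) : e.dbl.eval s = 2 * e.eval s := by
  simp [NatExp.dbl, NatExp.eval]; ring

theorem NatExp.eval_addr (b : NatExp) (f : Fin 32) (e : NatExp) :
    (NatExp.addr b f e).eval s = b.eval s + f + 32 * e.eval s := by
  simp only [NatExp.addr, NatExp.eval, NatExp.eval_dbl]; ring

theorem Rel.real_over (r : Rel E s h) (a : ℕ) (ha : 2 * E.n ≤ a) :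
    s.real a = h.over (a - 2 * E.n) := by
  unfold HS.over
  rw [← r.R]
  congr 1
  simp only
  omega

theorem Rel.ne (r : Rel E s h) (e : NE) : e.comp.eval s = e.ev E h := by
  induction e with
  | lit c => rfl
  | njobs => exact r.n
  | nmach => exact r.m
  | nrel => exact r.i
  | var f e ih =>
    simp only [NE.comp, NatExp.eval, NatExp.eval_addr, ih, NE.ev, r.n]
    exact r.N f _
  | add a b iha ihb => simp [NE.comp, NatExp.eval, NE.ev, iha, ihb]
  | sub a b iha ihb => simp [NE.comp, NatExp.eval, NE.ev, iha, ihb]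

theorem Rel.re (r : Rel E s h) (x : RE) : x.comp.eval s = x.ev E h := by
  induction x with
  | rel e =>
    simp only [RE.comp, RealExp.eval, NatExp.eval_dbl, r.ne, RE.ev]
    split_ifs with hk
    · exact r.rel _ hk
    · exact r.real_over _ (by omega)
  | siz e =>
    simp only [RE.comp, RealExp.eval, NatExp.eval, NatExp.eval_dbl, r.ne, RE.ev]
    split_ifs with hk
    · exact r.siz _ hk
    · exact r.real_over _ (by omega)
  | var f e =>
    simp only [RE.comp, RealExp.eval, NatExp.eval, NatExp.eval_addr, NatExp.eval_dbl, r.ne,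
      RE.ev, r.n]
    exact r.R f _
  | add a b iha ihb => simp [RE.comp, RealExp.eval, RE.ev, iha, ihb]
  | sub a b iha ihb => simp [RE.comp, RealExp.eval, RE.ev, iha, ihb]

theorem Rel.te (r : Rel E s h) (t : TE) : t.comp.holds s ↔ t.ev E h := by
  induction t with
  | nle a b => simp [TE.comp, Test.holds, TE.ev, r.ne]
  | rle a b => simp [TE.comp, Test.holds, TE.ev, r.re]
  | neg t ih => simp [TE.comp, Test.holds, TE.ev, ih]
  | both t u iht ihu => simp [TE.comp, Test.holds, TE.ev, iht, ihu]

theorem Rel.setN (r : Rel E s h) (f : Fin 32) (i v : ℕ) :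
    Rel E { s with nat := Function.update s.nat (E.n + 8 + f + 32 * i) v } (h.setN f i v) where
  n := by
    rw [← r.n]
    exact Function.update_of_ne (by omega) _ _
  m := by
    rw [← r.m]
    exact Function.update_of_ne (by omega) _ _
  i := by
    rw [← r.i]
    exact Function.update_of_ne (by omega) _ _
  N f' k := by
    have := f.2
    have := f'.2
    by_cases hf : f' = f
    · subst hf
      by_cases hk : k = i
      · subst hk; simp [HS.setN]
      · have : E.n + 8 + f' + 32 * k ≠ E.n + 8 + f' + 32 * i := by omega
        simp [HS.setN, Function.update_of_ne this, Function.update_of_ne hk, r.N]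
    · have hf' : (f' : ℕ) ≠ f := fun h => hf (Fin.ext h)
      have : E.n + 8 + f' + 32 * k ≠ E.n + 8 + f + 32 * i := by omega
      simp [HS.setN, Function.update_of_ne this, Function.update_of_ne hf, r.N]
  R := r.R
  rel := r.rel
  siz := r.siz
  used := r.used

theorem Rel.setR (r : Rel E s h) (f : Fin 32) (i : ℕ) (v : ℝ) :
    Rel E { s with real := Function.update s.real (2 * E.n + f + 32 * i) v } (h.setR f i v) where
  n := r.n
  m := r.m
  i := r.i
  N := r.N
  R f' k := by
    have := f.2
    have := f'.2
    by_cases hf : f' = f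
    · subst hf
      by_cases hk : k = i
      · subst hk; simp [HS.setR]
      · have : 2 * E.n + f' + 32 * k ≠ 2 * E.n + f' + 32 * i := by omega
        simp [HS.setR, Function.update_of_ne this, Function.update_of_ne hk, r.R]
    · have hf' : (f' : ℕ) ≠ f := fun h => hf (Fin.ext h)
      have : 2 * E.n + f' + 32 * k ≠ 2 * E.n + f + 32 * i := by omega
      simp [HS.setR, Function.update_of_ne this, Function.update_of_ne hf, r.R]
  rel k hk := by
    rw [← r.rel k hk]
    exact Function.update_of_ne (by omega) _ _
  siz k hk := by
    rw [← r.siz k hk]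
    exact Function.update_of_ne (by omega) _ _
  used := r.used

/-- The cells `3, …, 7` are reserved for the counters of loops. -/
theorem Rel.set_counter (r : Rel E s h) (q : ℕ) (h3 : 3 ≤ q) (h8 : q < 8) (v : ℕ) :
    Rel E { s with nat := Function.update s.nat q v } h where
  n := by
    rw [← r.n]
    exact Function.update_of_ne (by omega) _ _
  m := by
    rw [← r.m]
    exact Function.update_of_ne (by omega) _ _
  i := by
    rw [← r.i]
    exact Function.update_of_ne (by omega) _ _
  N f k := by
    rw [← r.N]
    exact Function.update_of_ne (by omega) _ _
  R := r.R
  rel := r.rel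
  siz := r.siz
  used := r.used

end

/-- The translation computes the effect of the program within its cost, and leaves the counters of
the surrounding loops unchanged. The bound on the depth is there because only the cells
`3, …, 7` are available for counters. -/
theorem HC.comp_correct (E : Env) (c : HC) : ∀ (d : ℕ) (s : State) (h : HS) (K : List Cmd),
    d + c.depth ≤ 5 → Rel E s h → ∃ t s', t ≤ c.cost E.n ∧
      (step E.tape)^[t] (c.comp d :: K, s) = (K, s') ∧ Rel E s' (c.run E h) ∧
      ∀ q < d, s'.nat (3 + q) = s.nat (3 + q) := by
  induction c with
  | skip => exact fun d s h K _ r => ⟨1, s, le_rfl, rfl, r, fun _ _ => rfl⟩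
  | setN f i e =>
    intro d s h K hd r
    have := r.setN f (i.ev E h) (e.ev E h)
    refine ⟨1, _, le_rfl, rfl, ?_, ?_⟩
    · simpa only [HC.run, NatExp.eval_addr, NatExp.eval, r.n, r.ne] using this
    · intro q hq
      simp only [HC.depth, NatExp.eval_addr, NatExp.eval, r.n] at hd ⊢
      exact Function.update_of_ne (by omega) _ _
  | setR f i x =>
    intro d s h K hd r
    have := r.setR f (i.ev E h) (x.ev E h)
    refine ⟨1, _, le_rfl, rfl, ?_, fun _ _ => rfl⟩
    simpa only [HC.run, NatExp.eval_addr, NatExp.eval_dbl, NatExp.eval, r.n, r.ne, r.re]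
      using this
  | flip f i =>
    intro d s h K hd r
    have := r.setN f (i.ev E h) (E.tape h.used).toNat
    refine ⟨1, _, le_rfl, rfl, ?_, ?_⟩
    · simp only [NatExp.eval_addr, NatExp.eval, r.n, r.ne, r.used]
      exact ⟨this.n, this.m, this.i, this.N, this.R, this.rel, this.siz, rfl⟩
    · intro q hq
      simp only [HC.depth, NatExp.eval_addr, NatExp.eval, r.n] at hd ⊢
      exact Function.update_of_ne (by omega) _ _
  | seq c e ihc ihe =>
    intro d s h K hd r
    simp only [HC.depth] at hd
    obtain ⟨t1, s1, ht1, hs1, r1, k1⟩ := ihc d s h (e.comp d :: K) (by omega) r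
    obtain ⟨t2, s2, ht2, hs2, r2, k2⟩ := ihe d s1 _ K (by omega) r1
    refine ⟨t2 + (t1 + 1), s2, by simp only [HC.cost]; omega, ?_, r2,
      fun q hq => (k2 q hq).trans (k1 q hq)⟩
    rw [Function.iterate_add_apply, Function.iterate_succ_apply]
    change (step E.tape)^[t2] ((step E.tape)^[t1] (c.comp d :: e.comp d :: K, s)) = _
    rw [hs1, hs2]
  | ite t c e ihc ihe =>
    intro d s h K hd r
    simp only [HC.depth] at hd
    by_cases ht : t.ev E h
    · obtain ⟨t1, s1, ht1, hs1, r1, k1⟩ := ihc d s h K (by omega) r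
      refine ⟨t1 + 1, s1, by simp only [HC.cost]; omega, ?_, by simpa [HC.run, ht] using r1, k1⟩
      rw [Function.iterate_succ_apply, ← hs1]
      simp [HC.comp, step, r.te, ht]
    · obtain ⟨t1, s1, ht1, hs1, r1, k1⟩ := ihe d s h K (by omega) r
      refine ⟨t1 + 1, s1, by simp only [HC.cost]; omega, ?_, by simpa [HC.run, ht] using r1, k1⟩
      rw [Function.iterate_succ_apply, ← hs1]
      simp [HC.comp, step, r.te, ht]
  | rep c ih =>
    intro d s h K hd r
    simp only [HC.depth] at hd
    have key : ∀ (v : ℕ) (s : State) (h : HS), Rel E s h → s.nat (3 + d) = v →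
        ∃ t s', t ≤ 1 + v * (c.cost E.n + 3) ∧
          (step E.tape)^[t] ((Cmd.loop (.natLe (.lit 1) (.mem (.lit (3 + d))))
            (.seq (.setNat (.lit (3 + d)) (.sub (.mem (.lit (3 + d))) (.lit 1)))
              (c.comp (d + 1)))) :: K, s) = (K, s') ∧ Rel E s' ((c.run E)^[v] h) ∧
          ∀ q < d, s'.nat (3 + q) = s.nat (3 + q) := by
      intro v
      induction v with
      | zero =>
        intro s h r hv
        refine ⟨1, s, by omega, ?_, r, fun _ _ => rfl⟩
        simp [step, Test.holds, NatExp.eval, hv]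
      | succ v ihv =>
        intro s h r hv
        obtain ⟨t1, s1, ht1, hs1, r1, k1⟩ := ih (d + 1) _ h
          ((Cmd.loop (.natLe (.lit 1) (.mem (.lit (3 + d))))
            (.seq (.setNat (.lit (3 + d)) (.sub (.mem (.lit (3 + d))) (.lit 1)))
              (c.comp (d + 1)))) :: K) (by omega)
          (r.set_counter (3 + d) (by omega) (by omega) v)
        obtain ⟨t2, s2, ht2, hs2, r2, k2⟩ := ihv s1 _ r1
          ((k1 d (by omega)).trans (by simp))
        refine ⟨t2 + (t1 + 3), s2, ?_, ?_, ?_, ?_⟩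
        · rw [Nat.succ_mul]; omega
        · rw [Function.iterate_add_apply, Function.iterate_add_apply, ← hs2, ← hs1]
          congr 2
          simp [step, Test.holds, NatExp.eval, hv]
        · rwa [Function.iterate_succ_apply]
        · intro q hq
          rw [k2 q hq, k1 q (by omega)]
          exact Function.update_of_ne (by omega) _ _
    obtain ⟨t1, s1, ht1, hs1, r1, k1⟩ := key (E.n + 1) _ h
      (r.set_counter (3 + d) (by omega) (by omega) (E.n + 1)) (by simp)
    refine ⟨t1 + 2, s1, by simp only [HC.cost]; omega, ?_, r1, ?_⟩
    · rw [Function.iterate_add_apply, ← hs1]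
      congr 1
      simp [step, HC.comp, NatExp.eval, r.n]
    · intro q hq
      rw [k1 q hq]
      exact Function.update_of_ne (by omega) _ _

/-- The cost is polynomial in the number of jobs. -/
theorem HC.exists_cost_le (c : HC) : ∃ a D : ℕ, ∀ n : ℕ, 1 ≤ n → c.cost n ≤ a * n ^ D := by
  have aux : ∀ a D a' D' n : ℕ, 1 ≤ n → a * n ^ D + a' * n ^ D' ≤ (a + a') * n ^ (D + D') := by
    intro a D a' D' n hn
    rw [add_mul]
    gcongr <;> first | exact hn | omega
  have aux2 : ∀ (a D n : ℕ), 1 ≤ n → a ≤ a * n ^ D := fun a D n hn =>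
    Nat.le_mul_of_pos_right _ (Nat.pow_pos hn)
  induction c with
  | skip => exact ⟨1, 0, fun n _ => by simp [HC.cost]⟩
  | setN => exact ⟨1, 0, fun n _ => by simp [HC.cost]⟩
  | setR => exact ⟨1, 0, fun n _ => by simp [HC.cost]⟩
  | flip => exact ⟨1, 0, fun n _ => by simp [HC.cost]⟩
  | seq c d ihc ihd =>
    obtain ⟨a, D, h⟩ := ihc
    obtain ⟨a', D', h'⟩ := ihd
    refine ⟨1 + a + a', D + D', fun n hn => ?_⟩
    have := aux a D a' D' n hn
    have := aux2 1 (D + D') n hn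
    simp only [HC.cost]
    nlinarith [h n hn, h' n hn]
  | ite t c d ihc ihd =>
    obtain ⟨a, D, h⟩ := ihc
    obtain ⟨a', D', h'⟩ := ihd
    refine ⟨1 + a + a', D + D', fun n hn => ?_⟩
    have := aux a D a' D' n hn
    have := aux2 1 (D + D') n hn
    simp only [HC.cost]
    nlinarith [h n hn, h' n hn]
  | rep c ih =>
    obtain ⟨a, D, h⟩ := ih
    refine ⟨2 * a + 9, D + 1, fun n hn => ?_⟩
    have h1 := h n hn
    have h2 : (n + 1) * (c.cost n + 3) ≤ (2 * n) * (a * n ^ D + 3) := by gcongr; omega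
    have h3 : n * n ^ D = n ^ (D + 1) := by ring
    have h4 : n ≤ n ^ (D + 1) := Nat.le_self_pow (by omega) n
    simp only [HC.cost]
    calc 3 + (n + 1) * (c.cost n + 3) ≤ 3 * n + (2 * n) * (a * n ^ D + 3) := by omega
      _ = 2 * a * (n * n ^ D) + 9 * n := by ring
      _ ≤ 2 * a * n ^ (D + 1) + 9 * n ^ (D + 1) := by rw [h3]; gcongr
      _ = _ := by ring

/-! ### Compilation to the machine -/

/-- The address expression of cell `k` of field `f` of the natural memory. -/
def natCell (f : Fin 32) (k : NatExp) : NatExp := .addr (.add (.mem (.lit 0)) (.lit 8)) f k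

/-- The address expression of cell `k` of field `f` of the real memory. -/
def realCell (f : Fin 32) (k : NatExp) : NatExp := .addr (.dbl (.mem (.lit 0))) f k

/-- Writes the start and the machine of one job to the place where the plan is read, the job being
given by the counter in cell `3`. Machines of jobs below `8` are left out, as their cells hold the
data that the loop needs. -/
def copyBody (fs fM : Fin 32) : Cmd :=
  .seq (.setNat (.lit 3) (.sub (.mem (.lit 3)) (.lit 1)))
    (.seq (.setReal (.mem (.lit 3)) (.mem (realCell fs (.mem (.lit 3)))))
      (.branch (.natLe (.lit 8) (.mem (.lit 3)))
        (.setNat (.mem (.lit 3)) (.mem (natCell fM (.mem (.lit 3))))) .skip))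

/-- Writes the machines of the jobs `c, c - 1, …, 0`. Cell `0` holds `n`, so it comes last. -/
def copyLow (fM : Fin 32) : ℕ → Cmd
  | 0 => .setNat (.lit 0) (.mem (natCell fM (.lit 0)))
  | c + 1 => .seq (.setNat (.lit (c + 1)) (.mem (natCell fM (.lit (c + 1))))) (copyLow fM c)

/-- The loop of `copyBody` over the released jobs. It overwrites the input, but no field, since
the fields start at the cells `n + 8` and `2 n`. -/
def copyLoop (fs fM : Fin 32) : Cmd :=
  .loop (.natLe (.lit 1) (.mem (.lit 3))) (copyBody fs fM)

/-- Output of a plan with start times in field `fs` and machines in field `fM`. -/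
def copyOut (fs fM : Fin 32) : Cmd :=
  .seq (.setNat (.lit 3) (.mem (.lit 2))) (.seq (copyLoop fs fM) (copyLow fM 7))

theorem copyLow_correct (n : ℕ) (tp : ℕ → Bool) (fM : Fin 32) (g : ℕ → ℕ) :
    ∀ (c : ℕ) (s : State), c ≤ 7 → s.nat 0 = n → (∀ k, s.nat (n + 8 + fM + 32 * k) = g k) →
      ∃ s', (step tp)^[2 * c + 1] ([copyLow fM c], s) = ([], s') ∧ s'.real = s.real ∧
        (∀ j ≤ c, s'.nat j = g j) ∧ ∀ j, c < j → s'.nat j = s.nat j := by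
  intro c
  induction c with
  | zero =>
    intro s _ h0 hg
    refine ⟨_, rfl, rfl, ?_, ?_⟩
    · intro j hj
      obtain rfl : j = 0 := by omega
      simp [NatExp.eval, natCell, NatExp.eval_addr, h0, ← hg]
    · intro j hj
      exact Function.update_of_ne (by simp only [NatExp.eval]; omega) _ _
  | succ c ih =>
    intro s hc h0 hg
    have hv : (NatExp.mem (natCell fM (.lit (c + 1)))).eval s = g (c + 1) := by
      simp only [NatExp.eval, natCell, NatExp.eval_addr, h0, hg]
    obtain ⟨s', h1, h2, h3, h4⟩ := ih
      { s with nat := Function.update s.nat (c + 1) (g (c + 1)) } (by omega)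
      ((Function.update_of_ne (show 0 ≠ c + 1 by omega) (g (c + 1)) s.nat).trans h0)
      (fun k => (Function.update_of_ne (show n + 8 + fM + 32 * k ≠ c + 1 by omega) (g (c + 1))
        s.nat).trans (hg k))
    refine ⟨s', ?_, h2, ?_, ?_⟩
    · rw [show 2 * (c + 1) + 1 = (2 * c + 1) + 2 by ring, Function.iterate_add_apply, ← h1]
      congr 1
      simp only [copyLow]
      change ([copyLow fM c], (⟨Function.update s.nat ((NatExp.lit (c + 1)).eval s)
        ((NatExp.mem (natCell fM (.lit (c + 1)))).eval s), s.real, s.used⟩ : State)) = _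
      rw [hv]; rfl
    · intro j hj
      rcases Nat.lt_or_ge c j with h | h
      · obtain rfl : j = c + 1 := by omega
        rw [h4 _ h]
        simp
      · exact h3 j h
    · intro j hj
      rw [h4 j (by omega)]
      exact Function.update_of_ne (by omega) _ _

theorem copyLoop_correct (n i : ℕ) (hin : i ≤ n) (tp : ℕ → Bool) (fs fM : Fin 32) (g : ℕ → ℕ)
    (x : ℕ → ℝ) (K : List Cmd) : ∀ (v : ℕ) (s : State), v ≤ i → s.nat 0 = n → s.nat 3 = v →
      (∀ k, s.nat (n + 8 + fM + 32 * k) = g k) → (∀ k, s.real (2 * n + fs + 32 * k) = x k) →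
      (∀ j, v ≤ j → j < i → s.real j = x j ∧ (8 ≤ j → s.nat j = g j)) →
      ∃ s', (step tp)^[7 * v + 1] (copyLoop fs fM :: K, s) = (K, s') ∧ s'.nat 0 = n ∧
      (∀ k, s'.nat (n + 8 + fM + 32 * k) = g k) ∧
      (∀ j < i, s'.real j = x j ∧ (8 ≤ j → s'.nat j = g j)) := by
  intro v
  induction v with
  | zero =>
    intro s _ h0 h3 hg hx hd
    refine ⟨s, ?_, h0, hg, fun j hj => hd j (by omega) hj⟩
    simp [copyLoop, step, Test.holds, NatExp.eval, h3]
  | succ v ih =>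
    intro s hv h0 h3 hg hx hd
    set s1 : State := { s with nat := Function.update s.nat 3 v } with hs1
    have e3 : s1.nat 3 = v := by simp [hs1]
    have e0 : s1.nat 0 = n := by simp [hs1, h0]
    have eg : ∀ k, s1.nat (n + 8 + fM + 32 * k) = g k := by
      intro k; rw [← hg]; exact Function.update_of_ne (by omega) _ _
    set s2 : State := { s1 with real := Function.update s1.real v (x v) } with hs2
    set s3 : State := if 8 ≤ v then { s2 with nat := Function.update s2.nat v (g v) } else s2
      with hs3
    have r3 : s3.real = Function.update s.real v (x v) := by
      simp only [hs3]; split_ifs <;> rfl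
    have n3 : ∀ a, a ≠ v ∨ a < 8 → s3.nat a = s1.nat a := by
      intro a ha
      simp only [hs3]; split_ifs
      · exact Function.update_of_ne (by omega) _ _
      · rfl
    have run7 : (step tp)^[7] (copyLoop fs fM :: K, s) = (copyLoop fs fM :: K, s3) := by
      have a1 : (step tp)^[3] (copyLoop fs fM :: K, s) =
          (.seq (.setReal (.mem (.lit 3)) (.mem (realCell fs (.mem (.lit 3)))))
            (.branch (.natLe (.lit 8) (.mem (.lit 3)))
            (.setNat (.mem (.lit 3)) (.mem (natCell fM (.mem (.lit 3))))) .skip)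
            :: copyLoop fs fM :: K, s1) := by
        simp [copyLoop, copyBody, step, Test.holds, NatExp.eval, h3, hs1]
      have a2 : (step tp)^[2] (.seq (.setReal (.mem (.lit 3))
            (.mem (realCell fs (.mem (.lit 3)))))
            (.branch (.natLe (.lit 8) (.mem (.lit 3)))
            (.setNat (.mem (.lit 3)) (.mem (natCell fM (.mem (.lit 3))))) .skip)
            :: copyLoop fs fM :: K, s1) = ((.branch (.natLe (.lit 8) (.mem (.lit 3)))
            (.setNat (.mem (.lit 3)) (.mem (natCell fM (.mem (.lit 3))))) .skip)
            :: copyLoop fs fM :: K, s2) := by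
        have : (RealExp.mem (realCell fs (.mem (.lit 3)))).eval s1 = x v := by
          simp only [RealExp.eval, realCell, NatExp.eval_addr, NatExp.eval_dbl, NatExp.eval, e3,
            e0]
          exact hx v
        simp [step, NatExp.eval, this, e3, hs2]
      have a3 : (step tp)^[2] ((.branch (.natLe (.lit 8) (.mem (.lit 3)))
            (.setNat (.mem (.lit 3)) (.mem (natCell fM (.mem (.lit 3))))) .skip)
            :: copyLoop fs fM :: K, s2) = (copyLoop fs fM :: K, s3) := by
        have : (NatExp.mem (natCell fM (.mem (.lit 3)))).eval s2 = g v := by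
          simp only [NatExp.eval, natCell, NatExp.eval_addr]
          change s1.nat (s1.nat 0 + 8 + fM + 32 * s1.nat 3) = _
          rw [e3, e0, eg]
        have e3' : s2.nat 3 = v := e3
        by_cases h8 : 8 ≤ v
        · simp only [Function.iterate_succ, Function.iterate_zero, Function.comp, id, step,
            Test.holds, NatExp.eval, e3', h8, if_true, hs3] at this ⊢
          rw [this]
        · simp [step, Test.holds, NatExp.eval, e3', h8, hs3]
      rw [show 7 = 2 + (2 + 3) by rfl, Function.iterate_add_apply, Function.iterate_add_apply,
        a1, a2, a3]
    have hd' : ∀ j, v ≤ j → j < i → s3.real j = x j ∧ (8 ≤ j → s3.nat j = g j) := by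
      intro j hj hji
      rcases Nat.lt_or_ge v j with h | h
      · obtain ⟨q1, q2⟩ := hd j (by omega) hji
        refine ⟨?_, fun h8 => ?_⟩
        · rw [r3, ← q1]
          exact Function.update_of_ne (by omega) _ _
        · rw [n3 j (by omega), ← q2 h8]
          exact Function.update_of_ne (by omega) _ _
      · obtain rfl : j = v := by omega
        refine ⟨by rw [r3]; simp, fun h8 => ?_⟩
        simp [hs3, h8]
    obtain ⟨s', p1, p2, p3, p4⟩ := ih s3 (by omega) ((n3 0 (by omega)).trans e0)
      ((n3 3 (by omega)).trans e3) (fun k => (n3 _ (by omega)).trans (eg k))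
      (fun k => by
        rw [r3, ← hx k]
        exact Function.update_of_ne (by omega) _ _) hd'
    refine ⟨s', ?_, p2, p3, p4⟩
    rw [show 7 * (v + 1) + 1 = (7 * v + 1) + 7 by ring, Function.iterate_add_apply, run7, p1]

/-- The memory before the first instruction. -/
def HS.init : HS := ⟨fun _ _ => 0, fun _ _ => 0, 0⟩

/-- The environment of a run on the instance `J` of the jobs released so far. -/
def Env.of (n m : ℕ) {i : ℕ} (J : Instance i) (tp : ℕ → Bool) : Env where
  n := n
  m := m
  i := i
  rel k := if h : k < i then J.release ⟨k, h⟩ else 0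
  siz k := if h : k < i then J.size ⟨k, h⟩ else 0
  tape := tp

theorem Rel.init (n m : ℕ) {i : ℕ} (hi : i ≤ n) (J : Instance i) (tp : ℕ → Bool) :
    Rel (Env.of n m J tp) (input n m J) HS.init where
  n := rfl
  m := rfl
  i := rfl
  N f k := by
    simp only [Env.of, input, HS.init]
    rw [if_neg (by omega), if_neg (by omega), if_neg (by omega)]
  R f k := by
    simp only [Env.of, input, HS.init]
    rw [dif_neg (by omega)]
  rel k _ := by
    simp only [Env.of, input]
    have : 2 * k / 2 = k := by omega
    have h2 : 2 * k % 2 = 0 := by omega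
    simp only [h2, if_true, this]
  siz k _ := by
    simp only [Env.of, input]
    have : (2 * k + 1) / 2 = k := by omega
    have h2 : ¬ (2 * k + 1) % 2 = 0 := by omega
    simp only [h2, if_false, this]
  used := rfl

/-- The machine program that performs `c` and then outputs the fields `fs` and `fM` as start times
and machines. -/
def HC.program (c : HC) (fs fM : Fin 32) : Cmd := .seq (c.comp 0) (copyOut fs fM)

theorem step_nil (tp : ℕ → Bool) (s : State) (t : ℕ) : (step tp)^[t] ([], s) = ([], s) := by
  induction t with
  | zero => rfl
  | succ t ih => rw [Function.iterate_succ_apply]; exact ih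

/-- The plan of the machine program consists of the fields `fs` and `fM` after the run of `c`. -/
theorem HC.program_correct (c : HC) (fs fM : Fin 32) (hc : c.depth ≤ 5) (n m : ℕ) {i : ℕ}
    (hi : i ≤ n) (J : Instance i) {T : ℕ} (hT : c.cost n + 7 * n + 20 ≤ T) (ω : Fin T → Bool) :
    (FlowTime.run (c.program fs fM) n m J ω).1 = [] ∧ ∀ j < i,
      (FlowTime.run (c.program fs fM) n m J ω).2.real j
        = (c.run (Env.of n m J (tape ω)) HS.init).R fs j ∧
      (FlowTime.run (c.program fs fM) n m J ω).2.nat j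
        = (c.run (Env.of n m J (tape ω)) HS.init).N fM j := by
  obtain ⟨t1, s1, ht1, hs1, r1, -⟩ := c.comp_correct (Env.of n m J (tape ω)) 0 _ HS.init
    [copyOut fs fM] (by omega) (Rel.init n m hi J (tape ω))
  set h := c.run (Env.of n m J (tape ω)) HS.init
  obtain ⟨s2, hs2, a0, ag, ax⟩ := copyLoop_correct n i hi (tape ω) fs fM (h.N fM) (h.R fs)
    [copyLow fM 7] i { s1 with nat := Function.update s1.nat 3 i } le_rfl
    (by exact r1.n) (by simp)
    (fun k => (Function.update_of_ne (show n + 8 + fM + 32 * k ≠ 3 by omega) i s1.nat).trans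
      (r1.N fM k))
    (fun k => r1.R fs k) (fun j h1 h2 => by omega)
  obtain ⟨s3, hs3, b1, b2, b3⟩ := copyLow_correct n (tape ω) fM (h.N fM) 7 s2 le_rfl a0 ag
  have hrun : FlowTime.run (c.program fs fM) n m J ω = ([], s3) := by
    obtain ⟨k, rfl⟩ : ∃ k, T = k + ((2 * 7 + 1) + ((7 * i + 1) + (3 + (t1 + 1)))) :=
      ⟨T - ((2 * 7 + 1) + ((7 * i + 1) + (3 + (t1 + 1)))), by
        have : t1 ≤ c.cost n := ht1
        omega⟩
    unfold FlowTime.run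
    rw [Function.iterate_add_apply, Function.iterate_add_apply _ (2 * 7 + 1),
      Function.iterate_add_apply _ (7 * i + 1), Function.iterate_add_apply _ 3,
      Function.iterate_succ_apply _ t1]
    have e1 : (step (tape ω))^[t1] (step (tape ω) ([c.program fs fM], input n m J))
        = ([copyOut fs fM], s1) := hs1
    have e2 : (step (tape ω))^[3] ([copyOut fs fM], s1) = ([copyLoop fs fM, copyLow fM 7],
        { s1 with nat := Function.update s1.nat 3 i }) := by
      have : s1.nat 2 = i := r1.i
      simp [copyOut, step, NatExp.eval, this]
    rw [e1, e2, hs2, hs3, step_nil]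
  rw [hrun]
  refine ⟨rfl, fun j hj => ⟨?_, ?_⟩⟩
  · rw [b1]; exact (ax j hj).1
  · rcases Nat.lt_or_ge 7 j with h7 | h7
    · rw [b3 j h7]; exact (ax j hj).2 h7
    · exact b2 j h7

/-! ### Frames, loops and information flow -/

/-- The program may write to the natural field `f`. -/
def HC.wN (f : Fin 32) : HC → Bool
  | setN g _ _ => g == f
  | flip g _ => g == f
  | seq c d => c.wN f || d.wN f
  | ite _ c d => c.wN f || d.wN f
  | rep c => c.wN f
  | _ => false

/-- The program may write to the real field `f`. -/
def HC.wR (f : Fin 32) : HC → Bool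
  | setR g _ _ => g == f
  | seq c d => c.wR f || d.wR f
  | ite _ c d => c.wR f || d.wR f
  | rep c => c.wR f
  | _ => false

section
variable {E E' : Env}

theorem iterate_inv {α : Type*} (F : α → α) (P : α → Prop) (hF : ∀ x, P x → P (F x)) (k : ℕ)
    (x : α) (hx : P x) : P (F^[k] x) := by
  induction k generalizing x with
  | zero => exact hx
  | succ k ih => exact ih _ (hF x hx)

theorem HC.run_N (f : Fin 32) (c : HC) : c.wN f = false → ∀ h, (c.run E h).N f = h.N f := by
  induction c with
  | skip => intro _ h; rfl
  | setN g i e =>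
    intro hc h
    simp only [HC.wN, beq_eq_false_iff_ne] at hc
    exact Function.update_of_ne (Ne.symm hc) _ _
  | setR => intro _ h; rfl
  | flip g i =>
    intro hc h
    simp only [HC.wN, beq_eq_false_iff_ne] at hc
    exact Function.update_of_ne (Ne.symm hc) _ _
  | seq c d ihc ihd =>
    intro hc h
    simp only [HC.wN, Bool.or_eq_false_iff] at hc
    exact (ihd hc.2 _).trans (ihc hc.1 h)
  | ite t c d ihc ihd =>
    intro hc h
    simp only [HC.wN, Bool.or_eq_false_iff] at hc
    simp only [HC.run]
    split_ifs
    · exact ihc hc.1 h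
    · exact ihd hc.2 h
  | rep c ih =>
    intro hc h
    exact iterate_inv (c.run E) (fun g => g.N f = h.N f) (fun g hg => (ih hc g).trans hg) _ _ rfl

theorem HC.run_R (f : Fin 32) (c : HC) : c.wR f = false → ∀ h, (c.run E h).R f = h.R f := by
  induction c with
  | skip => intro _ h; rfl
  | setR g i e =>
    intro hc h
    simp only [HC.wR, beq_eq_false_iff_ne] at hc
    exact Function.update_of_ne (Ne.symm hc) _ _
  | setN => intro _ h; rfl
  | flip g i => intro hc h; rfl
  | seq c d ihc ihd =>
    intro hc h
    simp only [HC.wR, Bool.or_eq_false_iff] at hc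
    exact (ihd hc.2 _).trans (ihc hc.1 h)
  | ite t c d ihc ihd =>
    intro hc h
    simp only [HC.wR, Bool.or_eq_false_iff] at hc
    simp only [HC.run]
    split_ifs
    · exact ihc hc.1 h
    · exact ihd hc.2 h
  | rep c ih =>
    intro hc h
    exact iterate_inv (c.run E) (fun g => g.R f = h.R f) (fun g hg => (ih hc g).trans hg) _ _ rfl

/-- `for k = 0, …, b - 1 do c`, where cell `0` of field `k` is the counter. -/
def HC.forTo (k : Fin 32) (b : NE) (c : HC) : HC :=
  .seq (.setN k (.lit 0) (.lit 0))
    (.rep (.ite (.nle (.add (.var k (.lit 0)) (.lit 1)) b)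
      (.seq c (.setN k (.lit 0) (.add (.var k (.lit 0)) (.lit 1)))) .skip))

/-- `g` differs from `h` only in fields that `c` writes. -/
structure Frame (c : HC) (h g : HS) : Prop where
  N : ∀ f, c.wN f = false → g.N f = h.N f
  R : ∀ f, c.wR f = false → g.R f = h.R f

theorem HC.frame (c : HC) (h : HS) : Frame c h (c.run E h) :=
  ⟨fun f hf => c.run_N f hf h, fun f hf => c.run_R f hf h⟩

/-- The invariant rule for a counting loop. The invariant `P` must not depend on the counter, and
the bound must be constant as long as only the fields written in the loop change. -/
theorem HC.forTo_ind (k : Fin 32) (B : NE) (c : HC) (h : HS) (b : ℕ) (hb : b ≤ E.n + 1)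
    (hk : c.wN k = false) (P : ℕ → HS → Prop)
    (hP : ∀ l g v, P l g → P l (g.setN k 0 v))
    (hB : ∀ g, Frame (forTo k B c) h g → B.ev E g = b)
    (h0 : P 0 h)
    (hs : ∀ l < b, ∀ g, Frame (forTo k B c) h g → g.N k 0 = l → P l g → P (l + 1) (c.run E g)) :
    P b ((forTo k B c).run E h) := by
  set body : HC := .ite (.nle (.add (.var k (.lit 0)) (.lit 1)) B)
      (.seq c (.setN k (.lit 0) (.add (.var k (.lit 0)) (.lit 1)))) .skip with hbody
  have key : ∀ l, Frame (forTo k B c) h ((body.run E)^[l] (h.setN k 0 0)) ∧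
      ((body.run E)^[l] (h.setN k 0 0)).N k 0 = min l b ∧
      P (min l b) ((body.run E)^[l] (h.setN k 0 0)) := by
    intro l
    induction l with
    | zero =>
      refine ⟨⟨fun f hf => ?_, fun f hf => rfl⟩, by simp [HS.setN], ?_⟩
      · simp only [forTo, HC.wN, Bool.or_eq_false_iff, beq_eq_false_iff_ne] at hf
        exact Function.update_of_ne (Ne.symm hf.1) _ _
      · simpa using hP 0 h 0 h0
    | succ l ih =>
      obtain ⟨i1, i2, i3⟩ := ih
      rw [Function.iterate_succ_apply']
      set g := (body.run E)^[l] (h.setN k 0 0)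
      have hBg := hB g i1
      refine ⟨⟨fun f hf => ?_, fun f hf => ?_⟩, ?_⟩
      · rw [← i1.N f hf]
        simp only [forTo, HC.wN, Bool.or_eq_false_iff] at hf
        exact body.run_N f (by simp [hbody, HC.wN, hf.1, hf.2.1.1]) g
      · rw [← i1.R f hf]
        simp only [forTo, HC.wR, Bool.or_eq_false_iff] at hf
        exact body.run_R f (by simp [hbody, HC.wR, hf.2.1.1]) g
      · by_cases hl : l < b
        · have e1 : body.run E g = (c.run E g).setN k 0 (l + 1) := by
            have e : g.N k 0 = l := by omega
            have : l + 1 ≤ b := hl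
            simp only [hbody, HC.run, TE.ev, NE.ev, hBg, e, this, c.run_N k hk, if_true]
          have e2 : min (l + 1) b = l + 1 := by omega
          rw [e1, e2]
          refine ⟨by simp [HS.setN], hP _ _ _ (hs l hl g i1 (by omega) ?_)⟩
          rwa [show min l b = l by omega] at i3
        · have e1 : body.run E g = g := by
            have : ¬ g.N k 0 + 1 ≤ b := by omega
            simp [hbody, HC.run, TE.ev, NE.ev, hBg, this]
          have e2 : min (l + 1) b = min l b := by omega
          rw [e1, e2]
          exact ⟨i2, i3⟩
  have := (key (E.n + 1)).2.2
  rwa [show min (E.n + 1) b = b by omega] at this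

/-! Programs that do not look at the input behave the same on all inputs. -/

/-- The expression does not use the number of released jobs. -/
def NE.noIn : NE → Bool
  | nrel => false
  | var _ e => e.noIn
  | add a b => a.noIn && b.noIn
  | sub a b => a.noIn && b.noIn
  | _ => true

/-- The expression does not use the input. -/
def RE.noIn : RE → Bool
  | rel _ => false
  | siz _ => false
  | var _ e => e.noIn
  | add a b => a.noIn && b.noIn
  | sub a b => a.noIn && b.noIn

/-- The test does not use the input. -/
def TE.noIn : TE → Bool
  | nle a b => a.noIn && b.noIn
  | rle a b => a.noIn && b.noIn
  | neg t => t.noIn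
  | both t u => t.noIn && u.noIn

/-- The program does not use the input. -/
def HC.noIn : HC → Bool
  | skip => true
  | setN _ i e => i.noIn && e.noIn
  | setR _ i e => i.noIn && e.noIn
  | flip _ i => i.noIn
  | seq c d => c.noIn && d.noIn
  | ite t c d => t.noIn && c.noIn && d.noIn
  | rep c => c.noIn

theorem NE.ev_noIn (hn : E.n = E'.n) (hm : E.m = E'.m) (h : HS) (e : NE) :
    e.noIn = true → e.ev E h = e.ev E' h := by
  induction e with
  | nrel => simp [NE.noIn]
  | _ => simp_all [NE.noIn, NE.ev]

theorem RE.ev_noIn (hn : E.n = E'.n) (hm : E.m = E'.m) (h : HS) (e : RE) :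
    e.noIn = true → e.ev E h = e.ev E' h := by
  induction e with
  | rel => simp [RE.noIn]
  | siz => simp [RE.noIn]
  | var f e => intro he; simp only [RE.ev]; rw [NE.ev_noIn hn hm h e he]
  | _ => simp_all [RE.noIn, RE.ev]

theorem TE.ev_noIn (hn : E.n = E'.n) (hm : E.m = E'.m) (h : HS) (t : TE) :
    t.noIn = true → (t.ev E h ↔ t.ev E' h) := by
  induction t with
  | nle a b =>
    intro ht; simp only [TE.noIn, Bool.and_eq_true] at ht
    simp only [TE.ev, NE.ev_noIn hn hm h _ ht.1, NE.ev_noIn hn hm h _ ht.2]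
  | rle a b =>
    intro ht; simp only [TE.noIn, Bool.and_eq_true] at ht
    simp only [TE.ev, RE.ev_noIn hn hm h _ ht.1, RE.ev_noIn hn hm h _ ht.2]
  | _ => simp_all [TE.noIn, TE.ev]

theorem HC.run_noIn (hn : E.n = E'.n) (hm : E.m = E'.m) (ht : E.tape = E'.tape) (c : HC) :
    c.noIn = true → ∀ h, c.run E h = c.run E' h := by
  induction c with
  | skip => intro _ _; rfl
  | setN f i e =>
    intro hc h; simp only [HC.noIn, Bool.and_eq_true] at hc
    simp only [HC.run, NE.ev_noIn hn hm h _ hc.1, NE.ev_noIn hn hm h _ hc.2]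
  | setR f i e =>
    intro hc h; simp only [HC.noIn, Bool.and_eq_true] at hc
    simp only [HC.run, NE.ev_noIn hn hm h _ hc.1, RE.ev_noIn hn hm h _ hc.2]
  | flip f i =>
    intro hc h
    simp only [HC.run, NE.ev_noIn hn hm h _ hc, ht]
  | seq c d ihc ihd =>
    intro hc h; simp only [HC.noIn, Bool.and_eq_true] at hc
    simp only [HC.run, ihc hc.1, ihd hc.2]
  | ite t c d ihc ihd =>
    intro hc h; simp only [HC.noIn, Bool.and_eq_true] at hc
    have := TE.ev_noIn hn hm h t hc.1.1
    simp only [HC.run, ihc hc.1.2, ihd hc.2]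
    by_cases hh : t.ev E h
    · rw [if_pos hh, if_pos (this.mp hh)]
    · rw [if_neg hh, if_neg (fun h => hh (this.mpr h))]
  | rep c ih =>
    intro hc h
    have : c.run E = c.run E' := funext (ih hc)
    simp only [HC.run, this, hn]

/-! Information flow: `dN` and `dR` tell which fields are independent of the random bits. -/

/-- The expression depends on independent fields only. -/
def NE.det (dN : Fin 32 → Bool) : NE → Bool
  | nrel => false
  | var f e => dN f && e.det dN
  | add a b => a.det dN && b.det dN
  | sub a b => a.det dN && b.det dN
  | _ => true

/-- The expression depends on independent fields only. -/
def RE.det (dN dR : Fin 32 → Bool) : RE → Bool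
  | rel _ => false
  | siz _ => false
  | var f e => dR f && e.det dN
  | add a b => a.det dN dR && b.det dN dR
  | sub a b => a.det dN dR && b.det dN dR

/-- The test depends on independent fields only. -/
def TE.det (dN dR : Fin 32 → Bool) : TE → Bool
  | nle a b => a.det dN && b.det dN
  | rle a b => a.det dN dR && b.det dN dR
  | neg t => t.det dN dR
  | both t u => t.det dN dR && u.det dN dR

/-- The program does not write to independent fields. -/
def HC.noDet (dN dR : Fin 32 → Bool) : HC → Bool
  | skip => true
  | setN f _ _ => !dN f
  | setR f _ _ => !dR f
  | flip f _ => !dN f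
  | seq c d => c.noDet dN dR && d.noDet dN dR
  | ite _ c d => c.noDet dN dR && d.noDet dN dR
  | rep c => c.noDet dN dR

/-- The program writes only independent values to independent fields, and writes to them under
independent conditions only. -/
def HC.det (dN dR : Fin 32 → Bool) : HC → Bool
  | skip => true
  | setN f i e => !dN f || (i.det dN && e.det dN)
  | setR f i e => !dR f || (i.det dN && e.det dN dR)
  | flip f _ => !dN f
  | seq c d => c.det dN dR && d.det dN dR
  | ite t c d => c.det dN dR && d.det dN dR &&
      (t.det dN dR || (c.noDet dN dR && d.noDet dN dR))
  | rep c => c.det dN dR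

/-- The states agree on the independent fields. -/
structure Agree (dN dR : Fin 32 → Bool) (h h' : HS) : Prop where
  N : ∀ f, dN f = true → h.N f = h'.N f
  R : ∀ f, dR f = true → h.R f = h'.R f

variable {dN dR : Fin 32 → Bool} {h h' : HS}

theorem Agree.trans {h'' : HS} (a : Agree dN dR h h') (b : Agree dN dR h' h'') :
    Agree dN dR h h'' :=
  ⟨fun f hf => (a.N f hf).trans (b.N f hf), fun f hf => (a.R f hf).trans (b.R f hf)⟩

theorem Agree.symm (a : Agree dN dR h h') : Agree dN dR h' h :=
  ⟨fun f hf => (a.N f hf).symm, fun f hf => (a.R f hf).symm⟩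

theorem Agree.ne (hn : E.n = E'.n) (hm : E.m = E'.m) (a : Agree dN dR h h') (e : NE) :
    e.det dN = true → e.ev E h = e.ev E' h' := by
  induction e with
  | nrel => simp [NE.det]
  | var f e ih =>
    intro he; simp only [NE.det, Bool.and_eq_true] at he
    simp only [NE.ev, ih he.2, a.N f he.1]
  | _ => simp_all [NE.det, NE.ev]

theorem Agree.re (hn : E.n = E'.n) (hm : E.m = E'.m) (a : Agree dN dR h h') (e : RE) :
    e.det dN dR = true → e.ev E h = e.ev E' h' := by
  induction e with
  | rel => simp [RE.det]
  | siz => simp [RE.det]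
  | var f e =>
    intro he; simp only [RE.det, Bool.and_eq_true] at he
    simp only [RE.ev, a.ne hn hm e he.2, a.R f he.1]
  | _ => simp_all [RE.det, RE.ev]

theorem Agree.te (hn : E.n = E'.n) (hm : E.m = E'.m) (a : Agree dN dR h h') (t : TE) :
    t.det dN dR = true → (t.ev E h ↔ t.ev E' h') := by
  induction t with
  | nle x y =>
    intro ht; simp only [TE.det, Bool.and_eq_true] at ht
    simp only [TE.ev, a.ne hn hm _ ht.1, a.ne hn hm _ ht.2]
  | rle x y =>
    intro ht; simp only [TE.det, Bool.and_eq_true] at ht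
    simp only [TE.ev, a.re hn hm _ ht.1, a.re hn hm _ ht.2]
  | _ => simp_all [TE.det, TE.ev]

theorem HC.agree_noDet (c : HC) : c.noDet dN dR = true → ∀ h, Agree dN dR h (c.run E h) := by
  induction c with
  | skip => exact fun _ h => ⟨fun _ _ => rfl, fun _ _ => rfl⟩
  | setN f i e =>
    intro hc h
    refine ⟨fun f' hf' => (Function.update_of_ne ?_ _ _).symm, fun _ _ => rfl⟩
    rintro rfl; simp [HC.noDet, hf'] at hc
  | setR f i e =>
    intro hc h
    refine ⟨fun _ _ => rfl, fun f' hf' => (Function.update_of_ne ?_ _ _).symm⟩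
    rintro rfl; simp [HC.noDet, hf'] at hc
  | flip f i =>
    intro hc h
    refine ⟨fun f' hf' => (Function.update_of_ne ?_ _ _).symm, fun _ _ => rfl⟩
    rintro rfl; simp [HC.noDet, hf'] at hc
  | seq c d ihc ihd =>
    intro hc h; simp only [HC.noDet, Bool.and_eq_true] at hc
    exact (ihc hc.1 h).trans (ihd hc.2 _)
  | ite t c d ihc ihd =>
    intro hc h; simp only [HC.noDet, Bool.and_eq_true] at hc
    simp only [HC.run]
    split_ifs
    exacts [ihc hc.1 h, ihd hc.2 h]
  | rep c ih =>
    intro hc h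
    exact iterate_inv (c.run E) (fun g => Agree dN dR h g) (fun g hg => hg.trans (ih hc g)) _ _
      ⟨fun _ _ => rfl, fun _ _ => rfl⟩

/-- Noninterference: runs with different random bits from states that agree on the independent
fields end in states that agree on them. -/
theorem HC.agree_det (hn : E.n = E'.n) (hm : E.m = E'.m) (c : HC) : c.det dN dR = true →
    ∀ h h', Agree dN dR h h' → Agree dN dR (c.run E h) (c.run E' h') := by
  induction c with
  | skip => exact fun _ _ _ a => a
  | setN f i e =>
    intro hc h h' a
    refine ⟨fun f' hf' => ?_, a.R⟩
    simp only [HC.run, HS.setN]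
    by_cases hf : f' = f
    · subst hf
      simp only [HC.det, hf', Bool.not_true, Bool.false_or, Bool.and_eq_true] at hc
      simp only [Function.update_self, a.N f' hf', a.ne hn hm _ hc.1, a.ne hn hm _ hc.2]
    · simp only [Function.update_of_ne hf, a.N f' hf']
  | setR f i e =>
    intro hc h h' a
    refine ⟨a.N, fun f' hf' => ?_⟩
    simp only [HC.run, HS.setR]
    by_cases hf : f' = f
    · subst hf
      simp only [HC.det, hf', Bool.not_true, Bool.false_or, Bool.and_eq_true] at hc
      simp only [Function.update_self, a.R f' hf', a.ne hn hm _ hc.1, a.re hn hm _ hc.2]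
    · simp only [Function.update_of_ne hf, a.R f' hf']
  | flip f i =>
    intro hc h h' a
    exact ((HC.agree_noDet (.flip f i) hc h).symm.trans a).trans
      (HC.agree_noDet (.flip f i) hc h')
  | seq c d ihc ihd =>
    intro hc h h' a; simp only [HC.det, Bool.and_eq_true] at hc
    exact ihd hc.2 _ _ (ihc hc.1 _ _ a)
  | ite t c d ihc ihd =>
    intro hc h h' a
    simp only [HC.det, Bool.and_eq_true, Bool.or_eq_true] at hc
    rcases hc.2 with ht | ht
    · have := a.te hn hm t ht
      simp only [HC.run]
      by_cases hh : t.ev E h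
      · rw [if_pos hh, if_pos (this.mp hh)]; exact ihc hc.1.1 _ _ a
      · rw [if_neg hh, if_neg (fun h => hh (this.mpr h))]; exact ihd hc.1.2 _ _ a
    · have hnd : HC.noDet dN dR (.ite t c d) = true := by simp [HC.noDet, ht.1, ht.2]
      exact ((HC.agree_noDet _ hnd h).symm.trans a).trans (HC.agree_noDet _ hnd h')
  | rep c ih =>
    intro hc h h' a
    simp only [HC.run, hn]
    generalize E'.n + 1 = k
    induction k generalizing h h' with
    | zero => exact a
    | succ k ihk => exact ihk _ _ (ih hc _ _ a)

end

/-! ### The scheduler -/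

/-! The fields of the scheduler. Scalars are kept in cell `0` of a field.
* `N_Q` and `N_mQ` hold `Q` and `m Q`, `N_rho` the rotation; `N_j`, `R_T` and `R_PJ` are the job
  that is being released, its release time and its size; `R_V` is the released volume.
* Indexed by jobs: size `R_p`, the product `R_y` of size and `m Q`; for the virtual schedule the
  flag `N_fs` of the started jobs, machine `N_nu` and start `R_sig`, and the flag `N_pl` of the jobs
  already placed in the current plan; for the big jobs group `N_gr`, machine `N_bm`, the flag `N_fb`
  of the started jobs, trigger clock `R_beta` and clock of the planned start `R_u`; machine `N_M`
  and start `R_s` in the real schedule.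
* Indexed by machines: end `R_f` of the started and `R_e` of the planned virtual work, idle clock
  `R_a`, total size `R_W` of the started big jobs and the clock `R_E` at which they end.
* The other fields hold counters and intermediate results. -/

local notation "N_Q" => (0 : Fin 32)
local notation "N_mQ" => (1 : Fin 32)
local notation "N_rho" => (2 : Fin 32)
local notation "N_j" => (3 : Fin 32)
local notation "N_k" => (4 : Fin 32)
local notation "N_l" => (5 : Fin 32)
local notation "N_best" => (6 : Fin 32)
local notation "N_bestm" => (7 : Fin 32)
local notation "N_found" => (8 : Fin 32)
local notation "N_cnt" => (9 : Fin 32)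
local notation "N_q" => (10 : Fin 32)
local notation "N_bit" => (11 : Fin 32)
local notation "N_fs" => (12 : Fin 32)
local notation "N_fb" => (13 : Fin 32)
local notation "N_nu" => (14 : Fin 32)
local notation "N_gr" => (15 : Fin 32)
local notation "N_bm" => (16 : Fin 32)
local notation "N_M" => (17 : Fin 32)
local notation "N_pl" => (18 : Fin 32)
local notation "N_grp" => (19 : Fin 32)
local notation "N_sq" => (20 : Fin 32)
local notation "N_rd" => (21 : Fin 32)
local notation "N_r" => (22 : Fin 32)
local notation "R_T" => (0 : Fin 32)
local notation "R_PJ" => (1 : Fin 32)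
local notation "R_V" => (2 : Fin 32)
local notation "R_p" => (3 : Fin 32)
local notation "R_y" => (4 : Fin 32)
local notation "R_beta" => (5 : Fin 32)
local notation "R_u" => (6 : Fin 32)
local notation "R_sig" => (7 : Fin 32)
local notation "R_s" => (8 : Fin 32)
local notation "R_f" => (9 : Fin 32)
local notation "R_e" => (10 : Fin 32)
local notation "R_a" => (11 : Fin 32)
local notation "R_W" => (12 : Fin 32)
local notation "R_E" => (13 : Fin 32)
local notation "R_X" => (14 : Fin 32)

/-- The natural scalar `f`. -/
abbrev NE.s (f : Fin 32) : NE := .var f (.lit 0)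

/-- The real scalar `f`. -/
abbrev RE.s (f : Fin 32) : RE := .var f (.lit 0)

/-- Assignment to a natural scalar. -/
abbrev HC.sN (f : Fin 32) (e : NE) : HC := .setN f (.lit 0) e

/-- Assignment to a real scalar. -/
abbrev HC.sR (f : Fin 32) (e : RE) : HC := .setR f (.lit 0) e

/-- The test `x < y` for reals. -/
abbrev TE.rlt (x y : RE) : TE := .neg (.rle y x)

/-- The test `x < y` for natural numbers. -/
abbrev TE.nlt (x y : NE) : TE := .neg (.nle y x)

/-- The test `e = 0`. -/
abbrev TE.zero (e : NE) : TE := .nle e (.lit 0)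

/-- The disjunction of two tests. -/
abbrev TE.orE (t u : TE) : TE := .neg (.both (.neg t) (.neg u))

/-- The test `a = b`, by two inequalities. -/
abbrev TE.neq (a b : NE) : TE := .both (.nle a b) (.nle b a)

/-- Draws one random bit. -/
def drawBit : HC := .flip N_bit (.lit 0)

/-- Computes `Q`, the least power of two with `n ≤ Q ^ 2 * m`, and `m Q`; the scalar `N_sq` runs
through the values `4 ^ l * m`. -/
def prepQ : HC :=
  .seq (.sN N_Q (.lit 1)) (.seq (.sN N_mQ .nmach) (.seq (.sN N_sq .nmach)
    (.rep (.ite (.nlt (.s N_sq) .njobs)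
      (.seq (.sN N_Q (.add (.s N_Q) (.s N_Q))) (.seq (.sN N_mQ (.add (.s N_mQ) (.s N_mQ)))
        (.sN N_sq (.add (.add (.s N_sq) (.s N_sq)) (.add (.s N_sq) (.s N_sq)))))) .skip))))

/-- Computes the rotation: a random number with `⌈log₂ m⌉` bits, reduced modulo `m`. It is not
uniform, but no residue has more than twice its share. -/
def prepRho : HC :=
  .seq (.sN N_q (.lit 1)) (.seq (.sN N_rho (.lit 0)) (.seq
    (.rep (.ite (.nlt (.s N_q) .nmach)
      (.seq (.sN N_q (.add (.s N_q) (.s N_q))) (.seq drawBit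
        (.sN N_rho (.add (.add (.s N_rho) (.s N_rho)) (.s N_bit))))) .skip))
    (.ite (.nle .nmach (.s N_rho)) (.sN N_rho (.sub (.s N_rho) .nmach)) .skip)))

/-- Advances the idle clocks to the current time: a machine whose planned virtual work ends at
`e < T` has been idle during `[e, T)`. -/
def idleClocks : HC :=
  .forTo N_k .nmach (.ite (.rlt (.var R_e (.s N_k)) (.s R_T))
    (.setR R_a (.s N_k) (.add (.var R_a (.s N_k)) (.sub (.s R_T) (.var R_e (.s N_k))))) .skip)

/-- The job `k` is small: its size is at most the released volume divided by `m Q`. -/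
def smallTest (k : NE) : TE := .rle (.var R_y k) (.s R_V)

/-- Marks the jobs that the virtual schedule has started before the current time, and moves the ends
of the started work of their machines. -/
def freezeSmall : HC :=
  .forTo N_k (.s N_j) (.ite (.both (.zero (.var N_fs (.s N_k))) (.both (smallTest (.s N_k))
      (.rlt (.var R_sig (.s N_k)) (.s R_T))))
    (.seq (.setN N_fs (.s N_k) (.lit 1))
      (.ite (.rle (.var R_f (.var N_nu (.s N_k)))
          (.add (.var R_sig (.s N_k)) (.var R_p (.s N_k))))
        (.setR R_f (.var N_nu (.s N_k)) (.add (.var R_sig (.s N_k)) (.var R_p (.s N_k))))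
        .skip)) .skip)

/-- Marks the big jobs that have started before the current time, that is, whose planned clock has
been passed by the idle clock of their machine, and accounts for their work. -/
def freezeBig : HC :=
  .forTo N_k (.s N_j) (.ite (.both (.zero (.var N_fb (.s N_k))) (.both (.neg (smallTest (.s N_k)))
      (.rlt (.var R_u (.s N_k)) (.var R_a (.var N_bm (.s N_k))))))
    (.seq (.setN N_fb (.s N_k) (.lit 1))
      (.seq (.setR R_W (.var N_bm (.s N_k))
          (.add (.var R_W (.var N_bm (.s N_k))) (.var R_p (.s N_k))))
        (.ite (.rle (.var R_E (.var N_bm (.s N_k)))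
            (.add (.var R_u (.s N_k)) (.var R_p (.s N_k))))
          (.setR R_E (.var N_bm (.s N_k)) (.add (.var R_u (.s N_k)) (.var R_p (.s N_k))))
          .skip))) .skip)

/-- Enters the size of the new job, adds it to the volume, and forms `m` times the size by repeated
addition. -/
def arriveSize : HC :=
  .seq (.setR R_p (.s N_j) (.s R_PJ)) (.seq (.sR R_V (.add (.s R_V) (.s R_PJ)))
    (.seq (.setR R_y (.s N_j) (.sub (.s R_PJ) (.s R_PJ)))
      (.forTo N_k .nmach (.setR R_y (.s N_j) (.add (.var R_y (.s N_j)) (.s R_PJ))))))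

/-- Draws the bits of a uniform number `K < Q` for the new job of size `p`, and forms `K p` and
`Q m p` by doublings. -/
def arriveDraw : HC :=
  .seq (.sR R_X (.sub (.s R_PJ) (.s R_PJ))) (.seq (.sN N_q (.lit 1))
    (.rep (.ite (.nlt (.s N_q) (.s N_Q))
      (.seq (.sN N_q (.add (.s N_q) (.s N_q))) (.seq
        (.setR R_y (.s N_j) (.add (.var R_y (.s N_j)) (.var R_y (.s N_j)))) (.seq drawBit
        (.seq (.sR R_X (.add (.s R_X) (.s R_X)))
          (.ite (.zero (.s N_bit)) .skip (.sR R_X (.add (.s R_X) (.s R_PJ)))))))) .skip)))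

/-- Counts the big jobs in group `k`. -/
def countGroup : HC :=
  .seq (.sN N_cnt (.lit 0)) (.forTo N_l (.s N_j)
    (.ite (.both (.neq (.var N_gr (.s N_l)) (.s N_k)) (.neg (smallTest (.s N_l))))
      (.sN N_cnt (.add (.s N_cnt) (.lit 1))) .skip))

/-- Finds the first group with fewer than `Q` big jobs. -/
def firstFit : HC :=
  .seq (.sN N_found (.lit 0)) (.seq (.sN N_grp (.lit 0)) (.forTo N_k .nmach
    (.seq countGroup (.ite (.both (.zero (.s N_found)) (.nlt (.s N_cnt) (.s N_Q)))
      (.seq (.sN N_found (.lit 1)) (.sN N_grp (.s N_k))) .skip))))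

/-- Enters the remaining data of the new job: its machine, which is the rotated group, and its
trigger clock, which is the free clock of that machine plus `K p`. -/
def register : HC :=
  .seq (.setN N_fs (.s N_j) (.lit 0)) (.seq (.setN N_fb (.s N_j) (.lit 0))
    (.seq (.setN N_gr (.s N_j) (.s N_grp)) (.seq
      (.setN N_bm (.s N_j) (.add (.s N_grp) (.s N_rho))) (.seq
        (.ite (.nle .nmach (.var N_bm (.s N_j)))
          (.setN N_bm (.s N_j) (.sub (.var N_bm (.s N_j)) .nmach)) .skip)
        (.ite (.rle (.var R_a (.var N_bm (.s N_j))) (.var R_E (.var N_bm (.s N_j))))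
          (.setR R_beta (.s N_j) (.add (.sub (.var R_E (.var N_bm (.s N_j)))
            (.var R_W (.var N_bm (.s N_j)))) (.s R_X)))
          (.setR R_beta (.s N_j) (.add (.sub (.var R_a (.var N_bm (.s N_j)))
            (.var R_W (.var N_bm (.s N_j)))) (.s R_X))))))))

/-- The virtual plan starts from the ends of the started work, and not before the current time; no
job is placed yet. -/
def planInit : HC :=
  .seq (.forTo N_k .nmach (.ite (.rle (.var R_f (.s N_k)) (.s R_T))
      (.setR R_e (.s N_k) (.s R_T)) (.setR R_e (.s N_k) (.var R_f (.s N_k)))))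
    (.forTo N_k (.add (.s N_j) (.lit 1)) (.setN N_pl (.s N_k) (.lit 0)))

/-- Finds a shortest small job that is neither started nor placed. -/
def findJob : HC :=
  .seq (.sN N_found (.lit 0)) (.forTo N_k (.add (.s N_j) (.lit 1))
    (.ite (.both (.both (.zero (.var N_fs (.s N_k))) (.zero (.var N_pl (.s N_k))))
        (.both (smallTest (.s N_k))
          (.neg (.both (.neg (.zero (.s N_found)))
            (.rle (.var R_p (.s N_best)) (.var R_p (.s N_k)))))))
      (.seq (.sN N_found (.lit 1)) (.sN N_best (.s N_k))) .skip))

/-- Finds a machine whose planned work ends first. -/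
def findMachine : HC :=
  .seq (.sN N_bestm (.lit 0)) (.forTo N_l .nmach
    (.ite (.rlt (.var R_e (.s N_l)) (.var R_e (.s N_bestm))) (.sN N_bestm (.s N_l)) .skip))

/-- Places the job at the end of the planned work of the machine. In the real schedule it starts
later by the lag of that machine, unless the job has already started as a big job; then only its
copy in the virtual schedule is placed. -/
def assignJob : HC :=
  .seq (.setR R_sig (.s N_best) (.var R_e (.s N_bestm))) (.seq
    (.setN N_nu (.s N_best) (.s N_bestm)) (.seq
    (.setR R_e (.s N_bestm) (.add (.var R_e (.s N_bestm)) (.var R_p (.s N_best)))) (.seq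
    (.setN N_pl (.s N_best) (.lit 1))
    (.ite (.zero (.var N_fb (.s N_best)))
      (.seq (.setN N_M (.s N_best) (.s N_bestm))
        (.ite (.rle (.var R_a (.s N_bestm)) (.var R_E (.s N_bestm)))
          (.setR R_s (.s N_best) (.add (.var R_sig (.s N_best))
            (.sub (.var R_E (.s N_bestm)) (.var R_a (.s N_bestm)))))
          (.setR R_s (.s N_best) (.var R_sig (.s N_best))))) .skip))))

/-- Plans the virtual schedule by shortest-first list scheduling. -/
def planSmall : HC :=
  .forTo N_rd (.add (.s N_j) (.lit 1))
    (.seq findJob (.ite (.zero (.s N_found)) .skip (.seq findMachine assignJob)))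

/-- Job `l` precedes job `k` in the order of the trigger clocks, ties being broken by number. -/
def precTest (l k : NE) : TE :=
  .orE (.rlt (.var R_beta l) (.var R_beta k))
    (.both (.rle (.var R_beta l) (.var R_beta k)) (.nlt l k))

/-- Job `k` is big and has not started. -/
def waitTest (k : NE) : TE := .both (.zero (.var N_fb k)) (.neg (smallTest k))

/-- Plans the big jobs: the planned clock of a job is its trigger clock, delayed by the big jobs of
its machine that have started or precede it. The start is the time when the idle clock shows the
planned clock, assuming that the machine stays idle after its planned virtual work. -/
def planBig : HC :=
  .forTo N_k (.add (.s N_j) (.lit 1)) (.ite (waitTest (.s N_k))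
    (.seq (.setR R_u (.s N_k) (.add (.var R_W (.var N_bm (.s N_k))) (.var R_beta (.s N_k)))) (.seq
      (.forTo N_r (.add (.s N_j) (.lit 1))
        (.ite (.both (waitTest (.s N_r)) (.both
            (.neq (.var N_bm (.s N_r)) (.var N_bm (.s N_k))) (precTest (.s N_r) (.s N_k))))
          (.setR R_u (.s N_k) (.add (.var R_u (.s N_k)) (.var R_p (.s N_r)))) .skip))
      (.seq (.setR R_s (.s N_k) (.add (.sub (.var R_e (.var N_bm (.s N_k)))
          (.var R_a (.var N_bm (.s N_k)))) (.var R_u (.s N_k))))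
        (.setN N_M (.s N_k) (.var N_bm (.s N_k)))))) .skip)

/-- The first part of an event: what has started before the release is settled. -/
def freeze : HC := .seq idleClocks (.seq freezeSmall freezeBig)

/-- The second part of an event: the new job is entered. -/
def arrive : HC := .seq arriveSize (.seq arriveDraw (.seq firstFit register))

/-- The last part of an event: a new plan is made. -/
def makePlan : HC := .seq planInit (.seq planSmall planBig)

/-- What is done at the release of a job. -/
def eventBody : HC := .seq freeze (.seq arrive makePlan)

/-- The whole program. It starts from scratch at every release and simulates its own behaviour at
all releases up to the present one. -/
def scheduler : HC :=
  .seq (.seq prepQ prepRho) (.forTo N_j .nrel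
    (.seq (.sR R_T (.rel (.s N_j))) (.seq (.sR R_PJ (.siz (.s N_j))) eventBody)))

/-- The natural fields whose contents do not depend on the random bits. -/
def detN (f : Fin 32) : Bool := !(f = 2 || f = 11 || f = 13 || f = 16 || f = 17 || f = 22)

/-- The real fields whose contents do not depend on the random bits. -/
def detR (f : Fin 32) : Bool := f = 0 || f = 1 || f = 2 || f = 3 || f = 4 || f = 7 || f = 9 ||
  f = 10 || f = 11

theorem scheduler_depth : scheduler.depth ≤ 5 := by decide
theorem eventBody_noIn : eventBody.noIn = true := by decide
theorem prep_noIn : (HC.seq prepQ prepRho).noIn = true := by decide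

/-- The virtual schedule, the volumes and the groups are independent of the random bits. -/
theorem eventBody_det : eventBody.det detN detR = true := by decide
theorem prep_det : (HC.seq prepQ prepRho).det detN detR = true := by decide

/-! ### Elementary program fragments -/

section

theorem HS.setN_R (h : HS) (f : Fin 32) (i v : ℕ) : (h.setN f i v).R = h.R := rfl
theorem HS.setR_N (h : HS) (f : Fin 32) (i : ℕ) (v : ℝ) : (h.setR f i v).N = h.N := rfl

theorem HS.setN_N (h : HS) (f g : Fin 32) (i v k : ℕ) :
    (h.setN f i v).N g k = if g = f ∧ k = i then v else h.N g k := by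
  by_cases hg : g = f
  · subst hg; simp [HS.setN, Function.update_apply]
  · simp [HS.setN, hg]

theorem HS.setR_R (h : HS) (f g : Fin 32) (i : ℕ) (v : ℝ) (k : ℕ) :
    (h.setR f i v).R g k = if g = f ∧ k = i then v else h.R g k := by
  by_cases hg : g = f
  · subst hg; simp [HS.setR, Function.update_apply]
  · simp [HS.setR, hg]

/-- The program draws no random bits. -/
def HC.noFlip : HC → Bool
  | flip _ _ => false
  | seq c d => c.noFlip && d.noFlip
  | ite _ c d => c.noFlip && d.noFlip
  | rep c => c.noFlip
  | _ => true

theorem HC.run_used (E : Env) (c : HC) : c.noFlip = true → ∀ h, (c.run E h).used = h.used := by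
  induction c with
  | skip => intro _ h; rfl
  | setN => intro _ h; rfl
  | setR => intro _ h; rfl
  | flip => intro hc; simp [HC.noFlip] at hc
  | seq c d ihc ihd =>
    intro hc h; simp only [HC.noFlip, Bool.and_eq_true] at hc
    exact (ihd hc.2 _).trans (ihc hc.1 h)
  | ite t c d ihc ihd =>
    intro hc h; simp only [HC.noFlip, Bool.and_eq_true] at hc
    simp only [HC.run]
    split_ifs
    exacts [ihc hc.1 h, ihd hc.2 h]
  | rep c ih =>
    intro hc h
    exact iterate_inv (c.run E) (fun g => g.used = h.used) (fun g hg => (ih hc g).trans hg) _ _ rfl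

variable {E : Env} {h : HS}

theorem idleClocks_spec (hm : E.m ≤ E.n + 1) (μ : ℕ) :
    (idleClocks.run E h).R R_a μ =
      if μ < E.m then h.R R_a μ + max 0 (h.R R_T 0 - h.R R_e μ) else h.R R_a μ := by
  refine HC.forTo_ind N_k .nmach _ h E.m hm (by decide) (fun l g => g.R R_a μ =
    if μ < l then h.R R_a μ + max 0 (h.R R_T 0 - h.R R_e μ) else h.R R_a μ)
    (fun _ _ _ hP => hP) (fun _ _ => rfl) (by simp) ?_
  intro l hl g hF hk hP
  have eT : g.R R_T = h.R R_T := hF.R _ (by decide)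
  have ee : g.R R_e = h.R R_e := hF.R _ (by decide)
  simp only [HC.run, TE.ev, RE.ev, NE.ev, hk, eT, ee]
  rcases lt_trichotomy μ l with h1 | h1 | h1
  · have h2 : μ < l + 1 := by omega
    have h3 : μ ≠ l := by omega
    split_ifs <;> simp_all [HS.setR_R]
  · subst h1
    by_cases hT : h.R R_T 0 ≤ h.R R_e μ
    · simp_all
    · rw [max_eq_right (by linarith)]
      simp_all [HS.setR_R]
  · have h2 : ¬ μ < l + 1 := by omega
    have h3 : μ ≠ l := by omega
    have h4 : ¬ μ < l := by omega
    split_ifs <;> simp_all [HS.setR_R]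

/-- Job `k` is started by the plan of the virtual schedule before the current time. -/
def NewSmall (h : HS) (k : ℕ) : Prop :=
  h.N N_fs k = 0 ∧ h.R R_y k ≤ h.R R_V 0 ∧ h.R R_sig k < h.R R_T 0

/-- The big job `k` is started by the plan before the current time. -/
def NewBig (h : HS) (k : ℕ) : Prop :=
  h.N N_fb k = 0 ∧ h.R R_V 0 < h.R R_y k ∧ h.R R_u k < h.R R_a (h.N N_bm k)

/-- `g` is the maximum of `f` and the values `x k` for `k < j` with `P k` and `c k = μ`. -/
structure MaxUpd (j : ℕ) (P : ℕ → Prop) (c : ℕ → ℕ) (x f g : ℕ → ℝ) : Prop where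
  le : ∀ μ, f μ ≤ g μ
  le_of : ∀ k < j, P k → x k ≤ g (c k)
  eq : ∀ μ, g μ = f μ ∨ ∃ k < j, P k ∧ c k = μ ∧ g μ = x k

theorem MaxUpd.zero (P : ℕ → Prop) (c : ℕ → ℕ) (x f : ℕ → ℝ) : MaxUpd 0 P c x f f :=
  ⟨fun _ => le_rfl, fun _ h => absurd h (Nat.not_lt_zero _), fun _ => Or.inl rfl⟩

theorem MaxUpd.succ_not {j : ℕ} {P : ℕ → Prop} {c : ℕ → ℕ} {x f g : ℕ → ℝ}
    (H : MaxUpd j P c x f g) (hj : ¬ P j) : MaxUpd (j + 1) P c x f g where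
  le := H.le
  le_of k hk hP := H.le_of k
    (lt_of_le_of_ne (by omega) (by rintro rfl; exact hj hP)) hP
  eq μ := (H.eq μ).imp_right (by rintro ⟨k, hk, r⟩; exact ⟨k, by omega, r⟩)

theorem MaxUpd.succ {j : ℕ} {P : ℕ → Prop} {c : ℕ → ℕ} {x f g g' : ℕ → ℝ}
    (H : MaxUpd j P c x f g) (hj : P j)
    (hg : ∀ μ, g' μ = if μ = c j then max (g μ) (x j) else g μ) : MaxUpd (j + 1) P c x f g' where
  le μ := (H.le μ).trans (by rw [hg]; split_ifs <;> simp)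
  le_of k hk hP := by
    rcases Nat.lt_or_ge k j with h | h
    · refine (H.le_of k h hP).trans (by rw [hg]; split_ifs <;> simp)
    · obtain rfl : k = j := by omega
      rw [hg]; simp
  eq μ := by
    rw [hg]
    split_ifs with h
    · rcases max_choice (g μ) (x j) with h1 | h1
      · rw [h1]
        exact (H.eq μ).imp_right (by rintro ⟨k, hk, r⟩; exact ⟨k, by omega, r⟩)
      · exact Or.inr ⟨j, by omega, hj, h.symm, h1⟩
    · exact (H.eq μ).imp_right (by rintro ⟨k, hk, r⟩; exact ⟨k, by omega, r⟩)

open Classical in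
theorem flag_succ {P : ℕ → Prop} {l : ℕ} (hl : P l) (k x : ℕ) :
    (if k < l + 1 ∧ P k then 1 else x) = if k = l then 1 else if k < l ∧ P k then 1 else x := by
  rcases lt_trichotomy k l with h | h | h
  · simp [h, h.ne, Nat.lt_succ_of_lt h]
  · simp [h, hl]
  · simp [h.ne', show ¬ k < l by omega, show ¬ k < l + 1 by omega]

theorem HS.ite_N (c : Prop) [Decidable c] (g g' : HS) (f : Fin 32) (k : ℕ) :
    (if c then g else g').N f k = if c then g.N f k else g'.N f k := by split_ifs <;> rfl

theorem HS.ite_R (c : Prop) [Decidable c] (g g' : HS) (f : Fin 32) (k : ℕ) :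
    (if c then g else g').R f k = if c then g.R f k else g'.R f k := by split_ifs <;> rfl

theorem ite_max (c : Prop) [Decidable c] (x y : ℝ) :
    (if x ≤ y then if c then y else x else x) = if c then max x y else x := by
  split_ifs with h1 h2 h2
  · rw [max_eq_right h1]
  · rfl
  · rw [max_eq_left (by linarith)]
  · rfl

open Classical in
theorem freezeSmall_spec (hj : h.N N_j 0 ≤ E.n + 1) :
    (∀ k, (freezeSmall.run E h).N N_fs k =
      if k < h.N N_j 0 ∧ NewSmall h k then 1 else h.N N_fs k) ∧
    MaxUpd (h.N N_j 0) (NewSmall h) (h.N N_nu) (fun k => h.R R_sig k + h.R R_p k) (h.R R_f)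
      ((freezeSmall.run E h).R R_f) := by
  refine HC.forTo_ind N_k (.s N_j) _ h (h.N N_j 0) hj (by decide) (fun l g => (∀ k, g.N N_fs k =
      if k < l ∧ NewSmall h k then 1 else h.N N_fs k) ∧
    MaxUpd l (NewSmall h) (h.N N_nu) (fun k => h.R R_sig k + h.R R_p k) (h.R R_f) (g.R R_f))
    (fun _ _ _ hP => hP) (fun g hF => ?_) ⟨by simp, MaxUpd.zero _ _ _ _⟩ ?_
  · exact congrFun (hF.N N_j (by decide)) 0
  intro l hl g hF hk ⟨hP1, hP2⟩
  have eT : g.R R_T = h.R R_T := hF.R _ (by decide)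
  have ey : g.R R_y = h.R R_y := hF.R _ (by decide)
  have eV : g.R R_V = h.R R_V := hF.R _ (by decide)
  have es : g.R R_sig = h.R R_sig := hF.R _ (by decide)
  have ep : g.R R_p = h.R R_p := hF.R _ (by decide)
  have enu : g.N N_nu = h.N N_nu := hF.N _ (by decide)
  have efs : g.N N_fs l = h.N N_fs l := by rw [hP1]; simp
  by_cases hN : NewSmall h l
  · have hg : (g.N N_fs l ≤ 0 ∧ g.R R_y l ≤ g.R R_V 0 ∧ ¬ g.R R_T 0 ≤ g.R R_sig l) := by
      rw [efs, ey, eV, eT, es]; exact ⟨hN.1.le, hN.2.1, not_le.mpr hN.2.2⟩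
    simp only [HC.run, TE.ev, RE.ev, NE.ev, hk, smallTest]
    rw [if_pos hg]
    simp only [HS.setN_R, HS.setN_N, ep, es, enu, hk]
    constructor
    · intro k
      rw [flag_succ hN]
      simp only [HS.ite_N, HS.setN_N, HS.setR_N, hP1, true_and, ite_self]
    · refine hP2.succ hN fun μ => ?_
      rw [← ite_max]
      simp [HS.ite_R, HS.setN_R, HS.setR_R]
      split_ifs <;> simp_all
      linarith
  · have hg : ¬ (g.N N_fs l ≤ 0 ∧ g.R R_y l ≤ g.R R_V 0 ∧ ¬ g.R R_T 0 ≤ g.R R_sig l) := by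
      rw [efs, ey, eV, eT, es]; rintro ⟨h1, h2, h3⟩; exact hN ⟨by omega, h2, not_le.mp h3⟩
    simp only [HC.run, TE.ev, RE.ev, NE.ev, hk, smallTest]
    rw [if_neg hg]
    refine ⟨fun k => ?_, hP2.succ_not hN⟩
    rw [hP1]
    refine if_congr ⟨fun h => ⟨by omega, h.2⟩, fun h => ⟨lt_of_le_of_ne (by omega) ?_, h.2⟩⟩ rfl rfl
    rintro rfl; exact hN h.2

open Classical in
theorem freezeBig_spec (hj : h.N N_j 0 ≤ E.n + 1) :
    (∀ k, (freezeBig.run E h).N N_fb k =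
      if k < h.N N_j 0 ∧ NewBig h k then 1 else h.N N_fb k) ∧
    (∀ μ, (freezeBig.run E h).R R_W μ = h.R R_W μ + ∑ k ∈ Finset.range (h.N N_j 0) with
      NewBig h k ∧ h.N N_bm k = μ, h.R R_p k) ∧
    MaxUpd (h.N N_j 0) (NewBig h) (h.N N_bm) (fun k => h.R R_u k + h.R R_p k) (h.R R_E)
      ((freezeBig.run E h).R R_E) := by
  refine HC.forTo_ind N_k (.s N_j) _ h (h.N N_j 0) hj (by decide) (fun l g => (∀ k, g.N N_fb k =
      if k < l ∧ NewBig h k then 1 else h.N N_fb k) ∧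
    (∀ μ, g.R R_W μ = h.R R_W μ + ∑ k ∈ Finset.range l with
      NewBig h k ∧ h.N N_bm k = μ, h.R R_p k) ∧
    MaxUpd l (NewBig h) (h.N N_bm) (fun k => h.R R_u k + h.R R_p k) (h.R R_E) (g.R R_E))
    (fun _ _ _ hP => hP) (fun g hF => ?_) ⟨by simp, by simp, MaxUpd.zero _ _ _ _⟩ ?_
  · exact congrFun (hF.N N_j (by decide)) 0
  intro l hl g hF hk ⟨hP1, hP2, hP3⟩
  have ea : g.R R_a = h.R R_a := hF.R _ (by decide)
  have ey : g.R R_y = h.R R_y := hF.R _ (by decide)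
  have eV : g.R R_V = h.R R_V := hF.R _ (by decide)
  have eu : g.R R_u = h.R R_u := hF.R _ (by decide)
  have ep : g.R R_p = h.R R_p := hF.R _ (by decide)
  have ebm : g.N N_bm = h.N N_bm := hF.N _ (by decide)
  have efb : g.N N_fb l = h.N N_fb l := by rw [hP1]; simp
  by_cases hN : NewBig h l
  · have hg : (g.N N_fb l ≤ 0 ∧ ¬ g.R R_y l ≤ g.R R_V 0 ∧ ¬ g.R R_a (g.N N_bm l) ≤ g.R R_u l) := by
      rw [efb, ey, eV, ea, eu, ebm]; exact ⟨hN.1.le, not_le.mpr hN.2.1, not_le.mpr hN.2.2⟩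
    simp only [HC.run, TE.ev, RE.ev, NE.ev, hk, smallTest]
    rw [if_pos hg]
    simp only [HS.setN_R, HS.setN_N, HS.setR_N, HS.setR_R, ep, eu, ebm, hk]
    refine ⟨?_, ?_, ?_⟩
    · intro k
      rw [flag_succ hN]
      simp only [HS.ite_N, HS.setN_N, HS.setR_N, hP1, true_and, ite_self]
    · intro μ
      have hsum : ∑ k ∈ Finset.range (l + 1) with NewBig h k ∧ h.N N_bm k = μ, h.R R_p k =
          (if h.N N_bm l = μ then h.R R_p l else 0) +
          ∑ k ∈ Finset.range l with NewBig h k ∧ h.N N_bm k = μ, h.R R_p k := by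
        rw [Finset.sum_filter, Finset.sum_filter, Finset.sum_range_succ, add_comm]
        congr 1
        simp [hN]
      rw [hsum]
      simp only [HS.ite_R, HS.setN_R, HS.setR_R, hP2, true_and]
      by_cases hμ : μ = h.N N_bm l
      · subst hμ; simp; ring
      · simp [hμ, Ne.symm hμ]
    · refine hP3.succ hN fun μ => ?_
      rw [← ite_max]
      simp [HS.ite_R, HS.setN_R, HS.setR_R]
      split_ifs <;> simp_all
      linarith
  · have hg : ¬ (g.N N_fb l ≤ 0 ∧ ¬ g.R R_y l ≤ g.R R_V 0 ∧
        ¬ g.R R_a (g.N N_bm l) ≤ g.R R_u l) := by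
      rw [efb, ey, eV, ea, eu, ebm]; rintro ⟨h1, h2, h3⟩
      exact hN ⟨by omega, not_le.mp h2, not_le.mp h3⟩
    simp only [HC.run, TE.ev, RE.ev, NE.ev, hk, smallTest]
    rw [if_neg hg]
    refine ⟨fun k => ?_, fun μ => ?_, hP3.succ_not hN⟩
    · rw [hP1]
      refine if_congr ⟨fun h => ⟨by omega, h.2⟩, fun h => ⟨lt_of_le_of_ne (by omega) ?_, h.2⟩⟩
        rfl rfl
      rintro rfl; exact hN h.2
    · rw [hP2, Finset.sum_filter, Finset.sum_filter, Finset.sum_range_succ]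
      simp [hN]

end

/-! ### Preparation and the release of a job -/

section

theorem iterate_ind {α : Type*} (F : α → α) (P : ℕ → α → Prop) (x : α) (h0 : P 0 x)
    (hs : ∀ l g, P l g → P (l + 1) (F g)) (k : ℕ) : P k (F^[k] x) := by
  induction k with
  | zero => exact h0
  | succ k ih => rw [Function.iterate_succ_apply']; exact hs _ _ ih

/-- The number with binary digits `tp s, tp (s + 1), …, tp (s + l - 1)`. -/
def bitsVal (tp : ℕ → Bool) (s : ℕ) : ℕ → ℕ
  | 0 => 0
  | l + 1 => bitsVal tp s l + bitsVal tp s l + (tp (s + l)).toNat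

/-- The least `κ` with `n ≤ 4 ^ κ * m`. -/
def lev (n m : ℕ) : ℕ := sInf {κ | n ≤ 4 ^ κ * m}

theorem le_lev {n m : ℕ} (hm : 1 ≤ m) : n ≤ 4 ^ lev n m * m := by
  refine Nat.sInf_mem (s := {κ | n ≤ 4 ^ κ * m}) ⟨n, ?_⟩
  calc n ≤ 4 ^ n := (Nat.lt_pow_self (by norm_num)).le
    _ ≤ 4 ^ n * m := Nat.le_mul_of_pos_right _ hm

theorem lt_lev_iff {n m : ℕ} (hm : 1 ≤ m) (κ : ℕ) : κ < lev n m ↔ 4 ^ κ * m < n := by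
  constructor
  · intro h
    have := Nat.notMem_of_lt_sInf h
    simpa using this
  · intro h
    by_contra hc
    have h1 : 4 ^ lev n m * m ≤ 4 ^ κ * m :=
      Nat.mul_le_mul_right _ (Nat.pow_le_pow_right (by norm_num) (by omega))
    have := le_lev (n := n) hm
    omega

theorem lev_le {n m : ℕ} (hm : 1 ≤ m) : lev n m ≤ n := by
  by_contra h
  have := (lt_lev_iff (n := n) hm n).mp (by omega)
  have h2 : n < 4 ^ n := Nat.lt_pow_self (by norm_num)
  have h3 : 4 ^ n ≤ 4 ^ n * m := Nat.le_mul_of_pos_right _ hm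
  omega

/-- Reduction modulo `m` of a number that is less than `2 m`. -/
def wrap (m v : ℕ) : ℕ := if m ≤ v then v - m else v

variable {E : Env} {h : HS}

theorem HC.run_ite_pos {t : TE} (c d : HC) (ht : t.ev E h) :
    (HC.ite t c d).run E h = c.run E h := by
  simp only [HC.run, if_pos ht]

theorem HC.run_ite_neg {t : TE} (c d : HC) (ht : ¬ t.ev E h) :
    (HC.ite t c d).run E h = d.run E h := by
  simp only [HC.run, if_neg ht]

theorem prepQ_spec (hm : 1 ≤ E.m) :
    (prepQ.run E h).N N_Q 0 = 2 ^ lev E.n E.m ∧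
    (prepQ.run E h).N N_mQ 0 = E.m * 2 ^ lev E.n E.m := by
  have := iterate_ind (HC.run E (.ite (.nlt (.s N_sq) .njobs)
      (.seq (.sN N_Q (.add (.s N_Q) (.s N_Q))) (.seq (.sN N_mQ (.add (.s N_mQ) (.s N_mQ)))
        (.sN N_sq (.add (.add (.s N_sq) (.s N_sq)) (.add (.s N_sq) (.s N_sq)))))) .skip))
    (fun l g => g.N N_Q 0 = 2 ^ min l (lev E.n E.m) ∧
      g.N N_mQ 0 = E.m * 2 ^ min l (lev E.n E.m) ∧ g.N N_sq 0 = 4 ^ min l (lev E.n E.m) * E.m)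
    (((h.setN N_Q 0 1).setN N_mQ 0 E.m).setN N_sq 0 E.m) (by simp [HS.setN_N]) ?_ (E.n + 1)
  · have hl : min (E.n + 1) (lev E.n E.m) = lev E.n E.m := by
      have := lev_le (n := E.n) hm; omega
    rw [hl] at this
    exact ⟨this.1, this.2.1⟩
  · rintro l g ⟨h1, h2, h3⟩
    have hiff := lt_lev_iff (n := E.n) hm (min l (lev E.n E.m))
    by_cases hc : g.N N_sq 0 < E.n
    · have h4 : l < lev E.n E.m := by
        have := hiff.mpr (by omega); omega
      have e1 : min l (lev E.n E.m) = l := by omega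
      have e2 : min (l + 1) (lev E.n E.m) = l + 1 := by omega
      rw [e1] at h1 h2 h3
      rw [e2]
      rw [HC.run_ite_pos _ _ (by simpa [TE.ev, NE.ev] using hc)]
      simp only [HC.run, NE.ev, HS.setN_N, h1, h2, h3]
      refine ⟨?_, ?_, ?_⟩ <;> simp [pow_succ] <;> ring
    · have h4 : lev E.n E.m ≤ l := by
        by_contra h5
        rw [show min l (lev E.n E.m) = l by omega] at h3
        have := (lt_lev_iff (n := E.n) hm l).mp (by omega)
        omega
      have e1 : min l (lev E.n E.m) = lev E.n E.m := by omega
      have e2 : min (l + 1) (lev E.n E.m) = lev E.n E.m := by omega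
      rw [e1] at h1 h2 h3
      rw [e2]
      rw [HC.run_ite_neg _ _ (by simpa [TE.ev, NE.ev] using hc)]
      exact ⟨h1, h2, h3⟩

theorem prepRho_spec (hm : E.m ≤ E.n) :
    (prepRho.run E h).N N_rho 0 = wrap E.m (bitsVal E.tape h.used (Nat.clog 2 E.m)) ∧
    (prepRho.run E h).used = h.used + Nat.clog 2 E.m := by
  have hc2 : Nat.clog 2 E.m ≤ E.n + 1 := by
    have : E.m ≤ 2 ^ E.m := (Nat.lt_pow_self (by norm_num)).le
    have := Nat.clog_le_of_le_pow this
    omega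
  have := iterate_ind (HC.run E (.ite (.nlt (.s N_q) .nmach)
      (.seq (.sN N_q (.add (.s N_q) (.s N_q))) (.seq drawBit
        (.sN N_rho (.add (.add (.s N_rho) (.s N_rho)) (.s N_bit))))) .skip))
    (fun l g => g.N N_q 0 = 2 ^ min l (Nat.clog 2 E.m) ∧
      g.N N_rho 0 = bitsVal E.tape h.used (min l (Nat.clog 2 E.m)) ∧
      g.used = h.used + min l (Nat.clog 2 E.m))
    ((h.setN N_q 0 1).setN N_rho 0 0) (by simp [bitsVal, HS.setN]) ?_ (E.n + 1)
  · rw [show min (E.n + 1) (Nat.clog 2 E.m) = Nat.clog 2 E.m by omega] at this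
    obtain ⟨-, h2, h3⟩ := this
    have e : prepRho.run E h = (HC.ite (.nle .nmach (.s N_rho))
      (.sN N_rho (.sub (.s N_rho) .nmach)) .skip).run E ((HC.run E
      (.ite (.nlt (.s N_q) .nmach) (.seq (.sN N_q (.add (.s N_q) (.s N_q))) (.seq drawBit
        (.sN N_rho (.add (.add (.s N_rho) (.s N_rho)) (.s N_bit))))) .skip))^[E.n + 1]
        ((h.setN N_q 0 1).setN N_rho 0 0)) := rfl
    rw [e]
    revert h2 h3
    generalize (HC.run E _)^[E.n + 1] _ = g
    intro h2 h3
    rw [← h2, ← h3]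
    by_cases hc : E.m ≤ g.N N_rho 0
    · rw [HC.run_ite_pos _ _ (by simpa [TE.ev, NE.ev] using hc), wrap, if_pos hc]
      simp [HC.run, NE.ev, HS.setN_N]; rfl
    · rw [HC.run_ite_neg _ _ (by simpa [TE.ev, NE.ev] using hc), wrap, if_neg hc]
      simp [HC.run]
  · rintro l g ⟨h1, h2, h3⟩
    have hiff := Nat.lt_clog_iff_pow_lt (b := 2) (x := E.m)
      (y := min l (Nat.clog 2 E.m)) (by norm_num)
    by_cases hc : g.N N_q 0 < E.m
    · have h4 : l < Nat.clog 2 E.m := by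
        have := hiff.mpr (by omega); omega
      have e1 : min l (Nat.clog 2 E.m) = l := by omega
      have e2 : min (l + 1) (Nat.clog 2 E.m) = l + 1 := by omega
      rw [e1] at h1 h2 h3
      rw [e2]
      rw [HC.run_ite_pos _ _ (by simpa [TE.ev, NE.ev] using hc)]
      simp only [HC.run, drawBit, NE.ev]
      refine ⟨?_, ?_, ?_⟩
      · simp [HS.setN, h1, pow_succ]; ring
      · simp [HS.setN, h2, h3, bitsVal]
      · simp [HS.setN, h3]; ring
    · have h4 : Nat.clog 2 E.m ≤ l := by
        by_contra h5
        rw [show min l (Nat.clog 2 E.m) = l by omega] at hiff h1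
        have := hiff.mp (by omega)
        omega
      have e1 : min l (Nat.clog 2 E.m) = Nat.clog 2 E.m := by omega
      have e2 : min (l + 1) (Nat.clog 2 E.m) = Nat.clog 2 E.m := by omega
      rw [e1] at h1 h2 h3
      rw [e2]
      rw [HC.run_ite_neg _ _ (by simpa [TE.ev, NE.ev] using hc)]
      exact ⟨h1, h2, h3⟩

theorem arriveSize_spec (hm : E.m ≤ E.n + 1) :
    (∀ k, (arriveSize.run E h).R R_p k = if k = h.N N_j 0 then h.R R_PJ 0 else h.R R_p k) ∧
    (arriveSize.run E h).R R_V 0 = h.R R_V 0 + h.R R_PJ 0 ∧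
    (∀ k, (arriveSize.run E h).R R_y k =
      if k = h.N N_j 0 then E.m * h.R R_PJ 0 else h.R R_y k) := by
  set h1 : HS := ((h.setR R_p (h.N N_j 0) (h.R R_PJ 0)).setR R_V 0
    (h.R R_V 0 + h.R R_PJ 0)).setR R_y (h.N N_j 0) (h.R R_PJ 0 - h.R R_PJ 0) with hh1
  have e : arriveSize.run E h = (HC.forTo N_k .nmach
      (.setR R_y (.s N_j) (.add (.var R_y (.s N_j)) (.s R_PJ)))).run E h1 := by
    simp [arriveSize, HC.run, hh1, NE.ev, RE.ev, HS.setR_N, HS.setR_R]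
  rw [e]
  have hF := HC.frame (E := E) (HC.forTo N_k .nmach
      (.setR R_y (.s N_j) (.add (.var R_y (.s N_j)) (.s R_PJ)))) h1
  refine ⟨fun k => ?_, ?_, ?_⟩
  · rw [hF.R R_p (by decide)]; simp [hh1, HS.setR_R]
  · rw [hF.R R_V (by decide)]; simp [hh1, HS.setR_R]
  · refine HC.forTo_ind N_k .nmach _ h1 E.m hm (by decide) (fun l g => ∀ k, g.R R_y k =
      if k = h.N N_j 0 then l * h.R R_PJ 0 else h.R R_y k)
      (fun _ _ _ hP => hP) (fun _ _ => rfl) ?_ ?_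
    · intro k; simp [hh1, HS.setR_R]
    · intro l hl g hF hk hP k
      have ej : g.N N_j = h.N N_j := hF.N N_j (by decide)
      have eP : g.R R_PJ = h.R R_PJ := by rw [hF.R R_PJ (by decide)]; ext; simp [hh1, HS.setR_R]
      simp only [HC.run, NE.ev, RE.ev, HS.setR_R, ej, eP, hP]
      by_cases hkj : k = h.N N_j 0
      · simp [hkj]; ring
      · simp [hkj]

theorem arriveDraw_spec {κ : ℕ} (hκ : κ ≤ E.n + 1) (hQ : h.N N_Q 0 = 2 ^ κ) :
    (∀ k, (arriveDraw.run E h).R R_y k =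
      if k = h.N N_j 0 then 2 ^ κ * h.R R_y k else h.R R_y k) ∧
    (arriveDraw.run E h).R R_X 0 = bitsVal E.tape h.used κ * h.R R_PJ 0 ∧
    (arriveDraw.run E h).used = h.used + κ := by
  set h1 : HS := (h.setR R_X 0 (h.R R_PJ 0 - h.R R_PJ 0)).setN N_q 0 1 with hh1
  have := iterate_ind (HC.run E (.ite (.nlt (.s N_q) (.s N_Q))
      (.seq (.sN N_q (.add (.s N_q) (.s N_q))) (.seq
        (.setR R_y (.s N_j) (.add (.var R_y (.s N_j)) (.var R_y (.s N_j)))) (.seq drawBit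
        (.seq (.sR R_X (.add (.s R_X) (.s R_X)))
          (.ite (.zero (.s N_bit)) .skip (.sR R_X (.add (.s R_X) (.s R_PJ)))))))) .skip))
    (fun l g => g.N N_q 0 = 2 ^ min l κ ∧ (∀ k, g.R R_y k =
      if k = h.N N_j 0 then 2 ^ min l κ * h.R R_y k else h.R R_y k) ∧
      g.R R_X 0 = bitsVal E.tape h.used (min l κ) * h.R R_PJ 0 ∧
      g.used = h.used + min l κ ∧ g.N N_j 0 = h.N N_j 0 ∧ g.R R_PJ 0 = h.R R_PJ 0 ∧
      g.N N_Q 0 = 2 ^ κ)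
    h1 ?_ ?_ (E.n + 1)
  · rw [show min (E.n + 1) κ = κ by omega] at this
    exact ⟨this.2.1, this.2.2.1, this.2.2.2.1⟩
  · refine ⟨by simp [hh1, HS.setN_N], fun k => ?_, ?_, rfl, ?_, ?_, ?_⟩
    · simp [hh1, HS.setN_R, HS.setR_R]
    · simp [hh1, HS.setN_R, HS.setR_R, bitsVal]
    · simp [hh1, HS.setN_N, HS.setR_N]
    · simp [hh1, HS.setN_R, HS.setR_R]
    · simp [hh1, HS.setN_N, HS.setR_N, hQ]
  · rintro l g ⟨a1, a2, a3, a4, a5, a6, a7⟩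
    by_cases hc : l < κ
    · rw [show min l κ = l by omega] at a1 a2 a3 a4
      rw [show min (l + 1) κ = l + 1 by omega]
      have hlt : (2 : ℕ) ^ l < 2 ^ κ := Nat.pow_lt_pow_right (by norm_num) hc
      rw [HC.run_ite_pos _ _ (by simpa [TE.ev, NE.ev, a1, a7] using hlt)]
      simp only [HC.run, drawBit, TE.ev, NE.ev, RE.ev]
      refine ⟨?_, ?_, ?_, ?_, ?_, ?_, ?_⟩
      · simp only [HS.ite_N]; simp [HS.setR_N, HS.setN, a1]; ring
      · intro k
        simp only [HS.ite_R]; simp [HS.setR_R, HS.setN, HS.setR_N, a5, a2]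
        by_cases hk : k = h.N N_j 0
        · simp [hk]; ring
        · simp [hk]
      · simp only [HS.ite_R]; simp [HS.setR, HS.setN, a3, a4, a6, bitsVal]
        cases E.tape (h.used + l) <;> simp <;> ring
      · split_ifs <;> simp [HS.setR, HS.setN, a4] <;> ring
      · simp only [HS.ite_N]; simp [HS.setN, a5, HS.setR]
      · simp only [HS.ite_R]; simp [HS.setR, HS.setN, a6]
      · simp only [HS.ite_N]; simp [HS.setN, a7, HS.setR]
    · rw [show min l κ = κ by omega] at a1 a2 a3 a4
      rw [show min (l + 1) κ = κ by omega]
      rw [HC.run_ite_neg _ _ (by simp [TE.ev, NE.ev, a1, a7])]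
      exact ⟨a1, a2, a3, a4, a5, a6, a7⟩

/-- The number of jobs `l < j` of group `k` that are big. -/
def groupCount (h : HS) (j k : ℕ) : ℕ :=
  ((Finset.range j).filter fun l => h.N N_gr l = k ∧ h.R R_V 0 < h.R R_y l).card

theorem countGroup_spec (hj : h.N N_j 0 ≤ E.n + 1) :
    (countGroup.run E h).N N_cnt 0 = groupCount h (h.N N_j 0) (h.N N_k 0) := by
  refine HC.forTo_ind N_l (.s N_j) _ (h.setN N_cnt 0 0) (h.N N_j 0) hj (by decide)
    (fun l g => g.N N_cnt 0 = groupCount h l (h.N N_k 0))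
    (fun _ _ _ hP => hP) (fun g hF => congrFun (hF.N N_j (by decide)) 0)
    (by simp [HS.setN_N, groupCount]) ?_
  intro l hl g hF hk hP
  have e1 : g.N N_gr = h.N N_gr := by rw [hF.N _ (by decide)]; ext; simp [HS.setN_N]
  have e2 : g.N N_k = h.N N_k := by rw [hF.N _ (by decide)]; ext; simp [HS.setN_N]
  have e3 : g.R R_V = h.R R_V := hF.R _ (by decide)
  have e4 : g.R R_y = h.R R_y := hF.R _ (by decide)
  have hS : groupCount h (l + 1) (h.N N_k 0) = groupCount h l (h.N N_k 0) +
      if h.N N_gr l = h.N N_k 0 ∧ h.R R_V 0 < h.R R_y l then 1 else 0 := by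
    unfold groupCount
    rw [Finset.card_filter, Finset.sum_range_succ, ← Finset.card_filter]
  rw [hS]
  simp only [HC.run, smallTest, TE.ev, NE.ev, RE.ev, hk, e1, e2, e3, e4, HS.ite_N, HS.setN_N, hP,
    ← le_antisymm_iff, not_le]
  split_ifs <;> simp_all

theorem firstFit_spec (hm1 : 1 ≤ E.m) (hm : E.m ≤ E.n + 1) (hj : h.N N_j 0 ≤ E.n + 1) :
    (firstFit.run E h).N N_grp 0 < E.m ∧
    ((∃ k < E.m, groupCount h (h.N N_j 0) k < h.N N_Q 0) →
      groupCount h (h.N N_j 0) ((firstFit.run E h).N N_grp 0) < h.N N_Q 0) := by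
  have := HC.forTo_ind (E := E) N_k .nmach (.seq countGroup
      (.ite (.both (.zero (.s N_found)) (.nlt (.s N_cnt) (.s N_Q)))
      (.seq (.sN N_found (.lit 1)) (.sN N_grp (.s N_k))) .skip))
    ((h.setN N_found 0 0).setN N_grp 0 0) E.m hm (by decide)
    (fun l g => g.N N_grp 0 < E.m ∧
      (g.N N_found 0 = 0 → ∀ k < l, ¬ groupCount h (h.N N_j 0) k < h.N N_Q 0) ∧
      (g.N N_found 0 ≠ 0 → groupCount h (h.N N_j 0) (g.N N_grp 0) < h.N N_Q 0))
    (fun _ _ _ hP => hP) (fun _ _ => rfl) (by simp [HS.setN_N]; omega) ?_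
  · refine ⟨this.1, fun ⟨k, hk, hc⟩ => this.2.2 fun h0 => this.2.1 h0 k hk hc⟩
  · rintro l hl g hF hk ⟨a1, a2, a3⟩
    have ej : g.N N_j = h.N N_j := by rw [hF.N _ (by decide)]; ext; simp [HS.setN_N]
    have eQ : g.N N_Q = h.N N_Q := by rw [hF.N _ (by decide)]; ext; simp [HS.setN_N]
    have e1 : g.N N_gr = h.N N_gr := by rw [hF.N _ (by decide)]; ext; simp [HS.setN_N]
    have e3 : g.R R_V = h.R R_V := hF.R _ (by decide)
    have e4 : g.R R_y = h.R R_y := hF.R _ (by decide)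
    have ec := countGroup_spec (E := E) (h := g) (by rw [ej]; exact hj)
    have ec' : groupCount g (g.N N_j 0) (g.N N_k 0) = groupCount h (h.N N_j 0) l := by
      unfold groupCount; rw [e1, e3, e4, ej, hk]
    rw [ec'] at ec
    have f1 : (countGroup.run E g).N N_found = g.N N_found := HC.run_N _ _ (by decide) _
    have f2 : (countGroup.run E g).N N_grp = g.N N_grp := HC.run_N _ _ (by decide) _
    have f3 : (countGroup.run E g).N N_Q = g.N N_Q := HC.run_N _ _ (by decide) _
    have f4 : (countGroup.run E g).N N_k = g.N N_k := HC.run_N _ _ (by decide) _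
    by_cases hc : g.N N_found 0 = 0 ∧ groupCount h (h.N N_j 0) l < h.N N_Q 0
    · rw [HC.run, HC.run_ite_pos _ _ (by simp [TE.ev, NE.ev, ec, f1, f3, eQ, hc.1, hc.2])]
      simp only [HC.run, NE.ev, HS.setN_N, f4, hk]
      simpa [hl] using hc.2
    · have : ¬ ((countGroup.run E g).N N_found 0 ≤ 0 ∧
          ¬ (countGroup.run E g).N N_Q 0 ≤ (countGroup.run E g).N N_cnt 0) := by
        rw [f1, f3, ec, eQ]; omega
      rw [HC.run, HC.run_ite_neg _ _ (by simpa only [TE.ev, NE.ev] using this)]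
      simp only [HC.run, f1, f2]
      refine ⟨a1, fun h0 k hk' => ?_, a3⟩
      rcases Nat.lt_or_ge k l with h5 | h5
      · exact a2 h0 k h5
      · obtain rfl : k = l := by omega
        exact fun h6 => hc ⟨h0, h6⟩

theorem register_spec :
    let j := h.N N_j 0
    let b := wrap E.m (h.N N_grp 0 + h.N N_rho 0)
    let g := register.run E h
    (∀ k, g.N N_fs k = if k = j then 0 else h.N N_fs k) ∧
    (∀ k, g.N N_fb k = if k = j then 0 else h.N N_fb k) ∧
    (∀ k, g.N N_gr k = if k = j then h.N N_grp 0 else h.N N_gr k) ∧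
    (∀ k, g.N N_bm k = if k = j then b else h.N N_bm k) ∧
    (∀ k, g.R R_beta k = if k = j then max (h.R R_a b) (h.R R_E b) - h.R R_W b + h.R R_X 0
      else h.R R_beta k) := by
  intro j b
  set h1 : HS := (((h.setN N_fs j 0).setN N_fb j 0).setN N_gr j (h.N N_grp 0)).setN N_bm j
    (h.N N_grp 0 + h.N N_rho 0) with hh1
  have hj1 : h1.N N_j 0 = j := by simp [hh1, HS.setN_N, j]
  have hb1 : h1.N N_bm j = h.N N_grp 0 + h.N N_rho 0 := by simp [hh1, HS.setN_N]
  obtain ⟨h2, e2, hb2, ho2, hR2⟩ : ∃ h2 : HS, HC.run E (.ite (.nle .nmach (.var N_bm (.s N_j)))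
      (.setN N_bm (.s N_j) (.sub (.var N_bm (.s N_j)) .nmach)) .skip) h1 = h2 ∧
      h2.N N_bm j = b ∧ (∀ f k, f ≠ N_bm ∨ k ≠ j → h2.N f k = h1.N f k) ∧ h2.R = h.R := by
    by_cases hc : E.m ≤ h.N N_grp 0 + h.N N_rho 0
    · rw [HC.run_ite_pos _ _ (by simpa [TE.ev, NE.ev, hj1, hb1] using hc)]
      refine ⟨_, rfl, ?_, ?_, rfl⟩
      · simp [HC.run, NE.ev, hj1, hb1, HS.setN_N, b, wrap, hc]
      · intro f k hfk
        simp only [HC.run, NE.ev, hj1, HS.setN_N]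
        rw [if_neg (by tauto)]
    · rw [HC.run_ite_neg _ _ (by simpa [TE.ev, NE.ev, hj1, hb1] using hc)]
      exact ⟨_, rfl, by simp [HC.run, hb1, b, wrap, hc], fun _ _ _ => rfl, rfl⟩
  have hj2 : h2.N N_j 0 = j := by rw [ho2 _ _ (Or.inl (by decide)), hj1]
  set x : ℝ := max (h.R R_a b) (h.R R_E b) - h.R R_W b + h.R R_X 0 with hx
  have e3 : register.run E h = h2.setR R_beta j x := by
    have e : register.run E h = HC.run E (.ite (.rle (.var R_a (.var N_bm (.s N_j)))
          (.var R_E (.var N_bm (.s N_j))))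
          (.setR R_beta (.s N_j) (.add (.sub (.var R_E (.var N_bm (.s N_j)))
            (.var R_W (.var N_bm (.s N_j)))) (.s R_X)))
          (.setR R_beta (.s N_j) (.add (.sub (.var R_a (.var N_bm (.s N_j)))
            (.var R_W (.var N_bm (.s N_j)))) (.s R_X)))) h2 := by
      rw [← e2, hh1]; rfl
    rw [e]
    by_cases hc : h.R R_a b ≤ h.R R_E b
    · rw [HC.run_ite_pos _ _ (by simpa [TE.ev, NE.ev, RE.ev, hj2, hb2, hR2] using hc)]
      simp only [HC.run, NE.ev, RE.ev, hj2, hb2, hR2, hx, max_eq_right hc]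
    · rw [HC.run_ite_neg _ _ (by simpa [TE.ev, NE.ev, RE.ev, hj2, hb2, hR2] using hc)]
      simp only [HC.run, NE.ev, RE.ev, hj2, hb2, hR2, hx, max_eq_left (not_le.mp hc).le]
  simp only [e3, HS.setR_N, HS.setR_R, hR2, true_and]
  refine ⟨fun k => ?_, fun k => ?_, fun k => ?_, fun k => ?_, fun k => trivial⟩
  · rw [ho2 _ _ (Or.inl (by decide))]; simp [hh1, HS.setN_N]
  · rw [ho2 _ _ (Or.inl (by decide))]; simp [hh1, HS.setN_N]
  · rw [ho2 _ _ (Or.inl (by decide))]; simp [hh1, HS.setN_N]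
  · by_cases hk : k = j
    · rw [hk, hb2, if_pos rfl]
    · rw [ho2 _ _ (Or.inr hk), if_neg hk]; simp [hh1, HS.setN_N, hk]

theorem planInit_spec (hm : E.m ≤ E.n + 1) (hj : h.N N_j 0 + 1 ≤ E.n + 1) :
    (∀ μ < E.m, (planInit.run E h).R R_e μ = max (h.R R_T 0) (h.R R_f μ)) ∧
    (∀ k ≤ h.N N_j 0, (planInit.run E h).N N_pl k = 0) := by
  set c1 : HC := (.forTo N_k .nmach (.ite (.rle (.var R_f (.s N_k)) (.s R_T))
      (.setR R_e (.s N_k) (.s R_T)) (.setR R_e (.s N_k) (.var R_f (.s N_k))))) with hc1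
  set c2 : HC := (.forTo N_k (.add (.s N_j) (.lit 1)) (.setN N_pl (.s N_k) (.lit 0))) with hc2
  have e : planInit.run E h = c2.run E (c1.run E h) := rfl
  rw [e]
  constructor
  · rw [HC.run_R R_e c2 (by decide)]
    refine HC.forTo_ind N_k .nmach _ h E.m hm (by decide)
      (fun l g => ∀ μ < l, g.R R_e μ = max (h.R R_T 0) (h.R R_f μ))
      (fun _ _ _ hP => hP) (fun _ _ => rfl) (by simp) ?_
    intro l hl g hF hk hP μ hμ
    have eT : g.R R_T = h.R R_T := hF.R _ (by decide)
    have ef : g.R R_f = h.R R_f := hF.R _ (by decide)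
    simp only [HC.run, TE.ev, RE.ev, NE.ev, hk, eT, ef, HS.ite_R, HS.setR_R, true_and]
    rcases Nat.lt_or_ge μ l with h1 | h1
    · have : μ ≠ l := by omega
      simp [this, hP μ h1]
    · obtain rfl : μ = l := by omega
      simp only [if_true]
      split_ifs with h2
      · rw [max_eq_left h2]
      · rw [max_eq_right (by linarith)]
  · have hj' : (c1.run E h).N N_j = h.N N_j := HC.run_N _ _ (by decide) _
    have := HC.forTo_ind (E := E) N_k (.add (.s N_j) (.lit 1)) (.setN N_pl (.s N_k) (.lit 0))
      (c1.run E h) (h.N N_j 0 + 1) hj (by decide) (fun l g => ∀ k < l, g.N N_pl k = 0)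
      (fun _ _ _ hP => hP) (fun g hF => ?_) (by simp) ?_
    · exact fun k hk => this k (by omega)
    · simp only [NE.ev]; rw [hF.N N_j (by decide), hj']
    · intro l hl g hF hk hP k hkl
      simp only [HC.run, NE.ev, hk, HS.setN_N, true_and]
      split_ifs with h1
      · rfl
      · exact hP k (by omega)

end

/-! ### List scheduling -/

section

/-- A non-preemptive list schedule of the jobs in `P`: job `k` runs on machine `ν k < m` from time
`σ k`, machine `μ` is busy exactly from `base μ` to `e μ`, and shorter jobs start first. -/
structure ListSchedule (m : ℕ) (P : Finset ℕ) (p base σ : ℕ → ℝ) (ν : ℕ → ℕ) (e : ℕ → ℝ) :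
    Prop where
  lt : ∀ k ∈ P, ν k < m
  base_le : ∀ k ∈ P, base (ν k) ≤ σ k
  end_le : ∀ k ∈ P, σ k + p k ≤ e (ν k)
  apart : ∀ k ∈ P, ∀ l ∈ P, k ≠ l → ν k = ν l → σ k + p k ≤ σ l ∨ σ l + p l ≤ σ k
  order : ∀ k ∈ P, ∀ l ∈ P, σ l < σ k → p l ≤ p k
  le : ∀ k ∈ P, ∀ μ < m, σ k ≤ e μ
  cover : ∀ μ < m, ∀ t, base μ ≤ t → t < e μ → ∃ l ∈ P, ν l = μ ∧ σ l ≤ t ∧ t < σ l + p l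
  load : ∀ μ < m, e μ = base μ + ∑ l ∈ P with ν l = μ, p l

theorem ListSchedule.empty (m : ℕ) (p base σ : ℕ → ℝ) (ν : ℕ → ℕ) :
    ListSchedule m ∅ p base σ ν base where
  lt := by simp
  base_le := by simp
  end_le := by simp
  apart := by simp
  order := by simp
  le := by simp
  cover := fun _ _ _ h1 h2 => absurd h2 (not_lt.mpr h1)
  load := by simp

theorem ListSchedule.congr {m : ℕ} {P : Finset ℕ} {p base base' σ σ' : ℕ → ℝ} {ν ν' : ℕ → ℕ}
    {e e' : ℕ → ℝ} (H : ListSchedule m P p base σ ν e) (hσ : ∀ k ∈ P, σ' k = σ k)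
    (hν : ∀ k ∈ P, ν' k = ν k) (hb : ∀ μ < m, base' μ = base μ) (he : ∀ μ < m, e' μ = e μ) :
    ListSchedule m P p base' σ' ν' e' where
  lt k hk := by rw [hν k hk]; exact H.lt k hk
  base_le k hk := by
    rw [hν k hk, hσ k hk, hb _ (H.lt k hk)]; exact H.base_le k hk
  end_le k hk := by
    rw [hν k hk, hσ k hk, he _ (H.lt k hk)]; exact H.end_le k hk
  apart k hk l hl := by
    rw [hν k hk, hσ k hk, hν l hl, hσ l hl]; exact H.apart k hk l hl
  order k hk l hl := by rw [hσ k hk, hσ l hl]; exact H.order k hk l hl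
  le k hk μ hμ := by rw [hσ k hk, he μ hμ]; exact H.le k hk μ hμ
  cover μ hμ t := by
    rw [hb μ hμ, he μ hμ]
    intro h1 h2
    obtain ⟨l, hl, r⟩ := H.cover μ hμ t h1 h2
    exact ⟨l, hl, by rwa [hν l hl, hσ l hl]⟩
  load μ hμ := by
    rw [he μ hμ, hb μ hμ, H.load μ hμ]
    congr 1
    refine Finset.sum_congr (Finset.filter_congr fun k hk => by rw [hν k hk]) fun _ _ => rfl

/-- Appending a longest job to the machine that becomes idle first. -/
theorem ListSchedule.insert {m : ℕ} {P : Finset ℕ} {p base σ : ℕ → ℝ} {ν : ℕ → ℕ} {e : ℕ → ℝ}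
    (H : ListSchedule m P p base σ ν e) {j b : ℕ} (hj : j ∉ P) (hp : 0 < p j)
    (hjp : ∀ k ∈ P, p k ≤ p j) (hb : b < m) (hmin : ∀ μ < m, e b ≤ e μ) :
    ListSchedule m (insert j P) p base (Function.update σ j (e b)) (Function.update ν j b)
      (Function.update e b (e b + p j)) := by
  have u1 : ∀ k ∈ P, Function.update σ j (e b) k = σ k := fun k hk =>
    Function.update_of_ne (by rintro rfl; exact hj hk) _ _
  have u2 : ∀ k ∈ P, Function.update ν j b k = ν k := fun k hk =>
    Function.update_of_ne (by rintro rfl; exact hj hk) _ _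
  have ue : ∀ μ, e μ ≤ Function.update e b (e b + p j) μ := by
    intro μ
    by_cases h : μ = b
    · subst h; simp; exact hp.le
    · rw [Function.update_of_ne h]
  have hload : ∀ μ < m, ∑ l ∈ P with ν l = μ, p l = e μ - base μ := fun μ hμ => by
    rw [H.load μ hμ]; ring
  have hold : ∀ k ∈ P, ν k = b → σ k + p k ≤ e b := fun k hk h => h ▸ H.end_le k hk
  refine ⟨?_, ?_, ?_, ?_, ?_, ?_, ?_, ?_⟩
  · intro k hk
    rcases Finset.mem_insert.mp hk with rfl | hk
    · simpa using hb
    · rw [u2 k hk]; exact H.lt k hk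
  · intro k hk
    rcases Finset.mem_insert.mp hk with rfl | hk
    · simp only [Function.update_self]
      by_contra hc
      push Not at hc
      -- a machine that would be planned to end before it starts carries no job
      have h1 := H.load b hb
      by_cases hne : ∃ l ∈ P, ν l = b
      · obtain ⟨l, hl, hlb⟩ := hne
        have h2 := H.base_le l hl
        have h3 := H.le l hl b hb
        rw [hlb] at h2
        linarith
      · have : ∑ l ∈ P with ν l = b, p l = 0 := by
          rw [Finset.filter_false_of_mem]
          · simp
          · intro l hl h; exact hne ⟨l, hl, h⟩
        linarith
    · rw [u1 k hk, u2 k hk]; exact H.base_le k hk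
  · intro k hk
    rcases Finset.mem_insert.mp hk with rfl | hk
    · simp
    · rw [u1 k hk, u2 k hk]; exact (H.end_le k hk).trans (ue _)
  · intro k hk l hl hkl
    rcases Finset.mem_insert.mp hk with rfl | hk' <;> rcases Finset.mem_insert.mp hl with rfl | hl'
    · exact absurd rfl hkl
    · rw [u1 l hl', u2 l hl']; simp only [Function.update_self]
      exact fun h => Or.inr (hold l hl' h.symm)
    · rw [u1 k hk', u2 k hk']; simp only [Function.update_self]
      exact fun h => Or.inl (hold k hk' h)
    · rw [u1 k hk', u2 k hk', u1 l hl', u2 l hl']; exact H.apart k hk' l hl' hkl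
  · intro k hk l hl
    rcases Finset.mem_insert.mp hk with rfl | hk' <;> rcases Finset.mem_insert.mp hl with rfl | hl'
    · exact fun _ => le_rfl
    · exact fun _ => hjp l hl'
    · rw [u1 k hk']; simp only [Function.update_self]
      intro h; linarith [H.le k hk' b hb]
    · rw [u1 k hk', u1 l hl']; exact H.order k hk' l hl'
  · intro k hk μ hμ
    refine le_trans ?_ (ue μ)
    rcases Finset.mem_insert.mp hk with rfl | hk
    · simpa using hmin μ hμ
    · rw [u1 k hk]; exact H.le k hk μ hμ
  · intro μ hμ t h1 h2
    by_cases h : t < e μ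
    · obtain ⟨l, hl, r⟩ := H.cover μ hμ t h1 h
      exact ⟨l, Finset.mem_insert_of_mem hl, by rwa [u1 l hl, u2 l hl]⟩
    · have hμb : μ = b := by
        by_contra hne
        rw [Function.update_of_ne hne] at h2
        exact h h2
      subst hμb
      refine ⟨j, Finset.mem_insert_self _ _, by simp, ?_, ?_⟩
      · simpa using h
      · simpa using h2
  · intro μ hμ
    rw [Finset.filter_insert]
    have hcong : (P.filter fun l => Function.update ν j b l = μ) = P.filter fun l => ν l = μ :=
      Finset.filter_congr fun k hk => by rw [u2 k hk]
    simp only [Function.update_self, hcong]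
    by_cases h : μ = b
    · subst h
      rw [if_pos rfl, Finset.sum_insert (by simp [hj]), hload μ hμ]
      simp only [Function.update_self]; ring
    · rw [if_neg (Ne.symm h), Function.update_of_ne h, hload μ hμ]; ring

variable {E : Env} {h : HS}

/-- The jobs that wait for a place in the virtual schedule. -/
def candidates (h : HS) : Finset ℕ :=
  (Finset.range (h.N N_j 0 + 1)).filter fun k =>
    h.N N_fs k = 0 ∧ h.N N_pl k = 0 ∧ h.R R_y k ≤ h.R R_V 0

theorem findJob_spec (hj : h.N N_j 0 ≤ E.n) :
    ((findJob.run E h).N N_found 0 = 0 → candidates h = ∅) ∧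
    ((findJob.run E h).N N_found 0 ≠ 0 → (findJob.run E h).N N_best 0 ∈ candidates h ∧
      ∀ k ∈ candidates h, h.R R_p ((findJob.run E h).N N_best 0) ≤ h.R R_p k) := by
  have key := HC.forTo_ind (E := E) N_k (.add (.s N_j) (.lit 1))
    (.ite (.both (.both (.zero (.var N_fs (.s N_k))) (.zero (.var N_pl (.s N_k))))
        (.both (smallTest (.s N_k))
          (.neg (.both (.neg (.zero (.s N_found)))
            (.rle (.var R_p (.s N_best)) (.var R_p (.s N_k)))))))
      (.seq (.sN N_found (.lit 1)) (.sN N_best (.s N_k))) .skip)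
    (h.setN N_found 0 0) (h.N N_j 0 + 1) (by omega) (by decide)
    (fun l g => (g.N N_found 0 = 0 → ∀ k < l, k ∉ candidates h) ∧
      (g.N N_found 0 ≠ 0 → g.N N_best 0 ∈ candidates h ∧
        ∀ k < l, k ∈ candidates h → h.R R_p (g.N N_best 0) ≤ h.R R_p k))
    (fun _ _ _ hP => hP) (fun g hF => ?_) (by simp [HS.setN_N]) ?_
  · refine ⟨fun h0 => Finset.eq_empty_of_forall_notMem fun k hk => ?_, fun h0 => ?_⟩
    · exact key.1 h0 k (Finset.mem_range.mp (Finset.mem_filter.mp hk).1) hk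
    · exact ⟨(key.2 h0).1, fun k hk =>
        (key.2 h0).2 k (Finset.mem_range.mp (Finset.mem_filter.mp hk).1) hk⟩
  · simp only [NE.ev]; rw [hF.N N_j (by decide)]; simp [HS.setN_N]
  · rintro l hl g hF hk ⟨a1, a2⟩
    have e1 : g.N N_fs = h.N N_fs := by rw [hF.N _ (by decide)]; ext; simp [HS.setN_N]
    have e2 : g.N N_pl = h.N N_pl := by rw [hF.N _ (by decide)]; ext; simp [HS.setN_N]
    have e3 : g.R R_V = h.R R_V := hF.R _ (by decide)
    have e4 : g.R R_y = h.R R_y := hF.R _ (by decide)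
    have e5 : g.R R_p = h.R R_p := hF.R _ (by decide)
    have hcand : l ∈ candidates h ↔ h.N N_fs l = 0 ∧ h.N N_pl l = 0 ∧ h.R R_y l ≤ h.R R_V 0 := by
      simp [candidates, hl]
    by_cases hc : l ∈ candidates h ∧
        ¬ (g.N N_found 0 ≠ 0 ∧ h.R R_p (g.N N_best 0) ≤ h.R R_p l)
    · have ht : h.N N_fs l = 0 ∧ h.N N_pl l = 0 ∧ h.R R_y l ≤ h.R R_V 0 := hcand.mp hc.1
      rw [HC.run_ite_pos _ _ (by
        simp only [TE.ev, NE.ev, RE.ev, smallTest, hk, e1, e2, e3, e4, e5, ht.1, ht.2.1, ht.2.2]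
        simpa using hc.2)]
      have f1 : (HC.run E (.seq (.sN N_found (.lit 1)) (.sN N_best (.s N_k))) g).N N_found 0 = 1 := by
        simp [HC.run, NE.ev, HS.setN_N]
      have f2 : (HC.run E (.seq (.sN N_found (.lit 1)) (.sN N_best (.s N_k))) g).N N_best 0 = l := by
        simp [HC.run, NE.ev, HS.setN_N, hk]
      rw [f1, f2]
      refine ⟨by simp, fun _ => ⟨hc.1, fun k hkl hkc => ?_⟩⟩
      rcases Nat.lt_or_ge k l with h5 | h5
      · by_cases h6 : g.N N_found 0 = 0
        · exact absurd hkc (a1 h6 k h5)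
        · have := hc.2
          push Not at this
          exact (this h6).le.trans ((a2 h6).2 k h5 hkc)
      · obtain rfl : k = l := by omega
        exact le_rfl
    · rw [HC.run_ite_neg _ _ (by
        simp only [TE.ev, NE.ev, RE.ev, smallTest, hk, e1, e2, e3, e4, e5, Nat.le_zero]
        rw [hcand] at hc
        tauto)]
      simp only [HC.run]
      refine ⟨fun h0 k hkl hkc => ?_, fun h0 => ⟨(a2 h0).1, fun k hkl hkc => ?_⟩⟩
      · rcases Nat.lt_or_ge k l with h5 | h5
        · exact a1 h0 k h5 hkc
        · obtain rfl : k = l := by omega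
          exact hc ⟨hkc, fun h6 => h6.1 h0⟩
      · rcases Nat.lt_or_ge k l with h5 | h5
        · exact (a2 h0).2 k h5 hkc
        · obtain rfl : k = l := by omega
          by_contra h6
          exact hc ⟨hkc, fun h7 => h6 h7.2⟩

theorem findMachine_spec (hm1 : 1 ≤ E.m) (hm : E.m ≤ E.n + 1) :
    (findMachine.run E h).N N_bestm 0 < E.m ∧
    ∀ μ < E.m, h.R R_e ((findMachine.run E h).N N_bestm 0) ≤ h.R R_e μ := by
  refine HC.forTo_ind N_l .nmach _ (h.setN N_bestm 0 0) E.m hm (by decide)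
    (fun l g => g.N N_bestm 0 < E.m ∧ ∀ μ < l, h.R R_e (g.N N_bestm 0) ≤ h.R R_e μ)
    (fun _ _ _ hP => hP) (fun _ _ => rfl) (by simp [HS.setN_N]; omega) ?_
  rintro l hl g hF hk ⟨a1, a2⟩
  have e1 : g.R R_e = h.R R_e := hF.R _ (by decide)
  by_cases hc : h.R R_e (g.N N_bestm 0) ≤ h.R R_e l
  · rw [HC.run_ite_neg _ _ (by simpa [TE.ev, NE.ev, RE.ev, e1, hk] using hc)]
    refine ⟨a1, fun μ hμ => ?_⟩
    rcases Nat.lt_or_ge μ l with h5 | h5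
    · exact a2 μ h5
    · obtain rfl : μ = l := by omega
      exact hc
  · rw [HC.run_ite_pos _ _ (by simpa [TE.ev, NE.ev, RE.ev, e1, hk] using hc)]
    simp only [HC.run, NE.ev, hk, HS.setN_N, true_and, if_true]
    refine ⟨hl, fun μ hμ => ?_⟩
    rcases Nat.lt_or_ge μ l with h5 | h5
    · exact (not_le.mp hc).le.trans (a2 μ h5)
    · obtain rfl : μ = l := by omega
      exact le_rfl

/-- The delay of the real schedule against the virtual one on machine `μ`. -/
def lag (h : HS) (μ : ℕ) : ℝ := max 0 (h.R R_E μ - h.R R_a μ)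

theorem assignJob_spec :
    let b := h.N N_bestm 0
    let k := h.N N_best 0
    let g := assignJob.run E h
    g.R R_sig = Function.update (h.R R_sig) k (h.R R_e b) ∧
    g.N N_nu = Function.update (h.N N_nu) k b ∧
    g.R R_e = Function.update (h.R R_e) b (h.R R_e b + h.R R_p k) ∧
    g.N N_pl = Function.update (h.N N_pl) k 1 ∧
    g.N N_M = (if h.N N_fb k = 0 then Function.update (h.N N_M) k b else h.N N_M) ∧
    g.R R_s = (if h.N N_fb k = 0 then Function.update (h.R R_s) k (h.R R_e b + lag h b)
      else h.R R_s) := by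
  intro b k
  set h1 : HS := (((h.setR R_sig k (h.R R_e b)).setN N_nu k b).setR R_e b
    (h.R R_e b + h.R R_p k)).setN N_pl k 1 with hh1
  have e : assignJob.run E h = HC.run E (.ite (.zero (.var N_fb (.s N_best)))
      (.seq (.setN N_M (.s N_best) (.s N_bestm))
        (.ite (.rle (.var R_a (.s N_bestm)) (.var R_E (.s N_bestm)))
          (.setR R_s (.s N_best) (.add (.var R_sig (.s N_best))
            (.sub (.var R_E (.s N_bestm)) (.var R_a (.s N_bestm)))))
          (.setR R_s (.s N_best) (.var R_sig (.s N_best))))) .skip) h1 := rfl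
  have b1 : h1.N N_bestm 0 = b := by simp [hh1, HS.setN_N, HS.setR_N, b]
  have k1 : h1.N N_best 0 = k := by simp [hh1, HS.setN_N, HS.setR_N, k]
  have s1 : h1.R R_sig = Function.update (h.R R_sig) k (h.R R_e b) := by
    ext i; simp [hh1, HS.setN_R, HS.setR_R, Function.update_apply]
  have n1 : h1.N N_nu = Function.update (h.N N_nu) k b := by
    ext i; simp [hh1, HS.setN_N, HS.setR_N, Function.update_apply]
  have e1 : h1.R R_e = Function.update (h.R R_e) b (h.R R_e b + h.R R_p k) := by
    ext i; simp [hh1, HS.setN_R, HS.setR_R, Function.update_apply]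
  have p1 : h1.N N_pl = Function.update (h.N N_pl) k 1 := by
    ext i; simp [hh1, HS.setN_N, HS.setR_N, Function.update_apply]
  have o1 : ∀ f, f ≠ N_nu → f ≠ N_pl → h1.N f = h.N f := by
    intro f h2 h3; ext i; simp [hh1, HS.setN_N, HS.setR_N, h2, h3]
  have o2 : ∀ f, f ≠ R_sig → f ≠ R_e → h1.R f = h.R f := by
    intro f h2 h3; ext i; simp [hh1, HS.setN_R, HS.setR_R, h2, h3]
  have fb1 : h1.N N_fb = h.N N_fb := o1 _ (by decide) (by decide)
  have a1 : h1.R R_a = h.R R_a := o2 _ (by decide) (by decide)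
  have E1 : h1.R R_E = h.R R_E := o2 _ (by decide) (by decide)
  have hM : h1.N N_M = h.N N_M := o1 _ (by decide) (by decide)
  have hs : h1.R R_s = h.R R_s := o2 _ (by decide) (by decide)
  intro g
  by_cases hfb : h.N N_fb k = 0
  · set h2 : HS := (h1.setN N_M k b).setR R_s k (h.R R_e b + lag h b) with hh2
    have : g = h2 := by
      change assignJob.run E h = h2
      rw [e, HC.run_ite_pos _ _ (by simp [TE.ev, NE.ev, k1, fb1, hfb]), HC.run]
      have w : HC.run E (.setN N_M (.s N_best) (.s N_bestm)) h1 = h1.setN N_M k b := by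
        simp only [HC.run, NE.ev, k1, b1]
      rw [w]
      have b2 : (h1.setN N_M k b).N N_bestm 0 = b := by simp [HS.setN_N, b1]
      have k2 : (h1.setN N_M k b).N N_best 0 = k := by simp [HS.setN_N, k1]
      by_cases hc : h.R R_a b ≤ h.R R_E b
      · rw [HC.run_ite_pos _ _ (by simpa [TE.ev, RE.ev, NE.ev, b2, HS.setN_R, a1, E1] using hc)]
        simp only [HC.run, RE.ev, NE.ev, b2, k2, HS.setN_R, a1, E1, s1, hh2, lag,
          Function.update_self]
        rw [max_eq_right (by linarith)]
      · rw [HC.run_ite_neg _ _ (by simpa [TE.ev, RE.ev, NE.ev, b2, HS.setN_R, a1, E1] using hc)]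
        simp only [HC.run, RE.ev, NE.ev, k2, HS.setN_R, s1, hh2, lag,
          Function.update_self]
        rw [max_eq_left (by linarith), add_zero]
    rw [this, if_pos hfb, if_pos hfb]
    refine ⟨?_, ?_, ?_, ?_, ?_, ?_⟩
    · ext i; simp [hh2, HS.setN_R, HS.setR_R, s1]
    · ext i; simp [hh2, HS.setN_N, HS.setR_N, n1]
    · ext i; simp [hh2, HS.setN_R, HS.setR_R, e1]
    · ext i; simp [hh2, HS.setN_N, HS.setR_N, p1]
    · ext i; simp [hh2, HS.setN_N, HS.setR_N, hM, Function.update_apply]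
    · ext i; simp [hh2, HS.setN_R, HS.setR_R, hs, Function.update_apply]
  · have : g = h1 := by
      change assignJob.run E h = h1
      rw [e, HC.run_ite_neg _ _ (by simp [TE.ev, NE.ev, k1, fb1, hfb])]
      rfl
    rw [this, if_neg hfb, if_neg hfb]
    exact ⟨s1, n1, e1, p1, hM, hs⟩

/-- The jobs that the virtual schedule has to plan. -/
def toPlan (h : HS) : Finset ℕ :=
  (Finset.range (h.N N_j 0 + 1)).filter fun k => h.N N_fs k = 0 ∧ h.R R_y k ≤ h.R R_V 0

/-- The state after the jobs in `P` have been given a place in the virtual schedule. -/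
structure Planned (m : ℕ) (h : HS) (P : Finset ℕ) (g : HS) : Prop where
  sched : ListSchedule m P (h.R R_p) (h.R R_e) (g.R R_sig) (g.N N_nu) (g.R R_e)
  sig : ∀ k ∉ P, g.R R_sig k = h.R R_sig k
  nu : ∀ k ∉ P, g.N N_nu k = h.N N_nu k
  out : ∀ k ∈ P, h.N N_fb k = 0 → g.N N_M k = g.N N_nu k ∧
    g.R R_s k = g.R R_sig k + lag h (g.N N_nu k)
  out_not : ∀ k, ¬ (k ∈ P ∧ h.N N_fb k = 0) → g.N N_M k = h.N N_M k ∧ g.R R_s k = h.R R_s k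

theorem planSmall_spec (hm1 : 1 ≤ E.m) (hm : E.m ≤ E.n + 1) (hj : h.N N_j 0 ≤ E.n)
    (hpl : ∀ k ≤ h.N N_j 0, h.N N_pl k = 0) (hp : ∀ k ≤ h.N N_j 0, 0 < h.R R_p k) :
    Planned E.m h (toPlan h) (planSmall.run E h) := by
  have key := HC.forTo_ind (E := E) N_rd (.add (.s N_j) (.lit 1))
    (.seq findJob (.ite (.zero (.s N_found)) .skip (.seq findMachine assignJob)))
    h (h.N N_j 0 + 1) (by omega) (by decide)
    (fun l g => ∃ P ⊆ toPlan h, (P = toPlan h ∨ P.card = l) ∧ Planned E.m h P g ∧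
      (∀ k ≤ h.N N_j 0, g.N N_pl k = if k ∈ P then 1 else 0) ∧
      ∀ k ∈ P, ∀ l ∈ toPlan h \ P, h.R R_p k ≤ h.R R_p l)
    (fun _ _ _ hP => by
      obtain ⟨P, h1, h2, h3, h4, h5⟩ := hP
      exact ⟨P, h1, h2, ⟨h3.1, h3.2, h3.3, h3.4, h3.5⟩, h4, h5⟩) (fun g hF => ?_) ?_ ?_
  · obtain ⟨P, h1, h2, h3, -⟩ := key
    have : P = toPlan h := by
      rcases h2 with h2 | h2
      · exact h2
      · refine Finset.eq_of_subset_of_card_le h1 ?_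
        rw [h2]
        exact (Finset.card_filter_le _ _).trans (by simp)
    rw [← this]; exact h3
  · simp only [NE.ev]; rw [hF.N N_j (by decide)]
  · refine ⟨∅, by simp, Or.inr rfl, ⟨ListSchedule.empty _ _ _ _ _, by simp, by simp, by simp,
      by simp⟩, fun k hk => by simp [hpl k hk], by simp⟩
  · rintro l hl g hF hk ⟨P, hPU, hPl, HP, hPpl, hPo⟩
    have eN : ∀ f, f = N_j ∨ f = N_fs ∨ f = N_fb → g.N f = h.N f := by
      rintro f (rfl | rfl | rfl) <;> exact hF.N _ (by decide)
    have ej := eN N_j (by simp)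
    have efs := eN N_fs (by simp)
    have efb := eN N_fb (by simp)
    have ep : g.R R_p = h.R R_p := hF.R _ (by decide)
    have ey : g.R R_y = h.R R_y := hF.R _ (by decide)
    have eV : g.R R_V = h.R R_V := hF.R _ (by decide)
    have ea : g.R R_a = h.R R_a := hF.R _ (by decide)
    have eE : g.R R_E = h.R R_E := hF.R _ (by decide)
    have hcand : candidates g = toPlan h \ P := by
      ext k
      simp only [candidates, toPlan, ej, efs, ey, eV, Finset.mem_filter, Finset.mem_range,
        Finset.mem_sdiff]
      constructor
      · rintro ⟨h1, h2, h3, h4⟩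
        refine ⟨⟨h1, h2, h4⟩, fun h5 => ?_⟩
        rw [hPpl k (by omega), if_pos h5] at h3
        exact one_ne_zero h3
      · rintro ⟨⟨h1, h2, h4⟩, h5⟩
        exact ⟨h1, h2, by rw [hPpl k (by omega), if_neg h5], h4⟩
    obtain ⟨fj1, fj2⟩ := findJob_spec (E := E) (h := g) (by rw [ej]; exact hj)
    rw [hcand] at fj1 fj2
    have fF := HC.frame (E := E) findJob g
    rw [HC.run]
    set g1 := findJob.run E g with hg1
    by_cases h0 : g1.N N_found 0 = 0
    · rw [HC.run_ite_pos _ _ (by simp [TE.ev, NE.ev, h0])]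
      have hU : P = toPlan h := by
        refine Finset.Subset.antisymm hPU ?_
        rw [← Finset.sdiff_eq_empty_iff_subset]; exact fj1 h0
      refine ⟨P, hPU, Or.inl hU, ⟨?_, ?_, ?_, ?_, ?_⟩, ?_, hPo⟩
      · simp only [HC.run]
        rw [fF.R R_sig (by decide), fF.N N_nu (by decide), fF.R R_e (by decide)]; exact HP.sched
      · simp only [HC.run]; rw [fF.R R_sig (by decide)]; exact HP.sig
      · simp only [HC.run]; rw [fF.N N_nu (by decide)]; exact HP.nu
      · simp only [HC.run]
        rw [fF.R R_sig (by decide), fF.N N_nu (by decide), fF.R R_s (by decide),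
          fF.N N_M (by decide)]; exact HP.out
      · simp only [HC.run]; rw [fF.R R_s (by decide), fF.N N_M (by decide)]; exact HP.out_not
      · simp only [HC.run]; rw [fF.N N_pl (by decide)]; exact hPpl
    · rw [HC.run_ite_neg _ _ (by simp [TE.ev, NE.ev, h0]), HC.run]
      obtain ⟨hb1, hb2⟩ := fj2 h0
      obtain ⟨hm2, hm3⟩ := findMachine_spec (E := E) (h := g1) hm1 hm
      have mF := HC.frame (E := E) findMachine g1
      set g2 := findMachine.run E g1 with hg2
      obtain ⟨s1, s2, s3, s4, s5, s6⟩ := assignJob_spec (E := E) (h := g2)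
      have eN2 : ∀ f, findJob.wN f = false → findMachine.wN f = false → g2.N f = g.N f :=
        fun f h1 h2 => (mF.N f h2).trans (fF.N f h1)
      have eR2 : ∀ f, g2.R f = g.R f := fun f =>
        (HC.run_R f _ (by revert f; decide) _).trans (HC.run_R f _ (by revert f; decide) _)
      have hbest : g2.N N_best = g1.N N_best := mF.N _ (by decide)
      have hR1 : ∀ f, g1.R f = g.R f := fun f => HC.run_R f _ (by revert f; decide) _
      rw [hR1] at hm3
      rw [← hbest] at hb1 hb2
      rw [ep] at hb2
      have elag : ∀ μ, lag g2 μ = lag h μ := fun μ => by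
        unfold lag; rw [eR2, eR2, ea, eE]
      simp only [eR2] at s1 s3
      rw [eN2 N_nu (by decide) (by decide)] at s2
      rw [eN2 N_pl (by decide) (by decide)] at s4
      rw [eN2 N_fb (by decide) (by decide), eN2 N_M (by decide) (by decide), efb] at s5
      rw [eN2 N_fb (by decide) (by decide), eR2, eR2, elag, efb] at s6
      rw [ep] at s3
      set b := g2.N N_bestm 0
      set k := g2.N N_best 0
      obtain ⟨hbU, hbP⟩ := Finset.mem_sdiff.mp hb1
      have hkj : k ≤ h.N N_j 0 := by
        have := Finset.mem_range.mp (Finset.mem_filter.mp hbU).1; omega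
      have hne : ∀ i ∈ P, i ≠ k := fun i hi => by rintro rfl; exact hbP hi
      refine ⟨insert k P, Finset.insert_subset hbU hPU, Or.inr ?_, ⟨?_, ?_, ?_, ?_, ?_⟩, ?_, ?_⟩
      · rw [Finset.card_insert_of_notMem hbP]
        rcases hPl with h1 | h1
        · exact absurd (h1 ▸ hbU) hbP
        · rw [h1]
      · rw [s1, s2, s3]
        exact HP.sched.insert hbP (hp k hkj) (fun i hi => hPo i hi k hb1) hm2 hm3
      · intro i hi
        rw [Finset.mem_insert, not_or] at hi
        rw [s1, Function.update_of_ne hi.1]; exact HP.sig i hi.2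
      · intro i hi
        rw [Finset.mem_insert, not_or] at hi
        rw [s2, Function.update_of_ne hi.1]; exact HP.nu i hi.2
      · intro i hi hfb
        rw [s1, s2, s5, s6]
        rcases Finset.mem_insert.mp hi with rfl | hi
        · simp only [hfb, if_true, Function.update_self]; exact ⟨trivial, trivial⟩
        · rw [Function.update_of_ne (hne i hi), Function.update_of_ne (hne i hi)]
          have := HP.out i hi hfb
          split_ifs
          · rwa [Function.update_of_ne (hne i hi), Function.update_of_ne (hne i hi)]
          · exact this
      · intro i hi
        rw [s5, s6]
        have h1 := HP.out_not i (fun h => hi ⟨Finset.mem_insert_of_mem h.1, h.2⟩)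
        split_ifs with h2
        · have : i ≠ k := by rintro rfl; exact hi ⟨Finset.mem_insert_self _ _, h2⟩
          rwa [Function.update_of_ne this, Function.update_of_ne this]
        · exact h1
      · intro i hi
        rw [s4]
        by_cases h1 : i = k
        · subst h1; simp
        · rw [Function.update_of_ne h1, hPpl i hi]; simp [Finset.mem_insert, h1]
      · intro i hi i' hi'
        rw [Finset.mem_sdiff, Finset.mem_insert, not_or] at hi'
        have h3 : i' ∈ toPlan h \ P := Finset.mem_sdiff.mpr ⟨hi'.1, hi'.2.2⟩
        rcases Finset.mem_insert.mp hi with rfl | hi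
        · exact hb2 i' h3
        · exact hPo i hi i' h3

/-- The order in which the big jobs of a machine are started: by trigger clock, ties by index. -/
def Prec (β : ℕ → ℝ) (l k : ℕ) : Prop := β l < β k ∨ β l ≤ β k ∧ l < k

/-- Job `k` is big and not yet started. -/
def Waiting (h : HS) (k : ℕ) : Prop := h.N N_fb k = 0 ∧ h.R R_V 0 < h.R R_y k

open Classical in
/-- The clock of its machine at which the big job `k` is to be started. -/
def planClock (h : HS) (k : ℕ) : ℝ := h.R R_W (h.N N_bm k) + h.R R_beta k +
  ∑ l ∈ Finset.range (h.N N_j 0 + 1) with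
    Waiting h l ∧ h.N N_bm l = h.N N_bm k ∧ Prec (h.R R_beta) l k, h.R R_p l

theorem planBig_spec (hj : h.N N_j 0 ≤ E.n) (k : ℕ) :
    (k ≤ h.N N_j 0 ∧ Waiting h k →
      (planBig.run E h).R R_u k = planClock h k ∧
      (planBig.run E h).R R_s k = h.R R_e (h.N N_bm k) - h.R R_a (h.N N_bm k) + planClock h k ∧
      (planBig.run E h).N N_M k = h.N N_bm k) ∧
    (¬ (k ≤ h.N N_j 0 ∧ Waiting h k) →
      (planBig.run E h).R R_u k = h.R R_u k ∧
      (planBig.run E h).R R_s k = h.R R_s k ∧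
      (planBig.run E h).N N_M k = h.N N_M k) := by
  classical
  set inner : HC := .ite (.both (waitTest (.s N_r)) (.both
            (.neq (.var N_bm (.s N_r)) (.var N_bm (.s N_k))) (precTest (.s N_r) (.s N_k))))
          (.setR R_u (.s N_k) (.add (.var R_u (.s N_k)) (.var R_p (.s N_r)))) .skip with hinner
  have key := HC.forTo_ind (E := E) N_k (.add (.s N_j) (.lit 1)) (.ite (waitTest (.s N_k))
    (.seq (.setR R_u (.s N_k) (.add (.var R_W (.var N_bm (.s N_k))) (.var R_beta (.s N_k)))) (.seq
      (.forTo N_r (.add (.s N_j) (.lit 1)) inner)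
      (.seq (.setR R_s (.s N_k) (.add (.sub (.var R_e (.var N_bm (.s N_k)))
          (.var R_a (.var N_bm (.s N_k)))) (.var R_u (.s N_k))))
        (.setN N_M (.s N_k) (.var N_bm (.s N_k)))))) .skip)
    h (h.N N_j 0 + 1) (by omega) (by decide)
    (fun l g => ∀ k, (k < l ∧ Waiting h k → g.R R_u k = planClock h k ∧
        g.R R_s k = h.R R_e (h.N N_bm k) - h.R R_a (h.N N_bm k) + planClock h k ∧
        g.N N_M k = h.N N_bm k) ∧
      (¬ (k < l ∧ Waiting h k) → g.R R_u k = h.R R_u k ∧ g.R R_s k = h.R R_s k ∧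
        g.N N_M k = h.N N_M k))
    (fun _ _ _ hP => hP) (fun g hF => ?_) (by simp) ?_
  · have := key k
    rw [Nat.lt_succ_iff] at this
    exact this
  · simp only [NE.ev]; rw [hF.N N_j (by decide)]
  · intro l hl g hF hk hP k
    have ej : g.N N_j = h.N N_j := hF.N _ (by decide)
    have efb : g.N N_fb = h.N N_fb := hF.N _ (by decide)
    have ebm : g.N N_bm = h.N N_bm := hF.N _ (by decide)
    have ey : g.R R_y = h.R R_y := hF.R _ (by decide)
    have eV : g.R R_V = h.R R_V := hF.R _ (by decide)
    have eW : g.R R_W = h.R R_W := hF.R _ (by decide)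
    have eb : g.R R_beta = h.R R_beta := hF.R _ (by decide)
    have ep : g.R R_p = h.R R_p := hF.R _ (by decide)
    have ea : g.R R_a = h.R R_a := hF.R _ (by decide)
    have ee : g.R R_e = h.R R_e := hF.R _ (by decide)
    by_cases hw : Waiting h l
    · rw [HC.run_ite_pos _ _ (by simpa [TE.ev, NE.ev, RE.ev, waitTest, smallTest, hk, efb, ey, eV,
        Waiting] using hw)]
      set g1 := g.setR R_u l (h.R R_W (h.N N_bm l) + h.R R_beta l) with hg1
      have w1 : HC.run E (.setR R_u (.s N_k)
          (.add (.var R_W (.var N_bm (.s N_k))) (.var R_beta (.s N_k)))) g = g1 := by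
        simp only [HC.run, NE.ev, RE.ev, hk, eW, ebm, eb, hg1]
      rw [HC.run, w1, HC.run]
      have hI := HC.forTo_ind (E := E) N_r (.add (.s N_j) (.lit 1)) inner g1 (h.N N_j 0 + 1)
        (by omega) (by decide) (fun r q => q.N N_k 0 = l ∧
          q.R R_u = Function.update (g.R R_u) l (h.R R_W (h.N N_bm l) + h.R R_beta l +
          ∑ i ∈ Finset.range r with
            Waiting h i ∧ h.N N_bm i = h.N N_bm l ∧ Prec (h.R R_beta) i l, h.R R_p i))
        (fun _ _ _ hP => hP) (fun q hq => ?_) ⟨by simp [hg1, HS.setR_N, hk], ?_⟩ ?_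
      · have hQ := HC.frame (E := E) (HC.forTo N_r (.add (.s N_j) (.lit 1)) inner) g1
        set g2 := (HC.forTo N_r (.add (.s N_j) (.lit 1)) inner).run E g1 with hg2
        obtain ⟨hk2, hu2⟩ := hI
        have hu3 : g2.R R_u l = planClock h l := by rw [hu2]; simp [planClock]
        have e2 : g2.R R_e = h.R R_e := by
          rw [hQ.R _ (by decide)]; ext i; simp [hg1, HS.setR_R, ee]
        have a2 : g2.R R_a = h.R R_a := by
          rw [hQ.R _ (by decide)]; ext i; simp [hg1, HS.setR_R, ea]
        have b2 : g2.N N_bm = h.N N_bm := by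
          rw [hQ.N _ (by decide)]; simp [hg1, HS.setR_N, ebm]
        have s2 : g2.R R_s = g.R R_s := by
          rw [hQ.R _ (by decide)]; ext i; simp [hg1, HS.setR_R]
        have m2 : g2.N N_M = g.N N_M := by
          rw [hQ.N _ (by decide)]; simp [hg1, HS.setR_N]
        simp only [HC.run, NE.ev, RE.ev, hk2, HS.setN_N, HS.setR_N, HS.setR_R, HS.setN_R, b2, e2,
          a2, hu3, s2, m2, true_and]
        by_cases hkl : k = l
        · subst hkl
          simp [hw, hu3]
        · have hPk := hP k
          have hiff : k < l + 1 ↔ k < l := by omega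
          rw [hiff]
          simpa [hkl, hu2, Function.update_apply] using hPk
      · simp only [NE.ev]; rw [hq.N N_j (by decide)]; simp [hg1, HS.setR_N, ej]
      · ext i; simp [hg1, HS.setR_R, Function.update_apply]
      · rintro r hr q hq hrq ⟨hqk, hqu⟩
        have qN : ∀ f, f ≠ N_r → f = N_fb ∨ f = N_bm → q.N f = h.N f := by
          rintro f - (rfl | rfl) <;> rw [hq.N _ (by decide)] <;> simp [hg1, HS.setR_N, efb, ebm]
        have qfb := qN N_fb (by decide) (by simp)
        have qbm := qN N_bm (by decide) (by simp)
        have qy : q.R R_y = h.R R_y := by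
          rw [hq.R _ (by decide)]; ext i; simp [hg1, HS.setR_R, ey]
        have qV : q.R R_V = h.R R_V := by
          rw [hq.R _ (by decide)]; ext i; simp [hg1, HS.setR_R, eV]
        have qb : q.R R_beta = h.R R_beta := by
          rw [hq.R _ (by decide)]; ext i; simp [hg1, HS.setR_R, eb]
        have qp : q.R R_p = h.R R_p := by
          rw [hq.R _ (by decide)]; ext i; simp [hg1, HS.setR_R, ep]
        have hsum : ∑ i ∈ Finset.range (r + 1) with
            Waiting h i ∧ h.N N_bm i = h.N N_bm l ∧ Prec (h.R R_beta) i l, h.R R_p i =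
            (∑ i ∈ Finset.range r with
            Waiting h i ∧ h.N N_bm i = h.N N_bm l ∧ Prec (h.R R_beta) i l, h.R R_p i) +
            if Waiting h r ∧ h.N N_bm r = h.N N_bm l ∧ Prec (h.R R_beta) r l then h.R R_p r
            else 0 := by
          rw [Finset.sum_filter, Finset.sum_filter, Finset.sum_range_succ]
        rw [hsum]
        have htest : TE.ev E q (.both (waitTest (.s N_r)) (.both
            (.neq (.var N_bm (.s N_r)) (.var N_bm (.s N_k))) (precTest (.s N_r) (.s N_k)))) ↔
            Waiting h r ∧ h.N N_bm r = h.N N_bm l ∧ Prec (h.R R_beta) r l := by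
          simp only [TE.ev, NE.ev, RE.ev, waitTest, smallTest, precTest, hrq, hqk, qfb, qbm, qy,
            qV, qb, Waiting, Prec, Nat.le_zero, not_le, ← le_antisymm_iff]
          tauto
        by_cases hc : Waiting h r ∧ h.N N_bm r = h.N N_bm l ∧ Prec (h.R R_beta) r l
        · rw [hinner, HC.run_ite_pos _ _ (htest.mpr hc), if_pos hc]
          simp only [HC.run, NE.ev, RE.ev, hqk, hrq, qp, hqu, HS.setR_N, true_and]
          ext i
          by_cases hi : i = l
          · subst hi; simp [HS.setR_R]; ring
          · simp [HS.setR_R, hi, hqu]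
        · rw [hinner, HC.run_ite_neg _ _ (fun h => hc (htest.mp h)), if_neg hc, add_zero]
          exact ⟨hqk, hqu⟩
    · rw [HC.run_ite_neg _ _ (by simpa [TE.ev, NE.ev, RE.ev, waitTest, smallTest, hk, efb, ey, eV,
        Waiting] using hw)]
      have hPk := hP k
      by_cases hkl : k = l
      · subst hkl
        simpa [hw, HC.run] using hPk
      · have hiff : k < l + 1 ↔ k < l := by omega
        rw [hiff]
        exact hPk

end

/-! ### Planning the big jobs -/

section

variable {E : Env} {h : HS}

/-- A big job of state `h` that is started before the clock `a` of its machine. -/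
def BeginsBig (h : HS) (a : ℕ → ℝ) (k : ℕ) : Prop :=
  h.N N_fb k = 0 ∧ h.R R_V 0 < h.R R_y k ∧ h.R R_u k < a (h.N N_bm k)

open Classical in
/-- What one release does to the state. -/
structure EventSpec (E : Env) (κ : ℕ) (h g : HS) : Prop where
  a : ∀ μ < E.m, g.R R_a μ = h.R R_a μ + max 0 (h.R R_T 0 - h.R R_e μ)
  fs : ∀ k < h.N N_j 0, g.N N_fs k = if NewSmall h k then 1 else h.N N_fs k
  fs_new : g.N N_fs (h.N N_j 0) = 0
  f : MaxUpd (h.N N_j 0) (NewSmall h) (h.N N_nu) (fun k => h.R R_sig k + h.R R_p k) (h.R R_f)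
    (g.R R_f)
  fb : ∀ k < h.N N_j 0, g.N N_fb k = if BeginsBig h (g.R R_a) k then 1 else h.N N_fb k
  fb_new : g.N N_fb (h.N N_j 0) = 0
  W : ∀ μ, g.R R_W μ = h.R R_W μ + ∑ k ∈ Finset.range (h.N N_j 0) with
    BeginsBig h (g.R R_a) k ∧ h.N N_bm k = μ, h.R R_p k
  Eb : MaxUpd (h.N N_j 0) (BeginsBig h (g.R R_a)) (h.N N_bm) (fun k => h.R R_u k + h.R R_p k)
    (h.R R_E) (g.R R_E)
  p : ∀ k, g.R R_p k = if k = h.N N_j 0 then h.R R_PJ 0 else h.R R_p k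
  V : g.R R_V 0 = h.R R_V 0 + h.R R_PJ 0
  y : ∀ k, g.R R_y k = if k = h.N N_j 0 then 2 ^ κ * (E.m * h.R R_PJ 0) else h.R R_y k
  gr : ∀ k, k ≠ h.N N_j 0 → g.N N_gr k = h.N N_gr k
  gr_lt : g.N N_gr (h.N N_j 0) < E.m
  gr_new : (∃ k < E.m, groupCount g (h.N N_j 0) k < 2 ^ κ) →
    groupCount g (h.N N_j 0) (g.N N_gr (h.N N_j 0)) < 2 ^ κ
  bm : ∀ k, k ≠ h.N N_j 0 → g.N N_bm k = h.N N_bm k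
  bm_new : g.N N_bm (h.N N_j 0) = wrap E.m (g.N N_gr (h.N N_j 0) + h.N N_rho 0)
  beta : ∀ k, k ≠ h.N N_j 0 → g.R R_beta k = h.R R_beta k
  beta_new : g.R R_beta (h.N N_j 0) =
    max (g.R R_a (g.N N_bm (h.N N_j 0))) (g.R R_E (g.N N_bm (h.N N_j 0))) -
      g.R R_W (g.N N_bm (h.N N_j 0)) + bitsVal E.tape h.used κ * h.R R_PJ 0
  used : g.used = h.used + κ
  Q : g.N N_Q = h.N N_Q
  rho : g.N N_rho = h.N N_rho
  j : g.N N_j = h.N N_j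
  sched : ListSchedule E.m (toPlan g) (g.R R_p) (fun μ => max (h.R R_T 0) (g.R R_f μ))
    (g.R R_sig) (g.N N_nu) (g.R R_e)
  sig : ∀ k ∉ toPlan g, g.R R_sig k = h.R R_sig k
  nu : ∀ k ∉ toPlan g, g.N N_nu k = h.N N_nu k
  out : ∀ k ∈ toPlan g, g.N N_fb k = 0 → g.N N_M k = g.N N_nu k ∧
    g.R R_s k = g.R R_sig k + lag g (g.N N_nu k)
  big : ∀ k ≤ h.N N_j 0, Waiting g k → g.R R_u k = planClock g k ∧
    g.R R_s k = g.R R_e (g.N N_bm k) - g.R R_a (g.N N_bm k) + planClock g k ∧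
    g.N N_M k = g.N N_bm k
  u : ∀ k, ¬ (k ≤ h.N N_j 0 ∧ Waiting g k) → g.R R_u k = h.R R_u k
  keep : ∀ k, ¬ (k ≤ h.N N_j 0 ∧ Waiting g k) → ¬ (k ∈ toPlan g ∧ g.N N_fb k = 0) →
    g.N N_M k = h.N N_M k ∧ g.R R_s k = h.R R_s k

open Classical in
theorem freeze_spec (hm : E.m ≤ E.n + 1) (hj : h.N N_j 0 ≤ E.n + 1) :
    let g := freeze.run E h
    (∀ μ < E.m, g.R R_a μ = h.R R_a μ + max 0 (h.R R_T 0 - h.R R_e μ)) ∧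
    (∀ k < h.N N_j 0, g.N N_fs k = if NewSmall h k then 1 else h.N N_fs k) ∧
    MaxUpd (h.N N_j 0) (NewSmall h) (h.N N_nu) (fun k => h.R R_sig k + h.R R_p k) (h.R R_f)
      (g.R R_f) ∧
    (∀ k < h.N N_j 0, g.N N_fb k = if BeginsBig h (g.R R_a) k then 1 else h.N N_fb k) ∧
    (∀ μ, g.R R_W μ = h.R R_W μ + ∑ k ∈ Finset.range (h.N N_j 0) with
      BeginsBig h (g.R R_a) k ∧ h.N N_bm k = μ, h.R R_p k) ∧
    MaxUpd (h.N N_j 0) (BeginsBig h (g.R R_a)) (h.N N_bm) (fun k => h.R R_u k + h.R R_p k)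
      (h.R R_E) (g.R R_E) := by
  intro g
  set h1 := idleClocks.run E h with hh1
  set h2 := freezeSmall.run E h1 with hh2
  have hg : g = freezeBig.run E h2 := rfl
  have F1 := HC.frame (E := E) idleClocks h
  have F2 := HC.frame (E := E) freezeSmall h1
  have F3 := HC.frame (E := E) freezeBig h2
  rw [← hh1] at F1
  rw [← hh2] at F2
  rw [← hg] at F3
  have N1 : h1.N N_j = h.N N_j := F1.N _ (by decide)
  have N2 : h2.N N_j = h.N N_j := (F2.N _ (by decide)).trans N1
  have ga : g.R R_a = h1.R R_a := (F3.R _ (by decide)).trans (F2.R _ (by decide))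
  have ns : NewSmall h1 = NewSmall h := by
    ext k; unfold NewSmall
    rw [F1.N N_fs (by decide), F1.R R_y (by decide), F1.R R_V (by decide), F1.R R_sig (by decide),
      F1.R R_T (by decide)]
  have nb : NewBig h2 = BeginsBig h (g.R R_a) := by
    ext k; unfold NewBig BeginsBig
    rw [ga, F2.N N_fb (by decide), F2.R R_y (by decide), F2.R R_V (by decide),
      F2.R R_u (by decide), F2.R R_a (by decide), F2.N N_bm (by decide),
      F1.N N_fb (by decide), F1.R R_y (by decide), F1.R R_V (by decide),
      F1.R R_u (by decide), F1.N N_bm (by decide)]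
  obtain ⟨s1, s2⟩ := freezeSmall_spec (E := E) (h := h1) (by rw [N1]; exact hj)
  obtain ⟨b1, b2, b3⟩ := freezeBig_spec (E := E) (h := h2) (by rw [N2]; exact hj)
  rw [ns, N1] at s1 s2
  rw [F1.R R_f (by decide), F1.N N_nu (by decide), F1.R R_sig (by decide),
    F1.R R_p (by decide)] at s2
  rw [N2, nb, ← hg] at b1 b2 b3
  rw [(F2.R R_p (by decide)).trans (F1.R R_p (by decide)),
    (F2.N N_bm (by decide)).trans (F1.N N_bm (by decide))] at b2 b3
  rw [(F2.R R_u (by decide)).trans (F1.R R_u (by decide)),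
    (F2.R R_E (by decide)).trans (F1.R R_E (by decide))] at b3
  refine ⟨fun μ hμ => ?_, fun k hk => ?_, ?_, fun k hk => ?_, fun μ => ?_, b3⟩
  · rw [ga, hh1, idleClocks_spec hm, if_pos hμ]
  · rw [F3.N N_fs (by decide), s1, F1.N N_fs (by decide)]
    simp [hk]
  · rw [F3.R R_f (by decide)]; exact s2
  · rw [b1, (F2.N N_fb (by decide)).trans (F1.N N_fb (by decide))]
    simp [hk]
  · rw [b2, (F2.R R_W (by decide)).trans (F1.R R_W (by decide))]

theorem arrive_spec {κ : ℕ} (hm1 : 1 ≤ E.m) (hm : E.m ≤ E.n + 1) (hj : h.N N_j 0 ≤ E.n + 1)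
    (hκ : κ ≤ E.n + 1) (hQ : h.N N_Q 0 = 2 ^ κ) :
    let g := arrive.run E h
    (∀ k, g.R R_p k = if k = h.N N_j 0 then h.R R_PJ 0 else h.R R_p k) ∧
    (g.R R_V 0 = h.R R_V 0 + h.R R_PJ 0) ∧
    (∀ k, g.R R_y k = if k = h.N N_j 0 then 2 ^ κ * (E.m * h.R R_PJ 0) else h.R R_y k) ∧
    (g.N N_gr (h.N N_j 0) < E.m) ∧
    ((∃ k < E.m, groupCount g (h.N N_j 0) k < 2 ^ κ) →
      groupCount g (h.N N_j 0) (g.N N_gr (h.N N_j 0)) < 2 ^ κ) ∧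
    g.used = h.used + κ ∧
    (∀ k, g.N N_fs k = if k = h.N N_j 0 then 0 else h.N N_fs k) ∧
    (∀ k, g.N N_fb k = if k = h.N N_j 0 then 0 else h.N N_fb k) ∧
    (∀ k, k ≠ h.N N_j 0 → g.N N_gr k = h.N N_gr k) ∧
    (∀ k, g.N N_bm k = if k = h.N N_j 0 then
      wrap E.m (g.N N_gr (h.N N_j 0) + h.N N_rho 0) else h.N N_bm k) ∧
    (∀ k, g.R R_beta k = if k = h.N N_j 0 then
      max (h.R R_a (g.N N_bm (h.N N_j 0))) (h.R R_E (g.N N_bm (h.N N_j 0))) -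
      h.R R_W (g.N N_bm (h.N N_j 0)) + bitsVal E.tape h.used κ * h.R R_PJ 0
      else h.R R_beta k) := by
  intro g
  set h1 := arriveSize.run E h with hh1
  set h2 := arriveDraw.run E h1 with hh2
  set h3 := firstFit.run E h2 with hh3
  have hg : g = register.run E h3 := rfl
  have F1 := HC.frame (E := E) arriveSize h
  have F2 := HC.frame (E := E) arriveDraw h1
  have F3 := HC.frame (E := E) firstFit h2
  have F4 := HC.frame (E := E) register h3
  rw [← hh1] at F1
  rw [← hh2] at F2
  rw [← hh3] at F3
  rw [← hg] at F4
  have N1 : h1.N N_j = h.N N_j := F1.N _ (by decide)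
  have N2 : h2.N N_j = h.N N_j := (F2.N _ (by decide)).trans N1
  have N3 : h3.N N_j = h.N N_j := (F3.N _ (by decide)).trans N2
  have Q1 : h1.N N_Q = h.N N_Q := F1.N _ (by decide)
  have Q2 : h2.N N_Q = h.N N_Q := (F2.N _ (by decide)).trans Q1
  obtain ⟨a1, a2, a3⟩ := arriveSize_spec (E := E) (h := h) hm
  obtain ⟨d1, d2, d3⟩ := arriveDraw_spec (E := E) (h := h1) hκ (by rw [Q1, hQ])
  obtain ⟨f1, f2⟩ := firstFit_spec (E := E) (h := h2) hm1 hm (by rw [N2]; exact hj)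
  obtain ⟨r1, r2, r3, r4, r5⟩ := register_spec (E := E) (h := h3)
  have u1 : h1.used = h.used := HC.run_used _ arriveSize (by decide) _
  have u3 : h3.used = h2.used := HC.run_used _ firstFit (by decide) _
  have u4 : g.used = h3.used := HC.run_used _ register (by decide) _
  simp only [N1, F1.R R_PJ (by decide), u1] at d1 d2 d3
  rw [← hh1] at a1 a2 a3
  rw [← hh2] at d1 d2 d3
  rw [← hh3, N2, Q2, hQ] at f2
  rw [← hh3] at f1
  rw [← hg, N3] at r1 r2 r3 r4 r5
  have gV : g.R R_V = h1.R R_V := (F4.R _ (by decide)).trans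
    ((F3.R _ (by decide)).trans (F2.R _ (by decide)))
  have gy : g.R R_y = h2.R R_y := (F4.R _ (by decide)).trans (F3.R _ (by decide))
  have e23 : ∀ f, (arriveSize.wN f = false) → (arriveDraw.wN f = false) →
      (firstFit.wN f = false) → h3.N f = h.N f := fun f x1 x2 x3 =>
    (F3.N f x3).trans ((F2.N f x2).trans (F1.N f x1))
  have e23R : ∀ f, (arriveSize.wR f = false) → (arriveDraw.wR f = false) →
      (firstFit.wR f = false) → h3.R f = h.R f := fun f x1 x2 x3 =>
    (F3.R f x3).trans ((F2.R f x2).trans (F1.R f x1))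
  have grj : g.N N_gr (h.N N_j 0) = h3.N N_grp 0 := by rw [r3, if_pos rfl]
  have hcount : ∀ k, groupCount g (h.N N_j 0) k = groupCount h2 (h.N N_j 0) k := by
    intro k
    unfold groupCount
    congr 1
    refine Finset.filter_congr fun l hl => ?_
    rw [r3, if_neg (Finset.mem_range.mp hl).ne, F3.N N_gr (by decide), gy, gV,
      F2.R R_V (by decide)]
  refine ⟨fun k => ?_, ?_, fun k => ?_, ?_, ?_, ?_, fun k => ?_, fun k => ?_, fun k hk => ?_,
    fun k => ?_, fun k => ?_⟩
  · rw [F4.R R_p (by decide), F3.R R_p (by decide), F2.R R_p (by decide), a1]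
  · rw [gV, a2]
  · rw [gy, d1, a3]
    split_ifs <;> rfl
  · rw [grj]; exact f1
  · simp only [hcount, grj]; exact f2
  · rw [u4, u3, d3]
  · rw [r1, e23 N_fs (by decide) (by decide) (by decide)]
  · rw [r2, e23 N_fb (by decide) (by decide) (by decide)]
  · rw [r3, if_neg hk, e23 N_gr (by decide) (by decide) (by decide)]
  · rw [r4, grj, e23 N_rho (by decide) (by decide) (by decide),
      e23 N_bm (by decide) (by decide) (by decide)]
  · rw [r5, r4, if_pos rfl, e23 N_rho (by decide) (by decide) (by decide),
      e23R R_a (by decide) (by decide) (by decide), e23R R_E (by decide) (by decide) (by decide),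
      e23R R_W (by decide) (by decide) (by decide),
      e23R R_beta (by decide) (by decide) (by decide), F3.R R_X (by decide), d2]

theorem makePlan_spec (hm1 : 1 ≤ E.m) (hm : E.m ≤ E.n + 1) (hj : h.N N_j 0 ≤ E.n)
    (hp : ∀ k ≤ h.N N_j 0, 0 < h.R R_p k) :
    let g := makePlan.run E h
    ListSchedule E.m (toPlan g) (g.R R_p) (fun μ => max (h.R R_T 0) (g.R R_f μ))
      (g.R R_sig) (g.N N_nu) (g.R R_e) ∧
    (∀ k ∉ toPlan g, g.R R_sig k = h.R R_sig k) ∧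
    (∀ k ∉ toPlan g, g.N N_nu k = h.N N_nu k) ∧
    (∀ k ∈ toPlan g, g.N N_fb k = 0 → g.N N_M k = g.N N_nu k ∧
      g.R R_s k = g.R R_sig k + lag g (g.N N_nu k)) ∧
    (∀ k ≤ h.N N_j 0, Waiting g k → g.R R_u k = planClock g k ∧
      g.R R_s k = g.R R_e (g.N N_bm k) - g.R R_a (g.N N_bm k) + planClock g k ∧
      g.N N_M k = g.N N_bm k) ∧
    (∀ k, ¬ (k ≤ h.N N_j 0 ∧ Waiting g k) → g.R R_u k = h.R R_u k) ∧
    (∀ k, ¬ (k ≤ h.N N_j 0 ∧ Waiting g k) → ¬ (k ∈ toPlan g ∧ g.N N_fb k = 0) →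
      g.N N_M k = h.N N_M k ∧ g.R R_s k = h.R R_s k) := by
  classical
  intro g
  set h1 := planInit.run E h with hh1
  set h2 := planSmall.run E h1 with hh2
  have hg : g = planBig.run E h2 := rfl
  have F1 := HC.frame (E := E) planInit h
  have F2 := HC.frame (E := E) planSmall h1
  have F3 := HC.frame (E := E) planBig h2
  rw [← hh1] at F1
  rw [← hh2] at F2
  rw [← hg] at F3
  have N1 : h1.N N_j = h.N N_j := F1.N _ (by decide)
  have N2 : h2.N N_j = h.N N_j := (F2.N _ (by decide)).trans N1
  obtain ⟨i1, i2⟩ := planInit_spec (E := E) (h := h) hm (by omega)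
  rw [← hh1] at i1 i2
  have PS := planSmall_spec (E := E) (h := h1) hm1 hm (by rw [N1]; exact hj)
    (by rw [N1]; exact i2) (by rw [N1, F1.R R_p (by decide)]; exact hp)
  rw [← hh2] at PS
  have PB := planBig_spec (E := E) (h := h2) (by rw [N2]; exact hj)
  rw [← hg, N2] at PB
  have gN : ∀ f, planSmall.wN f = false → planBig.wN f = false → g.N f = h1.N f :=
    fun f x1 x2 => (F3.N f x2).trans (F2.N f x1)
  have gR : ∀ f, planSmall.wR f = false → planBig.wR f = false → g.R f = h1.R f :=
    fun f x1 x2 => (F3.R f x2).trans (F2.R f x1)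
  have hU : toPlan g = toPlan h1 := by
    unfold toPlan
    rw [gN N_j (by decide) (by decide), gN N_fs (by decide) (by decide),
      gR R_y (by decide) (by decide), gR R_V (by decide) (by decide)]
  have hW : ∀ k, Waiting g k ↔ Waiting h2 k := by
    intro k; unfold Waiting
    rw [F3.N N_fb (by decide), F3.R R_y (by decide), F3.R R_V (by decide)]
  have hC : ∀ k, planClock g k = planClock h2 k := by
    intro k; unfold planClock
    simp only [hW]
    rw [F3.N N_bm (by decide), F3.R R_W (by decide), F3.R R_beta (by decide),
      F3.N N_j (by decide), F3.R R_p (by decide)]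
  have hlag : ∀ μ, lag g μ = lag h1 μ := by
    intro μ; unfold lag
    rw [gR R_E (by decide) (by decide), gR R_a (by decide) (by decide)]
  have gsig : g.R R_sig = h2.R R_sig := F3.R _ (by decide)
  have gnu : g.N N_nu = h2.N N_nu := F3.N _ (by decide)
  have gfb : g.N N_fb = h1.N N_fb := gN _ (by decide) (by decide)
  have ge : g.R R_e = h2.R R_e := F3.R _ (by decide)
  have gf : g.R R_f = h.R R_f := (gR _ (by decide) (by decide)).trans (F1.R _ (by decide))
  have hw0 : ∀ k ∈ toPlan g, ¬ (k ≤ h.N N_j 0 ∧ Waiting h2 k) := by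
    rintro k hk ⟨-, h3⟩
    rw [← hW] at h3
    exact absurd (Finset.mem_filter.mp hk).2.2 (not_le.mpr h3.2)
  refine ⟨?_, ?_, ?_, ?_, ?_, ?_, ?_⟩
  · rw [hU, gsig, gnu, ge, gf, gR R_p (by decide) (by decide)]
    exact PS.sched.congr (fun _ _ => rfl) (fun _ _ => rfl) (fun μ hμ => (i1 μ hμ).symm)
      fun _ _ => rfl
  · rw [hU, gsig]
    intro k hk
    rw [PS.sig k hk, F1.R R_sig (by decide)]
  · rw [hU, gnu]
    intro k hk
    rw [PS.nu k hk, F1.N N_nu (by decide)]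
  · intro k hk hfb
    obtain ⟨q1, q2, q3⟩ := (PB k).2 (hw0 k hk)
    rw [q2, q3, gsig, gnu, hlag]
    rw [hU] at hk
    rw [gfb] at hfb
    exact PS.out k hk hfb
  · intro k hk hw
    rw [hC, ge, F3.R R_a (by decide), F3.N N_bm (by decide)]
    exact (PB k).1 ⟨hk, (hW k).mp hw⟩
  · intro k hk
    rw [hW] at hk
    rw [((PB k).2 hk).1, F2.R R_u (by decide), F1.R R_u (by decide)]
  · intro k hk hk2
    rw [hW] at hk
    obtain ⟨q1, q2, q3⟩ := (PB k).2 hk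
    rw [hU, gfb] at hk2
    obtain ⟨q4, q5⟩ := PS.out_not k hk2
    rw [q2, q3, q4, q5, F1.R R_s (by decide), F1.N N_M (by decide)]
    exact ⟨rfl, rfl⟩

/-- The program at a release does what `EventSpec` says. -/
theorem eventBody_spec {κ : ℕ} (hm1 : 1 ≤ E.m) (hm : E.m ≤ E.n + 1) (hj : h.N N_j 0 ≤ E.n)
    (hκ : κ ≤ E.n + 1) (hQ : h.N N_Q 0 = 2 ^ κ) (hp : ∀ k < h.N N_j 0, 0 < h.R R_p k)
    (hP : 0 < h.R R_PJ 0) : EventSpec E κ h (eventBody.run E h) := by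
  set h1 := freeze.run E h with hh1
  set h2 := arrive.run E h1 with hh2
  set g := eventBody.run E h with hg0
  have hg : g = makePlan.run E h2 := rfl
  have F1 := HC.frame (E := E) freeze h
  have F2 := HC.frame (E := E) arrive h1
  have F3 := HC.frame (E := E) makePlan h2
  rw [← hh1] at F1
  rw [← hh2] at F2
  rw [← hg] at F3
  have N1 : h1.N N_j = h.N N_j := F1.N _ (by decide)
  have N2 : h2.N N_j = h.N N_j := (F2.N _ (by decide)).trans N1
  obtain ⟨a1, a2, a3, a4, a5, a6⟩ := freeze_spec (E := E) (h := h) hm (by omega)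
  obtain ⟨b1, b2, b3, b4, b5, b6, b7, b8, b9, b10, b11⟩ := arrive_spec (E := E) (h := h1) (κ := κ)
    hm1 hm (by rw [N1]; omega) hκ (by rw [F1.N N_Q (by decide), hQ])
  rw [← hh2, N1] at *
  have u1 : h1.used = h.used := HC.run_used _ freeze (by decide) _
  have u3 : g.used = h2.used := HC.run_used _ makePlan (by decide) _
  have pJ : h1.R R_PJ = h.R R_PJ := F1.R _ (by decide)
  have e1p : h1.R R_p = h.R R_p := F1.R _ (by decide)
  obtain ⟨c1, c2, c3, c4, c5, c6, c7⟩ := makePlan_spec (E := E) (h := h2) hm1 hm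
    (by rw [N2]; exact hj) (fun k hk => by
      rw [N2] at hk
      rw [b1, pJ, e1p]
      split_ifs with h3
      · exact hP
      · exact hp k (by omega))
  rw [← hg] at c1 c2 c3 c4 c5 c6 c7
  rw [N2] at c5 c6 c7
  have gR : ∀ f, arrive.wR f = false → makePlan.wR f = false → g.R f = h1.R f :=
    fun f x1 x2 => (F3.R f x2).trans (F2.R f x1)
  have ga : g.R R_a = h1.R R_a := gR _ (by decide) (by decide)
  have gE : g.R R_E = h1.R R_E := gR _ (by decide) (by decide)
  have gW : g.R R_W = h1.R R_W := gR _ (by decide) (by decide)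
  have gf : g.R R_f = h1.R R_f := gR _ (by decide) (by decide)
  have ggr : g.N N_gr = h2.N N_gr := F3.N _ (by decide)
  have gbm : g.N N_bm = h2.N N_bm := F3.N _ (by decide)
  have gy : g.R R_y = h2.R R_y := F3.R _ (by decide)
  have gV : g.R R_V = h2.R R_V := F3.R _ (by decide)
  have gcount : ∀ k, groupCount g (h.N N_j 0) k = groupCount h2 (h.N N_j 0) k := by
    intro k; unfold groupCount; rw [ggr, gy, gV]
  rw [← ga] at a1 a4 a5 a6 b11
  rw [← gE] at a6 b11
  rw [← gW] at a5 b11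
  rw [← gf] at a3
  rw [← ggr] at b4 b9 b10
  rw [← gbm] at b10 b11
  constructor
  · exact a1
  · intro k hk
    rw [F3.N N_fs (by decide), b7, if_neg hk.ne, a2 k hk]
  · rw [F3.N N_fs (by decide), b7, if_pos rfl]
  · exact a3
  · intro k hk
    rw [F3.N N_fb (by decide), b8, if_neg hk.ne, a4 k hk]
  · rw [F3.N N_fb (by decide), b8, if_pos rfl]
  · exact a5
  · exact a6
  · intro k; rw [F3.R R_p (by decide), b1, pJ, e1p]
  · rw [gV, b2, pJ, F1.R R_V (by decide)]
  · intro k; rw [gy, b3, pJ, F1.R R_y (by decide)]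
  · intro k hk; rw [b9 k hk, F1.N N_gr (by decide)]
  · exact b4
  · simp only [gcount, ggr]; exact b5
  · intro k hk; rw [b10, if_neg hk, F1.N N_bm (by decide)]
  · rw [b10, if_pos rfl, F1.N N_rho (by decide)]
  · intro k hk; rw [F3.R R_beta (by decide), b11, if_neg hk, F1.R R_beta (by decide)]
  · rw [F3.R R_beta (by decide), b11, if_pos rfl, u1, pJ]
  · rw [u3, b6, u1]
  · rw [F3.N _ (by decide), F2.N _ (by decide), F1.N _ (by decide)]
  · rw [F3.N _ (by decide), F2.N _ (by decide), F1.N _ (by decide)]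
  · rw [F3.N _ (by decide), N2]
  · rw [F2.R R_T (by decide), F1.R R_T (by decide)] at c1; exact c1
  · intro k hk; rw [c2 k hk, F2.R _ (by decide), F1.R _ (by decide)]
  · intro k hk; rw [c3 k hk, F2.N _ (by decide), F1.N _ (by decide)]
  · exact c4
  · exact c5
  · intro k hk; rw [c6 k hk, F2.R _ (by decide), F1.R _ (by decide)]
  · intro k hk hk2
    obtain ⟨q1, q2⟩ := c7 k hk hk2
    rw [q1, q2, F2.N _ (by decide), F1.N _ (by decide), F2.R R_s (by decide),
      F1.R R_s (by decide)]
    exact ⟨rfl, rfl⟩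

end

/-! ### The states of the scheduler -/

section

/-- The total size of the first `j` jobs. -/
def vol (p : ℕ → ℝ) (j : ℕ) : ℝ := ∑ k ∈ Finset.range j, p k

/-- Job `k` is small when `j` jobs are known. -/
def Small (m κ : ℕ) (p : ℕ → ℝ) (j k : ℕ) : Prop := 2 ^ κ * (m * p k) ≤ vol p j

open Classical in
/-- The virtual schedule through the first `n + 1` releases. The first index of each field is the
number of jobs that are known; `fs` marks the jobs that are started, `nu` and `sig` are machine
and start of a job, `f` and `e` are the ends of the started and of the planned work of a machine,
`a` is its idle time so far; `gr` is the group of a job. -/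
@[ext] structure Virtual (n m κ : ℕ) (r p : ℕ → ℝ) where
  fs : ℕ → ℕ → Prop
  nu : ℕ → ℕ → ℕ
  gr : ℕ → ℕ
  sig : ℕ → ℕ → ℝ
  f : ℕ → ℕ → ℝ
  e : ℕ → ℕ → ℝ
  a : ℕ → ℕ → ℝ
  f_zero : ∀ μ, f 0 μ = 0
  e_zero : ∀ μ, e 0 μ = 0
  a_zero : ∀ μ, a 0 μ = 0
  a_succ : ∀ j ≤ n, ∀ μ < m, a (j + 1) μ = a j μ + max 0 (r j - e j μ)
  fs_succ : ∀ j ≤ n, ∀ k < j, (fs (j + 1) k ↔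
    fs j k ∨ (¬ fs j k ∧ Small m κ p j k ∧ sig j k < r j))
  fs_new : ∀ j ≤ n, ¬ fs (j + 1) j
  f_succ : ∀ j ≤ n, MaxUpd j (fun k => ¬ fs j k ∧ Small m κ p j k ∧ sig j k < r j) (nu j)
    (fun k => sig j k + p k) (f j) (f (j + 1))
  gr_lt : ∀ j ≤ n, gr j < m
  gr_fit : ∀ j ≤ n,
    (∃ g < m, ((Finset.range j).filter fun l => gr l = g ∧ ¬ Small m κ p (j + 1) l).card < 2 ^ κ) →
    ((Finset.range j).filter fun l => gr l = gr j ∧ ¬ Small m κ p (j + 1) l).card < 2 ^ κ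
  sched : ∀ j ≤ n, ListSchedule m
    ((Finset.range (j + 1)).filter fun k => ¬ fs (j + 1) k ∧ Small m κ p (j + 1) k) p
    (fun μ => max (r j) (f (j + 1) μ)) (sig (j + 1)) (nu (j + 1)) (e (j + 1))
  keep : ∀ j ≤ n, ∀ k ≤ j, ¬ (¬ fs (j + 1) k ∧ Small m κ p (j + 1) k) →
    sig (j + 1) k = sig j k ∧ nu (j + 1) k = nu j k

open Classical in
/-- The real schedule through the first `n + 1` releases, for the rotation `rho` and the random
numbers `K`: `fb` marks the big jobs that are started, `bm` is the machine of a big job, `beta` and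
`u` are its trigger clock and the clock of its start, `s` and `M` are start and machine in the
plan, `W` is the started big work of a machine and `Eb` the clock at which it ends. -/
structure Actual {n m κ : ℕ} {r p : ℕ → ℝ} (D : Virtual n m κ r p) (rho : ℕ) (K : ℕ → ℕ) where
  fb : ℕ → ℕ → Prop
  bm : ℕ → ℕ
  M : ℕ → ℕ → ℕ
  beta : ℕ → ℝ
  u : ℕ → ℕ → ℝ
  s : ℕ → ℕ → ℝ
  W : ℕ → ℕ → ℝ
  Eb : ℕ → ℕ → ℝ
  W_zero : ∀ μ, W 0 μ = 0
  Eb_zero : ∀ μ, Eb 0 μ = 0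
  fb_succ : ∀ j ≤ n, ∀ k < j, (fb (j + 1) k ↔
    fb j k ∨ (¬ fb j k ∧ ¬ Small m κ p j k ∧ u j k < D.a (j + 1) (bm k)))
  fb_new : ∀ j ≤ n, ¬ fb (j + 1) j
  W_succ : ∀ j ≤ n, ∀ μ, W (j + 1) μ = W j μ + ∑ k ∈ Finset.range j with
    (¬ fb j k ∧ ¬ Small m κ p j k ∧ u j k < D.a (j + 1) (bm k)) ∧ bm k = μ, p k
  Eb_succ : ∀ j ≤ n, MaxUpd j
    (fun k => ¬ fb j k ∧ ¬ Small m κ p j k ∧ u j k < D.a (j + 1) (bm k)) bm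
    (fun k => u j k + p k) (Eb j) (Eb (j + 1))
  bm_eq : ∀ j ≤ n, bm j = wrap m (D.gr j + rho)
  beta_eq : ∀ j ≤ n, beta j =
    max (D.a (j + 1) (bm j)) (Eb (j + 1) (bm j)) - W (j + 1) (bm j) + K j * p j
  small : ∀ j ≤ n, ∀ k ≤ j, ¬ D.fs (j + 1) k → Small m κ p (j + 1) k → ¬ fb (j + 1) k →
    M (j + 1) k = D.nu (j + 1) k ∧ s (j + 1) k = D.sig (j + 1) k +
      max 0 (Eb (j + 1) (D.nu (j + 1) k) - D.a (j + 1) (D.nu (j + 1) k))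
  big : ∀ j ≤ n, ∀ k ≤ j, ¬ Small m κ p (j + 1) k → ¬ fb (j + 1) k →
    u (j + 1) k = W (j + 1) (bm k) + beta k + ∑ l ∈ Finset.range (j + 1) with
      (¬ fb (j + 1) l ∧ ¬ Small m κ p (j + 1) l) ∧ bm l = bm k ∧ Prec beta l k, p l ∧
    s (j + 1) k = D.e (j + 1) (bm k) - D.a (j + 1) (bm k) + u (j + 1) k ∧ M (j + 1) k = bm k
  u_keep : ∀ j ≤ n, ∀ k ≤ j, (fb (j + 1) k ∨ Small m κ p (j + 1) k) → u (j + 1) k = u j k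
  s_keep : ∀ j ≤ n, ∀ k ≤ j, (fb (j + 1) k ∨ (Small m κ p (j + 1) k ∧ D.fs (j + 1) k)) →
    M (j + 1) k = M j k ∧ s (j + 1) k = s j k

/-- The flag `f` of job `k` is set. -/
def Flag (h : HS) (f : Fin 32) (k : ℕ) : Prop := h.N f k ≠ 0

/-- The states of the scheduler after the first releases, for release times `r` and sizes `p`. -/
def hist (n m : ℕ) (tp : ℕ → Bool) (r p : ℕ → ℝ) : ℕ → HS
  | 0 => (HC.seq prepQ prepRho).run ⟨n, m, 0, fun _ => 0, fun _ => 0, tp⟩ HS.init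
  | j + 1 => eventBody.run ⟨n, m, 0, fun _ => 0, fun _ => 0, tp⟩
      ((((hist n m tp r p j).setN N_j 0 j).setR R_T 0 (r j)).setR R_PJ 0 (p j))

/-- The rotation that the random bits give. -/
def rotation (m : ℕ) (tp : ℕ → Bool) : ℕ := wrap m (bitsVal tp 0 (Nat.clog 2 m))

/-- The trigger number `K` of job `j`, which is uniform in `[0, Q)`. -/
def draw (n m : ℕ) (tp : ℕ → Bool) (j : ℕ) : ℕ :=
  bitsVal tp (Nat.clog 2 m + lev n m * j) (lev n m)

section
variable {n m : ℕ} {r p : ℕ → ℝ} (tp : ℕ → Bool)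

/-- What the state `h` after the first `j` events keeps of the prepared data, the bits consumed
and the jobs. -/
structure HistInv (n m : ℕ) (tp : ℕ → Bool) (p : ℕ → ℝ) (j : ℕ) (h : HS) : Prop where
  Q : h.N N_Q 0 = 2 ^ lev n m
  rho : h.N N_rho 0 = rotation m tp
  used : h.used = Nat.clog 2 m + lev n m * j
  size : ∀ k < j, h.R R_p k = p k
  V : h.R R_V 0 = vol p j
  y : ∀ k < j, h.R R_y k = 2 ^ lev n m * (m * p k)

theorem hist_zero_R (f : Fin 32) (k : ℕ) : (hist n m tp r p 0).R f k = 0 := by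
  have := HC.run_R (E := ⟨n, m, 0, fun _ => 0, fun _ => 0, tp⟩) f (HC.seq prepQ prepRho)
    (by revert f; decide) HS.init
  simp only [hist, this]; rfl

theorem histInv_zero (hm1 : 1 ≤ m) (hm : m ≤ n) : HistInv n m tp p 0 (hist n m tp r p 0) := by
  set E : Env := ⟨n, m, 0, fun _ => 0, fun _ => 0, tp⟩
  have q := (prepQ_spec (E := E) (h := HS.init) hm1).1
  have u : (prepQ.run E HS.init).used = 0 := HC.run_used _ prepQ (by decide) _
  have s := prepRho_spec (E := E) (h := prepQ.run E HS.init) hm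
  rw [u] at s
  have e : hist n m tp r p 0 = prepRho.run E (prepQ.run E HS.init) := rfl
  have V0 : (hist n m tp r p 0).R R_V 0 = 0 := hist_zero_R tp _ _
  refine ⟨?_, ?_, ?_, by simp, by rw [V0]; simp [vol], by simp⟩
  · rw [e, HC.run_N _ prepRho (by decide), q]
  · rw [e, s.1]; rfl
  · rw [e, s.2]; simp [E]

/-- The input of the release of job `j`. -/
abbrev beforeRelease (n m : ℕ) (tp : ℕ → Bool) (r p : ℕ → ℝ) (j : ℕ) : HS :=
  (((hist n m tp r p j).setN N_j 0 j).setR R_T 0 (r j)).setR R_PJ 0 (p j)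

theorem beforeRelease_N (j : ℕ) (f : Fin 32) (hf : f ≠ N_j) :
    (beforeRelease n m tp r p j).N f = (hist n m tp r p j).N f := by
  ext k; simp [beforeRelease, HS.setR_N, HS.setN_N, hf]

theorem beforeRelease_R (j : ℕ) (f : Fin 32) (hf : f ≠ R_T) (hf' : f ≠ R_PJ) :
    (beforeRelease n m tp r p j).R f = (hist n m tp r p j).R f := by
  ext k; simp [beforeRelease, HS.setR_R, HS.setN_R, hf, hf']

theorem beforeRelease_j (j : ℕ) : (beforeRelease n m tp r p j).N N_j 0 = j := by
  simp [beforeRelease, HS.setR_N, HS.setN_N]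

theorem beforeRelease_T (j : ℕ) : (beforeRelease n m tp r p j).R R_T 0 = r j := by
  simp [beforeRelease, HS.setR_R]

theorem beforeRelease_PJ (j : ℕ) : (beforeRelease n m tp r p j).R R_PJ 0 = p j := by
  simp [beforeRelease, HS.setR_R]

theorem vol_succ (p : ℕ → ℝ) (j : ℕ) : vol p (j + 1) = vol p j + p j := Finset.sum_range_succ _ _

theorem hist_spec (hm1 : 1 ≤ m) (hm : m ≤ n) (hp : ∀ k, 0 < p k) (j : ℕ) (hj : j ≤ n)
    (H : HistInv n m tp p j (hist n m tp r p j)) :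
    EventSpec ⟨n, m, 0, fun _ => 0, fun _ => 0, tp⟩ (lev n m) (beforeRelease n m tp r p j)
      (hist n m tp r p (j + 1)) := by
  refine eventBody_spec (E := ⟨n, m, 0, fun _ => 0, fun _ => 0, tp⟩) hm1 (by simp; omega)
    (by rw [beforeRelease_j]; exact hj) ?_ ?_ ?_ ?_
  · have := lev_le (n := n) hm1; simp; omega
  · rw [beforeRelease_N _ _ _ (by decide), H.Q]
  · intro k hk
    rw [beforeRelease_j] at hk
    rw [beforeRelease_R _ _ _ (by decide) (by decide), H.size k hk]; exact hp k
  · rw [beforeRelease_PJ]; exact hp j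

theorem histInv (hm1 : 1 ≤ m) (hm : m ≤ n) (hp : ∀ k, 0 < p k) (j : ℕ) (hj : j ≤ n + 1) :
    HistInv n m tp p j (hist n m tp r p j) := by
  induction j with
  | zero => exact histInv_zero tp hm1 hm
  | succ j ih =>
    have H := ih (by omega)
    have S := hist_spec tp hm1 hm hp j (by omega) H
    refine ⟨?_, ?_, ?_, ?_, ?_, ?_⟩
    · rw [S.Q, beforeRelease_N _ _ _ (by decide), H.Q]
    · rw [S.rho, beforeRelease_N _ _ _ (by decide), H.rho]
    · rw [S.used]
      change (hist n m tp r p j).used + _ = _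
      rw [H.used]; ring
    · intro k hk
      rw [S.p, beforeRelease_j, beforeRelease_PJ, beforeRelease_R _ _ _ (by decide) (by decide)]
      split_ifs with h1
      · rw [h1]
      · exact H.size k (by omega)
    · rw [S.V, beforeRelease_PJ, beforeRelease_R _ _ _ (by decide) (by decide), H.V, vol_succ]
    · intro k hk
      rw [S.y, beforeRelease_j, beforeRelease_PJ, beforeRelease_R _ _ _ (by decide) (by decide)]
      split_ifs with h1
      · rw [h1]
      · exact H.y k (by omega)

theorem hist_agree (tp' : ℕ → Bool) (j : ℕ) :
    Agree detN detR (hist n m tp r p j) (hist n m tp' r p j) := by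
  induction j with
  | zero =>
    exact HC.agree_det (E := ⟨n, m, 0, fun _ => 0, fun _ => 0, tp⟩)
      (E' := ⟨n, m, 0, fun _ => 0, fun _ => 0, tp'⟩) rfl rfl _ prep_det _ _
      ⟨fun _ _ => rfl, fun _ _ => rfl⟩
  | succ j ih =>
    refine HC.agree_det (E := ⟨n, m, 0, fun _ => 0, fun _ => 0, tp⟩)
      (E' := ⟨n, m, 0, fun _ => 0, fun _ => 0, tp'⟩) rfl rfl _ eventBody_det _ _ ⟨?_, ?_⟩
    · intro f hf; ext k
      simp only [HS.setR_N, HS.setN_N, ih.N f hf]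
    · intro f hf; ext k
      simp only [HS.setR_R, HS.setN_R, ih.R f hf]

theorem hist_small {j k : ℕ} (hk : k < j) (H : HistInv n m tp p j (hist n m tp r p j)) :
    (hist n m tp r p j).R R_y k ≤ (hist n m tp r p j).R R_V 0 ↔ Small m (lev n m) p j k := by
  rw [H.y k hk, H.V]; rfl

theorem maxUpd_congr {j : ℕ} {P P' : ℕ → Prop} {c c' : ℕ → ℕ} {x x' f g : ℕ → ℝ}
    (H : MaxUpd j P c x f g) (hP : ∀ k < j, (P k ↔ P' k)) (hc : ∀ k < j, c k = c' k)
    (hx : ∀ k < j, x k = x' k) : MaxUpd j P' c' x' f g where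
  le := H.le
  le_of k hk h := by rw [← hx k hk, ← hc k hk]; exact H.le_of k hk ((hP k hk).mpr h)
  eq μ := (H.eq μ).imp_right (by
    rintro ⟨k, hk, h1, h2, h3⟩
    exact ⟨k, hk, (hP k hk).mp h1, by rw [← hc k hk, h2], by rw [h3, hx k hk]⟩)

theorem hist_gr (hm1 : 1 ≤ m) (hm : m ≤ n) (hp : ∀ k, 0 < p k) (k j : ℕ) (hk : k < j)
    (hj : j ≤ n + 1) : (hist n m tp r p j).N N_gr k = (hist n m tp r p (k + 1)).N N_gr k ∧
      (hist n m tp r p j).N N_bm k = (hist n m tp r p (k + 1)).N N_bm k ∧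
      (hist n m tp r p j).R R_beta k = (hist n m tp r p (k + 1)).R R_beta k := by
  induction j, hk using Nat.le_induction with
  | base => exact ⟨rfl, rfl, rfl⟩
  | succ j hkj ih =>
    have S := hist_spec (r := r) tp hm1 hm hp j (by omega) (histInv tp hm1 hm hp j (by omega))
    have hne : k ≠ (beforeRelease n m tp r p j).N N_j 0 := by rw [beforeRelease_j]; omega
    rw [S.gr k hne, S.bm k hne, S.beta k hne, beforeRelease_N _ _ _ (by decide),
      beforeRelease_N _ _ _ (by decide), beforeRelease_R _ _ _ (by decide) (by decide)]
    exact ih (by omega)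

theorem toPlan_hist {j : ℕ} (H : HistInv n m tp p (j + 1) (hist n m tp r p (j + 1)))
    (hj : (hist n m tp r p (j + 1)).N N_j 0 = j) (k : ℕ) :
    k ∈ toPlan (hist n m tp r p (j + 1)) ↔ k ≤ j ∧
      ¬ Flag (hist n m tp r p (j + 1)) N_fs k ∧ Small m (lev n m) p (j + 1) k := by
  unfold toPlan Flag
  rw [Finset.mem_filter, hj, Finset.mem_range, Nat.lt_succ_iff, not_not]
  refine and_congr_right fun hk => ?_
  rw [hist_small tp (by omega) H]

theorem hist_j (hm1 : 1 ≤ m) (hm : m ≤ n) (hp : ∀ k, 0 < p k) (j : ℕ) (hj : j ≤ n) :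
    (hist n m tp r p (j + 1)).N N_j 0 = j := by
  have S := hist_spec (r := r) tp hm1 hm hp j hj (histInv tp hm1 hm hp j (by omega))
  rw [S.j, beforeRelease_j]

theorem newSmall_iff (hm1 : 1 ≤ m) (hm : m ≤ n) (hp : ∀ k, 0 < p k) {j k : ℕ} (hj : j ≤ n)
    (hk : k < j) : NewSmall (beforeRelease n m tp r p j) k ↔
      ¬ Flag (hist n m tp r p j) N_fs k ∧ Small m (lev n m) p j k ∧
        (hist n m tp r p j).R R_sig k < r j := by
  unfold NewSmall Flag
  rw [beforeRelease_N _ _ _ (by decide), beforeRelease_R _ _ _ (by decide) (by decide),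
    beforeRelease_R _ _ _ (by decide) (by decide), beforeRelease_R _ _ _ (by decide) (by decide),
    hist_small tp hk (histInv tp hm1 hm hp j (by omega)), beforeRelease_T, not_not]

open Classical in
theorem groupCount_hist (hm1 : 1 ≤ m) (hm : m ≤ n) (hp : ∀ k, 0 < p k) (j : ℕ) (hj : j ≤ n)
    (g : ℕ) : groupCount (hist n m tp r p (j + 1)) j g = ((Finset.range j).filter fun l =>
      (hist n m tp r p (l + 1)).N N_gr l = g ∧ ¬ Small m (lev n m) p (j + 1) l).card := by
  have H' := histInv (r := r) tp hm1 hm hp (j + 1) (by omega)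
  refine congrArg Finset.card (Finset.ext fun l => ?_)
  rw [Finset.mem_filter, Finset.mem_filter]
  refine and_congr_right fun hl => ?_
  have hl := Finset.mem_range.mp hl
  rw [(hist_gr (r := r) tp hm1 hm hp l (j + 1) (by omega) (by omega)).1,
    ← hist_small tp (by omega) H', not_le]

open Classical in
/-- The virtual schedule that the scheduler computes. -/
def Virtual.ofHist (hm1 : 1 ≤ m) (hm : m ≤ n) (hp : ∀ k, 0 < p k) :
    Virtual n m (lev n m) r p where
  fs j k := Flag (hist n m tp r p j) N_fs k
  nu j := (hist n m tp r p j).N N_nu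
  gr k := (hist n m tp r p (k + 1)).N N_gr k
  sig j := (hist n m tp r p j).R R_sig
  f j := (hist n m tp r p j).R R_f
  e j := (hist n m tp r p j).R R_e
  a j := (hist n m tp r p j).R R_a
  f_zero := hist_zero_R tp _
  e_zero := hist_zero_R tp _
  a_zero := hist_zero_R tp _
  a_succ j hj μ hμ := by
    have S := hist_spec (r := r) tp hm1 hm hp j hj (histInv tp hm1 hm hp j (by omega))
    rw [S.a μ hμ, beforeRelease_R _ _ _ (by decide) (by decide), beforeRelease_T,
      beforeRelease_R _ _ _ (by decide) (by decide)]
  fs_succ j hj k hk := by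
    have S := hist_spec (r := r) tp hm1 hm hp j hj (histInv tp hm1 hm hp j (by omega))
    unfold Flag
    rw [S.fs k (by rw [beforeRelease_j]; exact hk), newSmall_iff tp hm1 hm hp hj hk,
      beforeRelease_N _ _ _ (by decide)]
    split_ifs with h1
    · simp only [ne_eq, one_ne_zero, not_false_eq_true, true_iff]; exact Or.inr h1
    · unfold Flag at h1; tauto
  fs_new j hj := by
    have S := hist_spec (r := r) tp hm1 hm hp j hj (histInv tp hm1 hm hp j (by omega))
    have := S.fs_new
    rw [beforeRelease_j] at this
    exact fun h => h this
  f_succ j hj := by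
    have S := hist_spec (r := r) tp hm1 hm hp j hj (histInv tp hm1 hm hp j (by omega))
    have := S.f
    rw [beforeRelease_j, beforeRelease_R _ _ R_f (by decide) (by decide)] at this
    refine maxUpd_congr this (fun k hk => newSmall_iff tp hm1 hm hp hj hk) (fun k hk => ?_)
      fun k hk => ?_
    · rw [beforeRelease_N _ _ _ (by decide)]
    · rw [beforeRelease_R _ _ _ (by decide) (by decide),
        beforeRelease_R _ _ _ (by decide) (by decide),
        (histInv tp hm1 hm hp j (by omega)).size k hk]
  gr_lt j hj := by
    have S := hist_spec (r := r) tp hm1 hm hp j hj (histInv tp hm1 hm hp j (by omega))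
    have := S.gr_lt
    rwa [beforeRelease_j] at this
  gr_fit j hj := by
    have S := hist_spec (r := r) tp hm1 hm hp j hj (histInv tp hm1 hm hp j (by omega))
    have H' := histInv (r := r) tp hm1 hm hp (j + 1) (by omega)
    have := S.gr_new
    rw [beforeRelease_j] at this
    have key := groupCount_hist (r := r) tp hm1 hm hp j hj
    simpa only [key] using this
  sched j hj := by
    have S := hist_spec (r := r) tp hm1 hm hp j hj (histInv tp hm1 hm hp j (by omega))
    have H' := histInv (r := r) tp hm1 hm hp (j + 1) (by omega)
    suffices h : ∀ P, P = toPlan (hist n m tp r p (j + 1)) → ListSchedule m P p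
        (fun μ => max (r j) ((hist n m tp r p (j + 1)).R R_f μ)) ((hist n m tp r p (j + 1)).R R_sig)
        ((hist n m tp r p (j + 1)).N N_nu) ((hist n m tp r p (j + 1)).R R_e) by
      refine h _ (Finset.ext fun k => ?_)
      rw [toPlan_hist tp H' (hist_j tp hm1 hm hp j hj), Finset.mem_filter, Finset.mem_range,
        Nat.lt_succ_iff]
    rintro _ rfl
    have := S.sched
    rw [beforeRelease_T] at this
    have hpp : ∀ k ∈ toPlan (hist n m tp r p (j + 1)), (hist n m tp r p (j + 1)).R R_p k = p k := by
      intro k hk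
      exact H'.size k (by have := ((toPlan_hist tp H' (hist_j tp hm1 hm hp j hj) k).mp hk).1; omega)
    exact {
      lt := this.lt
      base_le := this.base_le
      end_le := fun k hk => by rw [← hpp k hk]; exact this.end_le k hk
      apart := fun k hk l hl => by rw [← hpp k hk, ← hpp l hl]; exact this.apart k hk l hl
      order := fun k hk l hl => by rw [← hpp k hk, ← hpp l hl]; exact this.order k hk l hl
      le := this.le
      cover := fun μ hμ t h1 h2 => by
        obtain ⟨l, hl, h3⟩ := this.cover μ hμ t h1 h2
        exact ⟨l, hl, by rwa [← hpp l hl]⟩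
      load := fun μ hμ => by
        rw [this.load μ hμ]
        congr 1
        exact Finset.sum_congr rfl fun k hk => hpp k (Finset.mem_filter.mp hk).1 }
  keep j hj k hk hn := by
    have S := hist_spec (r := r) tp hm1 hm hp j hj (histInv tp hm1 hm hp j (by omega))
    have H' := histInv (r := r) tp hm1 hm hp (j + 1) (by omega)
    have hk' : k ∉ toPlan (hist n m tp r p (j + 1)) := fun h =>
      hn ((toPlan_hist tp H' (hist_j tp hm1 hm hp j hj) k).mp h).2
    rw [S.sig k hk', S.nu k hk', beforeRelease_R _ _ _ (by decide) (by decide),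
      beforeRelease_N _ _ _ (by decide)]
    exact ⟨rfl, rfl⟩

/-- The virtual schedule does not depend on the random bits. -/
theorem Virtual.ofHist_eq (hm1 : 1 ≤ m) (hm : m ≤ n) (hp : ∀ k, 0 < p k) (tp' : ℕ → Bool) :
    Virtual.ofHist (r := r) tp hm1 hm hp = Virtual.ofHist tp' hm1 hm hp := by
  have A := hist_agree (n := n) (m := m) (r := r) (p := p) tp tp'
  refine Virtual.ext ?_ ?_ ?_ ?_ ?_ ?_ ?_ <;> simp only [Virtual.ofHist]
  · funext j k; unfold Flag; rw [(A j).N _ (by decide)]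
  · funext j; rw [(A j).N _ (by decide)]
  · funext j; rw [(A (j + 1)).N _ (by decide)]
  · funext j; rw [(A j).R _ (by decide)]
  · funext j; rw [(A j).R _ (by decide)]
  · funext j; rw [(A j).R _ (by decide)]
  · funext j; rw [(A j).R _ (by decide)]

theorem waiting_hist {j k : ℕ} (hk : k < j) (H : HistInv n m tp p j (hist n m tp r p j)) :
    Waiting (hist n m tp r p j) k ↔
      ¬ Flag (hist n m tp r p j) N_fb k ∧ ¬ Small m (lev n m) p j k := by
  unfold Waiting Flag
  rw [← hist_small tp hk H, not_le, not_not]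

theorem beginsBig_iff (hm1 : 1 ≤ m) (hm : m ≤ n) (hp : ∀ k, 0 < p k) {j k : ℕ} (hj : j ≤ n)
    (hk : k < j) (a : ℕ → ℝ) : BeginsBig (beforeRelease n m tp r p j) a k ↔
      ¬ Flag (hist n m tp r p j) N_fb k ∧ ¬ Small m (lev n m) p j k ∧
        (hist n m tp r p j).R R_u k < a ((hist n m tp r p (k + 1)).N N_bm k) := by
  unfold BeginsBig Flag
  rw [beforeRelease_N _ _ _ (by decide), beforeRelease_R _ _ _ (by decide) (by decide),
    beforeRelease_R _ _ _ (by decide) (by decide), beforeRelease_R _ _ _ (by decide) (by decide),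
    ← hist_small tp hk (histInv tp hm1 hm hp j (by omega)), not_not, not_le,
    beforeRelease_N _ _ _ (by decide),
    (hist_gr (r := r) tp hm1 hm hp k j (by omega) (by omega)).2.1]

open Classical in
/-- The real schedule that the scheduler computes. -/
def Actual.ofHist (hm1 : 1 ≤ m) (hm : m ≤ n) (hp : ∀ k, 0 < p k) :
    Actual (Virtual.ofHist (r := r) tp hm1 hm hp) (rotation m tp) (draw n m tp) where
  fb j k := Flag (hist n m tp r p j) N_fb k
  bm k := (hist n m tp r p (k + 1)).N N_bm k
  M j := (hist n m tp r p j).N N_M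
  beta k := (hist n m tp r p (k + 1)).R R_beta k
  u j := (hist n m tp r p j).R R_u
  s j := (hist n m tp r p j).R R_s
  W j := (hist n m tp r p j).R R_W
  Eb j := (hist n m tp r p j).R R_E
  W_zero := hist_zero_R tp _
  Eb_zero := hist_zero_R tp _
  fb_succ j hj k hk := by
    have S := hist_spec (r := r) tp hm1 hm hp j hj (histInv tp hm1 hm hp j (by omega))
    unfold Flag
    rw [S.fb k (by rw [beforeRelease_j]; exact hk), beginsBig_iff tp hm1 hm hp hj hk,
      beforeRelease_N _ _ _ (by decide)]
    split_ifs with h1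
    · simp only [ne_eq, one_ne_zero, not_false_eq_true, true_iff]; exact Or.inr h1
    · unfold Flag at h1; tauto
  fb_new j hj := by
    have S := hist_spec (r := r) tp hm1 hm hp j hj (histInv tp hm1 hm hp j (by omega))
    have := S.fb_new
    rw [beforeRelease_j] at this
    exact fun h => h this
  W_succ j hj μ := by
    have H := histInv (r := r) tp hm1 hm hp j (by omega)
    have S := hist_spec (r := r) tp hm1 hm hp j hj H
    rw [S.W, beforeRelease_j, beforeRelease_R _ _ _ (by decide) (by decide)]
    congr 1
    refine Finset.sum_congr (Finset.ext fun k => ?_) fun k hk => ?_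
    · rw [Finset.mem_filter, Finset.mem_filter]
      refine and_congr_right fun hk => ?_
      have hk := Finset.mem_range.mp hk
      rw [beginsBig_iff tp hm1 hm hp hj hk, beforeRelease_N _ _ _ (by decide),
        (hist_gr (r := r) tp hm1 hm hp k j (by omega) (by omega)).2.1]
      rfl
    · have hk := Finset.mem_range.mp (Finset.mem_filter.mp hk).1
      rw [beforeRelease_R _ _ _ (by decide) (by decide), H.size k hk]
  Eb_succ j hj := by
    have H := histInv (r := r) tp hm1 hm hp j (by omega)
    have S := hist_spec (r := r) tp hm1 hm hp j hj H
    have := S.Eb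
    rw [beforeRelease_j, beforeRelease_R _ _ R_E (by decide) (by decide)] at this
    refine maxUpd_congr this (fun k hk => beginsBig_iff tp hm1 hm hp hj hk _) (fun k hk => ?_)
      fun k hk => ?_
    · rw [beforeRelease_N _ _ _ (by decide),
        (hist_gr (r := r) tp hm1 hm hp k j (by omega) (by omega)).2.1]
    · rw [beforeRelease_R _ _ _ (by decide) (by decide),
        beforeRelease_R _ _ _ (by decide) (by decide), H.size k hk]
  bm_eq j hj := by
    have H := histInv (r := r) tp hm1 hm hp j (by omega)
    have S := hist_spec (r := r) tp hm1 hm hp j hj H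
    have := S.bm_new
    rw [beforeRelease_j, beforeRelease_N _ _ _ (by decide), H.rho] at this
    exact this
  beta_eq j hj := by
    have H := histInv (r := r) tp hm1 hm hp j (by omega)
    have S := hist_spec (r := r) tp hm1 hm hp j hj H
    have := S.beta_new
    rw [beforeRelease_j, beforeRelease_PJ] at this
    rw [this]
    change _ + (bitsVal tp (hist n m tp r p j).used (lev n m) : ℝ) * _ = _
    rw [H.used]; rfl
  small j hj k hk hfs hsm hfb := by
    have S := hist_spec (r := r) tp hm1 hm hp j hj (histInv tp hm1 hm hp j (by omega))
    have H' := histInv (r := r) tp hm1 hm hp (j + 1) (by omega)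
    exact S.out k ((toPlan_hist tp H' (hist_j tp hm1 hm hp j hj) k).mpr ⟨hk, hfs, hsm⟩)
      (not_not.mp hfb)
  big j hj k hk hsm hfb := by
    have S := hist_spec (r := r) tp hm1 hm hp j hj (histInv tp hm1 hm hp j (by omega))
    have H' := histInv (r := r) tp hm1 hm hp (j + 1) (by omega)
    obtain ⟨h1, h2, h3⟩ := S.big k (by rw [beforeRelease_j]; exact hk)
      ((waiting_hist tp (by omega) H').mpr ⟨hfb, hsm⟩)
    have hb := hist_gr (r := r) tp hm1 hm hp k (j + 1) (by omega) (by omega)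
    rw [hb.2.1] at h2 h3
    refine ⟨?_, by rw [h2, h1]; rfl, h3⟩
    rw [h1]
    unfold planClock
    rw [hist_j tp hm1 hm hp j hj, hb.2.1, hb.2.2]
    congr 1
    refine Finset.sum_congr (Finset.ext fun l => ?_) fun l hl => ?_
    · rw [Finset.mem_filter, Finset.mem_filter]
      refine and_congr_right fun hl => ?_
      have hl := Finset.mem_range.mp hl
      have hb' := hist_gr (r := r) tp hm1 hm hp l (j + 1) (by omega) (by omega)
      rw [waiting_hist tp hl H', hb'.2.1]
      unfold Prec
      rw [hb'.2.2, hb.2.2]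
    · exact H'.size l (Finset.mem_range.mp (Finset.mem_filter.mp hl).1)
  u_keep j hj k hk h1 := by
    have S := hist_spec (r := r) tp hm1 hm hp j hj (histInv tp hm1 hm hp j (by omega))
    have H' := histInv (r := r) tp hm1 hm hp (j + 1) (by omega)
    rw [S.u k (by rw [waiting_hist tp (by omega) H']; tauto),
      beforeRelease_R _ _ _ (by decide) (by decide)]
  s_keep j hj k hk h1 := by
    have S := hist_spec (r := r) tp hm1 hm hp j hj (histInv tp hm1 hm hp j (by omega))
    have H' := histInv (r := r) tp hm1 hm hp (j + 1) (by omega)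
    obtain ⟨q1, q2⟩ := S.keep k (by rw [waiting_hist tp (by omega) H']; tauto) (by
      rw [toPlan_hist tp H' (hist_j tp hm1 hm hp j hj)]
      rintro ⟨⟨-, h3, h4⟩, h5⟩
      tauto)
    rw [q1, q2, beforeRelease_R _ _ _ (by decide) (by decide), beforeRelease_N _ _ _ (by decide)]
    exact ⟨rfl, rfl⟩

/-- On an instance of `i` jobs the scheduler goes through the first `i` states. -/
theorem scheduler_run {i : ℕ} (hi : i ≤ n) (J : Instance i) (hr : ∀ k : Fin i, J.release k = r k)
    (hp : ∀ k : Fin i, J.size k = p k) :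
    (scheduler.run (Env.of n m J tp) HS.init).R R_s = (hist n m tp r p i).R R_s ∧
    (scheduler.run (Env.of n m J tp) HS.init).N N_M = (hist n m tp r p i).N N_M := by
  set E := Env.of n m J tp with hE
  set E0 : Env := ⟨n, m, 0, fun _ => 0, fun _ => 0, tp⟩ with hE0
  have h0 : (HC.seq prepQ prepRho).run E HS.init = hist n m tp r p 0 :=
    HC.run_noIn (E := E) (E' := E0) rfl rfl rfl _ prep_noIn HS.init
  have hrun : scheduler.run E HS.init = (HC.forTo N_j .nrel
    (.seq (.sR R_T (.rel (.s N_j))) (.seq (.sR R_PJ (.siz (.s N_j))) eventBody))).run E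
      (hist n m tp r p 0) := by
    rw [← h0]; rfl
  rw [hrun]
  have key := HC.forTo_ind (E := E) N_j .nrel
    (.seq (.sR R_T (.rel (.s N_j))) (.seq (.sR R_PJ (.siz (.s N_j))) eventBody))
    (hist n m tp r p 0) i (by change i ≤ n + 1; omega) (by decide)
    (fun l g => g.setN N_j 0 l = (hist n m tp r p l).setN N_j 0 l)
    (fun l g v hP => by
      rw [← hP]
      ext f k
      · simp only [HS.setN_N]; split_ifs <;> rfl
      · rfl
      · rfl)
    (fun _ _ => rfl) rfl ?_
  · have e1 := congrArg (fun h => HS.R h R_s) key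
    have e2 := congrArg (fun h => HS.N h N_M) key
    refine ⟨e1, ?_⟩
    ext k
    have := congrFun e2 k
    simpa [HS.setN_N] using this
  · intro l hl g hF hk hP
    have hg : g = (hist n m tp r p l).setN N_j 0 l := by
      rw [← hP]
      ext f k
      · rw [HS.setN_N]
        split_ifs with h1
        · rw [h1.1, h1.2, hk]
        · rfl
      · rfl
      · rfl
    have e : (HC.seq (.sR R_T (.rel (.s N_j))) (.seq (.sR R_PJ (.siz (.s N_j))) eventBody)).run E g
        = hist n m tp r p (l + 1) := by
      have er : E.rel l = r l := by
        simp only [hE, Env.of, dif_pos hl]; exact hr ⟨l, hl⟩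
      have es : E.siz l = p l := by
        simp only [hE, Env.of, dif_pos hl]; exact hp ⟨l, hl⟩
      rw [hist, ← HC.run_noIn (E := E) (E' := E0) rfl rfl rfl _ eventBody_noIn]
      rw [← hg]
      have hln : l < E.n := lt_of_lt_of_le hl hi
      simp only [HC.run, NE.ev, RE.ev, hk, HS.setR_N, er, es, hln, if_true]
    rw [e]
end

end

/-! ### The virtual schedule -/

section

/-- Finitely many intervals that cover an interval have at least its length. -/
theorem length_le_of_cover {P : Finset ℕ} {σ p : ℕ → ℝ} (hp : ∀ l ∈ P, 0 ≤ p l) {x y : ℝ}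
    (h : ∀ t, x ≤ t → t < y → ∃ l ∈ P, σ l ≤ t ∧ t < σ l + p l) : y - x ≤ ∑ l ∈ P, p l := by
  have h1 : Set.Ico x y ⊆ ⋃ l ∈ P, Set.Ico (σ l) (σ l + p l) := by
    rintro t ⟨h1, h2⟩
    obtain ⟨l, hl, h3, h4⟩ := h t h1 h2
    exact Set.mem_biUnion hl ⟨h3, h4⟩
  have h2 := (measure_mono (μ := volume) h1).trans (measure_biUnion_finset_le P _)
  simp only [Real.volume_Ico, add_sub_cancel_left] at h2
  rw [← ENNReal.ofReal_sum_of_nonneg hp] at h2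
  exact (ENNReal.ofReal_le_ofReal_iff (Finset.sum_nonneg hp)).mp h2

/-- The time of the last of the first `j` releases. -/
def lastTime (r : ℕ → ℝ) : ℕ → ℝ
  | 0 => 0
  | j + 1 => r j

theorem lastTime_le {r : ℕ → ℝ} (hr : Monotone r) (hr0 : ∀ k, 0 ≤ r k) (j : ℕ) :
    lastTime r j ≤ r j := by
  cases j with
  | zero => exact hr0 0
  | succ j => exact hr (Nat.le_succ j)

theorem vol_mono {p : ℕ → ℝ} (hp : ∀ k, 0 < p k) : Monotone (vol p) :=
  monotone_nat_of_le_succ fun j => by rw [vol_succ]; linarith [hp j]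

theorem Small.mono {m κ : ℕ} {p : ℕ → ℝ} (hp : ∀ k, 0 < p k) {j j' k : ℕ} (h : Small m κ p j k)
    (hj : j ≤ j') : Small m κ p j' k := le_trans h (vol_mono hp hj)

/-- The index of the release at which job `k` becomes small. -/
def avail (m κ : ℕ) (p : ℕ → ℝ) (k : ℕ) : ℕ := sInf {i | k ≤ i ∧ Small m κ p (i + 1) k}

theorem avail_spec {m κ : ℕ} {p : ℕ → ℝ} {j k : ℕ} (hk : k ≤ j) (h : Small m κ p (j + 1) k) :
    k ≤ avail m κ p k ∧ Small m κ p (avail m κ p k + 1) k ∧ avail m κ p k ≤ j := by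
  have := Nat.sInf_mem (s := {i | k ≤ i ∧ Small m κ p (i + 1) k}) ⟨j, hk, h⟩
  exact ⟨this.1, this.2, Nat.sInf_le ⟨hk, h⟩⟩

namespace Virtual

variable {n m κ : ℕ} {r p : ℕ → ℝ} (D : Virtual n m κ r p)

/-- The time from which a machine is planned at state `j`. -/
def base (j μ : ℕ) : ℝ := max (lastTime r j) (D.f j μ)

open Classical in
/-- The small jobs that are not yet started. -/
def unstarted (j : ℕ) : Finset ℕ :=
  (Finset.range j).filter fun k => ¬ D.fs j k ∧ Small m κ p j k

open Classical in
/-- The work that has been started on machine `μ`. -/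
def work (j μ : ℕ) : ℝ := ∑ k ∈ Finset.range j with D.fs j k ∧ D.nu j k = μ, p k

theorem mem_unstarted {j k : ℕ} :
    k ∈ D.unstarted j ↔ k < j ∧ ¬ D.fs j k ∧ Small m κ p j k := by
  simp [unstarted]

theorem schedule (j : ℕ) (hj : j ≤ n + 1) :
    ListSchedule m (D.unstarted j) p (D.base j) (D.sig j) (D.nu j) (D.e j) := by
  cases j with
  | zero =>
    have h1 : D.unstarted 0 = ∅ := by simp [unstarted]
    have h2 : D.base 0 = D.e 0 := by
      ext μ; simp [base, lastTime, D.f_zero, D.e_zero]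
    rw [h1, h2]
    exact ListSchedule.empty _ _ _ _ _
  | succ j => exact D.sched j (by omega)

theorem fs_succ' {j k : ℕ} (hj : j ≤ n) (hk : k < j + 1) (h : D.fs (j + 1) k) :
    k < j ∧ (D.fs j k ∨ (¬ D.fs j k ∧ Small m κ p j k ∧ D.sig j k < r j)) ∧
      D.sig (j + 1) k = D.sig j k ∧ D.nu (j + 1) k = D.nu j k := by
  have hkj : k < j := by
    refine lt_of_le_of_ne (by omega) ?_
    rintro rfl
    exact D.fs_new k hj h
  exact ⟨hkj, (D.fs_succ j hj k hkj).mp h, D.keep j hj k (by omega) (by tauto)⟩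

theorem fs_mono {j k : ℕ} (hj : j ≤ n) (hk : k < j) (h : D.fs j k) : D.fs (j + 1) k :=
  (D.fs_succ j hj k hk).mpr (Or.inl h)

theorem fs_of_lt {j k : ℕ} (hj : j ≤ n) (hk : k < j) (h : Small m κ p j k)
    (h' : D.sig j k < r j) : D.fs (j + 1) k := by
  by_cases h1 : D.fs j k
  · exact D.fs_mono hj hk h1
  · exact (D.fs_succ j hj k hk).mpr (Or.inr ⟨h1, h, h'⟩)

theorem fs_small (hp : ∀ k, 0 < p k) {j k : ℕ} (hj : j ≤ n + 1) (hk : k < j) (h : D.fs j k) :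
    Small m κ p j k := by
  induction j with
  | zero => omega
  | succ j ih =>
    obtain ⟨h1, h2, -⟩ := D.fs_succ' (by omega) hk h
    rcases h2 with h2 | h2
    · exact (ih (by omega) h1 h2).mono hp (by omega)
    · exact h2.2.1.mono hp (by omega)

/-- What is true of the virtual schedule after `j` releases. -/
structure Inv (j : ℕ) : Prop where
  lt : ∀ k < j, Small m κ p j k → D.nu j k < m
  end_le : ∀ k < j, D.fs j k → D.sig j k + p k ≤ D.f j (D.nu j k)
  lt_time : ∀ k < j, D.fs j k → D.sig j k < lastTime r j
  rel_le : ∀ k < j, Small m κ p j k → r (avail m κ p k) ≤ D.sig j k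
  apart : ∀ k < j, ∀ l < j, Small m κ p j k → Small m κ p j l → k ≠ l → D.nu j k = D.nu j l →
    D.sig j k + p k ≤ D.sig j l ∨ D.sig j l + p l ≤ D.sig j k
  busy : ∀ k < j, Small m κ p j k → ∀ t, r (avail m κ p k) ≤ t → t < D.sig j k → ∀ μ < m,
    ∃ l < j, Small m κ p j l ∧ D.nu j l = μ ∧ D.sig j l ≤ t ∧ t < D.sig j l + p l
  order : ∀ k < j, ∀ l < j, Small m κ p j k → Small m κ p j l →
    r (avail m κ p k) ≤ D.sig j l → D.sig j l < D.sig j k → p l ≤ p k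
  f_eq : ∀ μ, D.f j μ = 0 ∨ ∃ k < j, D.fs j k ∧ D.nu j k = μ ∧ D.f j μ = D.sig j k + p k
  work_ge : ∀ μ < m, D.base j μ - D.a j μ ≤ D.work j μ

theorem base_le_e (hp : ∀ k, 0 < p k) {j μ : ℕ} (hj : j ≤ n + 1) (hμ : μ < m) :
    D.base j μ ≤ D.e j μ := by
  rw [(D.schedule j hj).load μ hμ]
  have : 0 ≤ ∑ l ∈ D.unstarted j with D.nu j l = μ, p l :=
    Finset.sum_nonneg fun k _ => (hp k).le
  linarith

theorem time_le_sig {j k : ℕ} (hj : j ≤ n + 1) (hk : k < j) (h : Small m κ p j k)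
    (h' : ¬ D.fs j k) : lastTime r j ≤ D.sig j k :=
  (le_max_left _ _).trans ((D.schedule j hj).base_le k (D.mem_unstarted.mpr ⟨hk, h', h⟩))

theorem inv_zero : D.Inv 0 where
  lt := by simp
  end_le := by simp
  lt_time := by simp
  rel_le := by simp
  apart := by simp
  busy := by simp
  order := by simp
  f_eq μ := Or.inl (D.f_zero μ)
  work_ge μ _ := by simp [base, work, D.f_zero, D.a_zero, lastTime]

theorem f_mono {j μ : ℕ} (hj : j ≤ n) : D.f j μ ≤ D.f (j + 1) μ := (D.f_succ j hj).le μ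

theorem base_mono (hr : Monotone r) (hr0 : ∀ k, 0 ≤ r k) {j μ : ℕ} (hj : j ≤ n) :
    D.base j μ ≤ D.base (j + 1) μ :=
  max_le_max (lastTime_le hr hr0 j) (D.f_mono hj)

theorem a_mono {j μ : ℕ} (hj : j ≤ n) (hμ : μ < m) : D.a j μ ≤ D.a (j + 1) μ := by
  rw [D.a_succ j hj μ hμ]; linarith [le_max_left 0 (r j - D.e j μ)]

/-- Work that was started at the last release ends before the old plan ends. -/
theorem f_succ_le (hp : ∀ k, 0 < p k) {j μ : ℕ} (hj : j ≤ n) (hμ : μ < m) :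
    D.f (j + 1) μ ≤ D.e j μ := by
  rcases (D.f_succ j hj).eq μ with h | ⟨k, hk, h1, h2, h3⟩
  · rw [h]; exact (le_max_right _ _).trans (D.base_le_e hp (by omega) hμ)
  · rw [h3, ← h2]
    exact (D.schedule j (by omega)).end_le k (D.mem_unstarted.mpr ⟨hk, h1.1, h1.2.1⟩)

/-- One more release. What starts before the release was planned under the old state and stays as it
was; the rest is list scheduled anew from then on. -/
theorem inv_succ (hp : ∀ k, 0 < p k) (hr : Monotone r) (hr0 : ∀ k, 0 ≤ r k) {j : ℕ} (hj : j ≤ n)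
    (I : D.Inv j) : D.Inv (j + 1) := by
  have L := D.schedule (j + 1) (by omega)
  have L0 := D.schedule j (by omega)
  have hT : lastTime r (j + 1) = r j := rfl
  have small_fs : ∀ k < j + 1, D.fs (j + 1) k → k < j ∧ Small m κ p j k := fun k hk h => by
    obtain ⟨h1, h2, -⟩ := D.fs_succ' hj hk h
    exact ⟨h1, h2.elim (fun h => D.fs_small hp (by omega) h1 h) fun h => h.2.1⟩
  have lt_fs : ∀ k < j + 1, D.fs (j + 1) k → D.sig (j + 1) k < r j := fun k hk h => by
    obtain ⟨h1, h2, h3, -⟩ := D.fs_succ' hj hk h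
    rw [h3]
    exact h2.elim (fun h => (I.lt_time k h1 h).trans_le (lastTime_le hr hr0 j)) fun h => h.2.2
  have mem : ∀ k < j + 1, Small m κ p (j + 1) k → ¬ D.fs (j + 1) k → k ∈ D.unstarted (j + 1) :=
    fun k hk h h' => D.mem_unstarted.mpr ⟨hk, h', h⟩
  have end_fs : ∀ k < j + 1, D.fs (j + 1) k →
      D.sig (j + 1) k + p k ≤ D.f (j + 1) (D.nu (j + 1) k) := fun k hk h => by
    obtain ⟨h1, h2, h3, h4⟩ := D.fs_succ' hj hk h
    rw [h3, h4]
    exact h2.elim (fun h => (I.end_le k h1 h).trans (D.f_mono hj))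
      fun h => (D.f_succ j hj).le_of k h1 h
  -- a small job that was available before the last release was already known and small then
  have old : ∀ k < j + 1, Small m κ p (j + 1) k → r (avail m κ p k) < r j →
      k < j ∧ Small m κ p j k := fun k hk h h1 => by
    obtain ⟨a1, a2, a3⟩ := avail_spec (j := j) (by omega) h
    have : avail m κ p k < j := by
      by_contra hc
      exact absurd (hr (not_lt.mp hc)) (not_le.mpr h1)
    exact ⟨by omega, a2.mono hp (by omega)⟩
  have fse : ∀ μ, D.f (j + 1) μ = 0 ∨
      ∃ k < j + 1, D.fs (j + 1) k ∧ D.nu (j + 1) k = μ ∧ D.f (j + 1) μ = D.sig (j + 1) k + p k := by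
    intro μ
    rcases (D.f_succ j hj).eq μ with h | ⟨k, hk, h1, h2, h3⟩
    · rcases I.f_eq μ with h' | ⟨k, hk, h1, h2, h3⟩
      · exact Or.inl (h.trans h')
      · have hf := D.fs_mono hj hk h1
        obtain ⟨-, -, q3, q4⟩ := D.fs_succ' hj (by omega) hf
        exact Or.inr ⟨k, by omega, hf, q4.trans h2, by rw [h, h3, q3]⟩
    · have hf := (D.fs_succ j hj k hk).mpr (Or.inr h1)
      obtain ⟨-, -, q3, q4⟩ := D.fs_succ' hj (by omega) hf
      exact Or.inr ⟨k, by omega, hf, q4.trans h2, by rw [h3, q3]⟩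
  -- while a job that is small by now waits, every machine runs a job that is started by now
  have wit : ∀ k < j, Small m κ p j k → ∀ t, r (avail m κ p k) ≤ t → t < D.sig j k → t < r j →
      ∀ μ < m, ∃ l < j + 1, Small m κ p (j + 1) l ∧ D.nu (j + 1) l = μ ∧ D.sig (j + 1) l ≤ t ∧
        t < D.sig (j + 1) l + p l := fun k hk hs t h1 h2 h3 μ hμ => by
    obtain ⟨l, hl, q1, q2, q3, q4⟩ := I.busy k hk hs t h1 h2 μ hμ
    have hf := D.fs_of_lt hj hl q1 (lt_of_le_of_lt q3 h3)
    obtain ⟨-, -, q5, q6⟩ := D.fs_succ' hj (by omega) hf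
    exact ⟨l, by omega, q1.mono hp (by omega), by rw [q6, q2], by rw [q5]; exact q3,
      by rw [q5]; exact q4⟩
  refine ⟨?_, end_fs, lt_fs, ?_, ?_, ?_, ?_, fse, ?_⟩
  · intro k hk hs
    by_cases hf : D.fs (j + 1) k
    · obtain ⟨h1, h2⟩ := small_fs k hk hf
      rw [(D.fs_succ' hj hk hf).2.2.2]; exact I.lt k h1 h2
    · exact L.lt k (mem k hk hs hf)
  · intro k hk hs
    by_cases hf : D.fs (j + 1) k
    · obtain ⟨h1, h2⟩ := small_fs k hk hf
      rw [(D.fs_succ' hj hk hf).2.2.1]; exact I.rel_le k h1 h2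
    · exact (hr (avail_spec (j := j) (by omega) hs).2.2).trans
        (D.time_le_sig (by omega) hk hs hf)
  · intro k hk l hl hs hs' hkl hnu
    by_cases hf : D.fs (j + 1) k <;> by_cases hf' : D.fs (j + 1) l
    · obtain ⟨h1, h2⟩ := small_fs k hk hf
      obtain ⟨h1', h2'⟩ := small_fs l hl hf'
      obtain ⟨-, -, q1, q2⟩ := D.fs_succ' hj hk hf
      obtain ⟨-, -, q1', q2'⟩ := D.fs_succ' hj hl hf'
      rw [q1, q1']
      rw [q2, q2'] at hnu
      exact I.apart k h1 l h1' h2 h2' hkl hnu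
    · have h3 := L.base_le l (mem l hl hs' hf')
      have h4 := end_fs k hk hf
      rw [hnu] at h4
      exact Or.inl (h4.trans ((le_max_right _ _).trans h3))
    · have h3 := L.base_le k (mem k hk hs hf)
      have h4 := end_fs l hl hf'
      rw [← hnu] at h4
      exact Or.inr (h4.trans ((le_max_right _ _).trans h3))
    · exact L.apart k (mem k hk hs hf) l (mem l hl hs' hf') hkl hnu
  · intro k hk hs t ht1 ht2 μ hμ
    by_cases hf : D.fs (j + 1) k
    · obtain ⟨h1, h2⟩ := small_fs k hk hf
      have h3 := lt_fs k hk hf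
      rw [(D.fs_succ' hj hk hf).2.2.1] at ht2 h3
      exact wit k h1 h2 t ht1 ht2 (by linarith) μ hμ
    · rcases lt_or_ge t (r j) with htr | htr
      · obtain ⟨h1, h2⟩ := old k hk hs (by linarith)
        have h3 : r j ≤ D.sig j k := by
          by_contra hc
          exact hf (D.fs_of_lt hj h1 h2 (not_le.mp hc))
        exact wit k h1 h2 t ht1 (by linarith) htr μ hμ
      · rcases lt_or_ge t (D.f (j + 1) μ) with htf | htf
        · rcases fse μ with h0 | ⟨l, hl, q1, q2, q3⟩
          · linarith [hr0 j]
          · exact ⟨l, hl, D.fs_small hp (by omega) hl q1, q2,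
              ((lt_fs l hl q1).le).trans htr, by rwa [← q3]⟩
        · obtain ⟨l, hl, q1⟩ := L.cover μ hμ t (max_le htr htf)
            (lt_of_lt_of_le ht2 (L.le k (mem k hk hs hf) μ hμ))
          obtain ⟨q2, -, q3⟩ := D.mem_unstarted.mp hl
          exact ⟨l, q2, q3, q1⟩
  · intro k hk l hl hs hs' h1 h2
    by_cases hf' : D.fs (j + 1) l
    · have h3 := lt_fs l hl hf'
      obtain ⟨a1, a2⟩ := small_fs l hl hf'
      obtain ⟨-, -, q1, -⟩ := D.fs_succ' hj hl hf'
      rw [q1] at h1 h2 h3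
      obtain ⟨b1, b2⟩ := old k hk hs (by linarith)
      refine I.order k b1 l a1 b2 a2 h1 ?_
      by_cases hf : D.fs (j + 1) k
      · rwa [(D.fs_succ' hj hk hf).2.2.1] at h2
      · have h4 : r j ≤ D.sig j k := by
          by_contra hc
          exact hf (D.fs_of_lt hj b1 b2 (not_le.mp hc))
        linarith
    · have h3 := D.time_le_sig (by omega) hl hs' hf'
      have hf : ¬ D.fs (j + 1) k := fun hf => by
        have := lt_fs k hk hf
        rw [hT] at h3
        linarith
      exact L.order k (mem k hk hs hf) l (mem l hl hs' hf') h2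
  · intro μ hμ
    classical
    have hfe := D.f_succ_le hp hj hμ
    set new := (Finset.range j).filter fun k =>
      (¬ D.fs j k ∧ Small m κ p j k ∧ D.sig j k < r j) ∧ D.nu j k = μ with hnew
    have hw : D.work (j + 1) μ = D.work j μ + ∑ k ∈ new, p k := by
      have h1 : (Finset.range (j + 1)).filter (fun k => D.fs (j + 1) k ∧ D.nu (j + 1) k = μ) =
          (Finset.range j).filter (fun k => D.fs j k ∧ D.nu j k = μ) ∪ new := by
        ext k
        simp only [hnew, Finset.mem_filter, Finset.mem_union, Finset.mem_range]
        constructor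
        · rintro ⟨h1, h2, h3⟩
          obtain ⟨q1, q2, -, q4⟩ := D.fs_succ' hj h1 h2
          rw [q4] at h3
          tauto
        · intro h
          have hkj : k < j := by tauto
          have hf : D.fs (j + 1) k := (D.fs_succ j hj k hkj).mpr (by tauto)
          obtain ⟨-, -, -, q4⟩ := D.fs_succ' hj (by omega) hf
          exact ⟨by omega, hf, by rw [q4]; tauto⟩
      unfold work
      rw [h1, Finset.sum_union]
      rw [Finset.disjoint_left]
      simp only [hnew, Finset.mem_filter]
      tauto
    -- the jobs started since the last release fill the time until the old plan or the new base ends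
    have hcov : min (D.base (j + 1) μ) (D.e j μ) - D.base j μ ≤ ∑ k ∈ new, p k := by
      refine length_le_of_cover (σ := D.sig j) (fun k _ => (hp k).le) fun t h1 h2 => ?_
      obtain ⟨l, hl, q1, q2, q3⟩ := L0.cover μ hμ t h1 (lt_of_lt_of_le h2 (min_le_right _ _))
      obtain ⟨a1, a2, a3⟩ := D.mem_unstarted.mp hl
      rcases lt_or_ge t (r j) with htr | htr
      · exact ⟨l, by simp [hnew, a1, a2, a3, q1]; linarith, q2, q3⟩
      · have htf : t < D.f (j + 1) μ := by
          have := lt_of_lt_of_le h2 (min_le_left _ _)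
          exact (lt_max_iff.mp this).resolve_left (not_lt.mpr htr)
        rcases (D.f_succ j hj).eq μ with h | ⟨k, hk, b1, b2, b3⟩
        · rw [h] at htf
          exact absurd ((le_max_right _ _).trans h1) (not_le.mpr htf)
        · exact ⟨k, by simp only [hnew, Finset.mem_filter, Finset.mem_range]; exact ⟨hk, b1, b2⟩,
            b1.2.2.le.trans htr, by rw [← b3]; exact htf⟩
    have h1 := I.work_ge μ hμ
    rw [hw, D.a_succ j hj μ hμ]
    have h2 : D.base (j + 1) μ ≤ max (r j) (D.e j μ) := max_le_max le_rfl hfe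
    rcases le_total (r j) (D.e j μ) with h3 | h3
    · rw [max_eq_right h3] at h2
      rw [min_eq_left h2] at hcov
      have := le_max_left 0 (r j - D.e j μ)
      linarith
    · rw [max_eq_left h3] at h2
      have h4 : D.e j μ ≤ D.base (j + 1) μ := h3.trans (le_max_left _ _)
      rw [min_eq_right h4] at hcov
      have := le_max_right 0 (r j - D.e j μ)
      linarith

theorem inv (hp : ∀ k, 0 < p k) (hr : Monotone r) (hr0 : ∀ k, 0 ≤ r k) (j : ℕ)
    (hj : j ≤ n + 1) : D.Inv j := by
  induction j with
  | zero => exact D.inv_zero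
  | succ j ih => exact D.inv_succ hp hr hr0 (by omega) (ih (by omega))

end Virtual

end

/-! ### Feasibility and stability -/

section

theorem Prec.trans {β : ℕ → ℝ} {i k l : ℕ} (h : Prec β i k) (h' : Prec β k l) : Prec β i l := by
  rcases h with h | ⟨h, h1⟩ <;> rcases h' with h' | ⟨h', h1'⟩
  · exact Or.inl (h.trans h')
  · exact Or.inl (h.trans_le h')
  · exact Or.inl (h.trans_lt h')
  · exact Or.inr ⟨h.trans h', h1.trans h1'⟩

theorem Prec.total {β : ℕ → ℝ} {k l : ℕ} (h : k ≠ l) : Prec β k l ∨ Prec β l k := by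
  rcases lt_trichotomy (β k) (β l) with h1 | h1 | h1
  · exact Or.inl (Or.inl h1)
  · rcases lt_or_gt_of_ne h with h2 | h2
    · exact Or.inl (Or.inr ⟨h1.le, h2⟩)
    · exact Or.inr (Or.inr ⟨h1.ge, h2⟩)
  · exact Or.inr (Or.inl h1)

theorem Prec.irrefl {β : ℕ → ℝ} {k : ℕ} (h : Prec β k k) : False := by
  rcases h with h | h
  · exact lt_irrefl _ h
  · exact lt_irrefl _ h.2

theorem Prec.le {β : ℕ → ℝ} {k l : ℕ} (h : Prec β k l) : β k ≤ β l := h.elim le_of_lt And.left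

theorem Prec.exists_first {β : ℕ → ℝ} {S : Finset ℕ} (hS : S.Nonempty) :
    ∃ k ∈ S, ∀ l ∈ S, ¬ Prec β l k := by
  obtain ⟨k, hk, h⟩ := Finset.exists_min_image S (fun l => toLex (β l, l)) hS
  refine ⟨k, hk, fun l hl hlk => ?_⟩
  have := (Prod.Lex.toLex_le_toLex).mp (h l hl)
  simp only at this
  rcases hlk with h1 | ⟨h1, h2⟩ <;> rcases this with h3 | ⟨h3, h4⟩
  · linarith
  · linarith
  · linarith
  · omega

theorem wrap_lt {m a b : ℕ} (ha : a < m) (hb : b < m) : wrap m (a + b) < m := by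
  unfold wrap; split_ifs <;> omega

namespace Actual

variable {n m κ : ℕ} {r p : ℕ → ℝ} {D : Virtual n m κ r p} {rho : ℕ} {K : ℕ → ℕ}
  (A : Actual D rho K)

/-- Job `k` is big and waits when `j` jobs are known. -/
def waits (j k : ℕ) : Prop := ¬ A.fb j k ∧ ¬ Small m κ p j k

/-- The big job `k` is started before the release of job `j`. -/
def begins (j k : ℕ) : Prop := ¬ A.fb j k ∧ ¬ Small m κ p j k ∧ A.u j k < D.a (j + 1) (A.bm k)

/-- The delay of the real schedule against the virtual one. -/
def lag (j μ : ℕ) : ℝ := max 0 (A.Eb j μ - D.a j μ)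

/-- The plan for job `k` is final. -/
def fixed (j k : ℕ) : Prop := A.fb j k ∨ (Small m κ p j k ∧ D.fs j k)

open Classical in
/-- The waiting jobs that are to be started before job `k` on the same machine. -/
def ahead (j k : ℕ) : Finset ℕ := (Finset.range j).filter fun l =>
  (¬ A.fb j l ∧ ¬ Small m κ p j l) ∧ A.bm l = A.bm k ∧ Prec A.beta l k

open Classical in
/-- The jobs that are started on machine `μ` before the release of job `j`. -/
def begun (j μ : ℕ) : Finset ℕ := (Finset.range j).filter fun k =>
  (¬ A.fb j k ∧ ¬ Small m κ p j k ∧ A.u j k < D.a (j + 1) (A.bm k)) ∧ A.bm k = μ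

theorem mem_ahead {j k l : ℕ} :
    l ∈ A.ahead j k ↔ l < j ∧ A.waits j l ∧ A.bm l = A.bm k ∧ Prec A.beta l k := by
  simp only [ahead, Finset.mem_filter, Finset.mem_range, waits]

theorem mem_begun {j k μ : ℕ} : k ∈ A.begun j μ ↔ k < j ∧ A.begins j k ∧ A.bm k = μ := by
  simp only [begun, Finset.mem_filter, Finset.mem_range, begins]

theorem W_succ' {j : ℕ} (hj : j ≤ n) (μ : ℕ) :
    A.W (j + 1) μ = A.W j μ + ∑ k ∈ A.begun j μ, p k := A.W_succ j hj μ

theorem begins.waits {A : Actual D rho K} {j k : ℕ} (h : A.begins j k) : A.waits j k := ⟨h.1, h.2.1⟩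

theorem wait_spec {j k : ℕ} (hj : j ≤ n + 1) (hk : k < j) (h : A.waits j k) :
    A.u j k = A.W j (A.bm k) + A.beta k + ∑ l ∈ A.ahead j k, p l ∧
    A.s j k = D.e j (A.bm k) - D.a j (A.bm k) + A.u j k ∧ A.M j k = A.bm k := by
  cases j with
  | zero => omega
  | succ j => exact A.big j (by omega) k (by omega) h.2 h.1

theorem small_spec {j k : ℕ} (hj : j ≤ n + 1) (hk : k < j) (h : Small m κ p j k)
    (hfs : ¬ D.fs j k) (hfb : ¬ A.fb j k) :
    A.M j k = D.nu j k ∧ A.s j k = D.sig j k + A.lag j (D.nu j k) := by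
  cases j with
  | zero => omega
  | succ j => exact A.small j (by omega) k (by omega) hfs h hfb

theorem bm_lt (hrho : rho < m) {k : ℕ} (hk : k ≤ n) : A.bm k < m := by
  rw [A.bm_eq k hk]; exact wrap_lt (D.gr_lt k hk) hrho

/-- Of two waiting jobs on a machine, the second is planned after the end of the first. -/
theorem u_add_le (hp : ∀ k, 0 < p k) {j k l : ℕ} (hj : j ≤ n + 1) (hl : l < j) (hk : k < j)
    (hwl : A.waits j l) (hwk : A.waits j k) (hb : A.bm l = A.bm k) (h : Prec A.beta l k) :
    A.u j l + p l ≤ A.u j k := by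
  rw [(A.wait_spec hj hl hwl).1, (A.wait_spec hj hk hwk).1, hb]
  have h1 : l ∉ A.ahead j l := fun hm => (A.mem_ahead.mp hm).2.2.2.irrefl
  have h2 : insert l (A.ahead j l) ⊆ A.ahead j k := by
    intro i hi
    rcases Finset.mem_insert.mp hi with rfl | hi
    · exact A.mem_ahead.mpr ⟨hl, hwl, hb, h⟩
    · obtain ⟨q1, q2, q3, q4⟩ := A.mem_ahead.mp hi
      exact A.mem_ahead.mpr ⟨q1, q2, q3.trans hb, q4.trans h⟩
  have h3 := Finset.sum_le_sum_of_subset_of_nonneg h2 fun i _ _ => (hp i).le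
  rw [Finset.sum_insert h1] at h3
  linarith [h.le]

/-- A waiting job that is planned before the end of another one on its machine precedes it. -/
theorem prec_of_u_le (hp : ∀ k, 0 < p k) {j k l : ℕ} (hj : j ≤ n + 1) (hl : l < j) (hk : k < j)
    (hwl : A.waits j l) (hwk : A.waits j k) (hb : A.bm l = A.bm k) (hne : l ≠ k)
    (h : A.u j l ≤ A.u j k) : Prec A.beta l k := by
  refine (Prec.total hne).resolve_right fun h1 => ?_
  have := A.u_add_le hp hj hk hl hwk hwl hb.symm h1
  linarith [hp k]

/-- The trigger clocks of the waiting jobs are not passed by the clock `max a Eb - W`. -/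
def Clocks (j : ℕ) : Prop := ∀ k < j, A.waits j k →
  max (D.a j (A.bm k)) (A.Eb j (A.bm k)) ≤ A.W j (A.bm k) + A.beta k

/-- The free clock of a machine does not pass the trigger clock of a waiting job. Among the waiting
jobs that are not started, the first one bounds both the idle clock, as it has not begun, and the
end of the started work, as it follows all jobs that have begun. -/
theorem clocks_step (hp : ∀ k, 0 < p k) {j : ℕ} (hj : j ≤ n) (H : A.Clocks j) {k : ℕ} (hk : k < j)
    (hw : A.waits j k) (hb : ¬ A.begins j k) :
    max (D.a (j + 1) (A.bm k)) (A.Eb (j + 1) (A.bm k)) ≤ A.W (j + 1) (A.bm k) + A.beta k := by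
  classical
  set S := (Finset.range j).filter fun l => (A.waits j l ∧ ¬ A.begins j l) ∧ A.bm l = A.bm k
  have hS : S.Nonempty := ⟨k, by simp [S, hk, hw, hb]⟩
  obtain ⟨i, hi, hmin⟩ := Prec.exists_first (β := A.beta) hS
  simp only [S, Finset.mem_filter, Finset.mem_range] at hi hmin
  obtain ⟨hij, ⟨hiw, hib⟩, him⟩ := hi
  have hik : A.beta i ≤ A.beta k := by
    by_contra hc
    exact hmin k ⟨hk, ⟨hw, hb⟩, rfl⟩ (Or.inl (not_le.mp hc))
  have hsub : A.ahead j i ⊆ A.begun j (A.bm k) := by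
    intro l hl
    obtain ⟨q1, q2, q3, q4⟩ := A.mem_ahead.mp hl
    refine A.mem_begun.mpr ⟨q1, ?_, q3.trans him⟩
    by_contra hc
    exact hmin l ⟨q1, ⟨q2, hc⟩, q3.trans him⟩ q4
  have hsum := Finset.sum_le_sum_of_subset_of_nonneg hsub fun i _ _ => (hp i).le
  have hu := (A.wait_spec (by omega) hij hiw).1
  have hua : D.a (j + 1) (A.bm i) ≤ A.u j i := by
    by_contra hc
    exact hib ⟨hiw.1, hiw.2, not_le.mp hc⟩
  have hW := A.W_succ' hj (A.bm k)
  have hui : A.u j i ≤ A.W (j + 1) (A.bm k) + A.beta i := by rw [hu, hW, him]; linarith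
  rw [him] at hua
  refine (max_le ?_ ?_).trans (add_le_add_right hik _)
  · linarith
  · rcases (A.Eb_succ j hj).eq (A.bm k) with h | ⟨l, hl, h1, h2, h3⟩
    · have h4 := (le_max_right _ _).trans (H i hij hiw)
      rw [him] at h4
      have : 0 ≤ ∑ k ∈ A.begun j (A.bm k), p k := Finset.sum_nonneg fun k _ => (hp k).le
      rw [h, hW]; linarith
    · have h4 : Prec A.beta l i := by
        refine A.prec_of_u_le hp (by omega) hl hij ⟨h1.1, h1.2.1⟩ hiw (h2.trans him.symm) ?_ ?_
        · rintro rfl; exact hib h1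
        · have := h1.2.2
          rw [h2] at this
          linarith
      have h5 := A.u_add_le hp (by omega) hl hij ⟨h1.1, h1.2.1⟩ hiw (h2.trans him.symm) h4
      rw [h3]; linarith

theorem waits_of_succ (hp : ∀ k, 0 < p k) {j k : ℕ} (hj : j ≤ n) (hk : k < j)
    (h : A.waits (j + 1) k) : A.waits j k ∧ ¬ A.begins j k := by
  have h1 := fun h' => h.1 ((A.fb_succ j hj k hk).mpr h')
  exact ⟨⟨fun h2 => h1 (Or.inl h2), fun h2 => h.2 (h2.mono hp (by omega))⟩,
    fun h2 => h1 (Or.inr h2)⟩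

theorem clocks (hp : ∀ k, 0 < p k) (j : ℕ) (hj : j ≤ n + 1) : A.Clocks j := by
  induction j with
  | zero => intro k hk; omega
  | succ j ih =>
    intro k hk hw
    rcases Nat.lt_or_ge k j with h | h
    · obtain ⟨h1, h2⟩ := A.waits_of_succ hp (by omega) h hw
      exact A.clocks_step hp (by omega) (ih (by omega)) h h1 h2
    · obtain rfl : k = j := by omega
      rw [A.beta_eq k (by omega)]
      have : (0 : ℝ) ≤ K k * p k := mul_nonneg (Nat.cast_nonneg _) (hp k).le
      linarith

theorem le_u (hp : ∀ k, 0 < p k) {j k : ℕ} (hj : j ≤ n + 1) (hk : k < j) (h : A.waits j k) :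
    max (D.a j (A.bm k)) (A.Eb j (A.bm k)) ≤ A.u j k := by
  rw [(A.wait_spec hj hk h).1]
  have : 0 ≤ ∑ l ∈ A.ahead j k, p l := Finset.sum_nonneg fun k _ => (hp k).le
  linarith [A.clocks hp j hj k hk h]

theorem lag_nonneg (j μ : ℕ) : 0 ≤ A.lag j μ := le_max_left _ _

/-- A waiting job is planned after all planned virtual work. -/
theorem e_add_lag_le (hp : ∀ k, 0 < p k) {j k : ℕ} (hj : j ≤ n + 1) (hk : k < j)
    (h : A.waits j k) : D.e j (A.bm k) + A.lag j (A.bm k) ≤ A.s j k := by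
  rw [(A.wait_spec hj hk h).2.1]
  have h1 := A.le_u hp hj hk h
  have h2 := (le_max_left _ _).trans h1
  have h3 := (le_max_right _ _).trans h1
  have : A.lag j (A.bm k) ≤ A.u j k - D.a j (A.bm k) := max_le (by linarith) (by linarith)
  linarith

theorem not_fixed {j k : ℕ} (h : ¬ A.fixed j k) :
    A.waits j k ∨ (Small m κ p j k ∧ ¬ D.fs j k ∧ ¬ A.fb j k) := by
  unfold fixed at h; unfold waits; tauto

/-- A job that is not fixed is planned after the end of the fixed virtual work, delayed by the
lag. -/
theorem base_add_lag_le (hp : ∀ k, 0 < p k) (hrho : rho < m) {j k : ℕ} (hj : j ≤ n + 1)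
    (hk : k < j) (h : ¬ A.fixed j k) :
    D.base j (A.M j k) + A.lag j (A.M j k) ≤ A.s j k := by
  rcases A.not_fixed h with h | ⟨h1, h2, h3⟩
  · rw [(A.wait_spec hj hk h).2.2]
    linarith [A.e_add_lag_le hp hj hk h, D.base_le_e hp hj (A.bm_lt hrho (k := k) (by omega))]
  · obtain ⟨h4, h5⟩ := A.small_spec hj hk h1 h2 h3
    rw [h4, h5]
    linarith [(D.schedule j hj).base_le k (D.mem_unstarted.mpr ⟨hk, h2, h1⟩)]

theorem time_le (hp : ∀ k, 0 < p k) (hrho : rho < m) {j k : ℕ} (hj : j ≤ n + 1) (hk : k < j)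
    (h : ¬ A.fixed j k) : lastTime r j ≤ A.s j k := by
  have h1 := A.base_add_lag_le hp hrho hj hk h
  have h2 : lastTime r j ≤ D.base j (A.M j k) := le_max_left _ _
  linarith [A.lag_nonneg j (A.M j k)]

/-- When virtual work ends at `x`, then `x` plus the lag is no later in terms of the next state: the
lag decreases only while the machine is idle. -/
theorem lag_step {j μ : ℕ} (hj : j ≤ n) (hμ : μ < m) {x : ℝ}
    (h1 : x ≤ D.e j μ) (h2 : x ≤ D.base (j + 1) μ) :
    x + A.lag j μ ≤ D.base (j + 1) μ + A.lag (j + 1) μ := by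
  have hE := (A.Eb_succ j hj).le μ
  have ha := D.a_succ j hj μ hμ
  have hb : r j ≤ D.base (j + 1) μ := le_max_left _ _
  unfold lag
  have l1 := le_max_left 0 (A.Eb (j + 1) μ - D.a (j + 1) μ)
  have l2 := le_max_right 0 (A.Eb (j + 1) μ - D.a (j + 1) μ)
  rcases le_total (r j) (D.e j μ) with h | h
  · rw [max_eq_left (by linarith)] at ha
    rcases max_choice 0 (A.Eb j μ - D.a j μ) with h3 | h3 <;> rw [h3] <;> linarith
  · rw [max_eq_right (by linarith)] at ha
    rcases max_choice 0 (A.Eb j μ - D.a j μ) with h3 | h3 <;> rw [h3] <;> linarith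

/-- A fixed job keeps its start, and it was fixed before, or begins as a big job, or is started in
the virtual schedule. -/
theorem fixed_succ (hp : ∀ k, 0 < p k) {j k : ℕ} (hj : j ≤ n) (hk : k < j + 1)
    (h : A.fixed (j + 1) k) : k < j ∧ (A.M (j + 1) k = A.M j k ∧ A.s (j + 1) k = A.s j k) ∧
      (A.fixed j k ∨ A.begins j k ∨
        (Small m κ p j k ∧ ¬ D.fs j k ∧ ¬ A.fb j k ∧ D.sig j k < r j)) := by
  have hs := A.s_keep j hj k (by omega) h
  have hkj : k < j := by
    refine lt_of_le_of_ne (by omega) ?_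
    rintro rfl
    rcases h with h | h
    · exact A.fb_new k hj h
    · exact D.fs_new k hj h.2
  refine ⟨hkj, hs, ?_⟩
  rcases h with h | h
  · rcases (A.fb_succ j hj k hkj).mp h with h | h
    · exact Or.inl (Or.inl h)
    · exact Or.inr (Or.inl h)
  · rcases (D.fs_succ j hj k hkj).mp h.2 with h1 | h1
    · exact Or.inl (Or.inr ⟨D.fs_small hp (by omega) hkj h1, h1⟩)
    · by_cases hb : A.fb j k
      · exact Or.inl (Or.inl hb)
      · exact Or.inr (Or.inr ⟨h1.2.1, h1.1, hb, h1.2.2⟩)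

/-- What is true of the real schedule when `j` jobs are known. -/
structure Inv (j : ℕ) : Prop where
  M_lt : ∀ k < j, A.M j k < m
  fixed_end : ∀ k < j, A.fixed j k → A.s j k + p k ≤ D.base j (A.M j k) + A.lag j (A.M j k)
  rel_le : ∀ k < j, r k ≤ A.s j k
  apart : ∀ k < j, ∀ l < j, k ≠ l → A.M j k = A.M j l →
    A.s j k + p k ≤ A.s j l ∨ A.s j l + p l ≤ A.s j k

theorem inv_succ (hp : ∀ k, 0 < p k) (hr : Monotone r) (hr0 : ∀ k, 0 ≤ r k) (hrho : rho < m)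
    {j : ℕ} (hj : j ≤ n) (I : A.Inv j) : A.Inv (j + 1) := by
  have L := D.schedule j (by omega)
  have L' := D.schedule (j + 1) (by omega)
  have hM : ∀ k < j + 1, A.M (j + 1) k < m := by
    intro k hk
    by_cases hf : A.fixed (j + 1) k
    · obtain ⟨h1, h2, -⟩ := A.fixed_succ hp hj hk hf
      rw [h2.1]; exact I.M_lt k h1
    · rcases A.not_fixed hf with h | ⟨h1, h2, h3⟩
      · rw [(A.wait_spec (by omega) hk h).2.2]; exact A.bm_lt hrho (by omega)
      · rw [(A.small_spec (by omega) hk h1 h2 h3).1]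
        exact L'.lt k (D.mem_unstarted.mpr ⟨hk, h2, h1⟩)
  have hend : ∀ k < j + 1, A.fixed (j + 1) k →
      A.s (j + 1) k + p k ≤ D.base (j + 1) (A.M (j + 1) k) + A.lag (j + 1) (A.M (j + 1) k) := by
    intro k hk hf
    obtain ⟨h1, h2, h3⟩ := A.fixed_succ hp hj hk hf
    have hMk := hM k hk
    rw [h2.1] at hMk ⊢
    rw [h2.2]
    rcases h3 with h3 | h3 | ⟨h3, h4, h5, h6⟩
    · exact (I.fixed_end k h1 h3).trans (A.lag_step hj hMk (D.base_le_e hp (by omega) hMk)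
        (D.base_mono hr hr0 hj))
    · obtain ⟨w1, w2, w3⟩ := A.wait_spec (by omega) h1 h3.waits
      rw [w3] at hMk ⊢
      have hu := (le_max_left _ _).trans (A.le_u hp (by omega) h1 h3.waits)
      have ha := D.a_succ j hj _ hMk
      have h4 := h3.2.2
      have hE := (A.Eb_succ j hj).le_of k h1 h3
      -- the job starts in idle time of the virtual schedule
      have hidle : D.e j (A.bm k) < r j := by
        by_contra hc
        rw [max_eq_left (by linarith)] at ha
        linarith
      rw [max_eq_right (by linarith)] at ha
      have hb : r j ≤ D.base (j + 1) (A.bm k) := le_max_left _ _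
      have hl : A.Eb (j + 1) (A.bm k) - D.a (j + 1) (A.bm k) ≤ A.lag (j + 1) (A.bm k) :=
        le_max_right _ _
      rw [w2]
      linarith
    · obtain ⟨w1, w2⟩ := A.small_spec (by omega) h1 h3 h4 h5
      have hmem := D.mem_unstarted.mpr ⟨h1, h4, h3⟩
      rw [w1] at hMk ⊢
      rw [w2]
      have h7 := L.end_le k hmem
      have h8 : D.sig j k + p k ≤ D.base (j + 1) (D.nu j k) :=
        ((D.f_succ j hj).le_of k h1 ⟨h4, h3, h6⟩).trans (le_max_right _ _)
      linarith [A.lag_step hj hMk h7 h8]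
  refine ⟨hM, hend, fun k hk => ?_, ?_⟩
  · by_cases hf : A.fixed (j + 1) k
    · obtain ⟨h1, h2, -⟩ := A.fixed_succ hp hj hk hf
      rw [h2.2]; exact I.rel_le k h1
    · exact (hr (by omega)).trans (A.time_le hp hrho (by omega) hk hf)
  -- a waiting big job is apart from every other job that is not fixed
  · have two : ∀ k < j + 1, ∀ l < j + 1, ¬ A.fixed (j + 1) l → A.waits (j + 1) k → k ≠ l →
        A.M (j + 1) k = A.M (j + 1) l →
        A.s (j + 1) k + p k ≤ A.s (j + 1) l ∨ A.s (j + 1) l + p l ≤ A.s (j + 1) k := by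
      intro k hk l hl hf hw hkl hMkl
      obtain ⟨w1, w2, w3⟩ := A.wait_spec (by omega) hk hw
      rcases A.not_fixed hf with h | ⟨h1, h2, h3⟩
      · obtain ⟨v1, v2, v3⟩ := A.wait_spec (by omega) hl h
        rw [w3, v3] at hMkl
        rw [w2, v2, hMkl]
        rcases Prec.total (β := A.beta) hkl with hP | hP
        · left; linarith [A.u_add_le hp (by omega) hk hl hw h hMkl hP]
        · right; linarith [A.u_add_le hp (by omega) hl hk h hw hMkl.symm hP]
      · obtain ⟨v1, v2⟩ := A.small_spec (by omega) hl h1 h2 h3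
        right
        have h4 := L'.end_le l (D.mem_unstarted.mpr ⟨hl, h2, h1⟩)
        have h5 := A.e_add_lag_le hp (by omega) hk hw
        rw [w3, v1] at hMkl
        rw [hMkl] at h5
        rw [v2]; linarith
    intro k hk l hl hkl hMkl
    by_cases hf : A.fixed (j + 1) k <;> by_cases hf' : A.fixed (j + 1) l
    · obtain ⟨h1, h2, -⟩ := A.fixed_succ hp hj hk hf
      obtain ⟨h1', h2', -⟩ := A.fixed_succ hp hj hl hf'
      rw [h2.1, h2'.1] at hMkl
      rw [h2.2, h2'.2]
      exact I.apart k h1 l h1' hkl hMkl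
    · left
      have h1 := hend k hk hf
      rw [hMkl] at h1
      exact h1.trans (A.base_add_lag_le hp hrho (by omega) hl hf')
    · right
      have h1 := hend l hl hf'
      rw [← hMkl] at h1
      exact h1.trans (A.base_add_lag_le hp hrho (by omega) hk hf)
    · rcases A.not_fixed hf with h | ⟨h1, h2, h3⟩
      · exact two k hk l hl hf' h hkl hMkl
      · rcases A.not_fixed hf' with h | ⟨h1', h2', h3'⟩
        · exact (two l hl k hk hf h hkl.symm hMkl.symm).symm
        · obtain ⟨v1, v2⟩ := A.small_spec (by omega) hk h1 h2 h3
          obtain ⟨v1', v2'⟩ := A.small_spec (by omega) hl h1' h2' h3'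
          rw [v1, v1'] at hMkl
          rw [v2, v2', hMkl]
          rcases L'.apart k (D.mem_unstarted.mpr ⟨hk, h2, h1⟩) l
            (D.mem_unstarted.mpr ⟨hl, h2', h1'⟩) hkl hMkl with h | h
          · left; linarith
          · right; linarith

/-- The real schedule is feasible. -/
theorem inv (hp : ∀ k, 0 < p k) (hr : Monotone r) (hr0 : ∀ k, 0 ≤ r k) (hrho : rho < m) (j : ℕ)
    (hj : j ≤ n + 1) : A.Inv j := by
  induction j with
  | zero => exact ⟨by simp, by simp, by simp, by simp⟩
  | succ j ih => exact A.inv_succ hp hr hr0 hrho (by omega) (ih (by omega))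

/-- The plan is not revised in the past. -/
theorem stable (hp : ∀ k, 0 < p k) (hrho : rho < m) {j k : ℕ} (hj : j ≤ n) (hk : k < j)
    (h : A.s j k < r j ∨ A.s (j + 1) k < r j) :
    A.s (j + 1) k = A.s j k ∧ A.M (j + 1) k = A.M j k := by
  by_cases hf : A.fixed (j + 1) k
  · obtain ⟨-, h2, -⟩ := A.fixed_succ hp hj (by omega) hf
    exact ⟨h2.2, h2.1⟩
  · exfalso
    have h1 : r j ≤ A.s (j + 1) k := A.time_le hp hrho (j := j + 1) (by omega) (by omega) hf
    have h2 := h.resolve_right (not_lt.mpr h1)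
    have hfb : ¬ A.fb (j + 1) k := fun h => hf (Or.inl h)
    have hfb0 : ¬ A.fb j k := fun h => hfb ((A.fb_succ j hj k hk).mpr (Or.inl h))
    by_cases hs : Small m κ p j k
    · have hfs : ¬ D.fs (j + 1) k := fun h => hf (Or.inr ⟨hs.mono hp (by omega), h⟩)
      have h3 := fun h => hfs (D.fs_of_lt hj hk hs h)
      have h4 : ¬ D.fs j k := fun h => hfs (D.fs_mono hj hk h)
      obtain ⟨-, v2⟩ := A.small_spec (by omega) hk hs h4 hfb0
      linarith [A.lag_nonneg j (D.nu j k), not_lt.mp h3]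
    · have hb : ¬ A.begins j k := fun h => hfb ((A.fb_succ j hj k hk).mpr (Or.inr h))
      have h3 : D.a (j + 1) (A.bm k) ≤ A.u j k := by
        by_contra hc; exact hb ⟨hfb0, hs, not_le.mp hc⟩
      have h4 := (A.wait_spec (by omega) hk ⟨hfb0, hs⟩).2.1
      rw [D.a_succ j hj _ (A.bm_lt hrho (by omega))] at h3
      linarith [le_max_right 0 (r j - D.e j (A.bm k))]

end Actual

end

/-! ### Volumes, numbers of jobs and offline schedules -/

/-- Abel summation: weights whose sums over the smallest sizes are nonnegative keep a nonnegative
sum after division by the sizes. -/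
theorem sum_div_le_of_prefix {ι : Type*} (p f : ι → ℝ) (S : Finset ι) (hp : ∀ i ∈ S, 0 < p i)
    (h : ∀ i ∈ S, 0 ≤ ∑ l ∈ S with p l ≤ p i, f l) (x : ℝ) (hx : ∀ i ∈ S, p i ≤ x) :
    (∑ i ∈ S, f i) / x ≤ ∑ i ∈ S, f i / p i := by
  classical
  induction S using Finset.strongInduction generalizing x with
  | H S ih =>
    rcases S.eq_empty_or_nonempty with rfl | hS
    · simp
    obtain ⟨i, hi, hmax⟩ := Finset.exists_max_image S p hS
    have h1 : 0 ≤ ∑ l ∈ S, f l := by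
      have := h i hi
      rwa [Finset.filter_true_of_mem hmax] at this
    have h2 : (∑ l ∈ S with p l < p i, f l) / p i ≤ ∑ l ∈ S with p l < p i, f l / p l := by
      refine ih _ (Finset.filter_ssubset.mpr ⟨i, hi, lt_irrefl (p i)⟩)
        (fun l hl => hp l (Finset.mem_filter.mp hl).1) (fun l hl => ?_) (p i)
        fun l hl => le_of_lt (Finset.mem_filter.mp hl).2
      obtain ⟨q1, q2⟩ := Finset.mem_filter.mp hl
      have := h l q1
      rwa [Finset.filter_filter, Finset.filter_congr (q := fun k => p k ≤ p l)]
      exact fun k _ => ⟨And.right, fun hk => ⟨hk.trans_lt q2, hk⟩⟩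
    have h3 : (∑ l ∈ S with ¬ p l < p i, f l) / p i = ∑ l ∈ S with ¬ p l < p i, f l / p l := by
      rw [Finset.sum_div]
      refine Finset.sum_congr rfl fun l hl => ?_
      obtain ⟨q1, q2⟩ := Finset.mem_filter.mp hl
      rw [le_antisymm (hmax l q1) (not_lt.mp q2)]
    calc (∑ l ∈ S, f l) / x ≤ (∑ l ∈ S, f l) / p i :=
          div_le_div_of_nonneg_left h1 (hp i hi) (hx i hi)
      _ ≤ _ := by
          rw [← Finset.sum_filter_add_sum_filter_not S (fun l => p l < p i),
            ← Finset.sum_filter_add_sum_filter_not S (fun l => p l < p i) fun l => f l / p l,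
            add_div, h3]
          exact add_le_add_left h2 _

/-- Comparison of cardinalities by volumes: if for every bound on the size the jobs of `W` have at
most the volume of those of `B`, up to `c` jobs of the size of `i₀`, then `W` has at most `c` more
elements than `B`. -/
theorem card_le_card_add_of_volume {S W B : Finset ℕ} (hW : W ⊆ S) (hB : B ⊆ S) {p : ℕ → ℝ}
    (hp : ∀ k, 0 < p k) {i₀ : ℕ} (hi₀ : i₀ ∈ S) {c : ℝ}
    (h : ∀ i ∈ S, ∑ k ∈ W with p k ≤ p i, p k ≤
      ∑ k ∈ B with p k ≤ p i, p k + if p i₀ ≤ p i then c * p i₀ else 0) :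
    (W.card : ℝ) ≤ B.card + c := by
  classical
  -- the volumes of `B` and of the extra jobs, minus that of `W`; dividing by the sizes counts jobs
  set f : ℕ → ℝ := fun k => (if k ∈ B then p k else 0) + (if k = i₀ then c * p i₀ else 0) -
    if k ∈ W then p k else 0 with hf
  have key := sum_div_le_of_prefix p f S (fun i _ => hp i) (fun i hi => ?_) (∑ k ∈ S, p k)
    fun i hi => Finset.single_le_sum (fun k _ => (hp k).le) hi
  · have e1 : ∑ i ∈ S, f i / p i = B.card + c - W.card := by
      have : ∀ i ∈ S, f i / p i = (if i ∈ B then 1 else 0) + (if i = i₀ then c else 0) -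
          if i ∈ W then 1 else 0 := by
        intro i _
        have := (hp i).ne'
        simp only [hf]
        by_cases h1 : i = i₀
        · subst h1; split_ifs <;> field_simp <;> ring
        · simp only [h1, if_false]; split_ifs <;> field_simp <;> ring
      rw [Finset.sum_congr rfl this, Finset.sum_sub_distrib, Finset.sum_add_distrib,
        Finset.sum_ite_eq' S i₀, if_pos hi₀, Finset.sum_ite_mem, Finset.sum_ite_mem,
        Finset.inter_eq_right.mpr hB, Finset.inter_eq_right.mpr hW]
      simp
    have e2 : 0 ≤ (∑ i ∈ S, f i) / ∑ k ∈ S, p k := by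
      refine div_nonneg ?_ (Finset.sum_nonneg fun k _ => (hp k).le)
      obtain ⟨i, hi, hmax⟩ := Finset.exists_max_image S p ⟨i₀, hi₀⟩
      have := h i hi
      rw [Finset.filter_true_of_mem fun k hk => hmax k (hW hk),
        Finset.filter_true_of_mem fun k hk => hmax k (hB hk), if_pos (hmax i₀ hi₀)] at this
      simp only [hf]
      rw [Finset.sum_sub_distrib, Finset.sum_add_distrib, Finset.sum_ite_eq' S i₀, if_pos hi₀,
        Finset.sum_ite_mem, Finset.sum_ite_mem, Finset.inter_eq_right.mpr hB,
        Finset.inter_eq_right.mpr hW]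
      linarith
    linarith
  · have hs : ∀ T ⊆ S, (S.filter fun k => p k ≤ p i) ∩ T = T.filter fun k => p k ≤ p i := by
      intro T hT
      ext k
      simp only [Finset.mem_inter, Finset.mem_filter]
      exact ⟨fun h => ⟨h.2, h.1.2⟩, fun h => ⟨⟨hT h.1, h.2⟩, h.1⟩⟩
    simp only [hf]
    rw [Finset.sum_sub_distrib, Finset.sum_add_distrib, Finset.sum_ite_eq', Finset.sum_ite_mem,
      Finset.sum_ite_mem, hs B hB, hs W hW]
    have := h i hi
    simp only [Finset.mem_filter, hi₀, true_and]
    linarith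

/-- The integral over time of the number of active intervals is their total length. -/
theorem integral_sum_indicator_Ico (S : Finset ℕ) (a b : ℕ → ℝ) (h : ∀ k ∈ S, a k ≤ b k) :
    Integrable (fun t => ∑ k ∈ S, (Set.Ico (a k) (b k)).indicator (fun _ => (1 : ℝ)) t) volume ∧
    ∫ t, ∑ k ∈ S, (Set.Ico (a k) (b k)).indicator (fun _ => (1 : ℝ)) t =
      ∑ k ∈ S, (b k - a k) := by
  have hi : ∀ k ∈ S, Integrable ((Set.Ico (a k) (b k)).indicator fun _ => (1 : ℝ)) volume :=
    fun k _ => (integrable_indicator_iff measurableSet_Ico).mpr (by simp)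
  refine ⟨integrable_finsetSum S hi, ?_⟩
  rw [integral_finsetSum S hi]
  refine Finset.sum_congr rfl fun k hk => ?_
  rw [integral_indicator measurableSet_Ico]
  simp [h k hk]

/-- An inequality between numbers of active intervals gives one between the total lengths. -/
theorem sum_length_le {S S' S'' : Finset ℕ} {a b a' b' a'' b'' : ℕ → ℝ} {q : ℝ}
    (h0 : ∀ k ∈ S, a k ≤ b k) (h1 : ∀ k ∈ S', a' k ≤ b' k) (h2 : ∀ k ∈ S'', a'' k ≤ b'' k)
    (h : ∀ t, ((S.filter fun k => a k ≤ t ∧ t < b k).card : ℝ) ≤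
      (S'.filter fun k => a' k ≤ t ∧ t < b' k).card +
        q * (S''.filter fun k => a'' k ≤ t ∧ t < b'' k).card) :
    ∑ k ∈ S, (b k - a k) ≤ ∑ k ∈ S', (b' k - a' k) + q * ∑ k ∈ S'', (b'' k - a'' k) := by
  have cnt : ∀ (S : Finset ℕ) (a b : ℕ → ℝ) (t : ℝ),
      ((S.filter fun k => a k ≤ t ∧ t < b k).card : ℝ) =
      ∑ k ∈ S, (Set.Ico (a k) (b k)).indicator (fun _ => (1 : ℝ)) t := by
    intro S a b t
    rw [Finset.card_filter]
    push_cast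
    exact Finset.sum_congr rfl fun k _ => by simp [Set.indicator_apply, Set.mem_Ico]
  obtain ⟨i0, e0⟩ := integral_sum_indicator_Ico S a b h0
  obtain ⟨i1, e1⟩ := integral_sum_indicator_Ico S' a' b' h1
  obtain ⟨i2, e2⟩ := integral_sum_indicator_Ico S'' a'' b'' h2
  rw [← e0, ← e1, ← e2, ← integral_const_mul, ← integral_add i1 (i2.const_mul q)]
  refine integral_mono i0 (i1.add (i2.const_mul q)) fun t => ?_
  have := h t
  rw [cnt, cnt, cnt] at this
  exact this

/-- The jobs that a preemptive schedule completes within a time window. -/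
theorem PreemptiveSchedule.sum_size_le {m k : ℕ} {J : Instance k} (S : PreemptiveSchedule m J)
    (a b : ℝ) : ∑ j with a ≤ J.release j ∧ S.completion j ≤ b, J.size j ≤ m * max 0 (b - a) := by
  classical
  set A := Finset.univ.filter fun j => a ≤ J.release j ∧ S.completion j ≤ b
  rw [← Finset.sum_fiberwise A S.machine]
  have : ∀ μ : Fin m, ∑ j ∈ A with S.machine j = μ, J.size j ≤ max 0 (b - a) := by
    intro μ
    have h1 : volume (⋃ j ∈ A.filter fun j => S.machine j = μ, S.run j) ≤
        volume (Set.Ico a b) := by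
      refine measure_mono (Set.iUnion₂_subset fun j hj => ?_)
      simp only [A, Finset.mem_filter, Finset.mem_univ, true_and] at hj
      exact (S.run_subset j).trans (Set.Ico_subset_Ico hj.1.1 hj.1.2)
    rw [measure_biUnion_finset, Real.volume_Ico, Finset.sum_congr rfl fun j _ => S.volume_run j,
      ← ENNReal.ofReal_sum_of_nonneg fun j _ => (J.size_pos j).le] at h1
    · rcases le_total (b - a) 0 with h2 | h2
      · rw [ENNReal.ofReal_eq_zero.mpr h2] at h1
        exact (ENNReal.ofReal_eq_zero.mp (le_antisymm h1 (zero_le))).trans (le_max_left _ _)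
      · exact ((ENNReal.ofReal_le_ofReal_iff h2).mp h1).trans (le_max_right _ _)
    · intro i hi j hj hij
      simp only [Finset.coe_filter, Set.mem_ofPred_eq] at hi hj
      exact S.disjoint_run i j hij (hi.2.trans hj.2.symm)
    · exact fun j _ => S.measurable_run j
  calc _ ≤ ∑ _μ : Fin m, max 0 (b - a) := Finset.sum_le_sum fun μ _ => this μ
    _ = _ := by simp

/-! ### The waiting time in the virtual schedule -/

section

namespace Virtual

variable {n m κ : ℕ} {r p : ℕ → ℝ} (D : Virtual n m κ r p)

/-- The small job `k` waits at time `t` in the final virtual schedule. -/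
def waitsAt (t : ℝ) (k : ℕ) : Prop :=
  Small m κ p n k ∧ r (avail m κ p k) ≤ t ∧ t < D.sig n k

/-- From time `s` to time `t`, a job of size at most `x` waits in the final virtual schedule. -/
def BusyFrom (t x s : ℝ) : Prop :=
  s ≤ t ∧ ∀ τ, s ≤ τ → τ ≤ t → ∃ k < n, D.waitsAt τ k ∧ p k ≤ x

/-- If a job of size at most `x` waits at `t`, there is a job whose availability is the earliest
from which such jobs wait through `t` without a gap. -/
theorem exists_busyFrom_min {t x : ℝ} {k : ℕ} (hk : k < n) (h : D.waitsAt t k) (hx : p k ≤ x) :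
    ∃ i < n, Small m κ p n i ∧ D.BusyFrom t x (r (avail m κ p i)) ∧ ∀ l < n, Small m κ p n l →
      D.BusyFrom t x (r (avail m κ p l)) → r (avail m κ p i) ≤ r (avail m κ p l) := by
  classical
  obtain ⟨i, hi, hmin⟩ := Finset.exists_min_image ((Finset.range n).filter fun i =>
    Small m κ p n i ∧ D.BusyFrom t x (r (avail m κ p i))) (fun i => r (avail m κ p i))
    ⟨k, by
      simp only [Finset.mem_filter, Finset.mem_range]
      exact ⟨hk, h.1, h.2.1, fun τ h1 h2 => ⟨k, hk, ⟨h.1, h1, h2.trans_lt h.2.2⟩, hx⟩⟩⟩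
  simp only [Finset.mem_filter, Finset.mem_range] at hi hmin
  exact ⟨i, hi.1, hi.2.1, hi.2.2, fun l h1 h2 h3 => hmin l ⟨h1, h2, h3⟩⟩

variable {D}

theorem BusyFrom.mono {t x y s : ℝ} (h : D.BusyFrom t x s) (hxy : x ≤ y) : D.BusyFrom t y s :=
  ⟨h.1, fun τ h1 h2 => by
    obtain ⟨k, hk, q1, q2⟩ := h.2 τ h1 h2
    exact ⟨k, hk, q1, q2.trans hxy⟩⟩

open Classical in
/-- While jobs of size at most `x` wait, every machine starts enough of them to be busy, except
for the end of at most one job that was started before. -/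
theorem le_started_volume (hp : ∀ k, 0 < p k) (I : D.Inv n) {θ : ℝ}
    (hθ : ∀ k < n, Small m κ p n k → p k ≤ θ) {t x s : ℝ} (h : D.BusyFrom t x s) :
    m * max 0 (t - θ - s) ≤
      ∑ k ∈ Finset.range n with Small m κ p n k ∧ p k ≤ x ∧ s ≤ D.sig n k ∧ D.sig n k ≤ t, p k := by
  set S := (Finset.range n).filter fun k =>
    Small m κ p n k ∧ p k ≤ x ∧ s ≤ D.sig n k ∧ D.sig n k ≤ t with hS
  -- a machine is busy throughout, and from `s + θ` on with jobs that were started after `s`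
  have key : ∀ μ ∈ Finset.range m, max 0 (t - θ - s) ≤ ∑ k ∈ S with D.nu n k = μ, p k := by
    intro μ hμ
    refine max_le (Finset.sum_nonneg fun k _ => (hp k).le) ?_
    have := length_le_of_cover (P := S.filter fun k => D.nu n k = μ) (σ := D.sig n) (p := p)
      (x := s + θ) (y := t) (fun k _ => (hp k).le) fun τ h1 h2 => ?_
    · linarith
    have hθ0 : 0 ≤ θ := by
      obtain ⟨k, hk, q1, q2⟩ := h.2 t h.1 le_rfl
      exact (hp k).le.trans (hθ k hk q1.1)
    obtain ⟨k, hk, q1, q2⟩ := h.2 τ (by linarith) h2.le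
    obtain ⟨l, hl, b1, b2, b3, b4⟩ := I.busy k hk q1.1 τ q1.2.1 q1.2.2 μ (Finset.mem_range.mp hμ)
    have hsl : s ≤ D.sig n l := by linarith [hθ l hl b1]
    refine ⟨l, ?_, b3, b4⟩
    obtain ⟨i, hi, c1, c2⟩ := h.2 (D.sig n l) hsl (by linarith)
    simp only [hS, Finset.mem_filter, Finset.mem_range]
    exact ⟨⟨hl, b1, (I.order i hi l hl c1.1 b1 c1.2.1 c1.2.2).trans c2, hsl, by linarith⟩, b2⟩
  have h1 := Finset.sum_le_sum key
  rw [Finset.sum_const, Finset.card_range, nsmul_eq_mul,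
    Finset.sum_fiberwise_of_maps_to fun k hk => ?_] at h1
  · exact h1
  · simp only [hS, Finset.mem_filter, Finset.mem_range] at hk ⊢
    exact I.lt k hk.1 hk.2.1

/-- The jobs that are not available in the virtual schedule before time `s`, although they are
released by then. -/
def hidden (m κ n : ℕ) (r p : ℕ → ℝ) (s : ℝ) (k : ℕ) : Prop :=
  r k < s ∧ ¬ (Small m κ p n k ∧ r (avail m κ p k) < s)

open Classical in
/-- The waiting jobs of size at most `x` have at most the volume of those that are alive in the
offline schedule with completion times `c`, at a time earlier by `θ`, and the hidden ones. -/
theorem waiting_volume_le (hp : ∀ k, 0 < p k) (hr : Monotone r) (I : D.Inv n) {θ : ℝ}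
    (hθ : ∀ k < n, Small m κ p n k → p k ≤ θ) {c : ℕ → ℝ}
    (hc : ∀ a b, ∑ k ∈ Finset.range n with a ≤ r k ∧ c k ≤ b, p k ≤ m * max 0 (b - a))
    {t x : ℝ} {i : ℕ} (hi : i < n) (h : D.BusyFrom t x (r (avail m κ p i)))
    (hmin : ∀ l < n, Small m κ p n l →
      D.BusyFrom t x (r (avail m κ p l)) → r (avail m κ p i) ≤ r (avail m κ p l)) :
    ∑ k ∈ (Finset.range n).filter (D.waitsAt t) with p k ≤ x, p k ≤
      ∑ k ∈ (Finset.range n).filter (fun k => r k ≤ t ∧ t < c k + θ) with p k ≤ x, p k +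
      ∑ k ∈ (Finset.range n).filter (hidden m κ n r p (r (avail m κ p i))) with p k ≤ x, p k := by
  set s := r (avail m κ p i)
  have h1 := le_started_volume hp I hθ h
  have h2 := hc s (t - θ)
  -- the comparison holds job by job
  have h3 : ∑ k ∈ (Finset.range n).filter (D.waitsAt t) with p k ≤ x, p k +
      ∑ k ∈ Finset.range n with Small m κ p n k ∧ p k ≤ x ∧ s ≤ D.sig n k ∧ D.sig n k ≤ t, p k ≤
      ∑ k ∈ (Finset.range n).filter (fun k => r k ≤ t ∧ t < c k + θ) with p k ≤ x, p k +
      ∑ k ∈ Finset.range n with s ≤ r k ∧ c k ≤ t - θ, p k +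
      ∑ k ∈ (Finset.range n).filter (hidden m κ n r p s) with p k ≤ x, p k := by
    simp only [Finset.filter_filter]
    simp only [Finset.sum_filter, ← Finset.sum_add_distrib]
    refine Finset.sum_le_sum fun k hk => ?_
    have hk : k < n := Finset.mem_range.mp hk
    have hpk := (hp k).le
    have g1 : 0 ≤ if (r k ≤ t ∧ t < c k + θ) ∧ p k ≤ x then p k else 0 := by split_ifs <;> linarith
    have g2 : 0 ≤ if s ≤ r k ∧ c k ≤ t - θ then p k else 0 := by split_ifs <;> linarith
    have g3 : 0 ≤ if hidden m κ n r p s k ∧ p k ≤ x then p k else 0 := by split_ifs <;> linarith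
    -- a released job of size at most `x` that is not started before `s`
    have cover : p k ≤ x → r k ≤ t → (Small m κ p n k → s ≤ D.sig n k) →
        p k ≤ (if (r k ≤ t ∧ t < c k + θ) ∧ p k ≤ x then p k else 0) +
        (if s ≤ r k ∧ c k ≤ t - θ then p k else 0) +
        if hidden m κ n r p s k ∧ p k ≤ x then p k else 0 := by
      intro q1 q2 q3
      by_cases q4 : t < c k + θ
      · rw [if_pos ⟨⟨q2, q4⟩, q1⟩]; linarith
      by_cases q5 : s ≤ r k
      · rw [if_pos (show s ≤ r k ∧ c k ≤ t - θ from ⟨q5, by linarith⟩)]; linarith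
      have q6 : hidden m κ n r p s k := by
        refine ⟨not_le.mp q5, fun q6 => ?_⟩
        refine absurd (hmin k hk q6.1 ⟨q6.2.le.trans h.1, fun τ a1 a2 => ?_⟩) (not_le.mpr q6.2)
        rcases lt_or_ge τ s with a3 | a3
        · exact ⟨k, hk, ⟨q6.1, a1, a3.trans_le (q3 q6.1)⟩, q1⟩
        · exact h.2 τ a3 a2
      rw [if_pos (show hidden m κ n r p s k ∧ p k ≤ x from ⟨q6, q1⟩)]; linarith
    have rel : Small m κ p n k → r k ≤ r (avail m κ p k) := fun q => by
      obtain ⟨n, rfl⟩ : ∃ n', n = n' + 1 := ⟨n - 1, by omega⟩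
      exact hr (avail_spec (by omega) q).1
    by_cases w : D.waitsAt t k ∧ p k ≤ x
    · rw [if_pos w, if_neg fun q => absurd q.2.2.2 (not_le.mpr w.1.2.2), add_zero]
      exact cover w.2 ((rel w.1.1).trans w.1.2.1) fun _ => h.1.trans w.1.2.2.le
    · rw [if_neg w, zero_add]
      by_cases w' : Small m κ p n k ∧ p k ≤ x ∧ s ≤ D.sig n k ∧ D.sig n k ≤ t
      · rw [if_pos w']
        exact cover w'.2.1 ((rel w'.1).trans ((I.rel_le k hk w'.1).trans w'.2.2.2))
          fun _ => w'.2.2.1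
      · rw [if_neg w']; linarith
  linarith

/-- The released volume is small in comparison with every hidden job. -/
theorem released_volume_le_of_hidden (hp : ∀ k, 0 < p k) (hr : Monotone r) {s : ℝ} {k : ℕ}
    (hk : k < n) (h : hidden m κ n r p s k) :
    ∑ l ∈ Finset.range n with r l < s, p l ≤ 2 ^ κ * (m * p k) := by
  classical
  -- the last job that is released before `s`
  obtain ⟨i, hi, hmax⟩ := Finset.exists_max_image ((Finset.range n).filter fun l => r l < s) id
    ⟨k, by simp [hk, h.1]⟩
  simp only [Finset.mem_filter, Finset.mem_range, id] at hi hmax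
  have h1 : (Finset.range n).filter (fun l => r l < s) = Finset.range (i + 1) := by
    ext l
    simp only [Finset.mem_filter, Finset.mem_range]
    exact ⟨fun q => Nat.lt_succ_of_le (hmax l q),
      fun q => ⟨by omega, (hr (Nat.lt_succ_iff.mp q)).trans_lt hi.2⟩⟩
  rw [h1]
  by_contra hc
  have h2 : Small m κ p (i + 1) k := (not_le.mp hc).le
  obtain ⟨-, -, h3⟩ := avail_spec (hmax k ⟨hk, h.1⟩) h2
  exact h.2 ⟨h2.mono hp (by omega), (hr h3).trans_lt hi.2⟩

open Classical in
/-- The number of waiting jobs in the virtual schedule. -/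
theorem card_waiting_le (hp : ∀ k, 0 < p k) (hr : Monotone r) (I : D.Inv n) {θ : ℝ}
    (hθ : ∀ k < n, Small m κ p n k → p k ≤ θ) {c : ℕ → ℝ}
    (hc : ∀ a b, ∑ k ∈ Finset.range n with a ≤ r k ∧ c k ≤ b, p k ≤ m * max 0 (b - a)) (t : ℝ) :
    (((Finset.range n).filter (D.waitsAt t)).card : ℝ) ≤
      ((Finset.range n).filter fun k => r k ≤ t ∧ t < c k + θ).card + 2 ^ κ *
      (((Finset.range n).filter (Small m κ p n)).filter
        fun k => D.sig n k ≤ t ∧ t < D.sig n k + p k).card := by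
  rcases ((Finset.range n).filter (D.waitsAt t)).eq_empty_or_nonempty with hW | ⟨k, hk⟩
  · rw [hW, Finset.card_empty, Nat.cast_zero]; positivity
  simp only [Finset.mem_filter, Finset.mem_range] at hk
  -- all machines are busy
  have hrun : (m : ℝ) ≤ (((Finset.range n).filter (Small m κ p n)).filter
      fun k => D.sig n k ≤ t ∧ t < D.sig n k + p k).card := by
    have : Finset.range m ⊆ (((Finset.range n).filter (Small m κ p n)).filter
        fun k => D.sig n k ≤ t ∧ t < D.sig n k + p k).image (D.nu n) := by
      intro μ hμ
      obtain ⟨l, hl, q1, q2, q3⟩ := I.busy k hk.1 hk.2.1 t hk.2.2.1 hk.2.2.2 μ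
        (Finset.mem_range.mp hμ)
      exact Finset.mem_image.mpr ⟨l, by simp [hl, q1, q3], q2⟩
    have := (Finset.card_le_card this).trans Finset.card_image_le
    rw [Finset.card_range] at this
    exact_mod_cast this
  have hex : ∀ i, (∃ k < n, D.waitsAt t k ∧ p k ≤ p i) → ∃ l < n, Small m κ p n l ∧
      D.BusyFrom t (p i) (r (avail m κ p l)) ∧ ∀ l' < n, Small m κ p n l' →
      D.BusyFrom t (p i) (r (avail m κ p l')) → r (avail m κ p l) ≤ r (avail m κ p l') :=
    fun i ⟨k, h1, h2, h3⟩ => D.exists_busyFrom_min h1 h2 h3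
  choose! b hb1 hb2 hb3 hb4 using hex
  set X := (Finset.range n).filter fun i => (∃ k < n, D.waitsAt t k ∧ p k ≤ p i) ∧
    ∃ k < n, p k ≤ p i ∧ hidden m κ n r p (r (avail m κ p (b i))) k with hX
  -- the smallest size for which there are hidden jobs
  obtain ⟨i₀, hi₀, hd⟩ : ∃ i₀ < n, ∀ i ∈ X, i₀ ∈ X ∧ p i₀ ≤ p i := by
    rcases X.eq_empty_or_nonempty with h | h
    · exact ⟨k, hk.1, by simp [h]⟩
    · obtain ⟨i₀, h1, h2⟩ := Finset.exists_min_image X p h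
      exact ⟨i₀, Finset.mem_range.mp (Finset.mem_filter.mp h1).1, fun i hi => ⟨h1, h2 i hi⟩⟩
  -- the hidden jobs have at most the volume of `2 ^ κ * m` jobs of size `p i₀`
  have key := card_le_card_add_of_volume (S := Finset.range n)
    (W := (Finset.range n).filter (D.waitsAt t))
    (B := (Finset.range n).filter fun k => r k ≤ t ∧ t < c k + θ) (Finset.filter_subset _ _)
    (Finset.filter_subset _ _) hp (Finset.mem_range.mpr hi₀) (c := 2 ^ κ * m) fun i hi => ?_
  · calc _ ≤ _ := key
      _ ≤ _ := by gcongr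
  rcases (((Finset.range n).filter (D.waitsAt t)).filter
    fun k => p k ≤ p i).eq_empty_or_nonempty with hWi | ⟨l, hl⟩
  · rw [hWi, Finset.sum_empty]
    have := hp i₀
    refine add_nonneg (Finset.sum_nonneg fun k _ => (hp k).le) ?_
    split_ifs <;> positivity
  simp only [Finset.mem_filter, Finset.mem_range] at hl
  have hi' : ∃ k < n, D.waitsAt t k ∧ p k ≤ p i := ⟨l, hl.1.1, hl.1.2, hl.2⟩
  refine (waiting_volume_le hp hr I hθ hc (hb1 i hi') (hb3 i hi') (hb4 i hi')).trans ?_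
  refine add_le_add_right ?_ _
  by_cases hiX : i ∈ X
  · obtain ⟨h1, h2⟩ := hd i hiX
    rw [if_pos h2]
    obtain ⟨-, h3, k', hk', q1, q2⟩ := Finset.mem_filter.mp h1
    have hs := hb4 i hi' (b i₀) (hb1 i₀ h3) (hb2 i₀ h3) ((hb3 i₀ h3).mono h2)
    have h4 := released_volume_le_of_hidden hp hr hk' q2
    calc _ ≤ ∑ l ∈ Finset.range n with r l < r (avail m κ p (b i₀)), p l := by
          refine Finset.sum_le_sum_of_subset_of_nonneg (fun l hl => ?_) fun l _ _ => (hp l).le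
          simp only [Finset.mem_filter, Finset.mem_range, hidden] at hl ⊢
          exact ⟨hl.1.1, hl.1.2.1.trans_le hs⟩
      _ ≤ 2 ^ κ * (m * p k') := h4
      _ ≤ 2 ^ κ * (m * p i₀) := by gcongr
      _ = _ := by ring
  · have : (((Finset.range n).filter (hidden m κ n r p (r (avail m κ p (b i))))).filter
        fun k => p k ≤ p i) = ∅ := by
      refine Finset.filter_eq_empty_iff.mpr fun l hl hli => hiX ?_
      simp only [Finset.mem_filter, Finset.mem_range] at hl
      exact Finset.mem_filter.mpr ⟨hi, hi', l, hl.1, hli, hl.2⟩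
    rw [this, Finset.sum_empty]
    have := hp i₀
    split_ifs <;> positivity

open Classical in
/-- The total waiting time of the small jobs in the virtual schedule, against an offline schedule
with completion times `c`. -/
theorem sum_wait_le (hp : ∀ k, 0 < p k) (hr : Monotone r) (I : D.Inv n) {θ : ℝ} (hθ0 : 0 ≤ θ)
    (hθ : ∀ k < n, Small m κ p n k → p k ≤ θ) {c : ℕ → ℝ} (hrc : ∀ k < n, r k ≤ c k)
    (hc : ∀ a b, ∑ k ∈ Finset.range n with a ≤ r k ∧ c k ≤ b, p k ≤ m * max 0 (b - a)) :
    ∑ k ∈ Finset.range n with Small m κ p n k, (D.sig n k - r (avail m κ p k)) ≤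
      ∑ k ∈ Finset.range n, (c k - r k) + n * θ + 2 ^ κ * vol p n := by
  have h := sum_length_le (S := (Finset.range n).filter (Small m κ p n)) (S' := Finset.range n)
    (S'' := (Finset.range n).filter (Small m κ p n)) (a := fun k => r (avail m κ p k))
    (b := D.sig n) (a' := r) (b' := fun k => c k + θ) (a'' := D.sig n)
    (b'' := fun k => D.sig n k + p k) (q := 2 ^ κ) (fun k hk => ?_) (fun k hk => ?_)
    (fun k _ => by linarith [hp k]) fun t => ?_
  · refine h.trans (add_le_add (le_of_eq ?_) ?_)
    · rw [Finset.sum_congr rfl fun k _ => show c k + θ - r k = (c k - r k) + θ by ring,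
        Finset.sum_add_distrib]
      simp
    · simp only [add_sub_cancel_left]
      gcongr
      exact Finset.sum_le_sum_of_subset_of_nonneg (Finset.filter_subset _ _) fun k _ _ => (hp k).le
  · simp only [Finset.mem_filter, Finset.mem_range] at hk
    exact I.rel_le k hk.1 hk.2
  · linarith [hrc k (Finset.mem_range.mp hk)]
  · have := card_waiting_le hp hr I hθ hc t
    rw [Finset.filter_filter]
    convert this using 4
    exact Iff.rfl

end Virtual

end

/-! ### The waiting time of the big jobs -/

section

/-- Every job is counted on at most one machine. -/
theorem sum_fiber_le {m j : ℕ} {p : ℕ → ℝ} (hp : ∀ k, 0 < p k) (P : ℕ → Prop) [DecidablePred P]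
    (g : ℕ → ℕ) : ∑ μ ∈ Finset.range m, ∑ k ∈ Finset.range j with P k ∧ g k = μ, p k ≤
      ∑ k ∈ Finset.range j with P k, p k := by
  simp only [← Finset.filter_filter]
  exact Finset.sum_fiberwise_le_sum_of_sum_fiber_nonneg fun _ _ =>
    Finset.sum_nonneg fun k _ => (hp k).le

theorem wrap_injOn {m a b c : ℕ} (ha : a < m) (hb : b < m)
    (h : wrap m (a + c) = wrap m (b + c)) : a = b := by
  unfold wrap at h; split_ifs at h <;> omega

namespace Virtual

variable {n m κ : ℕ} {r p : ℕ → ℝ} (D : Virtual n m κ r p)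

open Classical in
/-- If all groups were full, the jobs that are not small would have too much volume. -/
theorem exists_group (hp : ∀ k, 0 < p k) (hm : 1 ≤ m) {j : ℕ} (hj : j ≤ n) : ∃ g < m,
    ((Finset.range j).filter fun l => D.gr l = g ∧ ¬ Small m κ p (j + 1) l).card < 2 ^ κ := by
  by_contra hc
  push Not at hc
  set S := (Finset.range j).filter fun l => ¬ Small m κ p (j + 1) l with hS
  have h1 : m * 2 ^ κ ≤ S.card := by
    rw [Finset.card_eq_sum_card_fiberwise (f := D.gr) (t := Finset.range m)]
    · calc m * 2 ^ κ = ∑ _g ∈ Finset.range m, 2 ^ κ := by simp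
        _ ≤ _ := Finset.sum_le_sum fun g hg => (hc g (Finset.mem_range.mp hg)).trans_eq (by
          rw [hS, Finset.filter_filter]
          congr 1
          exact Finset.filter_congr fun l _ => and_comm)
    · intro l hl
      simp only [hS, Finset.coe_filter, Finset.mem_range, Set.mem_ofPred_eq] at hl
      simp only [Finset.coe_range, Set.mem_Iio]
      exact D.gr_lt l (by omega)
  have hV : 0 < vol p (j + 1) := by
    rw [vol_succ]
    exact add_pos_of_nonneg_of_pos (Finset.sum_nonneg fun k _ => (hp k).le) (hp j)
  have h2 : 0 < (2 : ℝ) ^ κ * m := by positivity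
  have h3 : S.Nonempty := Finset.card_pos.mp (lt_of_lt_of_le (by positivity) h1)
  have h4 : ∑ l ∈ S, vol p (j + 1) < ∑ l ∈ S, 2 ^ κ * m * p l := by
    refine Finset.sum_lt_sum_of_nonempty h3 fun l hl => ?_
    have := (Finset.mem_filter.mp hl).2
    unfold Small at this
    linarith
  have h5 : ∑ l ∈ S, p l ≤ vol p (j + 1) :=
    Finset.sum_le_sum_of_subset_of_nonneg ((Finset.filter_subset _ _).trans
      (Finset.range_mono (Nat.le_succ j))) fun k _ _ => (hp k).le
  rw [Finset.sum_const, nsmul_eq_mul, ← Finset.mul_sum] at h4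
  have h6 : (2 : ℝ) ^ κ * m ≤ S.card := by rw [mul_comm]; exact_mod_cast h1
  nlinarith

open Classical in
/-- First fit keeps the groups small. -/
theorem card_group_le (hp : ∀ k, 0 < p k) (hm : 1 ≤ m) {j : ℕ} (hj : j ≤ n + 1) (g : ℕ) :
    ((Finset.range j).filter fun l => D.gr l = g ∧ ¬ Small m κ p j l).card ≤ 2 ^ κ := by
  induction j with
  | zero => simp
  | succ j ih =>
    have mono : (Finset.range j).filter (fun l => D.gr l = g ∧ ¬ Small m κ p (j + 1) l) ⊆
        (Finset.range j).filter fun l => D.gr l = g ∧ ¬ Small m κ p j l := by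
      intro l
      simp only [Finset.mem_filter]
      exact fun h => ⟨h.1, h.2.1, fun q => h.2.2 (q.mono hp (Nat.le_succ j))⟩
    rw [Finset.range_add_one, Finset.filter_insert]
    split_ifs with h
    · have := D.gr_fit j (by omega) (D.exists_group hp hm (by omega))
      rw [h.1] at this
      exact (Finset.card_insert_le _ _).trans this
    · exact (Finset.card_le_card mono).trans (ih (by omega))

open Classical in
/-- Apart from its idle time, a machine is occupied by virtual work until the plan ends. -/
theorem sum_e_sub_a_le (hp : ∀ k, 0 < p k) {j : ℕ} (hj : j ≤ n + 1) (I : D.Inv j) :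
    ∑ μ ∈ Finset.range m, (D.e j μ - D.a j μ) ≤ vol p j := by
  calc ∑ μ ∈ Finset.range m, (D.e j μ - D.a j μ)
      ≤ ∑ μ ∈ Finset.range m, (∑ k ∈ Finset.range j with D.fs j k ∧ D.nu j k = μ, p k +
        ∑ k ∈ Finset.range j with (¬ D.fs j k ∧ Small m κ p j k) ∧ D.nu j k = μ, p k) := by
        refine Finset.sum_le_sum fun μ hμ => ?_
        have h1 := I.work_ge μ (Finset.mem_range.mp hμ)
        have h2 := (D.schedule j hj).load μ (Finset.mem_range.mp hμ)
        rw [unstarted, Finset.filter_filter] at h2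
        rw [h2]
        unfold work at h1
        linarith
    _ ≤ ∑ k ∈ Finset.range j with D.fs j k, p k +
        ∑ k ∈ Finset.range j with ¬ D.fs j k ∧ Small m κ p j k, p k := by
        rw [Finset.sum_add_distrib]
        exact add_le_add (sum_fiber_le hp _ _) (sum_fiber_le hp _ _)
    _ ≤ ∑ k ∈ Finset.range j with D.fs j k, p k +
        ∑ k ∈ Finset.range j with ¬ D.fs j k, p k := by
        refine add_le_add_right (Finset.sum_le_sum_of_subset_of_nonneg (fun k => ?_)
          fun k _ _ => (hp k).le) _
        simp only [Finset.mem_filter]; tauto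
    _ = vol p j := Finset.sum_filter_add_sum_filter_not _ _ _

end Virtual

namespace Actual

variable {n m κ : ℕ} {r p : ℕ → ℝ} {D : Virtual n m κ r p} {rho : ℕ} {K : ℕ → ℕ}
  (A : Actual D rho K)

/-- The time minus the free clock `max a Eb - W` of a machine. The wait of a big job is paid by the
growth of this quantity. -/
def slack (j μ : ℕ) : ℝ := lastTime r j - (max (D.a j μ) (A.Eb j μ) - A.W j μ)

open Classical in
/-- The value that `slack` takes when all planned work is done. -/
def finalSlack (j μ : ℕ) : ℝ := D.e j μ - D.a j μ + (A.W j μ +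
  ∑ k ∈ Finset.range j with A.waits j k ∧ A.bm k = μ, p k)

theorem slack_zero (μ : ℕ) : A.slack 0 μ = 0 := by
  simp [slack, lastTime, D.a_zero, A.Eb_zero, A.W_zero]

theorem beta_eq_slack {k : ℕ} (hk : k ≤ n) :
    A.beta k = r k - A.slack (k + 1) (A.bm k) + K k * p k := by
  rw [A.beta_eq k hk, slack, lastTime]; ring

theorem begun_sum_nonneg (hp : ∀ k, 0 < p k) (j μ : ℕ) : 0 ≤ ∑ k ∈ A.begun j μ, p k :=
  Finset.sum_nonneg fun k _ => (hp k).le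

/-- The slack does not decrease: between two releases, the free clock advances by at most the
elapsed time. -/
theorem slack_le_succ (hp : ∀ k, 0 < p k) (hr : Monotone r) (hr0 : ∀ k, 0 ≤ r k) {j μ : ℕ}
    (hj : j ≤ n) (hμ : μ < m) : A.slack j μ ≤ A.slack (j + 1) μ := by
  have hT : lastTime r (j + 1) = r j := rfl
  have h0 := lastTime_le hr hr0 j
  have he : lastTime r j ≤ D.e j μ :=
    (le_max_left _ _).trans (D.base_le_e hp (by omega) hμ)
  have ha : D.a (j + 1) μ ≤ D.a j μ + (r j - lastTime r j) := by
    rw [D.a_succ j hj μ hμ]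
    exact add_le_add_right (max_le (by linarith) (by linarith)) _
  have hW := A.W_succ' hj μ
  have hb := A.begun_sum_nonneg hp j μ
  have h1 := le_max_left (D.a j μ) (A.Eb j μ)
  have h2 := le_max_right (D.a j μ) (A.Eb j μ)
  have key : max (D.a (j + 1) μ) (A.Eb (j + 1) μ) ≤
      max (D.a j μ) (A.Eb j μ) + (r j - lastTime r j) + ∑ k ∈ A.begun j μ, p k := by
    refine max_le (by linarith) ?_
    rcases (A.Eb_succ j hj).eq μ with h | ⟨k, hk, q1, q2, q3⟩
    · linarith
    · have h3 := Finset.single_le_sum (f := p) (fun k _ => (hp k).le)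
        (A.mem_begun.mpr ⟨hk, q1, q2⟩)
      have h4 := q1.2.2
      rw [q2] at h4
      linarith
  unfold slack
  linarith

/-- When a big job is started, its delay is covered by its trigger clock. -/
theorem start_le_of_begins (hp : ∀ k, 0 < p k) (hrho : rho < m) {j k : ℕ} (hj : j ≤ n)
    (hk : k < j) (h : A.begins j k) : A.s j k ≤ A.slack (j + 1) (A.bm k) + A.beta k := by
  classical
  have hb := A.bm_lt hrho (k := k) (by omega)
  obtain ⟨w1, w2, -⟩ := A.wait_spec (by omega) hk h.waits
  have hle := A.le_u hp (by omega) hk h.waits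
  have h1 := (le_max_left _ _).trans hle
  have h2 := (le_max_right _ _).trans hle
  have h3 := h.2.2
  have ha := D.a_succ j hj _ hb
  have hidle : D.e j (A.bm k) < r j := by
    by_contra hc
    rw [max_eq_left (by linarith)] at ha
    linarith
  rw [max_eq_right (by linarith)] at ha
  have hT : lastTime r (j + 1) = r j := rfl
  have hW := A.W_succ' hj (A.bm k)
  have hsub : insert k (A.ahead j k) ⊆ A.begun j (A.bm k) := by
    intro l hl
    rcases Finset.mem_insert.mp hl with rfl | hl
    · exact A.mem_begun.mpr ⟨hk, h, rfl⟩
    · obtain ⟨q1, q2, q3, q4⟩ := A.mem_ahead.mp hl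
      have := A.u_add_le hp (by omega) q1 hk q2 h.waits q3 q4
      refine A.mem_begun.mpr ⟨q1, ⟨q2.1, q2.2, ?_⟩, q3⟩
      rw [q3]; linarith [hp l]
  have hkn : k ∉ A.ahead j k := fun hm => (A.mem_ahead.mp hm).2.2.2.irrefl
  have hnn : ∀ i ∈ A.begun j (A.bm k), i ∉ insert k (A.ahead j k) → 0 ≤ p i :=
    fun i _ _ => (hp i).le
  have hs1 := Finset.sum_le_sum_of_subset_of_nonneg hsub hnn
  rw [Finset.sum_insert hkn] at hs1
  -- the clock at which the started work ends, minus the work that is started with it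
  have key : max (D.a (j + 1) (A.bm k)) (A.Eb (j + 1) (A.bm k)) ≤
      D.a (j + 1) (A.bm k) - ∑ l ∈ A.ahead j k, p l + ∑ l ∈ A.begun j (A.bm k), p l := by
    refine max_le (by linarith [hp k]) ?_
    rcases (A.Eb_succ j hj).eq (A.bm k) with h | ⟨l, hl, q1, q2, q3⟩
    · linarith [hp k]
    · by_cases hla : l ∈ A.ahead j k
      · obtain ⟨-, -, -, q4⟩ := A.mem_ahead.mp hla
        have := A.u_add_le hp (by omega) hl hk ⟨q1.1, q1.2.1⟩ h.waits q2 q4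
        linarith [hp k]
      · have hs2 := Finset.sum_le_sum_of_subset_of_nonneg (f := p) (s := insert l (A.ahead j k))
          (t := A.begun j (A.bm k)) (Finset.insert_subset (A.mem_begun.mpr ⟨hl, q1, q2⟩)
          ((Finset.subset_insert _ _).trans hsub)) fun i _ _ => (hp i).le
        rw [Finset.sum_insert hla] at hs2
        have := q1.2.2
        rw [q2] at this
        linarith
  unfold slack
  rw [w2, w1]
  linarith

/-- A big job that is not started waits no longer than its trigger clock allows. -/
theorem time_le_of_not_begins (hp : ∀ k, 0 < p k) {j k : ℕ} (hj : j ≤ n) (hk : k < j)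
    (hw : A.waits j k) (h : ¬ A.begins j k) : r j ≤ A.slack (j + 1) (A.bm k) + A.beta k := by
  have := A.clocks_step hp hj (A.clocks hp j (by omega)) hk hw h
  have hT : lastTime r (j + 1) = r j := rfl
  unfold slack
  linarith

open Classical in
/-- A job that still waits in the final plan starts when its trigger clock allows, all planned work
of its machine being counted. -/
theorem start_le_of_waits (hp : ∀ k, 0 < p k) {j k : ℕ} (hj : j ≤ n + 1) (hk : k < j)
    (hw : A.waits j k) : A.s j k ≤ A.finalSlack j (A.bm k) + A.beta k := by
  obtain ⟨w1, w2, -⟩ := A.wait_spec hj hk hw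
  rw [w2, w1, finalSlack]
  have : ∑ l ∈ A.ahead j k, p l ≤
      ∑ l ∈ Finset.range j with A.waits j l ∧ A.bm l = A.bm k, p l := by
    refine Finset.sum_le_sum_of_subset_of_nonneg (fun l hl => ?_) fun l _ _ => (hp l).le
    obtain ⟨q1, q2, q3, -⟩ := A.mem_ahead.mp hl
    simp [q1, q2, q3]
  linarith

theorem waits_of_le (hp : ∀ k, 0 < p k) {i j k : ℕ} (hj : j ≤ n + 1) (hi : k < i) (hij : i ≤ j)
    (h : A.waits j k) : A.waits i k := by
  induction j, hij using Nat.le_induction with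
  | base => exact h
  | succ j hij ih => exact ih (by omega) (A.waits_of_succ hp (by omega) (by omega) h).1

theorem fb_of_le {i j k : ℕ} (hj : j ≤ n + 1) (hi : k < i) (hij : i ≤ j) (h : A.fb i k) :
    A.fb j k := by
  induction j, hij using Nat.le_induction with
  | base => exact h
  | succ j hij ih => exact (A.fb_succ j (by omega) k (by omega)).mpr (Or.inl (ih (by omega)))

/-- The event at which a started big job begins; its start is not changed afterwards. -/
theorem exists_begins {j k : ℕ} (hj : j ≤ n + 1) (hk : k < j) (h : A.fb j k) :
    ∃ i < j, k < i ∧ A.begins i k ∧ A.s j k = A.s i k ∧ A.u j k = A.u i k := by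
  induction j with
  | zero => omega
  | succ j ih =>
    have hs := (A.s_keep j (by omega) k (by omega) (Or.inl h)).2
    have hu := A.u_keep j (by omega) k (by omega) (Or.inl h)
    have hkj : k < j := by
      refine lt_of_le_of_ne (by omega) ?_
      rintro rfl
      exact A.fb_new k (by omega) h
    rcases (A.fb_succ j (by omega) k hkj).mp h with h' | h'
    · obtain ⟨i, h1, h2, h3, h4, h5⟩ := ih (by omega) hkj h'
      exact ⟨i, by omega, h2, h3, hs.trans h4, hu.trans h5⟩
    · exact ⟨j, by omega, hkj, h', hs, hu⟩

open Classical in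
/-- The growth of the slack of its machine while job `k` waits, through state `j`. -/
def growth (j k : ℕ) : ℝ := ∑ i ∈ Finset.range j with k < i ∧ A.waits i k,
  (A.slack (i + 1) (A.bm k) - A.slack i (A.bm k))

theorem growth_eq (hp : ∀ k, 0 < p k) {j k : ℕ} (hj : j ≤ n + 1) (hk : k < j) (h : A.waits j k) :
    A.growth (j + 1) k = A.slack (j + 1) (A.bm k) - A.slack (k + 1) (A.bm k) ∧
    A.growth j k = A.slack j (A.bm k) - A.slack (k + 1) (A.bm k) := by
  classical
  have e : ∀ i, k < i → i ≤ j + 1 →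
      A.growth i k = A.slack i (A.bm k) - A.slack (k + 1) (A.bm k) := by
    intro i hi hij
    rw [growth, ← Finset.sum_Ico_sub (fun i => A.slack i (A.bm k)) (show k + 1 ≤ i by omega)]
    refine Finset.sum_congr ?_ fun _ _ => rfl
    ext l
    simp only [Finset.mem_filter, Finset.mem_range, Finset.mem_Ico]
    exact ⟨fun h => ⟨h.2.1, h.1⟩, fun q => ⟨q.2, q.1, A.waits_of_le hp hj q.1 (by omega) h⟩⟩
  exact ⟨e _ (by omega) le_rfl, e _ hk (by omega)⟩

theorem growth_mono (hp : ∀ k, 0 < p k) (hr : Monotone r) (hr0 : ∀ k, 0 ≤ r k) (hrho : rho < m)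
    {i j k : ℕ} (hj : j ≤ n + 1) (hk : k ≤ n) (hij : i ≤ j) : A.growth i k ≤ A.growth j k := by
  classical
  refine Finset.sum_le_sum_of_subset_of_nonneg
    (Finset.filter_subset_filter _ (Finset.range_mono hij)) fun l hl _ => ?_
  simp only [Finset.mem_filter, Finset.mem_range] at hl
  linarith [A.slack_le_succ hp hr hr0 (j := l) (by omega) (A.bm_lt hrho hk)]

open Classical in
/-- The time at which job `k` leaves the waiting state: its start if it is started as a big job,
and otherwise the time at which it becomes small. -/
def leave (k : ℕ) : ℝ := if Small m κ p n k ∧ ¬ A.fb n k then r (avail m κ p k) else A.s n k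

theorem slack_le_finalSlack (hp : ∀ k, 0 < p k) {j μ : ℕ} (hj : j ≤ n + 1) (hμ : μ < m) :
    A.slack j μ ≤ A.finalSlack j μ := by
  classical
  have h1 : lastTime r j ≤ D.e j μ := (le_max_left _ _).trans (D.base_le_e hp hj hμ)
  have h2 := le_max_left (D.a j μ) (A.Eb j μ)
  have h3 : 0 ≤ ∑ k ∈ Finset.range j with A.waits j k ∧ A.bm k = μ, p k :=
    Finset.sum_nonneg fun k _ => (hp k).le
  unfold slack finalSlack
  linarith

open Classical in
/-- The waiting time of a big job is at most its random delay plus the growth of the slack of its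
machine while it waits. The last summand is the growth after the last release. -/
theorem leave_sub_le (hp : ∀ k, 0 < p k) (hr : Monotone r) (hr0 : ∀ k, 0 ≤ r k) (hrho : rho < m)
    {k : ℕ} (hk : k < n) : A.leave k - r k ≤ K k * p k + A.growth n k +
      if A.waits n k then A.finalSlack n (A.bm k) - A.slack n (A.bm k) else 0 := by
  have hb := A.bm_lt hrho hk.le
  have hK : (0 : ℝ) ≤ K k * p k := mul_nonneg (Nat.cast_nonneg _) (hp k).le
  have hβ := A.beta_eq_slack hk.le
  have hlast : 0 ≤ if A.waits n k then A.finalSlack n (A.bm k) - A.slack n (A.bm k) else 0 := by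
    split_ifs
    · linarith [A.slack_le_finalSlack hp (j := n) (by omega) hb]
    · exact le_rfl
  have hg : ∀ j < n, k < j → A.waits j k →
      A.slack (j + 1) (A.bm k) - A.slack (k + 1) (A.bm k) ≤ A.growth n k := fun j h1 h2 h3 => by
    rw [← (A.growth_eq hp (by omega) h2 h3).1]
    exact A.growth_mono hp hr hr0 hrho (by omega) hk.le h1
  have hg0 : 0 ≤ A.growth n k := by
    have := A.growth_mono hp hr hr0 hrho (i := 0) (j := n) (by omega) hk.le (Nat.zero_le _)
    simpa [growth] using this
  unfold leave
  split_ifs with h hw hw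
  · exact absurd h.1 hw.2
  · obtain ⟨N, rfl⟩ : ∃ N, n = N + 1 := ⟨n - 1, by omega⟩
    obtain ⟨a1, a2, a3⟩ := avail_spec (j := N) (by omega) h.1
    set j := avail m κ p k with hj
    rcases a1.eq_or_lt with a1 | a1
    · rw [← a1]; linarith
    have w : A.waits j k := by
      refine ⟨fun q => h.2 (A.fb_of_le (by omega) a1 (by omega) q), fun q => ?_⟩
      obtain ⟨i, hi⟩ : ∃ i, j = i + 1 := ⟨j - 1, by omega⟩
      rw [hi] at q
      have := (avail_spec (j := i) (by omega) q).2.2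
      omega
    have nb : ¬ A.begins j k := fun q => h.2 (A.fb_of_le (i := j + 1) (by omega) (by omega)
      (by omega) ((A.fb_succ j (by omega) k a1).mpr (Or.inr q)))
    linarith [A.time_le_of_not_begins hp (by omega) a1 w nb, hg j (by omega) a1 w]
  · rw [(A.growth_eq hp (by omega) hk hw).2]
    linarith [A.start_le_of_waits hp (by omega) hk hw]
  · have hfb : A.fb n k := by
      by_contra hc
      exact hw ⟨hc, fun q => h ⟨q, hc⟩⟩
    obtain ⟨j, h1, h2, h3, h4, -⟩ := A.exists_begins (by omega) hk hfb
    rw [h4]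
    linarith [A.start_le_of_begins hp hrho (by omega) h2 h3, hg j h1 h2 h3.waits]

open Classical in
/-- A machine has at most `2 ^ κ` waiting jobs, as the rotation maps different groups to different
machines. -/
theorem card_waits_le (hp : ∀ k, 0 < p k) (hm : 1 ≤ m) {j : ℕ} (hj : j ≤ n + 1)
    (μ : ℕ) : ((Finset.range j).filter fun k => A.waits j k ∧ A.bm k = μ).card ≤ 2 ^ κ := by
  rcases ((Finset.range j).filter fun k => A.waits j k ∧ A.bm k = μ).eq_empty_or_nonempty with
    h | ⟨i, hi⟩
  · rw [h]; simp
  refine le_trans (Finset.card_le_card fun k hk => ?_) (D.card_group_le hp hm hj (D.gr i))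
  simp only [Finset.mem_filter, Finset.mem_range] at hi hk ⊢
  refine ⟨hk.1, ?_, hk.2.1.2⟩
  have h1 := hk.2.2.trans hi.2.2.symm
  rw [A.bm_eq k (by omega), A.bm_eq i (by omega)] at h1
  exact wrap_injOn (D.gr_lt k (by omega)) (D.gr_lt i (by omega)) h1

open Classical in
theorem W_eq (j : ℕ) (hj : j ≤ n + 1) (μ : ℕ) :
    A.W j μ = ∑ k ∈ Finset.range j with A.fb j k ∧ A.bm k = μ, p k := by
  induction j with
  | zero => simp [A.W_zero]
  | succ j ih =>
    rw [A.W_succ' (by omega), ih (by omega), ← Finset.sum_union]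
    · refine Finset.sum_congr ?_ fun _ _ => rfl
      ext k
      simp only [Finset.mem_union, Finset.mem_filter, Finset.mem_range, A.mem_begun]
      constructor
      · rintro (⟨h1, h2, h3⟩ | ⟨h1, h2, h3⟩)
        · exact ⟨by omega, (A.fb_succ j (by omega) k h1).mpr (Or.inl h2), h3⟩
        · exact ⟨by omega, (A.fb_succ j (by omega) k h1).mpr (Or.inr h2), h3⟩
      · rintro ⟨h1, h2, h3⟩
        have hkj : k < j := by
          refine lt_of_le_of_ne (by omega) ?_
          rintro rfl
          exact A.fb_new k (by omega) h2
        rcases (A.fb_succ j (by omega) k hkj).mp h2 with h | h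
        · exact Or.inl ⟨hkj, h, h3⟩
        · exact Or.inr ⟨hkj, h, h3⟩
    · rw [Finset.disjoint_left]
      intro k hk hk'
      exact (A.mem_begun.mp hk').2.1.1 (Finset.mem_filter.mp hk).2.1

theorem sum_finalSlack_le (hp : ∀ k, 0 < p k) {j : ℕ} (hj : j ≤ n + 1) (I : D.Inv j) :
    ∑ μ ∈ Finset.range m, A.finalSlack j μ ≤ 2 * vol p j := by
  classical
  have h1 := D.sum_e_sub_a_le hp hj I
  have h2 : ∑ μ ∈ Finset.range m, (A.W j μ +
      ∑ k ∈ Finset.range j with A.waits j k ∧ A.bm k = μ, p k) ≤ vol p j := by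
    simp only [A.W_eq j hj]
    rw [Finset.sum_add_distrib]
    calc _ ≤ ∑ k ∈ Finset.range j with A.fb j k, p k + ∑ k ∈ Finset.range j with A.waits j k, p k :=
          add_le_add (sum_fiber_le hp _ _) (sum_fiber_le hp _ _)
      _ ≤ ∑ k ∈ Finset.range j with A.fb j k, p k + ∑ k ∈ Finset.range j with ¬ A.fb j k, p k := by
          refine add_le_add_right (Finset.sum_le_sum_of_subset_of_nonneg (fun k hk => ?_)
            fun k _ _ => (hp k).le) _
          simp only [Finset.mem_filter] at hk ⊢
          exact ⟨hk.1, hk.2.1⟩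
      _ = vol p j := Finset.sum_filter_add_sum_filter_not _ _ _
  unfold finalSlack
  rw [Finset.sum_add_distrib]
  linarith

/-- At most `2 ^ κ` jobs wait on a machine at a time, so that the waiting times of the big jobs
have a sum of at most `2 ^ κ` times the growth of the slacks. -/
theorem sum_leave_le (hp : ∀ k, 0 < p k) (hr : Monotone r) (hr0 : ∀ k, 0 ≤ r k) (hm : 1 ≤ m)
    (hrho : rho < m) (hK : ∀ k, K k ≤ 2 ^ κ) (I : D.Inv n) :
    ∑ k ∈ Finset.range n, (A.leave k - r k) ≤ 3 * (2 ^ κ * vol p n) := by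
  classical
  have bm_mem : ∀ j ≤ n, ∀ k ∈ (Finset.range j).filter (A.waits j), A.bm k ∈ Finset.range m :=
    fun j hj k hk => Finset.mem_range.mpr
      (A.bm_lt hrho (by have := Finset.mem_range.mp (Finset.mem_filter.mp hk).1; omega))
  -- a charge to the machines of the waiting jobs
  have charge : ∀ j ≤ n, ∀ f : ℕ → ℝ, (∀ μ < m, 0 ≤ f μ) →
      ∑ k ∈ Finset.range j with A.waits j k, f (A.bm k) ≤
        2 ^ κ * ∑ μ ∈ Finset.range m, f μ := by
    intro j hj f hf
    rw [← Finset.sum_fiberwise_of_maps_to (bm_mem j hj), Finset.mul_sum]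
    refine Finset.sum_le_sum fun μ hμ => ?_
    rw [Finset.sum_congr rfl fun k hk => by rw [(Finset.mem_filter.mp hk).2], Finset.sum_const,
      nsmul_eq_mul, Finset.filter_filter]
    have := A.card_waits_le hp hm (j := j) (by omega) μ
    exact mul_le_mul_of_nonneg_right (by exact_mod_cast this) (hf μ (Finset.mem_range.mp hμ))
  have h1 : ∑ k ∈ Finset.range n, K k * p k ≤ 2 ^ κ * vol p n := by
    rw [vol, Finset.mul_sum]
    refine Finset.sum_le_sum fun k _ => mul_le_mul_of_nonneg_right ?_ (hp k).le
    exact_mod_cast hK k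
  have h2 : ∑ k ∈ Finset.range n, A.growth n k ≤
      ∑ i ∈ Finset.range n, 2 ^ κ * ∑ μ ∈ Finset.range m, (A.slack (i + 1) μ - A.slack i μ) := by
    simp only [growth, Finset.sum_filter]
    rw [Finset.sum_comm]
    refine Finset.sum_le_sum fun i hi => ?_
    have hi := Finset.mem_range.mp hi
    refine le_trans (le_of_eq ?_) (charge i hi.le (fun μ => A.slack (i + 1) μ - A.slack i μ)
      fun μ hμ => by linarith [A.slack_le_succ hp hr hr0 (j := i) (by omega) hμ])
    rw [← Finset.sum_filter]
    refine Finset.sum_congr ?_ fun _ _ => rfl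
    ext k
    simp only [Finset.mem_filter, Finset.mem_range]
    exact ⟨fun h => h.2, fun h => ⟨by omega, h⟩⟩
  have h3 : ∑ k ∈ Finset.range n,
      (if A.waits n k then A.finalSlack n (A.bm k) - A.slack n (A.bm k) else 0) ≤
      2 ^ κ * ∑ μ ∈ Finset.range m, (A.finalSlack n μ - A.slack n μ) := by
    rw [← Finset.sum_filter]
    exact charge n le_rfl (fun μ => A.finalSlack n μ - A.slack n μ)
      fun μ hμ => by linarith [A.slack_le_finalSlack hp (j := n) (by omega) hμ]
  have h4 : ∑ i ∈ Finset.range n, 2 ^ κ * ∑ μ ∈ Finset.range m, (A.slack (i + 1) μ - A.slack i μ) +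
      2 ^ κ * ∑ μ ∈ Finset.range m, (A.finalSlack n μ - A.slack n μ) =
      2 ^ κ * ∑ μ ∈ Finset.range m, A.finalSlack n μ := by
    rw [← Finset.mul_sum, Finset.sum_comm, ← mul_add, ← Finset.sum_add_distrib]
    congr 1
    refine Finset.sum_congr rfl fun μ _ => ?_
    rw [Finset.sum_range_sub (fun i => A.slack i μ), A.slack_zero]
    ring
  have h5 := mul_le_mul_of_nonneg_left (A.sum_finalSlack_le hp (j := n) (by omega) I)
    (show (0 : ℝ) ≤ 2 ^ κ by positivity)
  calc _ ≤ ∑ k ∈ Finset.range n, (K k * p k + A.growth n k +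
        if A.waits n k then A.finalSlack n (A.bm k) - A.slack n (A.bm k) else 0) :=
        Finset.sum_le_sum fun k hk => A.leave_sub_le hp hr hr0 hrho (Finset.mem_range.mp hk)
    _ ≤ _ := by
        rw [Finset.sum_add_distrib, Finset.sum_add_distrib]
        linarith

end Actual

end

/-! ### The coupling of two trigger numbers and the lag -/

section

theorem MaxUpd.congr {j : ℕ} {P P' : ℕ → Prop} {c c' : ℕ → ℕ} {x x' f f' g g' : ℕ → ℝ} {μ : ℕ}
    (h : MaxUpd j P c x f g) (h' : MaxUpd j P' c' x' f' g') (hf : f μ = f' μ)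
    (hP : ∀ k < j, (P k ∧ c k = μ ↔ P' k ∧ c' k = μ)) (hx : ∀ k < j, P k → c k = μ → x k = x' k) :
    g μ = g' μ := by
  apply le_antisymm
  · rcases h.eq μ with q | ⟨k, hk, q1, q2, q3⟩
    · rw [q, hf]; exact h'.le μ
    · obtain ⟨w1, w2⟩ := (hP k hk).mp ⟨q1, q2⟩
      rw [q3, hx k hk q1 q2, ← w2]; exact h'.le_of k hk w1
  · rcases h'.eq μ with q | ⟨k, hk, q1, q2, q3⟩
    · rw [q, ← hf]; exact h.le μ
    · obtain ⟨w1, w2⟩ := (hP k hk).mpr ⟨q1, q2⟩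
      rw [q3, ← hx k hk w1 w2, ← w2]; exact h.le_of k hk w1

theorem Prec.congr {β β' : ℕ → ℝ} {k l : ℕ} (hk : β k = β' k) (hl : β l = β' l) :
    Prec β k l ↔ Prec β' k l := by
  unfold Prec; rw [hk, hl]

namespace Actual

section
variable {n m κ : ℕ} {r p : ℕ → ℝ} {D : Virtual n m κ r p} {rho : ℕ} {K K' : ℕ → ℕ}
  (A : Actual D rho K) (A' : Actual D rho K')

theorem bm_congr {k : ℕ} (hk : k ≤ n) : A.bm k = A'.bm k := by rw [A.bm_eq k hk, A'.bm_eq k hk]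

/-- Two schedules, for trigger numbers that differ at job `i` only, agree on the machine of `i`. -/
structure Coupled (i j : ℕ) : Prop where
  fb : ∀ l < j, A.bm l = A.bm i → (A.fb j l ↔ A'.fb j l)
  beta : ∀ l < j, l ≠ i → A.bm l = A.bm i → A.beta l = A'.beta l
  beta_le : i < j → A.beta i + p i ≤ A'.beta i
  W : A.W j (A.bm i) = A'.W j (A.bm i)
  Eb : A.Eb j (A.bm i) = A'.Eb j (A.bm i)

variable {A A'}

theorem Coupled.waits {i j l : ℕ} (C : A.Coupled A' i j) (hl : l < j) (hb : A.bm l = A.bm i) :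
    A.waits j l ↔ A'.waits j l := by
  unfold Actual.waits; rw [C.fb l hl hb]

/-- The clock of a job that precedes `i` is the same in both schedules. -/
theorem Coupled.u_eq {i j l : ℕ} (hp : ∀ k, 0 < p k) (hj : j ≤ n + 1) (C : A.Coupled A' i j)
    (hi : i ≤ n) (hl : l < j) (hli : l ≠ i) (hb : A.bm l = A.bm i) (hw : A.waits j l)
    (h : i < j → Prec A.beta l i) : A.u j l = A'.u j l := by
  have hb' : A'.bm l = A.bm i := (bm_congr A A' (by omega)).symm.trans hb
  rw [(A.wait_spec hj hl hw).1, (A'.wait_spec hj hl ((C.waits hl hb).mp hw)).1, hb, hb', C.W,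
    C.beta l hl hli hb]
  congr 1
  refine Finset.sum_congr (Finset.ext fun q => ?_) fun _ _ => rfl
  rw [A.mem_ahead, A'.mem_ahead]
  constructor
  · rintro ⟨q1, q2, q3, q4⟩
    have hqi : q ≠ i := by
      rintro rfl
      exact (q4.trans (h q1)).irrefl
    rw [hb] at q3
    exact ⟨q1, (C.waits q1 q3).mp q2, by rw [← bm_congr A A' (by omega), q3, hb'],
      (Prec.congr (C.beta q q1 hqi q3) (C.beta l hl hli hb)).mp q4⟩
  · rintro ⟨q1, q2, q3, q4⟩
    have q3' : A.bm q = A.bm i := by rw [bm_congr A A' (k := q) (by omega), q3, hb']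
    have hqi : q ≠ i := by
      rintro rfl
      have h1 := q4.le
      have h2 := (h q1).le
      rw [← C.beta l hl hli hb] at h1
      linarith [C.beta_le q1, hp q]
    exact ⟨q1, (C.waits q1 q3').mpr q2, q3'.trans hb.symm,
      (Prec.congr (C.beta q q1 hqi q3') (C.beta l hl hli hb)).mpr q4⟩

/-- In the second schedule, job `i` and the jobs that follow `i` in the first one are not planned
before the position of `i` in the first one. -/
theorem Coupled.le_u {i j l : ℕ} (hp : ∀ k, 0 < p k) (hj : j ≤ n + 1) (C : A.Coupled A' i j)
    (hij : i < j) (hw : A.waits j i) (hl : l < j) (hb : A.bm l = A.bm i) (hwl : A.waits j l)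
    (h : l = i ∨ Prec A.beta i l) :
    A.u j i + (if l = i then p i else 0) ≤ A'.u j l := by
  have hb' : A'.bm l = A.bm i := (bm_congr A A' (by omega)).symm.trans hb
  rw [(A.wait_spec hj hij hw).1, (A'.wait_spec hj hl ((C.waits hl hb).mp hwl)).1, hb', C.W]
  have hsub : A.ahead j i ⊆ A'.ahead j l := by
    intro q hq
    obtain ⟨q1, q2, q3, q4⟩ := A.mem_ahead.mp hq
    have hqi : q ≠ i := by
      rintro rfl
      exact q4.irrefl
    refine A'.mem_ahead.mpr ⟨q1, (C.waits q1 q3).mp q2,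
      by rw [← bm_congr A A' (by omega), q3, hb'], ?_⟩
    by_cases hli : l = i
    · subst hli
      left
      rw [← C.beta q q1 hqi q3]
      linarith [q4.le, C.beta_le hij, hp l]
    · exact (Prec.congr (C.beta q q1 hqi q3) (C.beta l hl hli hb)).mp
        (q4.trans (h.resolve_left hli))
  have h1 := Finset.sum_le_sum_of_subset_of_nonneg hsub fun k _ _ => (hp k).le
  have h2 : A.beta i + (if l = i then p i else 0) ≤ A'.beta l := by
    split_ifs with hli
    · rw [hli]; exact C.beta_le hij
    · rw [← C.beta l hl hli hb]; linarith [(h.resolve_left hli).le]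
  linarith

variable (A A')

theorem coupled_zero (i : ℕ) : A.Coupled A' i 0 where
  fb := by simp
  beta := by simp
  beta_le := by simp
  W := by rw [A.W_zero, A'.W_zero]
  Eb := by rw [A.Eb_zero, A'.Eb_zero]

variable {A A'}

/-- The jobs that are started at an event are the same, as long as `i` is not started in the first
schedule. -/
theorem Coupled.begins_iff {i j l : ℕ} (hp : ∀ k, 0 < p k) (hj : j ≤ n) (hi : i ≤ n)
    (C : A.Coupled A' i j) (hw : i < j → A.waits j i) (hnb : i < j → ¬ A.begins j i) (hl : l < j)
    (hb : A.bm l = A.bm i) : A.begins j l ↔ A'.begins j l := by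
  have hb' : A'.bm l = A.bm i := (bm_congr A A' (by omega)).symm.trans hb
  by_cases hwl : A.waits j l
  swap
  · exact ⟨fun h => absurd h.waits hwl, fun h => absurd ((C.waits hl hb).mpr h.waits) hwl⟩
  have hwl' := (C.waits hl hb).mp hwl
  by_cases hpr : l ≠ i ∧ (i < j → Prec A.beta l i)
  · have hu := C.u_eq hp (by omega) hi hl hpr.1 hb hwl hpr.2
    unfold begins
    rw [hu, C.fb l hl hb, hb, hb']
  · have hij : i < j := by
      by_contra hc
      exact hpr ⟨by rintro rfl; exact hc hl, fun h => absurd h hc⟩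
    have h : l = i ∨ Prec A.beta i l := by
      by_contra hc
      push Not at hc
      exact hpr ⟨hc.1, fun _ => (Prec.total hc.1).resolve_right hc.2⟩
    have hu : D.a (j + 1) (A.bm i) ≤ A.u j i := by
      by_contra hc
      exact hnb hij ⟨(hw hij).1, (hw hij).2, not_le.mp hc⟩
    constructor
    · intro q
      exfalso
      rcases h with rfl | h
      · exact hnb hij q
      · have h1 := A.u_add_le hp (by omega) hij hl (hw hij) hwl hb.symm h
        have h2 := q.2.2
        rw [hb] at h2
        linarith [hp i]
    · intro q
      exfalso
      have h1 := C.le_u hp (by omega) hij (hw hij) hl hb hwl h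
      have h2 := q.2.2
      rw [hb'] at h2
      have : 0 ≤ if l = i then p i else 0 := by split_ifs <;> linarith [hp i]
      linarith

/-- The coupling lasts as long as job `i` has not begun in the first schedule. -/
theorem Coupled.succ {i j : ℕ} (hp : ∀ k, 0 < p k) (hj : j ≤ n) (hi : i ≤ n)
    (hK : ∀ k, k ≠ i → K k = K' k) (hKi : K i < K' i) (C : A.Coupled A' i j)
    (hw : i < j → A.waits j i) (hnb : i < j → ¬ A.begins j i) : A.Coupled A' i (j + 1) := by
  have hbeg := fun l (hl : l < j) (hb : A.bm l = A.bm i) => C.begins_iff hp hj hi hw hnb hl hb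
  have hbm : ∀ l < j, (A'.bm l = A.bm i ↔ A.bm l = A.bm i) := fun l hl => by
    rw [bm_congr A A' (k := l) (by omega)]
  have hu : ∀ l < j, A.begins j l → A.bm l = A.bm i → A.u j l = A'.u j l := by
    intro l hl h hb
    have hli : l ≠ i := by
      rintro rfl
      exact hnb hl h
    refine C.u_eq hp (by omega) hi hl hli hb h.waits fun hij => ?_
    refine (Prec.total hli).resolve_right fun h1 => hnb hij ⟨(hw hij).1, (hw hij).2, ?_⟩
    have h2 := A.u_add_le hp (by omega) hij hl (hw hij) h.waits hb.symm h1
    have h3 := h.2.2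
    rw [hb] at h3
    linarith [hp i]
  have hW : A.W (j + 1) (A.bm i) = A'.W (j + 1) (A.bm i) := by
    rw [A.W_succ' hj, A'.W_succ' hj, C.W]
    congr 1
    refine Finset.sum_congr (Finset.ext fun l => ?_) fun _ _ => rfl
    rw [A.mem_begun, A'.mem_begun]
    constructor
    · rintro ⟨q1, q2, q3⟩
      exact ⟨q1, (hbeg l q1 q3).mp q2, (hbm l q1).mpr q3⟩
    · rintro ⟨q1, q2, q3⟩
      have q4 := (hbm l q1).mp q3
      exact ⟨q1, (hbeg l q1 q4).mpr q2, q4⟩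
  have hE : A.Eb (j + 1) (A.bm i) = A'.Eb (j + 1) (A.bm i) := by
    refine (A.Eb_succ j hj).congr (A'.Eb_succ j hj) C.Eb (fun l hl => ?_) fun l hl h1 h2 => ?_
    · constructor
      · rintro ⟨q1, q2⟩
        exact ⟨(hbeg l hl q2).mp q1, (hbm l hl).mpr q2⟩
      · rintro ⟨q1, q2⟩
        exact ⟨(hbeg l hl ((hbm l hl).mp q2)).mpr q1, (hbm l hl).mp q2⟩
    · rw [hu l hl h1 h2]
  refine ⟨fun l hl hb => ?_, fun l hl hli hb => ?_, fun hij => ?_, hW, hE⟩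
  · rcases (Nat.lt_succ_iff.mp hl).lt_or_eq with h | rfl
    · rw [A.fb_succ j hj l h, A'.fb_succ j hj l h, C.fb l h hb]
      have := hbeg l h hb
      unfold begins at this
      rw [C.fb l h hb] at this
      rw [this]
    · exact ⟨fun h => absurd h (A.fb_new l hj), fun h => absurd h (A'.fb_new l hj)⟩
  · rcases (Nat.lt_succ_iff.mp hl).lt_or_eq with h | rfl
    · exact C.beta l h hli hb
    · rw [A.beta_eq l hj, A'.beta_eq l hj, ← bm_congr A A' hj, hb, hW, hE, hK l hli]
  · rcases (Nat.lt_succ_iff.mp hij).lt_or_eq with h | rfl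
    · exact C.beta_le h
    · rw [A.beta_eq i hj, A'.beta_eq i hj, ← bm_congr A A' hj, hW, hE]
      have : (K i : ℝ) + 1 ≤ K' i := by exact_mod_cast hKi
      nlinarith [hp i]

variable (A A')

/-- Increasing the trigger number of a started big job moves its interval on the idle clock
to the right by at least its size. -/
theorem u_add_le_of_lt (hp : ∀ k, 0 < p k) {i j : ℕ} (hj : j ≤ n + 1) (hi : i < j)
    (hK : ∀ k, k ≠ i → K k = K' k) (hKi : K i < K' i) (h : A.fb j i) (h' : A'.fb j i) :
    A.u j i + p i ≤ A'.u j i := by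
  obtain ⟨J, hJ1, hJ2, hJ3, -, hJ4⟩ := A.exists_begins hj hi h
  obtain ⟨J', hJ1', hJ2', hJ3', -, hJ4'⟩ := A'.exists_begins hj hi h'
  rw [hJ4, hJ4']
  have hin : i ≤ n := by omega
  have hw : ∀ k ≤ J, i < k → A.waits k i := fun k h1 h2 =>
    A.waits_of_le hp (by omega) h2 h1 hJ3.waits
  have hnb : ∀ k < J, i < k → ¬ A.begins k i := fun k h1 h2 h3 => hJ3.1
    (A.fb_of_le (i := k + 1) (by omega) (by omega) h1
      ((A.fb_succ k (by omega) i h2).mpr (Or.inr h3)))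
  -- the schedules are coupled until `i` begins in the first one, at the event `J`, and the job
  -- begins in the second one at the same event or later
  have C : ∀ k ≤ J, A.Coupled A' i k := by
    intro k hk
    induction k with
    | zero => exact A.coupled_zero A' i
    | succ k ih =>
      exact (ih (by omega)).succ hp (by omega) hin hK hKi (hw k (by omega)) (hnb k (by omega))
  have hJJ : J ≤ J' := by
    by_contra hc
    exact hnb J' (by omega) hJ2' (((C J' (by omega)).begins_iff hp (by omega) hin
      (hw J' (by omega)) (hnb J' (by omega)) hJ2' rfl).mpr hJ3')
  have CJ := C J le_rfl
  rcases hJJ.eq_or_lt with rfl | hlt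
  · have := CJ.le_u hp (by omega) hJ2 hJ3.waits hJ2 rfl hJ3.waits (Or.inl rfl)
    rwa [if_pos rfl] at this
  · have hbi := bm_congr A A' hin
    have hWm : ∀ k, J + 1 ≤ k → k ≤ J' → A'.W (J + 1) (A.bm i) ≤ A'.W k (A.bm i) := by
      intro k hk
      induction k, hk using Nat.le_induction with
      | base => exact fun _ => le_rfl
      | succ k hk ih =>
        intro h1
        rw [A'.W_succ' (j := k) (by omega)]
        linarith [ih (by omega), A'.begun_sum_nonneg hp k (A.bm i)]
    -- what precedes `i` in the first schedule begins in the second one no later than at `J`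
    have hsub : A.ahead J i ⊆ A'.begun J (A.bm i) := by
      intro l hl
      obtain ⟨q1, q2, q3, q4⟩ := A.mem_ahead.mp hl
      have hli : l ≠ i := by
        rintro rfl
        exact q4.irrefl
      have q5 : A'.bm l = A.bm i := (bm_congr A A' (by omega)).symm.trans q3
      refine A'.mem_begun.mpr ⟨q1, ⟨((CJ.waits q1 q3).mp q2).1, q2.2, ?_⟩, q5⟩
      rw [← CJ.u_eq hp (by omega) hin q1 hli q3 q2 fun _ => q4, q5]
      have h1 := A.u_add_le hp (by omega) q1 hJ2 q2 hJ3.waits q3 q4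
      linarith [hJ3.2.2, hp l]
    have h1 := Finset.sum_le_sum_of_subset_of_nonneg hsub fun k _ _ => (hp k).le
    have h2 := A'.W_succ' (j := J) (by omega) (A.bm i)
    have h3 := hWm J' hlt le_rfl
    have h4 : 0 ≤ ∑ l ∈ A'.ahead J' i, p l := Finset.sum_nonneg fun k _ => (hp k).le
    rw [(A.wait_spec (by omega) hJ2 hJ3.waits).1, (A'.wait_spec (by omega) hJ2' hJ3'.waits).1,
      CJ.W, ← hbi]
    linarith [CJ.beta_le hJ2]

end

variable {n m κ : ℕ} {r p : ℕ → ℝ} {D : Virtual n m κ r p} {rho : ℕ} {K : ℕ → ℕ}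
  (A : Actual D rho K)

/-- The interval of the started big job `i` on the idle clock of machine `μ` contains the current
value of that clock. -/
def Hits (j μ i : ℕ) : Prop :=
  A.fb j i ∧ A.bm i = μ ∧ A.u j i ≤ D.a j μ ∧ D.a j μ < A.u j i + p i

/-- Two values of a trigger number do not hit the same clock value. -/
theorem Hits.eq {K' : ℕ → ℕ} {A : Actual D rho K} {A' : Actual D rho K'} (hp : ∀ k, 0 < p k)
    {i j μ : ℕ} (hj : j ≤ n + 1) (hi : i < j) (hK : ∀ k, k ≠ i → K k = K' k) (h : A.Hits j μ i)
    (h' : A'.Hits j μ i) : K i = K' i := by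
  rcases lt_trichotomy (K i) (K' i) with q | q | q
  · have := A.u_add_le_of_lt A' hp hj hi hK q h.1 h'.1
    linarith [h.2.2.2, h'.2.2.1]
  · exact q
  · have := A'.u_add_le_of_lt A hp hj hi (fun k hk => (hK k hk).symm) q h'.1 h.1
    linarith [h.2.2.1, h'.2.2.2]

open Classical in
/-- The lag of a machine is at most the size of the job that hits it. -/
theorem lag_le (hp : ∀ k, 0 < p k) {j μ : ℕ} (hj : j ≤ n + 1) (hμ : μ < m) :
    A.lag j μ ≤ ∑ i ∈ Finset.range j with A.Hits j μ i, p i := by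
  have hsum : 0 ≤ ∑ i ∈ Finset.range j with A.Hits j μ i, p i :=
    Finset.sum_nonneg fun k _ => (hp k).le
  refine max_le hsum ?_
  by_cases hE : A.Eb j μ ≤ D.a j μ
  · linarith
  -- the clock `Eb` is the end of a started job whose start the idle clock has passed
  have key : ∀ j ≤ n + 1, 0 ≤ D.a j μ ∧ (A.Eb j μ = 0 ∨ ∃ i < j, A.fb j i ∧ A.bm i = μ ∧
      A.Eb j μ = A.u j i + p i ∧ A.u j i ≤ D.a j μ) := by
    intro j
    induction j with
    | zero => exact fun _ => ⟨(D.a_zero μ).ge, Or.inl (A.Eb_zero μ)⟩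
    | succ j ih =>
      intro hj
      obtain ⟨h0, h1⟩ := ih (by omega)
      have ha := D.a_mono (j := j) (by omega) hμ
      refine ⟨h0.trans ha, ?_⟩
      rcases (A.Eb_succ j (by omega)).eq μ with h | ⟨i, hi, q1, q2, q3⟩
      · rw [h]
        refine h1.imp id ?_
        rintro ⟨i, hi, q1, q2, q3, q4⟩
        have hf := (A.fb_succ j (by omega) i hi).mpr (Or.inl q1)
        have hu := A.u_keep j (by omega) i (by omega) (Or.inl hf)
        exact ⟨i, by omega, hf, q2, by rw [hu]; exact q3, by rw [hu]; exact q4.trans ha⟩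
      · have hf := (A.fb_succ j (by omega) i hi).mpr (Or.inr q1)
        have hu := A.u_keep j (by omega) i (by omega) (Or.inl hf)
        have := q1.2.2
        rw [q2] at this
        exact Or.inr ⟨i, by omega, hf, q2, by rw [hu]; exact q3, by rw [hu]; exact this.le⟩
  obtain ⟨h0, h1⟩ := key j hj
  rcases h1 with h1 | ⟨i, hi, q1, q2, q3, q4⟩
  · linarith
  · have : p i ≤ ∑ i ∈ Finset.range j with A.Hits j μ i, p i :=
      Finset.single_le_sum (f := p) (fun k _ => (hp k).le)
        (by simp only [Finset.mem_filter, Finset.mem_range]; exact ⟨hi, q1, q2, q4, by linarith⟩)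
    linarith

/-- A small job that is not started as a big one is delayed by the lag of its machine at the last
state in which its start was planned. That state depends on the virtual schedule only. -/
theorem exists_start_eq (D : Virtual n m κ r p) (hp : ∀ k, 0 < p k) {j k : ℕ} (hj : j ≤ n + 1)
    (hk : k < j) (h : Small m κ p j k) : ∃ i ≤ j, k < i ∧ D.nu i k = D.nu j k ∧
      ∀ (rho : ℕ) (K : ℕ → ℕ) (A : Actual D rho K), ¬ A.fb j k →
        A.s j k = D.sig j k + A.lag i (D.nu j k) := by
  induction j with
  | zero => omega
  | succ j ih =>
    by_cases hf : D.fs (j + 1) k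
    · obtain ⟨h1, h2, h3, h4⟩ := D.fs_succ' (by omega) hk hf
      have hs : Small m κ p j k :=
        h2.elim (fun q => D.fs_small hp (by omega) h1 q) fun q => q.2.1
      obtain ⟨i, q1, q2, q3, q4⟩ := ih (by omega) h1 hs
      refine ⟨i, by omega, q2, q3.trans h4.symm, fun rho K A hA => ?_⟩
      rw [(A.s_keep j (by omega) k (by omega) (Or.inr ⟨h, hf⟩)).2, h3, h4]
      exact q4 rho K A fun q => hA ((A.fb_succ j (by omega) k h1).mpr (Or.inl q))
    · exact ⟨j + 1, le_rfl, hk, rfl, fun rho K A hA => (A.small_spec hj hk h hf hA).2⟩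

end Actual

end

/-! ### The expected total flow time -/

section

theorem bitsVal_lt (tp : ℕ → Bool) (s l : ℕ) : bitsVal tp s l < 2 ^ l := by
  induction l with
  | zero => simp [bitsVal]
  | succ l ih =>
    have := Bool.toNat_le (tp (s + l))
    rw [bitsVal, pow_succ]; omega

theorem bitsVal_congr {tp tp' : ℕ → Bool} {s l : ℕ} (h : ∀ x, s ≤ x → x < s + l → tp x = tp' x) :
    bitsVal tp s l = bitsVal tp' s l := by
  induction l with
  | zero => rfl
  | succ l ih =>
    rw [bitsVal, bitsVal, ih fun x h1 h2 => h x h1 (by omega), h (s + l) (by omega) (by omega)]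

theorem eq_of_bitsVal_eq {tp tp' : ℕ → Bool} {s l : ℕ} (h : bitsVal tp s l = bitsVal tp' s l)
    {x : ℕ} (h1 : s ≤ x) (h2 : x < s + l) : tp x = tp' x := by
  induction l with
  | zero => omega
  | succ l ih =>
    rw [bitsVal, bitsVal] at h
    have h3 := Bool.toNat_le (tp (s + l))
    have h4 := Bool.toNat_le (tp' (s + l))
    rcases (show x ≤ s + l by omega).lt_or_eq with h5 | rfl
    · exact ih (by omega) h5
    · have h5 : (tp (s + l)).toNat = (tp' (s + l)).toNat := by omega
      revert h5
      cases tp (s + l) <;> cases tp' (s + l) <;> simp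

/-- The number that is reduced to the rotation is less than `2 * m`. -/
theorem bitsVal_clog_lt {m : ℕ} (hm : 1 ≤ m) (tp : ℕ → Bool) (s : ℕ) :
    bitsVal tp s (Nat.clog 2 m) < 2 * m := by
  refine (bitsVal_lt _ _ _).trans_le ?_
  rcases hm.eq_or_lt with rfl | h
  · simp
  · have h1 := Nat.pow_pred_clog_lt_self (b := 2) (by norm_num) h
    have h2 : 0 < Nat.clog 2 m := Nat.clog_pos (by norm_num) h
    obtain ⟨c, hc⟩ : ∃ c, Nat.clog 2 m = c + 1 := ⟨Nat.clog 2 m - 1, by omega⟩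
    rw [hc] at h1 ⊢
    rw [pow_succ]
    simp only [Nat.pred_succ] at h1
    omega

theorem rotation_lt {m : ℕ} (hm : 1 ≤ m) (tp : ℕ → Bool) : rotation m tp < m := by
  have := bitsVal_clog_lt hm tp 0
  unfold rotation wrap
  split_ifs <;> omega

theorem draw_le (n m : ℕ) (tp : ℕ → Bool) (k : ℕ) : draw n m tp k ≤ 2 ^ lev n m :=
  (bitsVal_lt _ _ _).le

/-- If every assignment of the bits outside of `S` has at most two extensions in `G`, then `G` has
density at most `2 / 2 ^ S.card`. -/
theorem card_mul_le_of_fiber {T : ℕ} (S : Finset (Fin T)) (G : Finset (Fin T → Bool))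
    (h : ∀ ω₀ ∈ G, (G.filter fun ω => ∀ x ∉ S, ω x = ω₀ x).card ≤ 2) :
    G.card * 2 ^ S.card ≤ 2 * 2 ^ T := by
  classical
  set g : (Fin T → Bool) → ({x // x ∈ Sᶜ} → Bool) := fun ω x => ω x with hg
  have h1 : G.card ≤ 2 * (G.image g).card := by
    refine Finset.card_le_mul_card_image G 2 fun a ha => ?_
    obtain ⟨ω₀, h0, rfl⟩ := Finset.mem_image.mp ha
    refine (Finset.card_le_card fun ω hω => ?_).trans (h ω₀ h0)
    simp only [Finset.mem_filter] at hω ⊢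
    exact ⟨hω.1, fun x hx => congrFun hω.2 ⟨x, Finset.mem_compl.mpr hx⟩⟩
  have h2 : (G.image g).card ≤ 2 ^ (T - S.card) := by
    refine (Finset.card_le_univ _).trans ?_
    rw [Fintype.card_fun, Fintype.card_bool, Fintype.card_coe, Finset.card_compl, Fintype.card_fin]
  have h3 : S.card ≤ T := by simpa using Finset.card_le_univ S
  calc G.card * 2 ^ S.card ≤ 2 * 2 ^ (T - S.card) * 2 ^ S.card := by gcongr; omega
    _ = 2 * 2 ^ T := by rw [mul_assoc, ← pow_add, Nat.sub_add_cancel h3]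

theorem Actual.Hits.draw_eq {n m κ : ℕ} {r p : ℕ → ℝ} {D : Virtual n m κ r p} {rho rho' : ℕ}
    {K K' : ℕ → ℕ} {A : Actual D rho K} {A' : Actual D rho' K'} (hp : ∀ k, 0 < p k)
    (e : rho = rho') {i j μ : ℕ} (hj : j ≤ n + 1) (hi : i < j) (hK : ∀ k, k ≠ i → K k = K' k)
    (h : A.Hits j μ i) (h' : A'.Hits j μ i) : K i = K' i := by
  subst e
  exact h.eq hp hj hi hK h'

open Classical in
/-- A given job hits a given clock value with probability at most `2 / (m * 2 ^ lev n m)`: for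
fixed trigger numbers of the other jobs, the machine of the job determines the rotation, and then
at most one value of its own trigger number makes it hit. -/
theorem card_hits_le {n m : ℕ} {r p : ℕ → ℝ} {D : Virtual n m (lev n m) r p} (hp : ∀ k, 0 < p k)
    (hm : 1 ≤ m) (A : ∀ tp, Actual D (rotation m tp) (draw n m tp)) {T i j μ : ℕ}
    (hj : j ≤ n + 1) (hi : i < j) (hin : i ≤ n) (hT : Nat.clog 2 m + lev n m * (i + 1) ≤ T) :
    (Finset.univ.filter fun ω : Fin T → Bool => (A (tape ω)).Hits j μ i).card *
      (m * 2 ^ lev n m) ≤ 2 * 2 ^ T := by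
  set G := Finset.univ.filter fun ω : Fin T → Bool => (A (tape ω)).Hits j μ i
  -- the bits for the rotation and for the trigger number of job `i`
  set S : Finset (Fin T) := Finset.univ.filter fun x =>
    (x : ℕ) < Nat.clog 2 m ∨ Nat.clog 2 m + lev n m * i ≤ x ∧
      (x : ℕ) < Nat.clog 2 m + lev n m * i + lev n m with hS
  have hli : lev n m * (i + 1) = lev n m * i + lev n m := by ring
  have hScard : S.card = Nat.clog 2 m + lev n m := by
    have h1 : S.map Fin.valEmbedding = Finset.range (Nat.clog 2 m) ∪
        Finset.Ico (Nat.clog 2 m + lev n m * i) (Nat.clog 2 m + lev n m * i + lev n m) := by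
      ext x
      simp only [hS, Finset.mem_map, Finset.mem_filter, Finset.mem_univ, true_and,
        Fin.valEmbedding_apply, Finset.mem_union, Finset.mem_range, Finset.mem_Ico]
      constructor
      · rintro ⟨y, hy, rfl⟩; exact hy
      · intro hx
        exact ⟨⟨x, by omega⟩, hx, rfl⟩
    rw [← Finset.card_map, h1, Finset.card_union_of_disjoint, Finset.card_range, Nat.card_Ico]
    · omega
    · rw [Finset.disjoint_left]
      intro x
      simp only [Finset.mem_range, Finset.mem_Ico]
      omega
  have tape_out : ∀ ω ω' : Fin T → Bool, (∀ x ∉ S, ω x = ω' x) → ∀ x, Nat.clog 2 m ≤ x →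
      ¬ (Nat.clog 2 m + lev n m * i ≤ x ∧ x < Nat.clog 2 m + lev n m * i + lev n m) →
      tape ω x = tape ω' x := by
    intro ω ω' h x h1 h2
    unfold tape
    split_ifs with hx
    · exact h _ (by simp only [hS, Finset.mem_filter, Finset.mem_univ, true_and]; omega)
    · rfl
  have draw_out : ∀ ω ω' : Fin T → Bool, (∀ x ∉ S, ω x = ω' x) → ∀ k, k ≠ i →
      draw n m (tape ω) k = draw n m (tape ω') k := by
    intro ω ω' h k hk
    refine bitsVal_congr fun x h1 h2 => tape_out ω ω' h x (by omega) fun h3 => ?_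
    rcases lt_or_gt_of_ne hk with h4 | h4
    · have : lev n m * (k + 1) ≤ lev n m * i := Nat.mul_le_mul_left (lev n m) h4
      rw [mul_add] at this
      omega
    · have : lev n m * (i + 1) ≤ lev n m * k := Nat.mul_le_mul_left (lev n m) h4
      rw [mul_add] at this
      omega
  have key := card_mul_le_of_fiber S G fun ω₀ h0 => ?_
  · rw [hScard, pow_add] at key
    refine le_trans ?_ key
    gcongr
    exact Nat.le_pow_clog (by norm_num) m
  set F := G.filter fun ω => ∀ x ∉ S, ω x = ω₀ x
  have hG : ∀ ω ∈ F, (A (tape ω)).Hits j μ i ∧ ∀ x ∉ S, ω x = ω₀ x := by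
    intro ω hω
    obtain ⟨h1, h2⟩ := Finset.mem_filter.mp hω
    exact ⟨(Finset.mem_filter.mp h1).2, h2⟩
  have hrot : ∀ ω ∈ F, rotation m (tape ω) = rotation m (tape ω₀) := by
    intro ω hω
    have h1 := (hG ω hω).1.2.1
    have h2 := (Finset.mem_filter.mp h0).2.2.1
    rw [Actual.bm_eq _ i hin] at h1 h2
    refine wrap_injOn (c := D.gr i) (rotation_lt hm _) (rotation_lt hm _) ?_
    rw [add_comm, h1, ← h2, add_comm]
  -- for fixed other bits the rotation is determined, so its bits form one of two numbers, and these
  -- determine the trigger number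
  refine (Finset.card_le_card_of_injOn (fun ω => bitsVal (tape ω) 0 (Nat.clog 2 m))
    (t := {rotation m (tape ω₀), rotation m (tape ω₀) + m}) (fun ω hω => ?_) ?_).trans
    Finset.card_le_two
  · have h1 := hrot ω hω
    have h2 := bitsVal_clog_lt hm (tape ω) 0
    unfold rotation wrap at h1
    simp only [Finset.coe_insert, Finset.coe_singleton, Set.mem_insert_iff, Set.mem_singleton_iff]
    unfold rotation wrap
    split_ifs at h1 ⊢ <;> omega
  · intro ω hω ω' hω' hx
    have e1 : ∀ x ∉ S, ω x = ω' x := fun x hx =>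
      ((hG ω hω).2 x hx).trans ((hG ω' hω').2 x hx).symm
    have e2 := Actual.Hits.draw_eq hp ((hrot ω hω).trans (hrot ω' hω').symm) hj hi
      (draw_out ω ω' e1) (hG ω hω).1 (hG ω' hω').1
    funext x
    by_cases hxS : x ∈ S
    · have e3 : tape ω x = tape ω' x := by
        rcases (Finset.mem_filter.mp hxS).2 with h | h
        · exact eq_of_bitsVal_eq hx (Nat.zero_le _) (by omega)
        · exact eq_of_bitsVal_eq e2 h.1 h.2
      simpa [tape] using e3
    · exact e1 x hxS

namespace Actual

variable {n m κ : ℕ} {r p : ℕ → ℝ}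

open Classical in
/-- The total flow time of the final plan: the sizes, the waiting times of the big jobs, the
waiting times in the virtual schedule, and the lags. -/
theorem exists_sum_flow_le (D : Virtual n m κ r p) (hp : ∀ k, 0 < p k) (hr : Monotone r)
    (hr0 : ∀ k, 0 ≤ r k) (hm : 1 ≤ m) : ∃ J : ℕ → ℕ, (∀ k < n, J k ≤ n) ∧
      ∀ (rho : ℕ) (K : ℕ → ℕ) (A : Actual D rho K), rho < m → (∀ k, K k ≤ 2 ^ κ) →
        ∑ k ∈ Finset.range n, (A.s n k + p k - r k) ≤ vol p n + 3 * (2 ^ κ * vol p n) +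
          ∑ k ∈ Finset.range n with Small m κ p n k, (D.sig n k - r (avail m κ p k)) +
          ∑ k ∈ Finset.range n, ∑ i ∈ Finset.range (J k) with A.Hits (J k) (D.nu n k) i, p i := by
  have I := D.inv hp hr hr0 n (by omega)
  -- the state `J k` whose lag delays job `k`
  have hex : ∀ k, (k < n ∧ Small m κ p n k) → ∃ i ≤ n, k < i ∧ D.nu i k = D.nu n k ∧
      ∀ (rho : ℕ) (K : ℕ → ℕ) (A : Actual D rho K), ¬ A.fb n k →
        A.s n k = D.sig n k + A.lag i (D.nu n k) :=
    fun k h => exists_start_eq D hp (by omega) h.1 h.2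
  choose! J hJ1 hJ2 hJ3 hJ4 using hex
  refine ⟨fun k => if k < n ∧ Small m κ p n k then J k else 0, fun k hk => ?_, ?_⟩
  · dsimp only
    split_ifs with h
    · exact hJ1 k h
    · omega
  intro rho K A hrho hK
  have h1 := A.sum_leave_le hp hr hr0 hm hrho hK I
  rw [Finset.sum_filter]
  have h2 : ∑ k ∈ Finset.range n, (A.s n k + p k - r k) ≤ ∑ k ∈ Finset.range n, (p k +
      (A.leave k - r k) + (if Small m κ p n k then D.sig n k - r (avail m κ p k) else 0) +
      ∑ i ∈ Finset.range (if k < n ∧ Small m κ p n k then J k else 0) with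
        A.Hits (if k < n ∧ Small m κ p n k then J k else 0) (D.nu n k) i, p i) := by
    refine Finset.sum_le_sum fun k hk => ?_
    have hk := Finset.mem_range.mp hk
    have hnn : 0 ≤ ∑ i ∈ Finset.range (if k < n ∧ Small m κ p n k then J k else 0) with
        A.Hits (if k < n ∧ Small m κ p n k then J k else 0) (D.nu n k) i, p i :=
      Finset.sum_nonneg fun k _ => (hp k).le
    by_cases hs : Small m κ p n k
    · have h3 := I.rel_le k hk hs
      rw [if_pos hs]
      by_cases hf : A.fb n k
      · rw [leave, if_neg fun h => h.2 hf]
        linarith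
      · rw [leave, if_pos ⟨hs, hf⟩, hJ4 k ⟨hk, hs⟩ rho K A hf, if_pos ⟨hk, hs⟩]
        have h4 := A.lag_le hp (j := J k) (by have := hJ1 k ⟨hk, hs⟩; omega) (I.lt k hk hs)
        linarith
    · rw [leave, if_neg fun h => hs h.1, if_neg hs]
      linarith
  refine h2.trans ?_
  rw [Finset.sum_add_distrib, Finset.sum_add_distrib, Finset.sum_add_distrib]
  unfold vol at h1 ⊢
  linarith

/-- The expectation of the total flow time of the final plan, against an offline schedule with
completion times `c`. -/
theorem sum_sum_flow_le {D : Virtual n m (lev n m) r p} (hp : ∀ k, 0 < p k) (hr : Monotone r)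
    (hr0 : ∀ k, 0 ≤ r k) (hm : 1 ≤ m) (A : ∀ tp, Actual D (rotation m tp) (draw n m tp)) {T : ℕ}
    (hT : Nat.clog 2 m + lev n m * n ≤ T) {c : ℕ → ℝ} (hrc : ∀ k < n, r k ≤ c k)
    (hc : ∀ a b, ∑ k ∈ Finset.range n with a ≤ r k ∧ c k ≤ b, p k ≤ m * max 0 (b - a)) :
    (∑ ω : Fin T → Bool, ∑ k ∈ Finset.range n, ((A (tape ω)).s n k + p k - r k)) / 2 ^ T ≤
      ∑ k ∈ Finset.range n, (c k - r k) + (1 + 7 * 2 ^ lev n m) * vol p n := by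
  classical
  set Q : ℝ := 2 ^ lev n m with hQ
  have hQ0 : 0 < Q := by positivity
  have hm0 : (0 : ℝ) < m := by exact_mod_cast hm
  have hV : 0 ≤ vol p n := Finset.sum_nonneg fun k _ => (hp k).le
  have I := D.inv hp hr hr0 n (by omega)
  -- this choice of `Q` bounds the two terms that are proportional to the number of jobs
  have hn : (n : ℝ) ≤ Q * Q * m := by
    have := le_lev (n := n) hm
    have h4 : (4 : ℝ) ^ lev n m = Q * Q := by rw [hQ, ← mul_pow]; norm_num
    rw [← h4]; exact_mod_cast this
  -- the waiting times in the virtual schedule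
  have h1 : ∑ k ∈ Finset.range n with Small m (lev n m) p n k,
      (D.sig n k - r (avail m (lev n m) p k)) ≤
      ∑ k ∈ Finset.range n, (c k - r k) + 2 * (Q * vol p n) := by
    have := D.sum_wait_le hp hr I (θ := vol p n / (Q * m)) (by positivity) (fun k _ hk => ?_) hrc hc
    · refine this.trans ?_
      have h2 : n * (vol p n / (Q * m)) ≤ Q * vol p n := by
        rw [mul_div_assoc', div_le_iff₀ (by positivity)]
        calc n * vol p n ≤ Q * Q * m * vol p n := by gcongr
          _ = _ := by ring
      linarith
    · rw [le_div_iff₀ (by positivity)]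
      unfold Small at hk
      linarith
  obtain ⟨J, hJ, hflow⟩ := exists_sum_flow_le D hp hr hr0 hm
  -- the expected lag of a job
  have h2 : ∀ k ∈ Finset.range n, ∑ ω : Fin T → Bool,
      ∑ i ∈ Finset.range (J k) with (A (tape ω)).Hits (J k) (D.nu n k) i, p i ≤
      2 * 2 ^ T / (m * Q) * vol p n := by
    intro k hk
    have hJk := hJ k (Finset.mem_range.mp hk)
    simp only [Finset.sum_filter]
    rw [Finset.sum_comm]
    calc _ ≤ ∑ i ∈ Finset.range (J k), 2 * 2 ^ T / (m * Q) * p i := by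
          refine Finset.sum_le_sum fun i hi => ?_
          have hi := Finset.mem_range.mp hi
          have h3 := card_hits_le (μ := D.nu n k) hp hm A (T := T) (j := J k) (by omega) hi
            (by omega)
            (le_trans (Nat.add_le_add_left (Nat.mul_le_mul_left _ (by omega)) _) hT)
          rw [← Finset.sum_filter, Finset.sum_const, nsmul_eq_mul]
          refine mul_le_mul_of_nonneg_right ?_ (hp i).le
          rw [le_div_iff₀ (by positivity), hQ]
          exact_mod_cast h3
      _ = 2 * 2 ^ T / (m * Q) * vol p (J k) := by rw [vol, Finset.mul_sum]
      _ ≤ _ := by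
          gcongr
          exact vol_mono hp hJk
  have h3 : ∑ ω : Fin T → Bool, ∑ k ∈ Finset.range n,
      ∑ i ∈ Finset.range (J k) with (A (tape ω)).Hits (J k) (D.nu n k) i, p i ≤
      2 ^ T * (2 * (Q * vol p n)) := by
    rw [Finset.sum_comm]
    refine (Finset.sum_le_sum h2).trans ?_
    rw [Finset.sum_const, Finset.card_range, nsmul_eq_mul]
    have : (n : ℝ) / (m * Q) ≤ Q := by
      rw [div_le_iff₀ (by positivity)]; linarith
    calc (n : ℝ) * (2 * 2 ^ T / (m * Q) * vol p n) =
          2 ^ T * (2 * ((n : ℝ) / (m * Q) * vol p n)) := by ring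
      _ ≤ _ := by gcongr
  rw [div_le_iff₀ (by positivity)]
  calc _ ≤ ∑ ω : Fin T → Bool, (vol p n + 3 * (Q * vol p n) +
        (∑ k ∈ Finset.range n, (c k - r k) + 2 * (Q * vol p n)) + ∑ k ∈ Finset.range n,
        ∑ i ∈ Finset.range (J k) with (A (tape ω)).Hits (J k) (D.nu n k) i, p i) :=
        Finset.sum_le_sum fun ω _ => by
          have := hflow _ _ (A (tape ω)) (rotation_lt hm _) (draw_le n m _)
          linarith
    _ ≤ _ := by
        rw [Finset.sum_add_distrib, Finset.sum_const, Finset.card_univ, Fintype.card_fun,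
          Fintype.card_bool, Fintype.card_fin, nsmul_eq_mul]
        push_cast
        nlinarith

end Actual

end

/-! ### The program and its competitive ratio -/

section

/-- The release times of an instance, continued by times at which nothing is released. -/
def Instance.releases {n : ℕ} (I : Instance n) (k : ℕ) : ℝ :=
  if h : k < n then I.release ⟨k, h⟩ else ∑ j, I.release j

/-- The sizes of an instance, continued by ones. -/
def Instance.sizes {n : ℕ} (I : Instance n) (k : ℕ) : ℝ := if h : k < n then I.size ⟨k, h⟩ else 1

section
variable {n : ℕ} (I : Instance n)

theorem Instance.releases_nonneg (k : ℕ) : 0 ≤ I.releases k := by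
  unfold Instance.releases
  split_ifs
  · exact I.release_nonneg _
  · exact Finset.sum_nonneg fun j _ => I.release_nonneg j

theorem Instance.releases_mono : Monotone I.releases := by
  intro a b hab
  unfold Instance.releases
  split_ifs with h1 h2
  · exact I.release_mono (by simpa using hab)
  · exact Finset.single_le_sum (fun j _ => I.release_nonneg j) (Finset.mem_univ _)
  · omega
  · exact le_rfl

theorem Instance.sizes_pos (k : ℕ) : 0 < I.sizes k := by
  unfold Instance.sizes
  split_ifs
  · exact I.size_pos _
  · exact one_pos

theorem Instance.releases_fin (k : Fin n) : I.releases k = I.release k := by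
  simp [Instance.releases]

theorem Instance.sizes_fin (k : Fin n) : I.sizes k = I.size k := by simp [Instance.sizes]

end

/-- The program of the scheduler. -/
def schedulerProgram : Cmd := scheduler.program R_s N_M

/-- Transport along an equality of virtual schedules. -/
def Actual.cast {n m κ : ℕ} {r p : ℕ → ℝ} {D D' : Virtual n m κ r p} {rho : ℕ} {K : ℕ → ℕ}
    (A : Actual D rho K) (h : D = D') : Actual D' rho K := h ▸ A

theorem Actual.cast_s {n m κ : ℕ} {r p : ℕ → ℝ} {D D' : Virtual n m κ r p} {rho : ℕ} {K : ℕ → ℕ}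
    (A : Actual D rho K) (h : D = D') : (A.cast h).s = A.s := by subst h; rfl

section
variable {n m : ℕ} (I : Instance n) {T : ℕ}

/-- The states of the scheduler are what the program outputs. -/
theorem plan_eq (hT : scheduler.cost n + 7 * n + 20 ≤ T) (ω : Fin T → Bool) {i : ℕ} (hi : i ≤ n)
    (J : Instance i) (hr : ∀ k : Fin i, J.release k = I.releases k)
    (hs : ∀ k : Fin i, J.size k = I.sizes k) :
    (run schedulerProgram n m J ω).1 = [] ∧ ∀ j : Fin i,
      (plan schedulerProgram n m J ω).start j =
        (hist n m (tape ω) I.releases I.sizes i).R R_s j ∧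
      (plan schedulerProgram n m J ω).machine j =
        (hist n m (tape ω) I.releases I.sizes i).N N_M j := by
  obtain ⟨h1, h2⟩ := HC.program_correct scheduler R_s N_M scheduler_depth n m hi J hT ω
  refine ⟨h1, fun j => ?_⟩
  obtain ⟨h3, h4⟩ := h2 j j.2
  obtain ⟨h5, h6⟩ := scheduler_run (n := n) (m := m) (tape ω) hi J hr hs
  rw [h5] at h3
  rw [h6] at h4
  exact ⟨h3, h4⟩

/-- The program halts in time, and feasibility and stability of its plans are those of the real
schedule. -/
theorem runsOnline (hm1 : 1 ≤ m) (hm : m ≤ n) (hT : scheduler.cost n + 7 * n + 20 ≤ T)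
    (ω : Fin T → Bool) : RunsOnline schedulerProgram m I ω := by
  set A := Actual.ofHist (r := I.releases) (tape ω) hm1 hm I.sizes_pos
  have hr : ∀ (i : ℕ) (hi : i ≤ n) (k : Fin i), (I.take i hi).release k = I.releases k :=
    fun i hi k => (I.releases_fin (Fin.castLE hi k)).symm
  have hs : ∀ (i : ℕ) (hi : i ≤ n) (k : Fin i), (I.take i hi).size k = I.sizes k :=
    fun i hi k => (I.sizes_fin (Fin.castLE hi k)).symm
  have hplan := fun (i : ℕ) (hi : i ≤ n) =>
    plan_eq (m := m) I hT ω hi (I.take i hi) (hr i hi) (hs i hi)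
  have hs' : ∀ (i : ℕ) (hi : i ≤ n) (j : Fin i),
      (plan schedulerProgram n m (I.take i hi) ω).start j = A.s i j :=
    fun i hi j => ((hplan i hi).2 j).1
  have hM' : ∀ (i : ℕ) (hi : i ≤ n) (j : Fin i),
      (plan schedulerProgram n m (I.take i hi) ω).machine j = A.M i j :=
    fun i hi j => ((hplan i hi).2 j).2
  have hrho := rotation_lt hm1 (tape ω)
  refine ⟨fun i hi => (hplan i hi).1, fun i hi => ?_, fun i hi j => ?_⟩
  · have H := A.inv I.sizes_pos I.releases_mono I.releases_nonneg hrho i (by omega)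
    refine ⟨fun j => ?_, fun j => ?_, fun j k hjk hM => ?_⟩
    · rw [hM']; exact H.M_lt j j.2
    · rw [hs', hr]; exact H.rel_le j j.2
    · rw [hM', hM'] at hM
      rw [hs', hs', hs, hs]
      exact H.apart j j.2 k k.2 (fun h => hjk (Fin.ext h)) hM
  · intro old new h
    have e1 : I.release ⟨i, hi⟩ = I.releases i := (I.releases_fin ⟨i, hi⟩).symm
    simp only [old, new] at h ⊢
    rw [hs', hs', e1, Fin.val_castSucc] at h
    rw [hs', hs', hM', hM', Fin.val_castSucc]
    exact A.stable I.sizes_pos hrho hi.le j.2 h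

/-- The expected total flow time against an arbitrary preemptive schedule. As the virtual schedule
does not depend on the random bits, the one that belongs to the bits `false` can be used. -/
theorem expectedFlow_le (hm1 : 1 ≤ m) (hm : m ≤ n) (hT : scheduler.cost n + 7 * n + 20 ≤ T)
    (hT' : Nat.clog 2 m + lev n m * n ≤ T) (S : PreemptiveSchedule m I) :
    expectedFlow schedulerProgram m I T ≤ (2 + 7 * 2 ^ lev n m) * S.totalFlow := by
  set D := Virtual.ofHist (n := n) (m := m) (r := I.releases) (fun _ => false) hm1 hm I.sizes_pos
  let A : ∀ tp, Actual D (rotation m tp) (draw n m tp) := fun tp =>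
    (Actual.ofHist (r := I.releases) tp hm1 hm I.sizes_pos).cast
      (Virtual.ofHist_eq tp hm1 hm I.sizes_pos _)
  set c : ℕ → ℝ := fun k => if h : k < n then S.completion ⟨k, h⟩ else 0 with hc
  have hcf : ∀ k : Fin n, c k = S.completion k := fun k => by simp [hc]
  have h1 := Actual.sum_sum_flow_le I.sizes_pos I.releases_mono I.releases_nonneg hm1 A hT'
    (c := c) (fun k hk => ?_) fun a b => ?_
  · have e1 : ∀ ω : Fin T → Bool, (plan schedulerProgram n m I ω).totalFlow I =
        ∑ k ∈ Finset.range n, ((A (tape ω)).s n k + I.sizes k - I.releases k) := by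
      intro ω
      rw [Finset.sum_range, Schedule.totalFlow]
      refine Finset.sum_congr rfl fun k _ => ?_
      rw [((plan_eq (m := m) I hT ω le_rfl I (fun k => (I.releases_fin k).symm)
        fun k => (I.sizes_fin k).symm).2 k).1, Actual.cast_s, I.releases_fin, I.sizes_fin]
      rfl
    have e2 : ∑ k ∈ Finset.range n, (c k - I.releases k) = S.totalFlow := by
      rw [Finset.sum_range, PreemptiveSchedule.totalFlow]
      exact Finset.sum_congr rfl fun k _ => by rw [hcf, I.releases_fin]
    have e3 : vol I.sizes n ≤ S.totalFlow := by
      rw [vol, Finset.sum_range, PreemptiveSchedule.totalFlow]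
      exact Finset.sum_le_sum fun k _ => by rw [I.sizes_fin]; exact S.size_le k
    rw [e2, ← Finset.sum_congr rfl fun ω _ => e1 ω] at h1
    have e4 : (1 + 7 * (2 : ℝ) ^ lev n m) * vol I.sizes n ≤
        (1 + 7 * 2 ^ lev n m) * S.totalFlow := by gcongr
    unfold expectedFlow
    linarith
  · rw [hcf ⟨k, hk⟩, I.releases_fin ⟨k, hk⟩]
    linarith [S.size_le ⟨k, hk⟩, I.size_pos ⟨k, hk⟩]
  · refine le_trans (le_of_eq ?_) (S.sum_size_le a b)
    rw [Finset.sum_filter, Finset.sum_range, Finset.sum_filter]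
    refine Finset.sum_congr rfl fun k _ => ?_
    rw [hcf, I.releases_fin, I.sizes_fin]

end

/-- By minimality of `Q = 2 ^ lev n m`, half of it is at most `√(n / m)`. -/
theorem pow_lev_le {n m : ℕ} (hm1 : 1 ≤ m) (hm : m ≤ n) :
    (2 : ℝ) ^ lev n m ≤ 2 * Real.sqrt ((n : ℝ) / m) := by
  have hm0 : (0 : ℝ) < m := by exact_mod_cast hm1
  rcases Nat.eq_zero_or_pos (lev n m) with h | h
  · have : (1 : ℝ) ≤ Real.sqrt ((n : ℝ) / m) := by
      rw [Real.one_le_sqrt, le_div_iff₀ hm0, one_mul]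
      exact_mod_cast hm
    rw [h, pow_zero]; linarith
  · obtain ⟨κ, hκ⟩ : ∃ κ, lev n m = κ + 1 := ⟨lev n m - 1, by omega⟩
    have h1 := (lt_lev_iff (n := n) hm1 κ).mp (by omega)
    have : (2 : ℝ) ^ κ ≤ Real.sqrt ((n : ℝ) / m) := by
      refine Real.le_sqrt_of_sq_le ?_
      rw [le_div_iff₀ hm0, ← pow_mul, mul_comm κ 2, pow_mul]
      norm_num
      exact_mod_cast h1.le
    rw [hκ, pow_succ]; linarith

/-- A polynomial bound for the number of steps and the number of random bits. -/
theorem exists_bound : ∃ d : ℕ, ∀ n m : ℕ, 1 ≤ m → m ≤ n →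
    scheduler.cost n + 7 * n + 20 ≤ d * n ^ d ∧ Nat.clog 2 m + lev n m * n ≤ d * n ^ d := by
  obtain ⟨a, D, h⟩ := HC.exists_cost_le scheduler
  refine ⟨a + D + 29, fun n m hm1 hm => ?_⟩
  have hn : 1 ≤ n := hm1.trans hm
  have h1 : n ^ D ≤ n ^ (a + D + 29) := Nat.pow_le_pow_right hn (by omega)
  have h2 : n ^ 2 ≤ n ^ (a + D + 29) := Nat.pow_le_pow_right hn (by omega)
  have h3 : n ≤ n ^ 2 := by nlinarith
  have h4 : Nat.clog 2 m ≤ m := Nat.clog_le_of_le_pow (Nat.lt_pow_self (by norm_num)).le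
  have h5 : lev n m * n ≤ n * n := Nat.mul_le_mul_right n (lev_le hm1)
  set x := n ^ (a + D + 29)
  have h6 := h n hn
  have h7 : a * n ^ D ≤ a * x := Nat.mul_le_mul_left a h1
  constructor
  · nlinarith
  · nlinarith

end

end FlowTime

end

theorem mainTheorem1 :
    ∃ (P : FlowTime.Cmd) (d : ℕ) (C : ℝ),
      ∀ (n m : ℕ), 1 ≤ m → m ≤ n → ∀ I : FlowTime.Instance n,
        (∀ ω : Fin (d * n ^ d) → Bool, FlowTime.RunsOnline P m I ω) ∧
        FlowTime.expectedFlow P m I (d * n ^ d)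
          ≤ C * Real.sqrt ((n : ℝ) / (m : ℝ)) * FlowTime.opt m I := by
  obtain ⟨d, hd⟩ := FlowTime.exists_bound
  refine ⟨FlowTime.schedulerProgram, d, 18, fun n m hm1 hm I => ?_⟩
  obtain ⟨h1, h2⟩ := hd n m hm1 hm
  refine ⟨FlowTime.runsOnline I hm1 hm h1, ?_⟩
  have : Nonempty (FlowTime.PreemptiveSchedule m I) := FlowTime.nonempty_preemptiveSchedule hm1 I
  rw [FlowTime.opt, Real.mul_iInf_of_nonneg (by positivity)]
  refine le_ciInf fun S => (FlowTime.expectedFlow_le I hm1 hm h1 h2 S).trans ?_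
  have h3 := FlowTime.pow_lev_le hm1 hm
  have h4 : (1 : ℝ) ≤ 2 ^ FlowTime.lev n m := one_le_pow₀ (by norm_num)
  have h5 : 0 ≤ S.totalFlow :=
    Finset.sum_nonneg fun j _ => (I.size_pos j).le.trans (S.size_le j)
  exact mul_le_mul_of_nonneg_right (by linarith) h5
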